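/- Let $H$ be a separable complex Hilbert space with a complex conjugation $x\mapsto\bar x$, inner product $\langle\cdot,\cdot\rangle$ linear in the first entry, and let $S_2(H)$ be the Hilbert space of Hilbert–Schmidt operators on $H$. Write $(x\otimes y)v=\langle v,y\rangle x$, $\overline{A}x=\overline{A\bar x}$, $(A\,\widetilde\otimes\,B)C=ACB^\dagger$ and $(A\,\widetilde\otimes_\top B)C=A\,\overline{C}^{\dagger}B^\dagger$, and let $\|\cdot\|_\infty$ denote operator norms (on $H$ or on $S_2(H)$). *The process.* Let $(\epsilon_t)_{t\in\mathbb Z}$ be i.i.d. random elements of a measurable space $S$ on a probability space, $(\epsilon'_t)$ an independent copy on the same space, $g:S^{\infty}\to H$ measurable, and $X_t=g(\epsilon_t,\epsilon_{t-1},\dots)$. Assume that $X_t$ is centred, real ($\overline{X_t}=X_t$ a.s.) and in $L^4_H$, and that $\sum_{j\ge0}\nu_{H,4}(X_j)<\infty$, where $\nu_{H,4}(X_t)=\big(\mathbb E\|X_t-\mathbb E[X_t\mid\mathcal G_{t,\{0\}}]\|_H^4\big)^{1/4}$ and $\mathcal G_{t,\{0\}}$ is generated by $\epsilon_t,\epsilon_{t-1},\dots$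 with $\epsilon_0$ replaced by $\epsilon_0'$. Put $C_h=\mathbb E[X_h\otimes X_0]$ and $\mathcal F^{(\lambda)}=\frac1{2\pi}\sum_{h\in\mathbb Z}C_he^{-\mathrm i\lambda h}$. *The weights.* For $T\in\mathbb N$ and $h\in\mathbb Z$ let $A_{T,h}=A_{T,-h}$ be bounded operators on $H$, and set $\phi^{(\lambda)}_{T,h}=A_{T,h}e^{\mathrm i\lambda h}$, $\Phi^{(\lambda)}_{T,s,t}=\phi^{(\lambda)}_{T,t-s}\widetilde\otimes I$, $$\|\Phi_T\|_F^2=\sum_{s,t=1}^T\|\phi_{T,t-s}\|_\infty^2,\qquad \varrho_T^2=\sum_{t=1}^T\|\phi_{T,t}\|_\infty^2 .$$ These do not depend on $\lambda$. Let $\lambda_1,\dots,\lambda_d\in(-\pi,\pi]$. Assume that $\|\Phi_T\|_F>0$ for all large $T$, and that for $\lambda\in\{\lambda_1,\dots,\lambda_d\}$ and $1\le s,t\le T$ the weights are Hermitian and balanced, $$\big(\Phi^{(\lambda)}_{T,s,t}\big)^\dagger=\Phi^{(\lambda)}_{T,t,s},\qquad \Phi^{(\lambda)}_{T,s,t}(x\otimes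 y)=x\otimes\big(\phi^{(\lambda)}_{T,t-s}\big)^\dagger y\quad(x,y\in H)$$ (so that $A_{T,h}$, $|h|<T$, is a real multiple of the identity), and that, as $T\to\infty$, (i) $T\varrho_T^2=O(\|\Phi_T\|_F^2)$; (ii) $\max_{1\le t\le T}\|\phi_{T,t}\|_\infty^2=o(\varrho_T^2)$; (iii) $\sum_{t=1}^T\|A_{T,t}-A_{T,t-1}\|_\infty^2=o(\varrho_T^2)$; (iv) $\sum_{j=1}^{T-1}\sum_{s=1}^{j-1}\big\|\sum_{t=j+1}^T\phi_{T,s-t}\widetilde\otimes\phi_{T,j-t}\big\|_\infty^2=o(\|\Phi_T\|_F^4)$. *Conclusion.* Let $\hat{\mathcal Q}^{\lambda}_T=\sum_{s,t=1}^T\Phi^{(\lambda)}_{T,s,t}(X_s\otimes X_t)$. Then $\sum_h\|C_h\|_{S_2}<\infty$, and in $S_2(H)^d$, as $T\to\infty$, $$\|\Phi_T\|_F^{-1}\big(\hat{\mathcal Q}^{\lambda_j}_T-\mathbb E\hat{\mathcal Q}^{\lambda_j}_T\big)_{j=1,\dots,d}\Rightarrow\big(\breve{\mathcal Q}^{\lambda_j}\big)_{j=1,\dots,d},$$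 where the $\breve{\mathcal Q}^{\lambda_j}$ are jointly complex Gaussian elements of $S_2(H)$ with mean zero, covariance operators $\Gamma_{ij}=\mathbb E[\breve{\mathcal Q}^{\lambda_i}\otimes\breve{\mathcal Q}^{\lambda_j}]$ and pseudocovariance operators $\Sigma_{ij}=\mathbb E[\breve{\mathcal Q}^{\lambda_i}\otimes\overline{\breve{\mathcal Q}^{\lambda_j}}]$ given by $$\Gamma_{ij}=4\pi^2\Big(\eta(\lambda_i-\lambda_j)\,\mathcal F^{(\lambda_i)}\widetilde\otimes\mathcal F^{(\lambda_i)}+\eta(\lambda_i+\lambda_j)\,\mathcal F^{(\lambda_i)}\widetilde\otimes_\top\mathcal F^{(\lambda_i)}\Big),$$ $$\Sigma_{ij}=4\pi^2\Big(\eta(\lambda_i+\lambda_j)\,\mathcal F^{(\lambda_i)}\widetilde\otimes\mathcal F^{(\lambda_i)}+\eta(\lambda_i-\lambda_j)\,\mathcal F^{(\lambda_i)}\widetilde\otimes_\top\mathcal F^{(\lambda_i)}\Big),$$ with $\eta(x)=1$ if $x\in2\pi\mathbb Z$ and $\eta(x)=0$ otherwise. If $\lambda_1,\dots,\lambda_d\in[0,\pi]$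 are distinct, then $\breve{\mathcal Q}^{\lambda_1},\dots,\breve{\mathcal Q}^{\lambda_d}$ are independent. -/

import Mathlib

open MeasureTheory ProbabilityTheory Filter Topology Asymptotics
open scoped ENNReal

noncomputable section

namespace QuadForm

section HilbertSchmidt

set_option linter.unusedSectionVars false

variable {H : Type*} [NormedAddCommGroup H] [InnerProductSpace ℂ H] [CompleteSpace H]

/-- A family satisfying Parseval's identity, e.g. an orthonormal basis. -/
def IsParseval {ι : Type*} (e : ι → H) : Prop :=
  ∀ x : H, ∑' i, ‖inner ℂ (e i) x‖ₑ ^ 2 = ‖x‖ₑ ^ 2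

theorem isParseval_hilbertBasis {ι : Type*} (b : HilbertBasis ι ℂ H) : IsParseval (b : ι → H) := by
  intro x
  have h := b.hasSum_inner_mul_inner x x
  have h2 : HasSum (fun i => ‖inner ℂ (b i) x‖ ^ 2) (‖x‖ ^ 2) := by
    have h3 := h.mapL Complex.reCLM
    have e1 : (fun i => Complex.reCLM (inner ℂ x (b i) * inner ℂ (b i) x)) =
        fun i => ‖inner ℂ (b i) x‖ ^ 2 := by
      funext i
      rw [← inner_conj_symm x (b i), ← Complex.normSq_eq_conj_mul_self]
      rw [Complex.reCLM_apply, Complex.ofReal_re, Complex.normSq_eq_norm_sq]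
    have e2 : Complex.reCLM (inner ℂ x x) = ‖x‖ ^ 2 := by
      rw [inner_self_eq_norm_sq_to_K]
      simp [← Complex.ofReal_pow]
    rw [e1, e2] at h3
    exact h3
  have key : ∀ y : ℝ, 0 ≤ y → ENNReal.ofReal (y ^ 2) = ENNReal.ofReal y ^ 2 :=
    fun y hy => ENNReal.ofReal_pow hy 2
  have h4 := ENNReal.ofReal_tsum_of_nonneg (fun i => sq_nonneg ‖inner ℂ (b i) x‖) h2.summable
  rw [h2.tsum_eq, key _ (norm_nonneg _), ofReal_norm] at h4
  rw [h4]
  refine tsum_congr fun i => ?_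
  rw [key _ (norm_nonneg _), ofReal_norm]

/-- `∑ᵢ ‖A eᵢ‖²`, as an extended nonnegative number. -/
def hsSum {ι : Type*} (e : ι → H) (A : H →L[ℂ] H) : ℝ≥0∞ := ∑' i, ‖A (e i)‖ₑ ^ 2

theorem hsSum_adjoint {ι κ : Type*} {e : ι → H} {f : κ → H} (he : IsParseval e)
    (hf : IsParseval f) (A : H →L[ℂ] H) :
    hsSum e A = hsSum f (ContinuousLinearMap.adjoint A) := by
  have h1 : hsSum e A = ∑' i, ∑' j, ‖inner ℂ (f j) (A (e i))‖ₑ ^ 2 :=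
    tsum_congr fun i => (hf (A (e i))).symm
  have h2 : hsSum f (ContinuousLinearMap.adjoint A) =
      ∑' j, ∑' i, ‖inner ℂ (e i) (ContinuousLinearMap.adjoint A (f j))‖ₑ ^ 2 :=
    tsum_congr fun j => (he _).symm
  rw [h1, h2, ENNReal.tsum_comm]
  refine tsum_congr fun j => tsum_congr fun i => ?_
  rw [ContinuousLinearMap.adjoint_inner_right, ← inner_conj_symm (A (e i)) (f j)]
  rw [← ofReal_norm, ← ofReal_norm, RCLike.norm_conj]

/-- The Hilbert-Schmidt sum does not depend on the orthonormal basis. -/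
theorem hsSum_eq {ι κ : Type*} {e : ι → H} {f : κ → H} (he : IsParseval e) (hf : IsParseval f)
    (A : H →L[ℂ] H) : hsSum e A = hsSum f A :=
  (hsSum_adjoint he he A).trans (hsSum_adjoint hf he A).symm

variable (H)

/-- Index set of a fixed orthonormal basis of `H`. -/
def stdIdx : Set H := (exists_hilbertBasis ℂ H).choose

/-- A fixed orthonormal basis of `H`; nothing below depends on the choice. -/
def stdBasis : HilbertBasis (stdIdx H) ℂ H := (exists_hilbertBasis ℂ H).choose_spec.choose

variable {H}

theorem summable_iff_hsSum (A : H →L[ℂ] H) :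
    (Summable fun i => ‖A (stdBasis H i)‖ ^ 2) ↔ hsSum (stdBasis H) A ≠ ∞ := by
  have h : hsSum (stdBasis H) A = ∑' i, ENNReal.ofReal (‖A (stdBasis H i)‖ ^ 2) :=
    tsum_congr fun i => by rw [ENNReal.ofReal_pow (norm_nonneg _), ofReal_norm]
  rw [h]
  constructor
  · intro hs
    rw [← ENNReal.ofReal_tsum_of_nonneg (fun i => sq_nonneg _) hs]
    exact ENNReal.ofReal_ne_top
  · intro hs
    have := ENNReal.summable_toReal hs
    simpa [ENNReal.toReal_ofReal, sq_nonneg] using this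

theorem summable_iff_memℓp (A : H →L[ℂ] H) :
    (Summable fun i => ‖A (stdBasis H i)‖ ^ 2) ↔ Memℓp (fun i => A (stdBasis H i)) 2 := by
  rw [memℓp_gen_iff (by norm_num)]
  simp

variable (H)

/-- The Hilbert-Schmidt operators, as a subspace of the bounded operators. -/
def hsSubmodule : Submodule ℂ (H →L[ℂ] H) where
  carrier := {A | Summable fun i => ‖A (stdBasis H i)‖ ^ 2}
  add_mem' {A B} hA hB := by
    simp only [Set.mem_ofPred_eq, summable_iff_memℓp] at *
    exact hA.add hB
  zero_mem' := by simp [summable_zero]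
  smul_mem' c A hA := by
    simp only [Set.mem_ofPred_eq, summable_iff_memℓp] at *
    exact hA.const_smul c

/-- The space `S₂(H)` of Hilbert-Schmidt operators on `H`. It is a type of its own because it
carries the Hilbert-Schmidt norm and not the operator norm. -/
def HS : Type _ := hsSubmodule H

instance : AddCommGroup (HS H) := inferInstanceAs (AddCommGroup (hsSubmodule H))
instance : Module ℂ (HS H) := inferInstanceAs (Module ℂ (hsSubmodule H))

variable {H}

/-- The bounded operator underlying a Hilbert-Schmidt operator. -/
def HS.op : HS H →ₗ[ℂ] (H →L[ℂ] H) := (hsSubmodule H).subtype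

theorem HS.op_injective : Function.Injective (HS.op : HS H → (H →L[ℂ] H)) :=
  Subtype.val_injective

theorem HS.hsSum_op_ne_top (C : HS H) : hsSum (stdBasis H) C.op ≠ ∞ :=
  (summable_iff_hsSum _).1 C.2

/-- A bounded operator with finite Hilbert-Schmidt sum, as an element of `S₂(H)`. -/
def HS.mk (A : H →L[ℂ] H) (hA : hsSum (stdBasis H) A ≠ ∞) : HS H :=
  ⟨A, (summable_iff_hsSum A).2 hA⟩

@[simp] theorem HS.op_mk (A : H →L[ℂ] H) (hA : hsSum (stdBasis H) A ≠ ∞) :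
    (HS.mk A hA).op = A := rfl

variable (H)

/-- `A ↦ (A eᵢ)ᵢ`. -/
def HS.toLp : HS H →ₗ[ℂ] lp (fun _ : stdIdx H => H) 2 where
  toFun C := ⟨fun i => C.op (stdBasis H i), (summable_iff_memℓp _).1 C.2⟩
  map_add' _ _ := rfl
  map_smul' _ _ := rfl

variable {H}

theorem HS.toLp_injective : Function.Injective (HS.toLp H) := by
  intro A B h
  apply HS.op_injective
  apply ContinuousLinearMap.ext_on (s := Set.range (stdBasis H))
  · have := (stdBasis H).dense_span
    rw [Submodule.dense_iff_topologicalClosure_eq_top]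
    exact this
  · rintro _ ⟨i, rfl⟩
    exact congrFun (congrArg Subtype.val h) i

/-- The Hilbert-Schmidt norm `(∑ᵢ ‖A eᵢ‖²)^(1/2)`. -/
instance : NormedAddCommGroup (HS H) :=
  NormedAddCommGroup.induced (HS H) (lp (fun _ : stdIdx H => H) 2) (HS.toLp H) HS.toLp_injective

/-- The Hilbert-Schmidt inner product `∑ᵢ ⟪A eᵢ, B eᵢ⟫`. -/
instance : InnerProductSpace ℂ (HS H) := InnerProductSpace.induced (HS.toLp H)

theorem HS.inner_eq (A B : HS H) :
    inner ℂ A B = ∑' i, inner ℂ (A.op (stdBasis H i)) (B.op (stdBasis H i)) := rfl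

theorem HS.norm_toLp (A : HS H) : ‖HS.toLp H A‖ = ‖A‖ := rfl

theorem HS.enorm_sq (A : HS H) : ‖A‖ₑ ^ 2 = hsSum (stdBasis H) A.op := by
  have h := lp.norm_rpow_eq_tsum (p := 2) (by norm_num) (HS.toLp H A)
  rw [HS.norm_toLp] at h
  simp only [ENNReal.toReal_ofNat, Real.rpow_ofNat] at h
  have hs : Summable fun i => ‖A.op (stdBasis H i)‖ ^ 2 := A.2
  rw [← ofReal_norm, ← ENNReal.ofReal_pow (norm_nonneg _), h]
  refine (ENNReal.ofReal_tsum_of_nonneg (fun i => sq_nonneg _) hs).trans ?_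
  exact tsum_congr fun i => by rw [ENNReal.ofReal_pow (norm_nonneg _), ofReal_norm]

theorem HS.norm_op_le (C : HS H) : ‖C.op‖ ≤ ‖C‖ := by
  rw [← ContinuousLinearMap.adjoint.norm_map C.op]
  refine ContinuousLinearMap.opNorm_le_bound _ (norm_nonneg _) fun y => ?_
  have hp := isParseval_hilbertBasis (stdBasis H)
  have h : ‖ContinuousLinearMap.adjoint C.op y‖ₑ ^ 2 ≤ (‖C‖ₑ * ‖y‖ₑ) ^ 2 := by
    rw [mul_pow, HS.enorm_sq, ← hp, hsSum, ← ENNReal.tsum_mul_right]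
    refine ENNReal.tsum_le_tsum fun i => ?_
    rw [ContinuousLinearMap.adjoint_inner_right, ← mul_pow]
    gcongr
    rw [← ofReal_norm, ← ofReal_norm, ← ofReal_norm, ← ENNReal.ofReal_mul (norm_nonneg _)]
    exact ENNReal.ofReal_le_ofReal (norm_inner_le_norm _ _)
  have h' := (ENNReal.pow_le_pow_left_iff two_ne_zero).1 h
  rw [← ofReal_norm, ← ofReal_norm, ← ofReal_norm, ← ENNReal.ofReal_mul (norm_nonneg _)] at h'
  exact (ENNReal.ofReal_le_ofReal_iff (by positivity)).1 h'

theorem HS.isometry_toLp : Isometry (HS.toLp H) :=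
  AddMonoidHomClass.isometry_of_norm _ HS.norm_toLp

instance : CompleteSpace (HS H) := by
  refine Metric.complete_of_cauchySeq_tendsto fun u hu => ?_
  have h1 : CauchySeq fun n => HS.toLp H (u n) := hu.map HS.isometry_toLp.uniformContinuous
  obtain ⟨f, hf⟩ := cauchySeq_tendsto_of_complete h1
  have h2 : CauchySeq fun n => (u n).op := by
    rw [Metric.cauchySeq_iff] at hu ⊢
    intro r hr
    obtain ⟨N, hN⟩ := hu r hr
    refine ⟨N, fun m hm n hn => lt_of_le_of_lt ?_ (hN m hm n hn)⟩
    rw [dist_eq_norm, dist_eq_norm, ← map_sub]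
    exact HS.norm_op_le _
  obtain ⟨A, hA⟩ := cauchySeq_tendsto_of_complete h2
  have h3 : ∀ i, A (stdBasis H i) = f i := by
    intro i
    have h4 : Tendsto (fun n => (u n).op (stdBasis H i)) atTop (𝓝 (A (stdBasis H i))) :=
      ((ContinuousLinearMap.apply ℂ H (stdBasis H i)).continuous.tendsto A).comp hA
    have h5 : Tendsto (fun n => (u n).op (stdBasis H i)) atTop (𝓝 (f i)) := by
      rw [tendsto_iff_norm_sub_tendsto_zero] at hf ⊢
      refine squeeze_zero (fun _ => norm_nonneg _) (fun n => ?_) hf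
      exact lp.norm_apply_le_norm two_ne_zero (HS.toLp H (u n) - f) i
    exact tendsto_nhds_unique h4 h5
  have hmem : Memℓp (fun i => A (stdBasis H i)) 2 := by
    have : (fun i => A (stdBasis H i)) = f := funext h3
    rw [this]
    exact lp.memℓp f
  obtain ⟨C, hC⟩ : ∃ C : HS H, HS.toLp H C = f :=
    ⟨HS.mk A ((summable_iff_hsSum A).1 ((summable_iff_memℓp A).2 hmem)), by
      ext i
      exact h3 i⟩
  refine ⟨C, HS.isometry_toLp.isEmbedding.tendsto_nhds_iff.2 ?_⟩
  rw [hC]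
  exact hf

instance : MeasurableSpace (HS H) := borel _
instance : BorelSpace (HS H) := ⟨rfl⟩

theorem countable_stdIdx [TopologicalSpace.SeparableSpace H] : Countable (stdIdx H) := by
  have ho := (stdBasis H).orthonormal
  have hd : Pairwise fun i j : stdIdx H => 1 ≤ dist (stdBasis H i) (stdBasis H j) := by
    intro i j hij
    have h : ‖stdBasis H i - stdBasis H j‖ ^ 2 = 2 := by
      rw [@norm_sub_sq ℂ, ho.2 hij, ho.1 i, ho.1 j]
      norm_num
    rw [dist_eq_norm]
    nlinarith [norm_nonneg (stdBasis H i - stdBasis H j)]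
  have := Set.PairwiseDisjoint.countable_of_isOpen (ι := stdIdx H) (a := Set.univ)
    (s := fun i => Metric.ball (stdBasis H i) (1 / 2)) (fun i _ j _ hij => ?_)
    (fun i _ => Metric.isOpen_ball) (fun i _ => ⟨_, Metric.mem_ball_self (by norm_num)⟩)
  · exact Set.countable_univ_iff.1 this
  · exact Metric.ball_disjoint_ball (by have := hd hij; linarith)

instance [TopologicalSpace.SeparableSpace H] : SecondCountableTopology (HS H) := by
  classical
  have := countable_stdIdx (H := H)
  have hsep : TopologicalSpace.IsSeparable
      (Set.univ : Set (lp (fun _ : stdIdx H => H) 2)) := by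
    have h1 : TopologicalSpace.IsSeparable (⋃ i : stdIdx H,
        Set.range (lp.single (E := fun _ : stdIdx H => H) 2 i)) :=
      TopologicalSpace.IsSeparable.iUnion fun i =>
        TopologicalSpace.isSeparable_range (lp.isometry_single (p := 2) i).continuous
    have h2 := (h1.span (R := ℂ)).closure
    refine h2.mono fun f _ => ?_
    have hf := lp.hasSum_single (p := 2) (by norm_num) f
    refine mem_closure_of_tendsto hf (Eventually.of_forall fun s => ?_)
    refine Submodule.sum_mem _ fun i _ => Submodule.subset_span ?_
    exact Set.mem_iUnion.2 ⟨i, _, rfl⟩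
  have : TopologicalSpace.SeparableSpace (lp (fun _ : stdIdx H => H) 2) :=
    TopologicalSpace.isSeparable_univ_iff.1 hsep
  have : SecondCountableTopology (lp (fun _ : stdIdx H => H) 2) :=
    UniformSpace.secondCountable_of_separable _
  exact HS.isometry_toLp.isEmbedding.secondCountableTopology

end HilbertSchmidt

section Operations

set_option linter.unusedSectionVars false

variable {H : Type*} [NormedAddCommGroup H] [InnerProductSpace ℂ H] [CompleteSpace H]

theorem hsSum_comp_le {ι : Type*} (e : ι → H) (A C : H →L[ℂ] H) :
    hsSum e (A ∘L C) ≤ ‖A‖ₑ ^ 2 * hsSum e C := by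
  rw [hsSum, hsSum, ← ENNReal.tsum_mul_left]
  refine ENNReal.tsum_le_tsum fun i => ?_
  rw [← mul_pow]
  gcongr
  exact A.le_opENorm _

theorem hsSum_kron_le {ι : Type*} {e : ι → H} (he : IsParseval e) (A B C : H →L[ℂ] H) :
    hsSum e (A ∘L C ∘L ContinuousLinearMap.adjoint B) ≤ ‖A‖ₑ ^ 2 * (‖B‖ₑ ^ 2 * hsSum e C) := by
  refine (hsSum_comp_le e A _).trans ?_
  gcongr
  rw [hsSum_adjoint he he, ContinuousLinearMap.adjoint_comp,
    ContinuousLinearMap.adjoint_adjoint, hsSum_adjoint he he C]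
  exact hsSum_comp_le e B _

/-- The tensor product `(x ⊗ y) v = ⟨v, y⟩ x`, an element of `S₂(H)`. -/
def tensor (x y : H) : HS H :=
  HS.mk (InnerProductSpace.rankOne ℂ x y) (by
    have h : hsSum (stdBasis H) (InnerProductSpace.rankOne ℂ x y) ≤ ‖x‖ₑ ^ 2 * ‖y‖ₑ ^ 2 := by
      rw [← isParseval_hilbertBasis (stdBasis H) y, ← ENNReal.tsum_mul_left]
      refine ENNReal.tsum_le_tsum fun i => le_of_eq ?_
      rw [InnerProductSpace.rankOne_apply, enorm_smul, mul_pow, mul_comm,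
        ← inner_conj_symm y, ← ofReal_norm (starRingEnd ℂ _), RCLike.norm_conj, ofReal_norm]
    exact ne_top_of_le_ne_top (by simp [ENNReal.mul_eq_top]) h)

theorem HS.norm_le_of_enorm_sq_le {C D : HS H} {r : ℝ} (hr : 0 ≤ r)
    (h : ‖C‖ₑ ^ 2 ≤ (ENNReal.ofReal r * ‖D‖ₑ) ^ 2) : ‖C‖ ≤ r * ‖D‖ := by
  have h' := (ENNReal.pow_le_pow_left_iff two_ne_zero).1 h
  rw [← ofReal_norm, ← ofReal_norm, ← ENNReal.ofReal_mul hr] at h'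
  exact (ENNReal.ofReal_le_ofReal_iff (by positivity)).1 h'

theorem hsSum_kron_ne_top (A B : H →L[ℂ] H) (C : HS H) :
    hsSum (stdBasis H) (A ∘L C.op ∘L ContinuousLinearMap.adjoint B) ≠ ∞ :=
  ne_top_of_le_ne_top (by simp [ENNReal.mul_eq_top, C.hsSum_op_ne_top])
    (hsSum_kron_le (isParseval_hilbertBasis (stdBasis H)) A B C.op)

/-- The Kronecker tensor product `(A ⊗̃ B) C = A C B†`, a bounded operator on `S₂(H)`. -/
def kron (A B : H →L[ℂ] H) : HS H →L[ℂ] HS H :=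
  LinearMap.mkContinuous
    { toFun := fun C => HS.mk (A ∘L C.op ∘L ContinuousLinearMap.adjoint B)
        (hsSum_kron_ne_top A B C)
      map_add' := fun C D => HS.op_injective (by ext; simp)
      map_smul' := fun c C => HS.op_injective (by ext; simp) }
    (‖A‖ * ‖B‖) (fun C => by
      refine HS.norm_le_of_enorm_sq_le (by positivity) ?_
      rw [HS.enorm_sq, ENNReal.ofReal_mul (norm_nonneg _), ofReal_norm, ofReal_norm, mul_pow,
        mul_pow, mul_assoc, HS.enorm_sq C]
      exact hsSum_kron_le (isParseval_hilbertBasis (stdBasis H)) A B C.op)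

theorem kron_op (A B : H →L[ℂ] H) (C : HS H) :
    (kron A B C).op = A ∘L C.op ∘L ContinuousLinearMap.adjoint B := rfl

variable (H) in
/-- A complex conjugation on the Hilbert space `H`: an antilinear involution with
`⟨x̄, ȳ⟩ = ⟨y, x⟩`. -/
structure Conjugation where
  /-- the map `x ↦ x̄` -/
  conj : H →L⋆[ℂ] H
  conj_conj : ∀ x, conj (conj x) = x
  inner_conj_conj : ∀ x y, inner ℂ (conj x) (conj y) = inner ℂ y x

/-- The conjugate operator, `Ā x` is the conjugate of `A x̄`. -/
def Conjugation.bar (J : Conjugation H) (A : H →L[ℂ] H) : H →L[ℂ] H := J.conj.comp (A.comp J.conj)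

theorem Conjugation.bar_apply (J : Conjugation H) (A : H →L[ℂ] H) (x : H) :
    J.bar A x = J.conj (A (J.conj x)) := rfl

theorem Conjugation.norm_conj (J : Conjugation H) (x : H) : ‖J.conj x‖ = ‖x‖ := by
  rw [@norm_eq_sqrt_re_inner ℂ, @norm_eq_sqrt_re_inner ℂ _ _ _ _ x, J.inner_conj_conj]

theorem Conjugation.isParseval (J : Conjugation H) {ι : Type*} {e : ι → H} (he : IsParseval e) :
    IsParseval fun i => J.conj (e i) := by
  intro x
  have h := he (J.conj x)
  rw [← ofReal_norm (J.conj x), J.norm_conj, ofReal_norm] at h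
  rw [← h]
  refine tsum_congr fun i => ?_
  rw [← J.inner_conj_conj, J.conj_conj, ← inner_conj_symm, ← ofReal_norm, RCLike.norm_conj,
    ofReal_norm]

theorem Conjugation.hsSum_bar (J : Conjugation H) {ι : Type*} {e : ι → H} (he : IsParseval e)
    (A : H →L[ℂ] H) : hsSum e (J.bar A) = hsSum e A := by
  rw [hsSum_eq he (J.isParseval he) A]
  refine tsum_congr fun i => ?_
  rw [J.bar_apply, ← ofReal_norm, J.norm_conj, ofReal_norm]

/-- The conjugate `C̄` of a Hilbert-Schmidt operator. -/
def Conjugation.barHS (J : Conjugation H) (C : HS H) : HS H :=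
  HS.mk (J.bar C.op) (by
    rw [J.hsSum_bar (isParseval_hilbertBasis _)]
    exact C.hsSum_op_ne_top)

theorem Conjugation.hsSum_transpose (J : Conjugation H) (A : H →L[ℂ] H) :
    hsSum (stdBasis H) (ContinuousLinearMap.adjoint (J.bar A)) = hsSum (stdBasis H) A := by
  have hp := isParseval_hilbertBasis (stdBasis H)
  rw [← hsSum_adjoint hp hp, J.hsSum_bar hp]

/-- The transpose `C ↦ (C̄)†` on `S₂(H)`. -/
def Conjugation.transpose (J : Conjugation H) : HS H →L[ℂ] HS H :=
  LinearMap.mkContinuous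
    { toFun := fun C => HS.mk (ContinuousLinearMap.adjoint (J.bar C.op))
        ((J.hsSum_transpose C.op).trans_ne C.hsSum_op_ne_top)
      map_add' := fun C D => HS.op_injective (by
        have : J.bar (C.op + D.op) = J.bar C.op + J.bar D.op := by
          ext x; simp [Conjugation.bar_apply]
        simp [this])
      map_smul' := fun c C => HS.op_injective (by
        have : J.bar (c • C.op) = (starRingEnd ℂ c) • J.bar C.op := by
          ext x; simp [Conjugation.bar_apply]
        simp [this, map_smulₛₗ]) }
    1 (fun C => by
      refine HS.norm_le_of_enorm_sq_le zero_le_one (le_of_eq ?_)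
      rw [HS.enorm_sq, ENNReal.ofReal_one, one_mul, HS.enorm_sq C]
      exact J.hsSum_transpose C.op)

theorem Conjugation.transpose_op (J : Conjugation H) (C : HS H) :
    (J.transpose C).op = ContinuousLinearMap.adjoint (J.bar C.op) := rfl

/-- The transpose Kronecker tensor product `(A ⊗̃_⊤ B) C = A (C̄)† B†`. -/
def kronT (J : Conjugation H) (A B : H →L[ℂ] H) : HS H →L[ℂ] HS H := kron A B ∘L J.transpose

end Operations

section TimeSeries

variable {Ω S : Type*} [MeasurableSpace Ω] [MeasurableSpace S]

/-- The Bernoulli shift `X_t = g(ε_t, ε_{t-1}, …)`. -/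
def shiftProcess {H : Type*} (g : (ℕ → S) → H) (ε : ℤ → Ω → S) (t : ℤ) (ω : Ω) : H :=
  g fun k => ε (t - k) ω

/-- `ε` is an i.i.d. sequence and `ε'` is an independent copy of it: all the variables
`ε_t`, `ε'_t` together are independent and identically distributed. -/
structure IsIIDWithCopy (ε ε' : ℤ → Ω → S) (P : Measure Ω) : Prop where
  measurable : ∀ t, Measurable (ε t)
  measurable' : ∀ t, Measurable (ε' t)
  indep : iIndepFun (Sum.elim ε ε') P
  identDistrib : ∀ t, IdentDistrib (ε t) (ε 0) P P
  identDistrib' : ∀ t, IdentDistrib (ε' t) (ε 0) P P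

open Classical in
/-- `ε_{t,I}`: the innovations with `ε_t` replaced by `ε'_t` for `t ∈ I`. -/
def coupled (ε ε' : ℤ → Ω → S) (I : Set ℤ) (t : ℤ) : Ω → S := if t ∈ I then ε' t else ε t

/-- The σ-algebra `σ(e_t, e_{t-1}, …)`. -/
abbrev pastSigma (e : ℤ → Ω → S) (t : ℤ) : MeasurableSpace Ω :=
  ⨆ k : ℕ, MeasurableSpace.comap (e (t - k)) inferInstance

/-- The physical dependence coefficient `ν_{H,p}(X_t) = ‖X_t - E[X_t | 𝒢_{t,{0}}]‖_{H,p}`. -/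
def nu {H : Type*} [NormedAddCommGroup H] [InnerProductSpace ℂ H] [CompleteSpace H]
    (P : Measure Ω) (ε ε' : ℤ → Ω → S) (X : ℤ → Ω → H) (p : ℝ≥0∞) (t : ℤ) : ℝ≥0∞ :=
  eLpNorm (X t - P[X t | pastSigma (coupled ε ε' {0}) t]) p P

end TimeSeries

section Statistics

variable {H : Type*} [NormedAddCommGroup H] [InnerProductSpace ℂ H] [CompleteSpace H]
variable {Ω : Type*} [MeasurableSpace Ω]

/-- The lag-`h` covariance operator `C_h = E[X_h ⊗ X_0]` of a centred stationary process. -/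
def lagCov (P : Measure Ω) (X : ℤ → Ω → H) (h : ℤ) : HS H := ∫ ω, tensor (X h ω) (X 0 ω) ∂P

/-- The spectral density operator `F^(λ) = (2π)⁻¹ ∑_h C_h e^{-iλh}`, a series in `S₂(H)`. -/
def specDens (P : Measure Ω) (X : ℤ → Ω → H) (lam : ℝ) : HS H :=
  (1 / (2 * (Real.pi : ℂ))) •
    ∑' h : ℤ, Complex.exp (-(Complex.I * (lam : ℂ) * (h : ℂ))) • lagCov P X h

/-- `φ^(λ)_{T,h} = A_{T,h} e^{iλh}`. -/
def phi (A : ℕ → ℤ → (H →L[ℂ] H)) (lam : ℝ) (T : ℕ) (h : ℤ) : H →L[ℂ] H :=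
  Complex.exp (Complex.I * (lam : ℂ) * (h : ℂ)) • A T h

/-- `Φ^(λ)_{T,s,t} = φ^(λ)_{T,t-s} ⊗̃ I`. -/
def Phi (A : ℕ → ℤ → (H →L[ℂ] H)) (lam : ℝ) (T : ℕ) (s t : ℤ) : HS H →L[ℂ] HS H :=
  kron (phi A lam T (t - s)) (ContinuousLinearMap.id ℂ H)

/-- `‖Φ_T‖_F² = ∑_{s,t=1}^T ‖φ_{T,t-s}‖_∞²`. -/
def frobSq (φ : ℕ → ℤ → (H →L[ℂ] H)) (T : ℕ) : ℝ :=
  ∑ t ∈ Finset.Icc (1 : ℤ) T, ∑ s ∈ Finset.Icc (1 : ℤ) T, ‖φ T (t - s)‖ ^ 2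

/-- `ϱ_T² = ∑_{t=1}^T ‖φ_{T,t}‖_∞²`. -/
def rhoSq (φ : ℕ → ℤ → (H →L[ℂ] H)) (T : ℕ) : ℝ :=
  ∑ t ∈ Finset.Icc (1 : ℤ) T, ‖φ T t‖ ^ 2

/-- The conditions on the weights at frequency `λ`. -/
structure AdmissibleWeights (A : ℕ → ℤ → (H →L[ℂ] H)) (lam : ℝ) : Prop where
  even : ∀ T h, A T (-h) = A T h
  /-- the weights form a Hermitian kernel: `Φ_{T,s,t}† = Φ_{T,t,s}` -/
  hermitian : ∀ T : ℕ, ∀ s ∈ Finset.Icc (1 : ℤ) T, ∀ t ∈ Finset.Icc (1 : ℤ) T,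
    ContinuousLinearMap.adjoint (Phi A lam T s t) = Phi A lam T t s
  /-- the weights can be moved to the other factor: `Φ_{T,s,t}(x ⊗ y) = x ⊗ φ_{T,t-s}† y` -/
  balanced : ∀ T : ℕ, ∀ s ∈ Finset.Icc (1 : ℤ) T, ∀ t ∈ Finset.Icc (1 : ℤ) T, ∀ x y : H,
    Phi A lam T s t (tensor x y) =
      tensor x (ContinuousLinearMap.adjoint (phi A lam T (t - s)) y)
  /-- one divides by `‖Φ_T‖_F` -/
  nondegenerate : ∀ᶠ T in atTop, 0 < frobSq (phi A lam) T
  /-- condition (i) -/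
  balance : (fun T : ℕ => (T : ℝ) * rhoSq (phi A lam) T) =O[atTop] frobSq (phi A lam)
  /-- condition (ii) -/
  negligible : (fun T : ℕ => ⨆ t : Finset.Icc (1 : ℤ) T, ‖phi A lam T t‖ ^ 2)
    =o[atTop] rhoSq (phi A lam)
  /-- condition (iii) -/
  smooth : (fun T : ℕ => ∑ t ∈ Finset.Icc (1 : ℤ) T, ‖A T t - A T (t - 1)‖ ^ 2)
    =o[atTop] rhoSq (phi A lam)
  /-- condition (iv) -/
  overlap : (fun T : ℕ => ∑ j ∈ Finset.Icc (1 : ℤ) (T - 1), ∑ s ∈ Finset.Icc (1 : ℤ) (j - 1),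
      ‖∑ t ∈ Finset.Icc (j + 1) (T : ℤ),
        kron (phi A lam T (s - t)) (phi A lam T (j - t))‖ ^ 2)
    =o[atTop] fun T => frobSq (phi A lam) T ^ 2

/-- The quadratic form `∑_{s,t=1}^T Φ^(λ)_{T,s,t}(X_s ⊗ X_t)`. -/
def Qhat (A : ℕ → ℤ → (H →L[ℂ] H)) (X : ℤ → Ω → H) (lam : ℝ) (T : ℕ) (ω : Ω) : HS H :=
  ∑ s ∈ Finset.Icc (1 : ℤ) T, ∑ t ∈ Finset.Icc (1 : ℤ) T,
    Phi A lam T s t (tensor (X s ω) (X t ω))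

open Classical in
/-- `η(x) = 1` if `x ∈ 2πℤ`, and `0` otherwise. -/
def eta (x : ℝ) : ℂ := if ∃ z : ℤ, x = 2 * Real.pi * z then 1 else 0

/-- The asymptotic covariance of the quadratic forms at the frequencies `λ` and `λ'`. For
`λ, λ' ∈ [0, π]` one has `η(λ - λ') = 1` iff `λ = λ'`, and `η(λ + λ') = 1` iff
`λ = λ' ∈ {0, π}`. -/
def Gam (J : Conjugation H) (F : ℝ → HS H) (lam lam' : ℝ) : HS H →L[ℂ] HS H :=
  (4 * (Real.pi : ℂ) ^ 2) •
    (eta (lam - lam') • kron (F lam).op (F lam).op +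
      eta (lam + lam') • kronT J (F lam).op (F lam).op)

/-- The asymptotic pseudocovariance of the quadratic forms at the frequencies `λ` and `λ'`. -/
def Sig (J : Conjugation H) (F : ℝ → HS H) (lam lam' : ℝ) : HS H →L[ℂ] HS H :=
  (4 * (Real.pi : ℂ) ^ 2) •
    (eta (lam + lam') • kron (F lam).op (F lam).op +
      eta (lam - lam') • kronT J (F lam).op (F lam).op)

/-- `μ` is the law of a vector `(Q_1, …, Q_d)` of jointly complex Gaussian elements of `S₂(H)`
(that is, jointly Gaussian over the reals) with mean zero, covariance operators
`E[Q_i ⊗ Q_j] = Γ_{ij}` and pseudocovariance operators `E[Q_i ⊗ Q̄_j] = Ψ_{ij}`. Here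
`⟨(Q ⊗ R) A, B⟩ = ⟨Q, B⟩ ⟨A, R⟩`, with inner products that are linear in the first entry, while
`inner ℂ` is linear in the second one. -/
structure IsComplexGaussian {d : ℕ} (J : Conjugation H) (μ : Measure (Fin d → HS H))
    (Γ Ψ : Fin d → Fin d → HS H →L[ℂ] HS H) : Prop where
  gaussian : IsGaussian μ
  mean_zero : ∫ q, q ∂μ = 0
  cov : ∀ i j (A B : HS H),
    ∫ q, inner ℂ B (q i) * inner ℂ (q j) A ∂μ = inner ℂ B (Γ i j A)
  pseudocov : ∀ i j (A B : HS H),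
    ∫ q, inner ℂ B (q i) * inner ℂ (J.barHS (q j)) A ∂μ = inner ℂ B (Ψ i j A)

end Statistics

end QuadForm

end

/-! The process is realised on the product space of two-sided i.i.d. sequences as X_t = f(shift t
e), where f depends on the coordinates at times ≤ 0. Dependence is measured only by influences: the
influence of coordinate j is the L⁴ distance between f and f with that coordinate resampled. `theta`
is the sum over j, and the hypothesis on ν bounds it (`IsIIDWithCopy.theta_le`). Exposing the
coordinates one at a time, in any order, gives a martingale, hence a Burkholder inequality in L⁴ and
the Efron–Stein inequality in L². With the product rule for influences and Young's inequality these
give the variance bound `eLpNorm_qform_sub_integral_le`: a centred form Σ w_{st} b(f_s, g_t) has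
squared L² norm at most 16 θ(f)² θ(g)² ‖w‖_F². So weights may be changed at a cost seen by the
Frobenius norm, and the process at a cost seen by θ, uniformly in T.

Three reductions rest on this bound. Hermitian balanced weights are real scalars, and division by
‖Φ_T‖_F turns (i)–(iv) into size estimates for one even real family β
(`AdmissibleWeights.exists_isWeights`). The process is replaced by a finite sum Σ χ_a x_a, with x_a
real vectors and χ_a bounded real functions of finitely many past innovations (`exists_approx`).
Each χ_a is split into martingale differences P_{-k}χ_a, k ≤ m. Shifting their time indices hardly
changes the weights, by (iii), except for a phase. Hence χ_a may be replaced by D_a = Σ_k e^{-iλk}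
P_0 χ_a(k), the projections moved to a common time, and the band |t - s| ≤ m, negligible by (ii),
may be deleted (`integral_form_sub_sq_le`).

For each real linear functional there remains a sum over q of martingale differences ξ_q, built from
linear forms in the D_r with r < q - m times D_q, and their conjugates. `norm_charFun_sum_sub_le`
compares its characteristic function with a Gaussian one, given fourth moments O(T⁻²) and Σ(ξ_q² -
Eξ_q²) → 0 in L². The latter comes down to the Frobenius norm of the kernel Σ_q w_{q-r} w_{q-r'}
e^{i(λ+λ')q}, with λ, λ' among the ±λ_j. In resonance, λ + λ' ∈ 2πℤ, it is controlled by (iv);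
otherwise summation by parts and (iii) make it small. The same dichotomy gives Σ w_{q-r}²
e^{ix(q-r)} → η(x)/2, and E[D_a D̄_b] is the coefficient matrix of 2πF^(λ) (`sum_integral_mul_ex`).
Together they produce Γ and Σ.

Finally, the approximating forms live in finite-dimensional subspaces that do not depend on T, which
gives tightness in S₂(H)^d. Prokhorov's theorem and the convergence of characteristic functionals to
exp(-`limForm`/2) give the limit. Its covariances follow by polarisation, and its independence from
the vanishing of covariances of jointly Gaussian variables. -/

noncomputable section

namespace QuadForm

/-! ### Pairs of independent i.i.d. sequences: mixing and shifting. -/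

section Coupling

set_option linter.unusedSectionVars false

variable {S : Type*} [MeasurableSpace S]

open Classical in
/-- The sequence that agrees with `e` on `I` and with `e'` off `I`. -/
def mix (I : Set ℤ) (e e' : ℤ → S) : ℤ → S := fun k => if k ∈ I then e k else e' k

/-- The time shift of a sequence. -/
def shift (t : ℤ) (e : ℤ → S) : ℤ → S := fun k => e (k + t)

theorem measurable_mix (I : Set ℤ) : Measurable fun p : (ℤ → S) × (ℤ → S) => mix I p.1 p.2 := by
  refine measurable_pi_lambda _ fun k => ?_
  by_cases h : k ∈ I
  · simp only [mix, h, if_true]; fun_prop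
  · simp only [mix, h, if_false]; fun_prop

theorem measurable_shift (t : ℤ) : Measurable (shift t : (ℤ → S) → ℤ → S) :=
  measurable_pi_lambda _ fun _ => measurable_pi_apply _

variable (μ : Measure S) [IsProbabilityMeasure μ]

/-- The law of an i.i.d. sequence with marginal `μ`. -/
abbrev iidLaw : Measure (ℤ → S) := Measure.infinitePi fun _ : ℤ => μ

/-- Seen as one i.i.d. family over ℤ ⊕ ℤ, a pair of sequences inherits a measure-preserving map from
every injection of the index set. The laws agree on boxes because a finite set of indices splits
into its left and right parts. -/
theorem map_sumElim_prod_iidLaw :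
    ((iidLaw μ).prod (iidLaw μ)).map (fun p => Sum.elim p.1 p.2) =
      Measure.infinitePi fun _ : ℤ ⊕ ℤ => μ := by
  have hm : Measurable fun p : (ℤ → S) × (ℤ → S) => (Sum.elim p.1 p.2 : ℤ ⊕ ℤ → S) := by
    refine measurable_pi_lambda _ fun k => ?_
    cases k <;> simp only [Sum.elim_inl, Sum.elim_inr] <;> fun_prop
  refine Measure.eq_infinitePi _ fun s t ht => ?_
  rw [Measure.map_apply hm (MeasurableSet.pi s.countable_toSet fun i _ => ht i)]
  have : (fun p : (ℤ → S) × (ℤ → S) => (Sum.elim p.1 p.2 : ℤ ⊕ ℤ → S)) ⁻¹' (s : Set (ℤ ⊕ ℤ)).pi t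
      = ((s.toLeft : Set ℤ).pi fun i => t (.inl i)) ×ˢ
        ((s.toRight : Set ℤ).pi fun i => t (.inr i)) := by
    ext p
    simp [Set.mem_pi, Sum.forall]
  rw [this, Measure.prod_prod, Measure.infinitePi_pi _ fun i _ => ht _,
    Measure.infinitePi_pi _ fun i _ => ht _]
  conv_rhs => rw [← Finset.toLeft_disjSum_toRight (u := s), Finset.prod_disjSum]

theorem measurePreserving_sumElim :
    MeasurePreserving (fun p : (ℤ → S) × (ℤ → S) => (Sum.elim p.1 p.2 : ℤ ⊕ ℤ → S))
      ((iidLaw μ).prod (iidLaw μ)) (Measure.infinitePi fun _ : ℤ ⊕ ℤ => μ) := by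
  refine ⟨?_, map_sumElim_prod_iidLaw μ⟩
  refine measurable_pi_lambda _ fun k => ?_
  cases k <;> simp only [Sum.elim_inl, Sum.elim_inr] <;> fun_prop

theorem measurePreserving_sumSplit :
    MeasurePreserving (fun e : ℤ ⊕ ℤ → S => (fun k => e (.inl k), fun k => e (.inr k)))
      (Measure.infinitePi fun _ : ℤ ⊕ ℤ => μ) ((iidLaw μ).prod (iidLaw μ)) := by
  have hm : Measurable (fun e : ℤ ⊕ ℤ → S => ((fun k => e (.inl k) : ℤ → S),
      (fun k => e (.inr k) : ℤ → S))) := by fun_prop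
  refine ⟨hm, ?_⟩
  rw [← map_sumElim_prod_iidLaw, Measure.map_map hm (measurePreserving_sumElim μ).measurable]
  exact Measure.map_id

open Classical in
/-- Exchanging the two sequences off `I` preserves the law of a pair of independent sequences. -/
theorem measurePreserving_exchange (I : Set ℤ) :
    MeasurePreserving (fun p : (ℤ → S) × (ℤ → S) => (mix I p.1 p.2, mix I p.2 p.1))
      ((iidLaw μ).prod (iidLaw μ)) ((iidLaw μ).prod (iidLaw μ)) := by
  -- σ transposes the two copies of every k outside I. It is an involution, and reindexing an i.i.d.
  -- family along an injection keeps its law.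
  let σ : ℤ ⊕ ℤ → ℤ ⊕ ℤ := Sum.elim (fun k => if k ∈ I then .inl k else .inr k)
    (fun k => if k ∈ I then .inr k else .inl k)
  have hσ : Function.Injective σ := by
    have : Function.Involutive σ := by
      rintro (k | k) <;> by_cases h : k ∈ I <;> simp [σ, h]
    exact this.injective
  have h : MeasurePreserving (fun (e : ℤ ⊕ ℤ → S) i => e (σ i))
      (Measure.infinitePi fun _ => μ) (Measure.infinitePi fun _ => μ) :=
    ⟨by fun_prop, Measure.map_infinitePi_infinitePi_of_inj (P := fun _ => μ) hσ⟩
  have h3 := (measurePreserving_sumSplit μ).comp (h.comp (measurePreserving_sumElim μ))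
  convert h3 using 1
  funext p
  refine Prod.ext (funext fun k => ?_) (funext fun k => ?_) <;>
    by_cases hk : k ∈ I <;> simp [mix, σ, hk]

theorem measurePreserving_mix (I : Set ℤ) :
    MeasurePreserving (fun p : (ℤ → S) × (ℤ → S) => mix I p.1 p.2)
      ((iidLaw μ).prod (iidLaw μ)) (iidLaw μ) :=
  measurePreserving_fst.comp (measurePreserving_exchange μ I)

theorem measurePreserving_shift (t : ℤ) :
    MeasurePreserving (shift t : (ℤ → S) → ℤ → S) (iidLaw μ) (iidLaw μ) :=
  ⟨measurable_shift t, Measure.map_infinitePi_infinitePi_of_inj (P := fun _ : ℤ => μ)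
    (f := fun k => k + t) (add_left_injective t)⟩

theorem shift_mix (t : ℤ) (I : Set ℤ) (e e' : ℤ → S) :
    shift t (mix I e e') = mix ((· + t) ⁻¹' I) (shift t e) (shift t e') := rfl

theorem shift_shift (s t : ℤ) (e : ℤ → S) : shift s (shift t e) = shift (s + t) e := by
  funext k; simp [shift, add_assoc]

theorem shift_zero (e : ℤ → S) : shift 0 e = e := by funext k; simp [shift]

end Coupling

/-! ### Averages over coordinates and influences of coordinates. -/

section Averaging

set_option linter.unusedSectionVars false

variable {α β : Type*} [MeasurableSpace α] [MeasurableSpace β]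
variable {G : Type*} [NormedAddCommGroup G] [NormedSpace ℝ G]

/-- Integrating out one variable is a contraction in `L^p`. -/
theorem eLpNorm_integral_prod_le {μ : Measure α} {ν : Measure β} [SFinite μ]
    [IsProbabilityMeasure ν] {F : α × β → G} (hF : StronglyMeasurable F) {p : ℝ≥0∞} (hp : 1 ≤ p)
    (hp' : p ≠ ∞) :
    eLpNorm (fun x => ∫ y, F (x, y) ∂ν) p μ ≤ eLpNorm F p (μ.prod ν) := by
  have hp0 : p ≠ 0 := (zero_lt_one.trans_le hp).ne'
  have hpr : 0 < p.toReal := ENNReal.toReal_pos hp0 hp'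
  rw [eLpNorm_eq_lintegral_rpow_enorm_toReal hp0 hp', eLpNorm_eq_lintegral_rpow_enorm_toReal hp0 hp']
  refine ENNReal.rpow_le_rpow ?_ (by positivity)
  rw [lintegral_prod _ (by
    exact (hF.enorm.pow_const _).aemeasurable)]
  refine lintegral_mono fun x => ?_
  -- Jensen's inequality for fixed x, as the comparison of L¹ and Lᵖ norms under the probability
  -- measure ν.
  have h1 : ‖∫ y, F (x, y) ∂ν‖ₑ ≤ eLpNorm (fun y => F (x, y)) p ν := by
    refine (enorm_integral_le_lintegral_enorm _).trans ?_
    rw [← eLpNorm_one_eq_lintegral_enorm]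
    exact eLpNorm_le_eLpNorm_of_exponent_le hp
      (hF.comp_measurable measurable_prodMk_left).aestronglyMeasurable
  have h2 := ENNReal.rpow_le_rpow h1 hpr.le
  rw [eLpNorm_eq_lintegral_rpow_enorm_toReal hp0 hp', ← ENNReal.rpow_mul,
    one_div_mul_cancel hpr.ne', ENNReal.rpow_one] at h2
  exact h2

theorem measurePreserving_prod_right_comm {γ : Type*} [MeasurableSpace γ] (a : Measure α)
    (b : Measure β) (c : Measure γ) [SFinite a] [SFinite b] [SFinite c] :
    MeasurePreserving (fun q : (α × β) × γ => ((q.1.1, q.2), q.1.2))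
      ((a.prod b).prod c) ((a.prod c).prod b) := by
  have a1 := measurePreserving_prodAssoc a b c
  have a2 := (MeasurePreserving.id a).prod (Measure.measurePreserving_swap (μ := b) (ν := c))
  have a3 := (measurePreserving_prodAssoc a c b).symm
  exact a3.comp (a2.comp a1)

variable {S : Type*} [MeasurableSpace S] (μ : Measure S) [IsProbabilityMeasure μ]

/-- The conditional expectation of `f` given the coordinates in `I`. -/
def avg (I : Set ℤ) (f : (ℤ → S) → G) (e : ℤ → S) : G := ∫ e', f (mix I e e') ∂(iidLaw μ)

/-- The `L^p`-influence of coordinate `j` on `f`. -/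
def del (p : ℝ≥0∞) (j : ℤ) (f : (ℤ → S) → G) : ℝ≥0∞ :=
  eLpNorm (fun q : (ℤ → S) × (ℤ → S) => f q.1 - f (mix {j}ᶜ q.1 q.2)) p
    ((iidLaw μ).prod (iidLaw μ))

variable {μ}

theorem stronglyMeasurable_comp_mix {f : (ℤ → S) → G} (hf : StronglyMeasurable f) (I : Set ℤ) :
    StronglyMeasurable fun q : (ℤ → S) × (ℤ → S) => f (mix I q.1 q.2) :=
  hf.comp_measurable (measurable_mix I)

theorem stronglyMeasurable_avg {f : (ℤ → S) → G} (hf : StronglyMeasurable f) (I : Set ℤ) :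
    StronglyMeasurable (avg μ I f) :=
  StronglyMeasurable.integral_prod_right (f := fun e e' => f (mix I e e'))
    (stronglyMeasurable_comp_mix hf I)

theorem dependsOn_avg (f : (ℤ → S) → G) (I : Set ℤ) : DependsOn (avg μ I f) I := by
  intro e₁ e₂ h
  refine integral_congr_ae (Eventually.of_forall fun e' => ?_)
  refine congrArg f (funext fun k => ?_)
  by_cases hk : k ∈ I
  · simp [mix, hk, h k hk]
  · simp [mix, hk]

theorem avg_of_dependsOn [CompleteSpace G] {f : (ℤ → S) → G} {I : Set ℤ} (h : DependsOn f I) :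
    avg μ I f = f := by
  funext e
  have : ∀ e', f (mix I e e') = f e := fun e' => h fun k hk => by simp [mix, hk]
  simp [avg, this]

theorem eLpNorm_comp_mix {f : (ℤ → S) → G} (hf : StronglyMeasurable f) (I : Set ℤ) (p : ℝ≥0∞) :
    eLpNorm (fun q : (ℤ → S) × (ℤ → S) => f (mix I q.1 q.2)) p ((iidLaw μ).prod (iidLaw μ)) =
      eLpNorm f p (iidLaw μ) :=
  eLpNorm_comp_measurePreserving hf.aestronglyMeasurable (measurePreserving_mix μ I)

theorem eLpNorm_avg_le {f : (ℤ → S) → G} (hf : StronglyMeasurable f) (I : Set ℤ) {p : ℝ≥0∞}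
    (hp : 1 ≤ p) (hp' : p ≠ ∞) : eLpNorm (avg μ I f) p (iidLaw μ) ≤ eLpNorm f p (iidLaw μ) := by
  rw [← eLpNorm_comp_mix hf I p]
  exact eLpNorm_integral_prod_le (stronglyMeasurable_comp_mix hf I) hp hp'

theorem memLp_avg {f : (ℤ → S) → G} (hf : StronglyMeasurable f) (I : Set ℤ) {p : ℝ≥0∞}
    (hp : 1 ≤ p) (hp' : p ≠ ∞) (h : MemLp f p (iidLaw μ)) : MemLp (avg μ I f) p (iidLaw μ) :=
  ⟨(stronglyMeasurable_avg hf I).aestronglyMeasurable,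
    (eLpNorm_avg_le hf I hp hp').trans_lt h.2⟩

theorem ae_integrable_mix {f : (ℤ → S) → G} (h : Integrable f (iidLaw μ)) (I : Set ℤ) :
    ∀ᵐ e ∂(iidLaw μ), Integrable (fun e' => f (mix I e e')) (iidLaw μ) := by
  have h1 : Integrable (fun q : (ℤ → S) × (ℤ → S) => f (mix I q.1 q.2))
      ((iidLaw μ).prod (iidLaw μ)) := (measurePreserving_mix μ I).integrable_comp_of_integrable h
  exact h1.prod_right_ae

theorem avg_sub_ae {f g : (ℤ → S) → G} (hf : Integrable f (iidLaw μ))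
    (hg : Integrable g (iidLaw μ)) (I : Set ℤ) :
    avg μ I (f - g) =ᵐ[iidLaw μ] avg μ I f - avg μ I g := by
  filter_upwards [ae_integrable_mix hf I, ae_integrable_mix hg I] with e h1 h2
  exact integral_sub h1 h2

theorem eLpNorm_avg_sub_avg_le {f : (ℤ → S) → G} (hf : StronglyMeasurable f)
    (hi : Integrable f (iidLaw μ)) (I I' : Set ℤ) {p : ℝ≥0∞} (hp : 1 ≤ p) (hp' : p ≠ ∞) :
    eLpNorm (avg μ I f - avg μ I' f) p (iidLaw μ) ≤
      eLpNorm (fun q : (ℤ → S) × (ℤ → S) => f (mix I q.1 q.2) - f (mix I' q.1 q.2)) p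
        ((iidLaw μ).prod (iidLaw μ)) := by
  have : avg μ I f - avg μ I' f =ᵐ[iidLaw μ]
      fun e => ∫ e', (f (mix I e e') - f (mix I' e e')) ∂(iidLaw μ) := by
    filter_upwards [ae_integrable_mix hi I, ae_integrable_mix hi I'] with e h1 h2
    exact (integral_sub h1 h2).symm
  rw [eLpNorm_congr_ae this]
  exact eLpNorm_integral_prod_le (F := fun q : (ℤ → S) × (ℤ → S) =>
    f (mix I q.1 q.2) - f (mix I' q.1 q.2))
    ((stronglyMeasurable_comp_mix hf I).sub (stronglyMeasurable_comp_mix hf I')) hp hp'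

theorem stronglyMeasurable_del {f : (ℤ → S) → G} (hf : StronglyMeasurable f) (j : ℤ) :
    StronglyMeasurable (fun q : (ℤ → S) × (ℤ → S) => f q.1 - f (mix {j}ᶜ q.1 q.2)) :=
  (hf.comp_measurable measurable_fst).sub (stronglyMeasurable_comp_mix hf _)

/-- The influence of `j` bounds the increment of the averages when `j` is added to `I`. -/
theorem eLpNorm_avg_insert_sub_le {f : (ℤ → S) → G} (hf : StronglyMeasurable f)
    (hi : Integrable f (iidLaw μ)) {I : Set ℤ} {j : ℤ} (hj : j ∉ I) {p : ℝ≥0∞}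
    (hp : 1 ≤ p) (hp' : p ≠ ∞) :
    eLpNorm (avg μ (insert j I) f - avg μ I f) p (iidLaw μ) ≤ del μ p j f := by
  refine (eLpNorm_avg_sub_avg_le hf hi _ _ hp hp').trans (le_of_eq ?_)
  -- The exchange along `insert j I` carries the pair (f, f with coordinate j resampled) to (f mixed
  -- along `insert j I`, f mixed along I), because j ∉ I. Hence the two norms are equal.
  rw [del, ← eLpNorm_comp_measurePreserving (f := fun q : (ℤ → S) × (ℤ → S) =>
    (mix (insert j I) q.1 q.2, mix (insert j I) q.2 q.1))
    (stronglyMeasurable_del hf j).aestronglyMeasurable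
    (measurePreserving_exchange μ (insert j I))]
  congr 1
  funext q
  simp only [Function.comp]
  congr 2
  funext k
  by_cases hk : k = j
  · subst hk; simp [mix, hj]
  · have h : k ∈ insert j I ↔ k ∈ I := by simp [hk]
    by_cases hI : k ∈ I <;> simp [mix, hk, h, hI]

theorem del_le {f : (ℤ → S) → G} (hf : StronglyMeasurable f) (j : ℤ) {p : ℝ≥0∞} (hp : 1 ≤ p) :
    del μ p j f ≤ 2 * eLpNorm f p (iidLaw μ) := by
  refine (eLpNorm_sub_le (hf.comp_measurable measurable_fst).aestronglyMeasurable
    (stronglyMeasurable_comp_mix hf _).aestronglyMeasurable hp).trans ?_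
  rw [eLpNorm_comp_mix hf, two_mul]
  refine add_le_add (le_of_eq ?_) le_rfl
  exact eLpNorm_comp_measurePreserving hf.aestronglyMeasurable measurePreserving_fst

theorem del_add_le {f g : (ℤ → S) → G} (hf : StronglyMeasurable f) (hg : StronglyMeasurable g)
    (j : ℤ) {p : ℝ≥0∞} (hp : 1 ≤ p) : del μ p j (f + g) ≤ del μ p j f + del μ p j g := by
  refine le_trans (le_of_eq ?_) (eLpNorm_add_le
    (stronglyMeasurable_del hf j).aestronglyMeasurable
    (stronglyMeasurable_del hg j).aestronglyMeasurable hp)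
  rw [del]
  congr 1
  funext q
  simp only [Pi.add_apply]
  abel

theorem del_sub_le {f g : (ℤ → S) → G} (hf : StronglyMeasurable f) (hg : StronglyMeasurable g)
    (j : ℤ) {p : ℝ≥0∞} (hp : 1 ≤ p) : del μ p j (f - g) ≤ del μ p j f + del μ p j g := by
  refine le_trans (le_of_eq ?_) (eLpNorm_sub_le
    (stronglyMeasurable_del hf j).aestronglyMeasurable
    (stronglyMeasurable_del hg j).aestronglyMeasurable hp)
  rw [del]
  congr 1
  funext q
  simp only [Pi.sub_apply]
  abel

theorem del_const_sub (f : (ℤ → S) → G) (c : G) (j : ℤ) (p : ℝ≥0∞) :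
    del μ p j (fun e => f e - c) = del μ p j f := by
  simp [del]

theorem del_eq_zero {f : (ℤ → S) → G} {I : Set ℤ} (h : DependsOn f I) {j : ℤ} (hj : j ∉ I)
    (p : ℝ≥0∞) : del μ p j f = 0 := by
  have : (fun q : (ℤ → S) × (ℤ → S) => f q.1 - f (mix {j}ᶜ q.1 q.2)) = 0 := by
    funext q
    rw [Pi.zero_apply, sub_eq_zero]
    refine h fun k hk => ?_
    have : k ≠ j := fun h => hj (h ▸ hk)
    simp [mix, this]
  rw [del, this, eLpNorm_zero]

theorem del_comp_shift {f : (ℤ → S) → G} (hf : StronglyMeasurable f) (t j : ℤ) (p : ℝ≥0∞) :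
    del μ p j (f ∘ shift t) = del μ p (j - t) f := by
  have h := (measurePreserving_shift μ t).prod (measurePreserving_shift μ t)
  rw [del, del, ← eLpNorm_comp_measurePreserving
    (stronglyMeasurable_del hf (j - t)).aestronglyMeasurable h]
  congr 1
  funext q
  simp only [Function.comp, shift_mix, Prod.map_fst, Prod.map_snd]
  congr 3
  ext k
  simp only [Set.mem_compl_iff, Set.mem_singleton_iff, Set.mem_preimage]
  omega

theorem integral_comp_shift {f : (ℤ → S) → G} (hf : StronglyMeasurable f) (t : ℤ) :
    ∫ e, f (shift t e) ∂(iidLaw μ) = ∫ e, f e ∂(iidLaw μ) := by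
  rw [← integral_map_of_stronglyMeasurable (measurable_shift t) hf,
    (measurePreserving_shift μ t).map_eq]

theorem integral_comp_mix {f : (ℤ → S) → G} (hf : StronglyMeasurable f) (I : Set ℤ) :
    ∫ q, f (mix I q.1 q.2) ∂((iidLaw μ).prod (iidLaw μ)) = ∫ e, f e ∂(iidLaw μ) := by
  rw [← integral_map_of_stronglyMeasurable (φ := fun q : (ℤ → S) × (ℤ → S) => mix I q.1 q.2)
    (measurable_mix I) hf, (measurePreserving_mix μ I).map_eq]

/-- For j ∈ I, averaging out the coordinates off I commutes with resampling j, so the influence of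
the average is the norm of an averaged increment and the averaging contracts it. For j ∉ I the
average ignores j. -/
theorem del_avg_le {f : (ℤ → S) → G} (hf : StronglyMeasurable f) (hi : Integrable f (iidLaw μ))
    (I : Set ℤ) (j : ℤ) {p : ℝ≥0∞} (hp : 1 ≤ p) (hp' : p ≠ ∞) :
    del μ p j (avg μ I f) ≤ del μ p j f := by
  by_cases hj : j ∈ I
  swap
  · rw [del_eq_zero (dependsOn_avg f I) hj]; exact zero_le
  have hmix : ∀ e e' e'' : ℤ → S, mix I (mix {j}ᶜ e e') e'' = mix {j}ᶜ (mix I e e'') e' := by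
    intro e e' e''
    funext k
    by_cases hk : k = j
    · subst hk; simp [mix, hj]
    · simp [mix, hk]
  have hmp : MeasurePreserving (fun q : ((ℤ → S) × (ℤ → S)) × (ℤ → S) => (mix I q.1.1 q.2, q.1.2))
      (((iidLaw μ).prod (iidLaw μ)).prod (iidLaw μ)) ((iidLaw μ).prod (iidLaw μ)) := by
    have h1 := measurePreserving_prod_right_comm (iidLaw μ) (iidLaw μ) (iidLaw μ)
    exact ((measurePreserving_mix μ I).prod (MeasurePreserving.id (iidLaw μ))).comp h1
  have hF : StronglyMeasurable fun q : ((ℤ → S) × (ℤ → S)) × (ℤ → S) =>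
      f (mix I q.1.1 q.2) - f (mix {j}ᶜ (mix I q.1.1 q.2) q.1.2) :=
    (stronglyMeasurable_del hf j).comp_measurable hmp.measurable
  have hae : (fun q : (ℤ → S) × (ℤ → S) => avg μ I f q.1 - avg μ I f (mix {j}ᶜ q.1 q.2))
      =ᵐ[(iidLaw μ).prod (iidLaw μ)] fun q => ∫ e'', (f (mix I q.1 e'') -
        f (mix {j}ᶜ (mix I q.1 e'') q.2)) ∂(iidLaw μ) := by
    have h1 := ae_integrable_mix hi I
    have h2 := (measurePreserving_fst (μ := iidLaw μ) (ν := iidLaw μ)).quasiMeasurePreserving.ae h1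
    have h3 := (measurePreserving_mix μ {j}ᶜ).quasiMeasurePreserving.ae h1
    filter_upwards [h2, h3] with q h2 h3
    rw [avg, avg, ← integral_sub h2 h3]
    refine integral_congr_ae (Eventually.of_forall fun e'' => ?_)
    simp only [hmix]
  rw [del, eLpNorm_congr_ae hae]
  have h1 := eLpNorm_integral_prod_le (μ := (iidLaw μ).prod (iidLaw μ)) (ν := iidLaw μ) hF hp hp'
  have h2 := eLpNorm_comp_measurePreserving (p := p)
    (stronglyMeasurable_del hf j).aestronglyMeasurable hmp
  exact h1.trans (le_of_eq h2)

end Averaging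

end QuadForm

end

noncomputable section

namespace QuadForm

/-! ### Density of functions of finitely many coordinates. -/

section Density

set_option linter.unusedSectionVars false

variable {G : Type*} [NormedAddCommGroup G] [NormedSpace ℝ G]
variable {S : Type*} [MeasurableSpace S] {μ : Measure S} [IsProbabilityMeasure μ]

/-- Functions of finitely many coordinates are dense in `L^p`. -/
theorem exists_dependsOn_window {f : (ℤ → S) → G} {p : ℝ≥0∞} (hp' : p ≠ ∞)
    (hf : MemLp f p (iidLaw μ)) {r : ℝ≥0∞} (hr : r ≠ 0) :
    ∃ h : (ℤ → S) → G, eLpNorm (f - h) p (iidLaw μ) ≤ r ∧ StronglyMeasurable h ∧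
      ∃ n : ℕ, DependsOn h (Set.Icc (-n : ℤ) n) := by
  refine hf.induction_dense hp' (fun h => StronglyMeasurable h ∧
      ∃ n : ℕ, DependsOn h (Set.Icc (-n : ℤ) n)) ?_ ?_ ?_ hr
  · intro c s hs _ r hr
    obtain ⟨η, hη, h⟩ := exists_eLpNorm_indicator_le (μ := iidLaw μ) hp' c hr
    -- Cylinders form a ring of sets that generates the product σ-algebra, so a measurable set is a
    -- cylinder up to a small symmetric difference.
    obtain ⟨t, ht, hts⟩ := exists_measure_symmDiff_lt_of_generateFrom_isSetRing (μ := iidLaw μ)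
      (isSetRing_measurableCylinders (ι := ℤ) (α := fun _ => S))
      ⟨{Set.univ}, Set.countable_singleton _, by
        simpa using univ_mem_measurableCylinders (fun _ : ℤ => S), by simp⟩
      generateFrom_measurableCylinders.symm hs (ε := η) (by exact_mod_cast hη)
    refine ⟨t.indicator fun _ => c, ?_, ?_, ?_⟩
    · rw [eLpNorm_indicator_sub_indicator]
      exact h _ hts.le
    · exact stronglyMeasurable_const.indicator (MeasurableSet.of_mem_measurableCylinders ht)
    · obtain ⟨I, A, -, rfl⟩ := (mem_measurableCylinders t).1 ht
      obtain ⟨n, hn⟩ : ∃ n : ℕ, ∀ k ∈ I, k ∈ Set.Icc (-n : ℤ) n := by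
        refine ⟨I.sup Int.natAbs, fun k hk => ?_⟩
        have : k.natAbs ≤ I.sup Int.natAbs := Finset.le_sup (f := Int.natAbs) hk
        constructor <;> omega
      refine ⟨n, fun e₁ e₂ h => ?_⟩
      have : I.restrict e₁ = I.restrict e₂ := funext fun k => h k (hn k k.2)
      have h' : e₁ ∈ cylinder I A ↔ e₂ ∈ cylinder I A := by rw [mem_cylinder, mem_cylinder, this]
      by_cases h2 : e₂ ∈ cylinder I A
      · rw [Set.indicator_of_mem (h'.2 h2), Set.indicator_of_mem h2]
      · rw [Set.indicator_of_notMem (fun h => h2 (h'.1 h)), Set.indicator_of_notMem h2]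
  · rintro f g ⟨hf, n, hn⟩ ⟨hg, m, hm⟩
    refine ⟨hf.add hg, max n m, fun e₁ e₂ h => ?_⟩
    simp only [Pi.add_apply]
    rw [hn fun k hk => h k ?_, hm fun k hk => h k ?_]
    · simp only [Set.mem_Icc] at hk ⊢; push_cast; omega
    · simp only [Set.mem_Icc] at hk ⊢; push_cast; omega
  · exact fun f hf => hf.1.aestronglyMeasurable

/-- Large window averages fix every function of finitely many coordinates and all of them contract
Lᵖ. Density of such functions therefore gives convergence, with no martingale convergence theorem.
-/
theorem tendsto_avg_window [CompleteSpace G] {f : (ℤ → S) → G} (hf : StronglyMeasurable f)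
    {p : ℝ≥0∞} (hp : 1 ≤ p) (hp' : p ≠ ∞) (h : MemLp f p (iidLaw μ)) :
    Tendsto (fun n : ℕ => eLpNorm (avg μ (Set.Icc (-n : ℤ) n) f - f) p (iidLaw μ)) atTop (𝓝 0) := by
  rw [ENNReal.tendsto_nhds_zero]
  intro r hr
  have hr2 : r / 2 ≠ 0 := by simp [hr.ne']
  obtain ⟨g, hfg, hg, n, hn⟩ := exists_dependsOn_window hp' h hr2
  filter_upwards [eventually_ge_atTop n] with N hN
  have hgN : avg μ (Set.Icc (-N : ℤ) N) g = g :=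
    avg_of_dependsOn fun e₁ e₂ h => hn fun k hk => h k (by
      simp only [Set.mem_Icc] at hk ⊢; omega)
  by_cases hr' : r = ∞
  · simp [hr']
  have hgp : MemLp g p (iidLaw μ) := by
    have : g = f - (f - g) := by abel
    rw [this]
    refine h.sub ⟨(hf.sub hg).aestronglyMeasurable, hfg.trans_lt ?_⟩
    exact ENNReal.div_lt_top hr' (by simp)
  have hae : avg μ (Set.Icc (-N : ℤ) N) f - f =ᵐ[iidLaw μ]
      avg μ (Set.Icc (-N : ℤ) N) (f - g) - (f - g) := by
    filter_upwards [avg_sub_ae (h.integrable hp) (hgp.integrable hp) (Set.Icc (-N : ℤ) N)] with e he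
    simp only [Pi.sub_apply] at he ⊢
    rw [he, hgN]
    abel
  rw [eLpNorm_congr_ae hae]
  refine (eLpNorm_sub_le (stronglyMeasurable_avg (hf.sub hg) _).aestronglyMeasurable
    (hf.sub hg).aestronglyMeasurable hp).trans ?_
  refine (add_le_add ((eLpNorm_avg_le (hf.sub hg) _ hp hp').trans hfg) hfg).trans ?_
  rw [ENNReal.add_halves]

end Density

/-! ### Averages as conditional expectations. -/

section Orthogonality

variable {S : Type*} [MeasurableSpace S] {μ : Measure S} [IsProbabilityMeasure μ]
variable {G : Type*} [NormedAddCommGroup G] [InnerProductSpace ℂ G] [CompleteSpace G]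

/-- The pull-out property of conditional expectation: V ignores the coordinates that are averaged,
so it passes under the inner integral, and mixing preserves the law. -/
theorem integral_inner_avg {V f : (ℤ → S) → G} (hV : StronglyMeasurable V)
    (hf : StronglyMeasurable f) {I I' : Set ℤ} (hI : I' ⊆ I) (hd : DependsOn V I')
    (hfi : Integrable f (iidLaw μ)) (hVf : Integrable (fun e => inner ℂ (V e) (f e)) (iidLaw μ)) :
    ∫ e, inner ℂ (V e) (avg μ I f e) ∂(iidLaw μ) = ∫ e, inner ℂ (V e) (f e) ∂(iidLaw μ) := by
  have hVm : ∀ e e', V (mix I e e') = V e := fun e e' => hd fun k hk => by simp [mix, hI hk]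
  have h1 : ∫ e, inner ℂ (V e) (avg μ I f e) ∂(iidLaw μ) =
      ∫ e, ∫ e', inner ℂ (V (mix I e e')) (f (mix I e e')) ∂(iidLaw μ) ∂(iidLaw μ) := by
    refine integral_congr_ae ?_
    filter_upwards [ae_integrable_mix hfi I] with e he
    simp only [hVm]
    exact (integral_inner he (V e)).symm
  have hinteg := (measurePreserving_mix μ I).integrable_comp_of_integrable hVf
  rw [h1, ← integral_comp_mix (f := fun e => inner ℂ (V e) (f e)) (hV.inner hf) I]
  exact (integral_prod _ hinteg).symm

/-- Mixing along I keeps the integral of the product but lets U read only the first sequence and V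
only the second, where Fubini factorises. -/
theorem integral_mul_of_disjoint {𝕜 : Type*} [RCLike 𝕜] {U V : (ℤ → S) → 𝕜}
    (hU : StronglyMeasurable U) (hV : StronglyMeasurable V) {I I' : Set ℤ} (hI : Disjoint I I')
    (hdU : DependsOn U I) (hdV : DependsOn V I') :
    ∫ e, U e * V e ∂(iidLaw μ) = (∫ e, U e ∂(iidLaw μ)) * ∫ e, V e ∂(iidLaw μ) := by
  rw [← integral_comp_mix (f := fun e => U e * V e) (hU.mul hV) I, ← integral_prod_mul]
  refine integral_congr_ae (Eventually.of_forall fun q => ?_)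
  have h1 : U (mix I q.1 q.2) = U q.1 := hdU fun k hk => by simp [mix, hk]
  have h2 : V (mix I q.1 q.2) = V q.2 := hdV fun k hk => by
    have : k ∉ I := fun h => Set.disjoint_left.1 hI h hk
    simp [mix, this]
  simp [h1, h2]

end Orthogonality

/-! ### One step of the moment inequalities for martingales. -/

section Burkholder

variable {α : Type*} [MeasurableSpace α] {ν : Measure α}
variable {G : Type*} [NormedAddCommGroup G] [InnerProductSpace ℂ G]

/-- Expand (‖x‖² + 2r + ‖y‖²)² with r = Re⟨x, y⟩. The term ‖x‖² r is kept exactly, because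
orthogonality will integrate it to zero. All the others go into ‖x‖²‖y‖² and ‖y‖⁴ by r² ≤ ‖x‖²‖y‖²
and 2‖x‖‖y‖ ≤ ‖x‖² + ‖y‖². -/
theorem norm_add_pow_four_le (x y : G) :
    ‖x + y‖ ^ 4 ≤ ‖x‖ ^ 4 + 4 * (‖x‖ ^ 2 * (inner ℂ x y).re) + 8 * (‖x‖ ^ 2 * ‖y‖ ^ 2)
      + 3 * ‖y‖ ^ 4 := by
  have h1 : ‖x + y‖ ^ 2 = ‖x‖ ^ 2 + 2 * (inner ℂ x y).re + ‖y‖ ^ 2 := @norm_add_sq ℂ _ _ _ _ x y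
  have h2 : |(inner ℂ x y).re| ≤ ‖x‖ * ‖y‖ :=
    (Complex.abs_re_le_norm _).trans (norm_inner_le_norm x y)
  set r := (inner ℂ x y).re
  have h3 : ‖x + y‖ ^ 4 = (‖x‖ ^ 2 + 2 * r + ‖y‖ ^ 2) ^ 2 := by rw [← h1]; ring
  have h4 : r ^ 2 ≤ ‖x‖ ^ 2 * ‖y‖ ^ 2 := by
    rw [← mul_pow, ← sq_abs r]; gcongr
  have h5 : r ≤ ‖x‖ * ‖y‖ := (le_abs_self r).trans h2
  have h6 : r * ‖y‖ ^ 2 ≤ ‖x‖ * ‖y‖ * ‖y‖ ^ 2 := by gcongr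
  have h7 : 0 ≤ ‖y‖ ^ 2 * (‖x‖ - ‖y‖) ^ 2 := by positivity
  rw [h3]
  nlinarith

theorem integrable_pow_mul_pow {f g : α → ℝ} (hf : MemLp f 4 ν) (hg : MemLp g 4 ν) {k l : ℕ}
    (hkl : k + l = 4) : Integrable (fun a => f a ^ k * g a ^ l) ν := by
  have h4 : Integrable (fun a => |f a| ^ 4 + |g a| ^ 4) ν := by
    have h1 := hf.integrable_norm_pow (p := 4) (by norm_num)
    have h2 := hg.integrable_norm_pow (p := 4) (by norm_num)
    exact h1.add h2
  refine h4.mono' ((hf.1.pow _).mul (hg.1.pow _)) (Eventually.of_forall fun a => ?_)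
  rw [norm_mul, norm_pow, norm_pow, Real.norm_eq_abs, Real.norm_eq_abs]
  rcases le_total |f a| |g a| with h | h
  · calc |f a| ^ k * |g a| ^ l ≤ |g a| ^ k * |g a| ^ l := by gcongr
      _ = |g a| ^ 4 := by rw [← pow_add, hkl]
      _ ≤ _ := by have := pow_nonneg (abs_nonneg (f a)) 4; linarith
  · calc |f a| ^ k * |g a| ^ l ≤ |f a| ^ k * |f a| ^ l := by gcongr
      _ = |f a| ^ 4 := by rw [← pow_add, hkl]
      _ ≤ _ := by have := pow_nonneg (abs_nonneg (g a)) 4; linarith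

theorem integral_norm_pow_eq {E : Type*} [NormedAddCommGroup E] {f : α → E} {n : ℕ} (hn : n ≠ 0)
    (hf : MemLp f n ν) : ∫ a, ‖f a‖ ^ n ∂ν = (eLpNorm f n ν).toReal ^ n := by
  rw [hf.eLpNorm_eq_integral_rpow_norm (by exact_mod_cast hn) (by simp)]
  have h0 : 0 ≤ ∫ a, ‖f a‖ ^ n ∂ν := integral_nonneg fun _ => by positivity
  simp only [ENNReal.toReal_natCast, Real.rpow_natCast]
  rw [ENNReal.toReal_ofReal (by positivity), ← Real.rpow_natCast, ← Real.rpow_mul h0,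
    inv_mul_cancel₀ (by exact_mod_cast hn), Real.rpow_one]

theorem integral_sq_mul_sq_le {f g : α → ℝ} (hf : MemLp f 4 ν) (hg : MemLp g 4 ν) :
    ∫ a, f a ^ 2 * g a ^ 2 ∂ν ≤ (eLpNorm f 4 ν).toReal ^ 2 * (eLpNorm g 4 ν).toReal ^ 2 := by
  have e1 := integral_norm_pow_eq (n := 4) (by norm_num) (by exact_mod_cast hf)
  have e2 := integral_norm_pow_eq (n := 4) (by norm_num) (by exact_mod_cast hg)
  simp only [Nat.cast_ofNat] at e1 e2
  set x := (eLpNorm f 4 ν).toReal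
  set y := (eLpNorm g 4 ν).toReal
  have hx : 0 ≤ x := ENNReal.toReal_nonneg
  have hy : 0 ≤ y := ENNReal.toReal_nonneg
  have i1 : Integrable (fun a => ‖f a‖ ^ 4) ν := hf.integrable_norm_pow (p := 4) (by norm_num)
  have i2 : Integrable (fun a => ‖g a‖ ^ 4) ν := hg.integrable_norm_pow (p := 4) (by norm_num)
  have i3 := integrable_pow_mul_pow hf hg (k := 2) (l := 2) rfl
  have key : ∀ c : ℝ, 0 < c →
      ∫ a, f a ^ 2 * g a ^ 2 ∂ν ≤ (c * x ^ 4 + c⁻¹ * y ^ 4) / 2 := by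
    intro c hc
    rw [← e1, ← e2, ← integral_const_mul, ← integral_const_mul, ← integral_add
      (i1.const_mul _) (i2.const_mul _), ← integral_div]
    refine integral_mono i3 (((i1.const_mul _).add (i2.const_mul _)).div_const _) fun a => ?_
    simp only [Real.norm_eq_abs]
    rw [le_div_iff₀ two_pos]
    have h1 : |f a| ^ 4 = (f a ^ 2) ^ 2 := by rw [← sq_abs (f a)]; ring
    have h2 : |g a| ^ 4 = (g a ^ 2) ^ 2 := by rw [← sq_abs (g a)]; ring
    rw [h1, h2]
    have h3 : 0 ≤ c⁻¹ * (c * f a ^ 2 - g a ^ 2) ^ 2 := by positivity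
    have h4 : c⁻¹ * (c * f a ^ 2 - g a ^ 2) ^ 2 =
      c * (f a ^ 2) ^ 2 + c⁻¹ * (g a ^ 2) ^ 2 - f a ^ 2 * g a ^ 2 * 2 := by
      field_simp; ring
    linarith
  rcases hx.eq_or_lt with h0 | h0
  · rw [← h0]
    have : ∫ a, ‖f a‖ ^ 4 ∂ν = 0 := by rw [e1, ← h0]; norm_num
    rw [integral_eq_zero_iff_of_nonneg (fun a => by positivity) i1] at this
    refine le_of_eq ?_
    rw [zero_pow two_ne_zero, zero_mul]
    refine integral_eq_zero_of_ae ?_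
    filter_upwards [this] with a ha
    have : f a = 0 := by simpa using ha
    simp [this]
  rcases hy.eq_or_lt with h1 | h1
  · rw [← h1]
    have : ∫ a, ‖g a‖ ^ 4 ∂ν = 0 := by rw [e2, ← h1]; norm_num
    rw [integral_eq_zero_iff_of_nonneg (fun a => by positivity) i2] at this
    refine le_of_eq ?_
    rw [zero_pow two_ne_zero, mul_zero]
    refine integral_eq_zero_of_ae ?_
    filter_upwards [this] with a ha
    have : g a = 0 := by simpa using ha
    simp [this]
  -- This weight makes c x⁴ and c⁻¹ y⁴ equal, so the weighted arithmetic-geometric bound becomes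
  -- Cauchy–Schwarz. It needs x and y positive, hence the separate degenerate cases.
  · refine (key (y ^ 2 / x ^ 2) (by positivity)).trans (le_of_eq ?_)
    field_simp
    ring

/-- One step of Burkholder's inequality in `L⁴`. -/
theorem eLpNorm_add_four_le {f g : α → G} (hf : MemLp f 4 ν) (hg : MemLp g 4 ν)
    (h : ∫ a, ‖f a‖ ^ 2 * (inner ℂ (f a) (g a)).re ∂ν = 0) :
    eLpNorm (f + g) 4 ν ^ 2 ≤ eLpNorm f 4 ν ^ 2 + 4 * eLpNorm g 4 ν ^ 2 := by
  have e0 := integral_norm_pow_eq (n := 4) (by norm_num) (by exact_mod_cast hf.add hg)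
  have e1 := integral_norm_pow_eq (n := 4) (by norm_num) (by exact_mod_cast hf)
  have e2 := integral_norm_pow_eq (n := 4) (by norm_num) (by exact_mod_cast hg)
  have e3 := integral_sq_mul_sq_le hf.norm hg.norm
  simp only [Nat.cast_ofNat] at e0 e1 e2
  rw [eLpNorm_norm, eLpNorm_norm] at e3
  have i0 : Integrable (fun a => ‖(f + g) a‖ ^ 4) ν :=
    (hf.add hg).integrable_norm_pow (p := 4) (by norm_num)
  have i1 : Integrable (fun a => ‖f a‖ ^ 4) ν := hf.integrable_norm_pow (p := 4) (by norm_num)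
  have i2 : Integrable (fun a => ‖g a‖ ^ 4) ν := hg.integrable_norm_pow (p := 4) (by norm_num)
  have i3 := integrable_pow_mul_pow hf.norm hg.norm (k := 2) (l := 2) rfl
  have i4 : Integrable (fun a => ‖f a‖ ^ 2 * (inner ℂ (f a) (g a)).re) ν := by
    have := integrable_pow_mul_pow hf.norm hg.norm (k := 3) (l := 1) rfl
    refine this.mono' ?_ (Eventually.of_forall fun a => ?_)
    · exact ((hf.1.norm).pow 2).mul
        (Complex.continuous_re.comp_aestronglyMeasurable (hf.1.inner hg.1))
    · rw [norm_mul, norm_pow, norm_norm]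
      calc ‖f a‖ ^ 2 * ‖(inner ℂ (f a) (g a)).re‖ ≤ ‖f a‖ ^ 2 * (‖f a‖ * ‖g a‖) := by
            gcongr
            exact (Complex.abs_re_le_norm _).trans (norm_inner_le_norm _ _)
        _ = _ := by ring
  have hle : ∫ a, ‖(f + g) a‖ ^ 4 ∂ν ≤ ∫ a, ‖f a‖ ^ 4 ∂ν
      + 8 * ∫ a, ‖f a‖ ^ 2 * ‖g a‖ ^ 2 ∂ν + 3 * ∫ a, ‖g a‖ ^ 4 ∂ν := by
    have : ∫ a, ‖(f + g) a‖ ^ 4 ∂ν ≤ ∫ a, (‖f a‖ ^ 4 + 4 * (‖f a‖ ^ 2 * (inner ℂ (f a) (g a)).re)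
        + 8 * (‖f a‖ ^ 2 * ‖g a‖ ^ 2) + 3 * ‖g a‖ ^ 4) ∂ν :=
      integral_mono i0 (((i1.add (i4.const_mul 4)).add (i3.const_mul 8)).add (i2.const_mul 3))
        fun a => norm_add_pow_four_le (f a) (g a)
    have i5 : Integrable (fun a => ‖f a‖ ^ 4 + 4 * (‖f a‖ ^ 2 * (inner ℂ (f a) (g a)).re)) ν :=
      i1.add (i4.const_mul 4)
    have i6 : Integrable (fun a => ‖f a‖ ^ 4 + 4 * (‖f a‖ ^ 2 * (inner ℂ (f a) (g a)).re)
        + 8 * (‖f a‖ ^ 2 * ‖g a‖ ^ 2)) ν := i5.add (i3.const_mul 8)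
    rw [integral_add i6 (i2.const_mul 3), integral_add i5 (i3.const_mul 8),
      integral_add i1 (i4.const_mul 4), integral_const_mul, integral_const_mul,
      integral_const_mul, h] at this
    linarith
  rw [e0, e1, e2] at hle
  rw [← ENNReal.ofReal_toReal (hf.add hg).2.ne, ← ENNReal.ofReal_toReal hf.2.ne,
    ← ENNReal.ofReal_toReal hg.2.ne]
  have hx : 0 ≤ (eLpNorm f 4 ν).toReal := ENNReal.toReal_nonneg
  have hy : 0 ≤ (eLpNorm g 4 ν).toReal := ENNReal.toReal_nonneg
  have hz : 0 ≤ (eLpNorm (f + g) 4 ν).toReal := ENNReal.toReal_nonneg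
  set x := (eLpNorm f 4 ν).toReal
  set y := (eLpNorm g 4 ν).toReal
  set z := (eLpNorm (f + g) 4 ν).toReal
  -- What is known is z⁴ ≤ x⁴ + 8x²y² + 3y⁴. The constant 4 completes the square: 8 = 2·4 and 3 ≤
  -- 4².
  have hfin : z ^ 2 ≤ x ^ 2 + 4 * y ^ 2 := by
    refine le_of_sq_le_sq ?_ (by positivity)
    nlinarith [sq_nonneg (y ^ 2)]
  rw [← ENNReal.ofReal_pow hx, ← ENNReal.ofReal_pow hy, ← ENNReal.ofReal_pow hz,
    show (4 : ℝ≥0∞) = ENNReal.ofReal 4 by simp, ← ENNReal.ofReal_mul (by norm_num),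
    ← ENNReal.ofReal_add (by positivity) (by positivity)]
  exact ENNReal.ofReal_le_ofReal hfin

theorem eLpNorm_add_two_le {f g : α → G} (hf : MemLp f 2 ν) (hg : MemLp g 2 ν)
    (h : ∫ a, (inner ℂ (f a) (g a)).re ∂ν = 0) :
    eLpNorm (f + g) 2 ν ^ 2 ≤ eLpNorm f 2 ν ^ 2 + eLpNorm g 2 ν ^ 2 := by
  have e0 := integral_norm_pow_eq (n := 2) (by norm_num) (by exact_mod_cast hf.add hg)
  have e1 := integral_norm_pow_eq (n := 2) (by norm_num) (by exact_mod_cast hf)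
  have e2 := integral_norm_pow_eq (n := 2) (by norm_num) (by exact_mod_cast hg)
  simp only [Nat.cast_ofNat] at e0 e1 e2
  have i1 : Integrable (fun a => ‖f a‖ ^ 2) ν := hf.integrable_norm_pow (p := 2) (by norm_num)
  have i2 : Integrable (fun a => ‖g a‖ ^ 2) ν := hg.integrable_norm_pow (p := 2) (by norm_num)
  have i4 : Integrable (fun a => (inner ℂ (f a) (g a)).re) ν := by
    refine (i1.add i2).mono' (Complex.continuous_re.comp_aestronglyMeasurable (hf.1.inner hg.1))
      (Eventually.of_forall fun a => ?_)
    refine ((Complex.abs_re_le_norm _).trans (norm_inner_le_norm _ _)).trans ?_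
    simp only [Pi.add_apply]
    nlinarith [sq_nonneg (‖f a‖ - ‖g a‖), sq_nonneg ‖f a‖, sq_nonneg ‖g a‖]
  have hle : ∫ a, ‖(f + g) a‖ ^ 2 ∂ν = ∫ a, ‖f a‖ ^ 2 ∂ν + ∫ a, ‖g a‖ ^ 2 ∂ν := by
    have : ∀ a, ‖(f + g) a‖ ^ 2 = ‖f a‖ ^ 2 + 2 * (inner ℂ (f a) (g a)).re + ‖g a‖ ^ 2 :=
      fun a => @norm_add_sq ℂ _ _ _ _ (f a) (g a)
    simp_rw [this]
    have i5 : Integrable (fun a => ‖f a‖ ^ 2 + 2 * (inner ℂ (f a) (g a)).re) ν :=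
      i1.add (i4.const_mul 2)
    rw [integral_add i5 i2, integral_add i1 (i4.const_mul 2),
      integral_const_mul, h]
    ring
  rw [e0, e1, e2] at hle
  rw [← ENNReal.ofReal_toReal (hf.add hg).2.ne, ← ENNReal.ofReal_toReal hf.2.ne,
    ← ENNReal.ofReal_toReal hg.2.ne, ← ENNReal.ofReal_pow ENNReal.toReal_nonneg,
    ← ENNReal.ofReal_pow ENNReal.toReal_nonneg, ← ENNReal.ofReal_pow ENNReal.toReal_nonneg,
    ← ENNReal.ofReal_add (by positivity) (by positivity), hle]

end Burkholder

end QuadForm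

end

noncomputable section

namespace QuadForm

/-! ### Burkholder and Efron–Stein inequalities in terms of influences. -/

section EfronStein

set_option linter.unusedSectionVars false

variable {S : Type*} [MeasurableSpace S] {μ : Measure S} [IsProbabilityMeasure μ]
variable {G : Type*} [NormedAddCommGroup G] [InnerProductSpace ℂ G] [CompleteSpace G]

theorem avg_empty (f : (ℤ → S) → G) (e : ℤ → S) : avg μ ∅ f e = ∫ e', f e' ∂(iidLaw μ) := by
  have h : ∀ e', mix ∅ e e' = e' := fun e' => by funext k; simp [mix]
  simp only [avg, h]

/-- Martingale property: exposing more coordinates adds an increment that is orthogonal to every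
function of the coordinates already exposed. Time order plays no role. -/
theorem integral_inner_avg_sub_avg {V f : (ℤ → S) → G} (hV : StronglyMeasurable V)
    (hf : StronglyMeasurable f) {I I' : Set ℤ} (hI : I' ⊆ I) (hd : DependsOn V I')
    (hfi : Integrable f (iidLaw μ)) (hVf : Integrable (fun e => inner ℂ (V e) (f e)) (iidLaw μ))
    (h1 : Integrable (fun e => inner ℂ (V e) (avg μ I f e)) (iidLaw μ))
    (h2 : Integrable (fun e => inner ℂ (V e) (avg μ I' f e)) (iidLaw μ)) :
    ∫ e, inner ℂ (V e) ((avg μ I f - avg μ I' f) e) ∂(iidLaw μ) = 0 := by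
  simp only [Pi.sub_apply, inner_sub_right]
  rw [integral_sub h1 h2, integral_inner_avg hV hf hI hd hfi hVf,
    integral_inner_avg hV hf le_rfl hd hfi hVf, sub_self]

theorem dependsOn_avg_sub (f : (ℤ → S) → G) (I : Set ℤ) (c : G) :
    DependsOn (fun e => avg μ I f e - c) I := fun _ _ h => by
  simp only [dependsOn_avg (μ := μ) f I h]

/-- Burkholder's inequality in `L⁴` for functions of independent variables. -/
theorem eLpNorm_avg_sub_integral_four_le {f : (ℤ → S) → G} (hf : StronglyMeasurable f)
    (h : MemLp f 4 (iidLaw μ)) (s : Finset ℤ) :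
    eLpNorm (fun e => avg μ s f e - ∫ e', f e' ∂(iidLaw μ)) 4 (iidLaw μ) ^ 2 ≤
      4 * ∑ j ∈ s, del μ 4 j f ^ 2 := by
  have hi : Integrable f (iidLaw μ) := h.integrable (by norm_num)
  induction s using Finset.induction_on with
  | empty => simp [avg_empty]
  | insert j s hj ih =>
    set m := ∫ e', f e' ∂(iidLaw μ)
    have h4 : ∀ I : Set ℤ, MemLp (avg μ I f) 4 (iidLaw μ) :=
      fun I => memLp_avg hf I (by norm_num) (by norm_num) h
    have hS : MemLp (fun e => avg μ s f e - m) 4 (iidLaw μ) := (h4 _).sub (memLp_const m)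
    have hSm : StronglyMeasurable (fun e => avg μ s f e - m) :=
      (stronglyMeasurable_avg hf _).sub stronglyMeasurable_const
    have hd : MemLp (avg μ (insert j (s : Set ℤ)) f - avg μ s f) 4 (iidLaw μ) := (h4 _).sub (h4 _)
    have e1 : (fun e => avg μ ((insert j s : Finset ℤ) : Set ℤ) f e - m) =
        (fun e => avg μ s f e - m) + (avg μ (insert j (s : Set ℤ)) f - avg μ s f) := by
      funext e
      rw [Finset.coe_insert]
      simp only [Pi.add_apply, Pi.sub_apply]
      abel
    -- The cross term in the fourth-moment step is the pairing of the new increment with ‖S‖²S, S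
    -- being the centred average over s. This is a function of the coordinates in s, so
    -- orthogonality applies to it.
    have hVm : StronglyMeasurable (fun e => ((‖avg μ s f e - m‖ ^ 2 : ℝ) : ℂ) •
        (avg μ s f e - m)) :=
      (Complex.continuous_ofReal.comp_stronglyMeasurable (hSm.norm.pow 2)).smul hSm
    have hinteg : ∀ g : (ℤ → S) → G, MemLp g 4 (iidLaw μ) → Integrable (fun e => inner ℂ
        (((‖avg μ s f e - m‖ ^ 2 : ℝ) : ℂ) • (avg μ s f e - m)) (g e)) (iidLaw μ) := by
      intro g hg
      refine (integrable_pow_mul_pow hS.norm hg.norm (k := 3) (l := 1) rfl).mono'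
        (hVm.aestronglyMeasurable.inner hg.1) (Eventually.of_forall fun e => ?_)
      refine (norm_inner_le_norm _ _).trans (le_of_eq ?_)
      rw [norm_smul, Complex.norm_real, norm_pow, norm_norm]
      ring
    have horth := integral_inner_avg_sub_avg (μ := μ) hVm hf
      (Set.subset_insert j (s : Set ℤ)) (fun e₁ e₂ h => by
        simp only [dependsOn_avg (μ := μ) f (s : Set ℤ) h]) hi (hinteg f h) (hinteg _ (h4 _))
        (hinteg _ (h4 _))
    have horth' : ∫ e, ‖avg μ s f e - m‖ ^ 2 * (inner ℂ (avg μ s f e - m)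
        ((avg μ (insert j (s : Set ℤ)) f - avg μ s f) e)).re ∂(iidLaw μ) = 0 := by
      have h0 := congrArg Complex.re horth
      rw [Complex.zero_re] at h0
      rw [← h0]
      refine Eq.trans ?_ (integral_re (hinteg _ hd))
      refine integral_congr_ae (Eventually.of_forall fun e => ?_)
      simp only [inner_smul_left, Complex.conj_ofReal]
      exact (Complex.re_ofReal_mul _ _).symm
    rw [e1, Finset.sum_insert hj, mul_add, add_comm (4 * _)]
    refine (eLpNorm_add_four_le hS hd horth').trans ?_
    refine add_le_add ih ?_
    gcongr
    exact eLpNorm_avg_insert_sub_le hf hi (by simpa using hj) (by norm_num) (by norm_num)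

/-- The Efron-Stein inequality for a finite set of variables. -/
theorem eLpNorm_avg_sub_integral_two_le {f : (ℤ → S) → G} (hf : StronglyMeasurable f)
    (h : MemLp f 2 (iidLaw μ)) (s : Finset ℤ) :
    eLpNorm (fun e => avg μ s f e - ∫ e', f e' ∂(iidLaw μ)) 2 (iidLaw μ) ^ 2 ≤
      ∑ j ∈ s, del μ 2 j f ^ 2 := by
  have hi : Integrable f (iidLaw μ) := h.integrable (by norm_num)
  induction s using Finset.induction_on with
  | empty => simp [avg_empty]
  | insert j s hj ih =>
    set m := ∫ e', f e' ∂(iidLaw μ)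
    have h4 : ∀ I : Set ℤ, MemLp (avg μ I f) 2 (iidLaw μ) :=
      fun I => memLp_avg hf I (by norm_num) (by norm_num) h
    have hS : MemLp (fun e => avg μ s f e - m) 2 (iidLaw μ) := (h4 _).sub (memLp_const m)
    have hSm : StronglyMeasurable (fun e => avg μ s f e - m) :=
      (stronglyMeasurable_avg hf _).sub stronglyMeasurable_const
    have hd : MemLp (avg μ (insert j (s : Set ℤ)) f - avg μ s f) 2 (iidLaw μ) := (h4 _).sub (h4 _)
    have e1 : (fun e => avg μ ((insert j s : Finset ℤ) : Set ℤ) f e - m) =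
        (fun e => avg μ s f e - m) + (avg μ (insert j (s : Set ℤ)) f - avg μ s f) := by
      funext e
      rw [Finset.coe_insert]
      simp only [Pi.add_apply, Pi.sub_apply]
      abel
    have hinteg : ∀ g : (ℤ → S) → G, MemLp g 2 (iidLaw μ) → Integrable (fun e => inner ℂ
        (avg μ s f e - m) (g e)) (iidLaw μ) := by
      intro g hg
      have i1 := hS.integrable_norm_pow (p := 2) (by norm_num)
      have i2 := hg.integrable_norm_pow (p := 2) (by norm_num)
      refine (i1.add i2).mono' (hS.1.inner hg.1) (Eventually.of_forall fun e => ?_)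
      refine (norm_inner_le_norm _ _).trans ?_
      simp only [Pi.add_apply]
      nlinarith [sq_nonneg (‖avg μ s f e - m‖ - ‖g e‖), sq_nonneg ‖g e‖,
        sq_nonneg ‖avg μ s f e - m‖]
    have horth := integral_inner_avg_sub_avg (μ := μ) hSm hf
      (Set.subset_insert j (s : Set ℤ)) (dependsOn_avg_sub f _ m) hi (hinteg f h) (hinteg _ (h4 _))
        (hinteg _ (h4 _))
    have horth' : ∫ e, (inner ℂ (avg μ s f e - m)
        ((avg μ (insert j (s : Set ℤ)) f - avg μ s f) e)).re ∂(iidLaw μ) = 0 := by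
      have h0 := congrArg Complex.re horth
      rw [Complex.zero_re] at h0
      rw [← h0]
      exact integral_re (hinteg _ hd)
    rw [e1, Finset.sum_insert hj, add_comm (del μ 2 j f ^ 2)]
    refine (eLpNorm_add_two_le hS hd horth').trans ?_
    refine add_le_add ih ?_
    gcongr
    exact eLpNorm_avg_insert_sub_le hf hi (by simpa using hj) (by norm_num) (by norm_num)

/-- Window averages converge to f in Lᵖ, so a bound that is uniform over finite sets of exposed
coordinates passes to f. -/
theorem eLpNorm_sub_integral_le_of_avg {f : (ℤ → S) → G} (hf : StronglyMeasurable f)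
    {p : ℝ≥0∞} (hp : 1 ≤ p) (hp' : p ≠ ∞) (h : MemLp f p (iidLaw μ)) {C : ℝ≥0∞}
    (hC : ∀ s : Finset ℤ,
      eLpNorm (fun e => avg μ s f e - ∫ e', f e' ∂(iidLaw μ)) p (iidLaw μ) ^ 2 ≤ C) :
    eLpNorm (fun e => f e - ∫ e', f e' ∂(iidLaw μ)) p (iidLaw μ) ^ 2 ≤ C := by
  set m := ∫ e', f e' ∂(iidLaw μ)
  have hlim := tendsto_avg_window hf hp hp' h
  have key : ∀ n : ℕ, eLpNorm (fun e => f e - m) p (iidLaw μ) ≤ C ^ (1 / 2 : ℝ) +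
      eLpNorm (avg μ (Set.Icc (-n : ℤ) n) f - f) p (iidLaw μ) := by
    intro n
    have e1 : (fun e => f e - m) = (fun e => avg μ (Set.Icc (-n : ℤ) n) f e - m) -
        (avg μ (Set.Icc (-n : ℤ) n) f - f) := by
      funext e; simp only [Pi.sub_apply]; abel
    rw [e1]
    refine (eLpNorm_sub_le ((stronglyMeasurable_avg hf _).sub
      stronglyMeasurable_const).aestronglyMeasurable
      ((stronglyMeasurable_avg hf _).sub hf).aestronglyMeasurable hp).trans ?_
    refine add_le_add ?_ le_rfl
    have h1 := hC (Finset.Icc (-n : ℤ) n)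
    rw [Finset.coe_Icc] at h1
    have h2 := ENNReal.rpow_le_rpow h1 (by norm_num : (0 : ℝ) ≤ 1 / 2)
    rw [← ENNReal.rpow_natCast, ← ENNReal.rpow_mul] at h2
    norm_num at h2 ⊢
    exact h2
  have h3 : eLpNorm (fun e => f e - m) p (iidLaw μ) ≤ C ^ (1 / 2 : ℝ) := by
    have := le_of_tendsto_of_tendsto' tendsto_const_nhds
      ((tendsto_const_nhds (x := C ^ (1 / 2 : ℝ))).add hlim) key
    simpa using this
  calc eLpNorm (fun e => f e - m) p (iidLaw μ) ^ 2 ≤ (C ^ (1 / 2 : ℝ)) ^ 2 := by gcongr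
    _ = C := by rw [← ENNReal.rpow_natCast, ← ENNReal.rpow_mul]; norm_num

theorem eLpNorm_sub_integral_four_le {f : (ℤ → S) → G} (hf : StronglyMeasurable f)
    (h : MemLp f 4 (iidLaw μ)) :
    eLpNorm (fun e => f e - ∫ e', f e' ∂(iidLaw μ)) 4 (iidLaw μ) ^ 2 ≤
      4 * ∑' j, del μ 4 j f ^ 2 := by
  refine eLpNorm_sub_integral_le_of_avg hf (by norm_num) (by norm_num) h fun s => ?_
  refine (eLpNorm_avg_sub_integral_four_le hf h s).trans ?_
  gcongr
  exact ENNReal.sum_le_tsum s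

/-- The Efron-Stein inequality. -/
theorem eLpNorm_sub_integral_two_le {f : (ℤ → S) → G} (hf : StronglyMeasurable f)
    (h : MemLp f 2 (iidLaw μ)) :
    eLpNorm (fun e => f e - ∫ e', f e' ∂(iidLaw μ)) 2 (iidLaw μ) ^ 2 ≤
      ∑' j, del μ 2 j f ^ 2 := by
  refine eLpNorm_sub_integral_le_of_avg hf (by norm_num) (by norm_num) h fun s => ?_
  refine (eLpNorm_avg_sub_integral_two_le hf h s).trans ?_
  exact ENNReal.sum_le_tsum s

end EfronStein

/-! ### Young's inequality for convolutions. -/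

section Young

theorem ENNReal_sum_mul_sq_le {ι : Type*} (s : Finset ι) (x y : ι → ℝ≥0∞) :
    (∑ i ∈ s, x i * y i) ^ 2 ≤ (∑ i ∈ s, x i ^ 2) * ∑ i ∈ s, y i ^ 2 := by
  have h := ENNReal.inner_le_Lp_mul_Lq s x y Real.HolderConjugate.two_two
  have h2 : (∑ i ∈ s, x i * y i) ^ 2 ≤ ((∑ i ∈ s, x i ^ (2 : ℝ)) ^ (1 / 2 : ℝ) *
      (∑ i ∈ s, y i ^ (2 : ℝ)) ^ (1 / 2 : ℝ)) ^ 2 := by gcongr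
  refine h2.trans (le_of_eq ?_)
  rw [mul_pow, ← ENNReal.rpow_natCast, ← ENNReal.rpow_mul, ← ENNReal.rpow_natCast,
    ← ENNReal.rpow_mul]
  norm_num

/-- Young's convolution inequality `ℓ² * ℓ¹ ⊆ ℓ²`. -/
theorem tsum_sum_mul_sq_le (s : Finset ℤ) (c θ : ℤ → ℝ≥0∞) :
    ∑' j : ℤ, (∑ t ∈ s, c t * θ (j - t)) ^ 2 ≤ (∑' j, θ j) ^ 2 * ∑ t ∈ s, c t ^ 2 := by
  have hθ : ∀ t : ℤ, ∑' j : ℤ, θ (j - t) = ∑' j, θ j := fun t =>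
    (Equiv.subRight t).tsum_eq θ
  have hθ' : ∀ j : ℤ, ∑ t ∈ s, θ (j - t) ≤ ∑' j, θ j := fun j =>
    (ENNReal.sum_le_tsum s).trans (le_of_eq ((Equiv.subLeft j).tsum_eq θ))
  have h1 : ∀ j : ℤ, (∑ t ∈ s, c t * θ (j - t)) ^ 2 ≤
      (∑' j, θ j) * ∑ t ∈ s, c t ^ 2 * θ (j - t) := by
    intro j
    -- Write θ = θ^(1/2) θ^(1/2): one factor sums to the ℓ¹ norm of θ, the other stays with c² and
    -- is summed over j afterwards.
    have h2 := ENNReal_sum_mul_sq_le s (fun t => θ (j - t) ^ (1 / 2 : ℝ))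
      (fun t => c t * θ (j - t) ^ (1 / 2 : ℝ))
    have e1 : ∀ x : ℝ≥0∞, (x ^ (1 / 2 : ℝ)) ^ 2 = x := fun x => by
      rw [← ENNReal.rpow_natCast, ← ENNReal.rpow_mul]; norm_num
    have e2 : ∀ t, θ (j - t) ^ (1 / 2 : ℝ) * (c t * θ (j - t) ^ (1 / 2 : ℝ)) =
        c t * θ (j - t) := fun t => by
      rw [mul_left_comm, ← sq, e1]
    simp only [mul_pow, e1, e2] at h2
    exact h2.trans (by gcongr; exact hθ' j)
  calc ∑' j : ℤ, (∑ t ∈ s, c t * θ (j - t)) ^ 2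
      ≤ ∑' j : ℤ, (∑' j, θ j) * ∑ t ∈ s, c t ^ 2 * θ (j - t) := ENNReal.tsum_le_tsum h1
    _ = (∑' j, θ j) * ∑ t ∈ s, c t ^ 2 * ∑' j, θ j := by
        rw [ENNReal.tsum_mul_left, Summable.tsum_finsetSum fun _ _ => ENNReal.summable]
        simp_rw [ENNReal.tsum_mul_left, hθ]
    _ = _ := by rw [← Finset.sum_mul]; ring

end Young

end QuadForm

end

noncomputable section

namespace QuadForm

/-! ### Moment bounds for linear and sesquilinear forms. -/

section Forms

set_option linter.unusedSectionVars false

variable {S : Type*} [MeasurableSpace S] {μ : Measure S} [IsProbabilityMeasure μ]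
variable {E : Type*} [NormedAddCommGroup E] [InnerProductSpace ℂ E] [CompleteSpace E]
variable {E' : Type*} [NormedAddCommGroup E'] [InnerProductSpace ℂ E'] [CompleteSpace E']
variable {G : Type*} [NormedAddCommGroup G] [InnerProductSpace ℂ G] [CompleteSpace G]

variable (μ) in
/-- The total `L⁴`-dependence `∑_j δ_j(f)`. -/
def theta (f : (ℤ → S) → E) : ℝ≥0∞ := ∑' j, del μ 4 j f

theorem del_smul (c : ℂ) (f : (ℤ → S) → E) (j : ℤ) (p : ℝ≥0∞) :
    del μ p j (fun e => c • f e) = ‖c‖ₑ * del μ p j f := by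
  rw [del, del, ← eLpNorm_const_smul]
  congr 1
  funext q
  simp [smul_sub]

theorem eLpNorm_fun_sum_le {α ι : Type*} [MeasurableSpace α] {ν : Measure α} {s : Finset ι}
    {f : ι → α → E} (hf : ∀ i ∈ s, AEStronglyMeasurable (f i) ν) {p : ℝ≥0∞} (hp : 1 ≤ p) :
    eLpNorm (fun a => ∑ i ∈ s, f i a) p ν ≤ ∑ i ∈ s, eLpNorm (f i) p ν := by
  have : (fun a => ∑ i ∈ s, f i a) = ∑ i ∈ s, f i := by funext a; simp
  rw [this]
  exact eLpNorm_sum_le hf hp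

theorem del_sum_le {ι : Type*} (s : Finset ι) {f : ι → (ℤ → S) → E}
    (hf : ∀ i ∈ s, StronglyMeasurable (f i)) (j : ℤ) {p : ℝ≥0∞} (hp : 1 ≤ p) :
    del μ p j (fun e => ∑ i ∈ s, f i e) ≤ ∑ i ∈ s, del μ p j (f i) := by
  refine le_trans (le_of_eq ?_) (eLpNorm_sum_le
    (f := fun i (q : (ℤ → S) × (ℤ → S)) => f i q.1 - f i (mix {j}ᶜ q.1 q.2))
    (fun i hi => (stronglyMeasurable_del (hf i hi) j).aestronglyMeasurable) hp)
  rw [del]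
  congr 1
  funext q
  simp [Finset.sum_sub_distrib]

theorem stronglyMeasurable_linear {f : (ℤ → S) → E} (hf : StronglyMeasurable f) (s : Finset ℤ)
    (c : ℤ → ℂ) : StronglyMeasurable (fun e => ∑ t ∈ s, c t • f (shift t e)) :=
  Finset.stronglyMeasurable_fun_sum _ fun t _ =>
    (hf.comp_measurable (measurable_shift t)).const_smul (c t)

theorem memLp_comp_shift {f : (ℤ → S) → E} {p : ℝ≥0∞} (h : MemLp f p (iidLaw μ)) (t : ℤ) :
    MemLp (fun e => f (shift t e)) p (iidLaw μ) :=
  h.comp_measurePreserving (measurePreserving_shift μ t)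

theorem memLp_linear {f : (ℤ → S) → E} {p : ℝ≥0∞}
    (h : MemLp f p (iidLaw μ)) (s : Finset ℤ) (c : ℤ → ℂ) :
    MemLp (fun e => ∑ t ∈ s, c t • f (shift t e)) p (iidLaw μ) :=
  memLp_finsetSum _ fun t _ => (memLp_comp_shift h t).const_smul (c t)

theorem integral_linear {f : (ℤ → S) → E} (hf : StronglyMeasurable f)
    (h : Integrable f (iidLaw μ)) (h0 : ∫ e, f e ∂(iidLaw μ) = 0) (s : Finset ℤ) (c : ℤ → ℂ) :
    ∫ e, ∑ t ∈ s, c t • f (shift t e) ∂(iidLaw μ) = 0 := by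
  rw [integral_finsetSum]
  · refine Finset.sum_eq_zero fun t _ => ?_
    rw [integral_smul, integral_comp_shift hf, h0, smul_zero]
  · intro t _
    exact ((measurePreserving_shift μ t).integrable_comp_of_integrable h).smul (c t)

/-- Moment bound for linear forms of a stationary process. -/
theorem eLpNorm_linear_le {f : (ℤ → S) → E} (hf : StronglyMeasurable f)
    (h : MemLp f 4 (iidLaw μ)) (h0 : ∫ e, f e ∂(iidLaw μ) = 0) (s : Finset ℤ) (c : ℤ → ℂ) :
    eLpNorm (fun e => ∑ t ∈ s, c t • f (shift t e)) 4 (iidLaw μ) ^ 2 ≤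
      4 * (theta μ f ^ 2 * ∑ t ∈ s, ‖c t‖ₑ ^ 2) := by
  have h1 := eLpNorm_sub_integral_four_le (stronglyMeasurable_linear hf s c) (memLp_linear h s c)
  rw [integral_linear hf (h.integrable (by norm_num)) h0] at h1
  simp only [sub_zero] at h1
  refine h1.trans ?_
  gcongr
  refine le_trans (ENNReal.tsum_le_tsum fun j => ?_)
    (tsum_sum_mul_sq_le s (fun t => ‖c t‖ₑ) (fun j => del μ 4 j f))
  gcongr
  refine (del_sum_le s (fun t _ => (hf.comp_measurable (measurable_shift t)).const_smul (c t)) j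
    (by norm_num)).trans (Finset.sum_le_sum fun t _ => le_of_eq ?_)
  rw [← del_comp_shift hf t j 4]
  exact del_smul (c t) (fun e => f (shift t e)) j 4

theorem continuous_sesq (b : E →L[ℂ] E' →L⋆[ℂ] G) : Continuous fun p : E × E' => b p.1 p.2 := by
  refine continuous_iff_continuousAt.2 fun p => ?_
  have h1 : Tendsto (fun q : E × E' => b (q.1 - p.1) q.2) (𝓝 p) (𝓝 0) := by
    have h2 : Tendsto (fun q : E × E' => ‖b (q.1 - p.1)‖ * ‖q.2‖) (𝓝 p) (𝓝 (‖b (p.1 - p.1)‖ * ‖p.2‖)) :=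
      Continuous.tendsto (by fun_prop) p
    rw [sub_self, map_zero, norm_zero, zero_mul] at h2
    exact squeeze_zero_norm (fun q => (b (q.1 - p.1)).le_opNorm q.2) h2
  have h3 : Tendsto (fun q : E × E' => b p.1 q.2) (𝓝 p) (𝓝 (b p.1 p.2)) :=
    Continuous.tendsto ((b p.1).continuous.comp continuous_snd) p
  have h4 := h1.add h3
  rw [zero_add] at h4
  refine h4.congr fun q => ?_
  rw [map_sub, sub_apply, sub_add_cancel]

theorem stronglyMeasurable_sesq (b : E →L[ℂ] E' →L⋆[ℂ] G) {α : Type*} [MeasurableSpace α]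
    {f : α → E} {g : α → E'} (hf : StronglyMeasurable f) (hg : StronglyMeasurable g) :
    StronglyMeasurable fun a => b (f a) (g a) :=
  (continuous_sesq b).comp_stronglyMeasurable (hf.prodMk hg)

theorem eLpNorm_sesq_le {b : E →L[ℂ] E' →L⋆[ℂ] G} (hb : ∀ x y, ‖b x y‖ ≤ ‖x‖ * ‖y‖)
    {α : Type*} [MeasurableSpace α] {ν : Measure α} {f : α → E} {g : α → E'}
    (hf : AEStronglyMeasurable f ν) (hg : AEStronglyMeasurable g ν) :
    eLpNorm (fun a => b (f a) (g a)) 2 ν ≤ eLpNorm f 4 ν * eLpNorm g 4 ν := by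
  have : ENNReal.HolderTriple 4 4 2 := ⟨by
    rw [show (4 : ℝ≥0∞) = 2 * 2 by norm_num, ENNReal.mul_inv (by simp) (by simp), ← two_mul,
      ← mul_assoc, ENNReal.mul_inv_cancel (by simp) (by simp), one_mul]⟩
  refine (eLpNorm_le_eLpNorm_mul_eLpNorm_of_nnnorm (p := 4) (q := 4) (r := 2) hf hg (fun x y => b x y) 1
    (Eventually.of_forall fun a => ?_)).trans (by simp)
  rw [one_mul]
  exact hb _ _

theorem memLp_sesq {b : E →L[ℂ] E' →L⋆[ℂ] G} (hb : ∀ x y, ‖b x y‖ ≤ ‖x‖ * ‖y‖)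
    {α : Type*} [MeasurableSpace α] {ν : Measure α} {f : α → E} {g : α → E'}
    (hf : MemLp f 4 ν) (hg : MemLp g 4 ν) : MemLp (fun a => b (f a) (g a)) 2 ν :=
  ⟨(continuous_sesq b).comp_aestronglyMeasurable (hf.1.prodMk hg.1),
    (eLpNorm_sesq_le hb hf.1 hg.1).trans_lt (ENNReal.mul_lt_top hf.2 hg.2)⟩

/-- The sesquilinear form `∑ w_{st} b(X_s, Y_t)`. -/
def qform (b : E →L[ℂ] E' →L⋆[ℂ] G) (f : (ℤ → S) → E) (g : (ℤ → S) → E') (s t : Finset ℤ)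
    (w : ℤ → ℤ → ℂ) (e : ℤ → S) : G :=
  ∑ i ∈ s, ∑ k ∈ t, w i k • b (f (shift i e)) (g (shift k e))

theorem stronglyMeasurable_qform (b : E →L[ℂ] E' →L⋆[ℂ] G) {f : (ℤ → S) → E} {g : (ℤ → S) → E'}
    (hf : StronglyMeasurable f) (hg : StronglyMeasurable g) (s t : Finset ℤ) (w : ℤ → ℤ → ℂ) :
    StronglyMeasurable (qform b f g s t w) :=
  Finset.stronglyMeasurable_fun_sum _ fun i _ => Finset.stronglyMeasurable_fun_sum _ fun k _ =>
    (stronglyMeasurable_sesq b (hf.comp_measurable (measurable_shift i))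
      (hg.comp_measurable (measurable_shift k))).const_smul _

theorem memLp_qform {b : E →L[ℂ] E' →L⋆[ℂ] G} (hb : ∀ x y, ‖b x y‖ ≤ ‖x‖ * ‖y‖)
    {f : (ℤ → S) → E} {g : (ℤ → S) → E'} (hf : MemLp f 4 (iidLaw μ)) (hg : MemLp g 4 (iidLaw μ))
    (s t : Finset ℤ) (w : ℤ → ℤ → ℂ) : MemLp (qform b f g s t w) 2 (iidLaw μ) :=
  memLp_finsetSum _ fun i _ => memLp_finsetSum _ fun k _ =>
    (memLp_sesq hb (memLp_comp_shift hf i) (memLp_comp_shift hg k)).const_smul _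

/-- Product rule: resampling coordinate j changes b(x, y) by b(Δx, y) + b(x', Δy). The index that is
not differenced is summed first, which leaves linear forms whose L⁴ norms are governed by the ℓ²
norms of the rows and columns of w. This is how the Frobenius norm arises. -/
theorem del_qform_le {b : E →L[ℂ] E' →L⋆[ℂ] G} (hb : ∀ x y, ‖b x y‖ ≤ ‖x‖ * ‖y‖)
    {f : (ℤ → S) → E} {g : (ℤ → S) → E'} (hf : StronglyMeasurable f) (hg : StronglyMeasurable g)
    (s t : Finset ℤ) (w : ℤ → ℤ → ℂ) (j : ℤ) :
    del μ 2 j (qform b f g s t w) ≤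
      ∑ i ∈ s, eLpNorm (fun e => ∑ k ∈ t, starRingEnd ℂ (w i k) • g (shift k e)) 4 (iidLaw μ) *
          del μ 4 (j - i) f +
        ∑ k ∈ t, eLpNorm (fun e => ∑ i ∈ s, w i k • f (shift i e)) 4 (iidLaw μ) *
          del μ 4 (j - k) g := by
  let Lg : ℤ → (ℤ → S) → E' := fun i e => ∑ k ∈ t, starRingEnd ℂ (w i k) • g (shift k e)
  let Lf : ℤ → (ℤ → S) → E := fun k e => ∑ i ∈ s, w i k • f (shift i e)
  have hLg : ∀ i, StronglyMeasurable (Lg i) := fun i => stronglyMeasurable_linear hg t _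
  have hLf : ∀ k, StronglyMeasurable (Lf k) := fun k => stronglyMeasurable_linear hf s _
  have hfs : ∀ i, StronglyMeasurable (f ∘ shift i) := fun i =>
    hf.comp_measurable (measurable_shift i)
  have hgs : ∀ i, StronglyMeasurable (g ∘ shift i) := fun i =>
    hg.comp_measurable (measurable_shift i)
  have e1 : (fun q : (ℤ → S) × (ℤ → S) => qform b f g s t w q.1 - qform b f g s t w (mix {j}ᶜ q.1 q.2)) =
      (fun q => ∑ i ∈ s, b (f (shift i q.1) - f (shift i (mix {j}ᶜ q.1 q.2))) (Lg i q.1)) +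
      fun q => ∑ k ∈ t, b (Lf k (mix {j}ᶜ q.1 q.2))
        (g (shift k q.1) - g (shift k (mix {j}ᶜ q.1 q.2))) := by
    funext q
    simp only [Pi.add_apply, qform, Lg, Lf, map_sum, map_sub, sub_apply,
      sum_apply, map_smulₛₗ, RingHom.id_apply, Complex.conj_conj, smul_apply,
      smul_sub, Finset.sum_sub_distrib]
    rw [Finset.sum_comm (s := t) (t := s), Finset.sum_comm (s := t) (t := s)]
    abel
  rw [del, e1]
  have m1 : ∀ i, StronglyMeasurable fun q : (ℤ → S) × (ℤ → S) =>
      b (f (shift i q.1) - f (shift i (mix {j}ᶜ q.1 q.2))) (Lg i q.1) := fun i =>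
    stronglyMeasurable_sesq b (stronglyMeasurable_del (hfs i) j)
      ((hLg i).comp_measurable measurable_fst)
  have m2 : ∀ k, StronglyMeasurable fun q : (ℤ → S) × (ℤ → S) => b (Lf k (mix {j}ᶜ q.1 q.2))
      (g (shift k q.1) - g (shift k (mix {j}ᶜ q.1 q.2))) := fun k =>
    stronglyMeasurable_sesq b (stronglyMeasurable_comp_mix (hLf k) _)
      (stronglyMeasurable_del (hgs k) j)
  refine (eLpNorm_add_le (Finset.stronglyMeasurable_fun_sum _ fun i _ => m1 i).aestronglyMeasurable
    (Finset.stronglyMeasurable_fun_sum _ fun k _ => m2 k).aestronglyMeasurable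
    (by norm_num)).trans ?_
  refine add_le_add ?_ ?_
  · refine (eLpNorm_fun_sum_le (fun i _ => (m1 i).aestronglyMeasurable) (by norm_num)).trans
      (Finset.sum_le_sum fun i _ => ?_)
    have h1 := eLpNorm_sesq_le (ν := (iidLaw μ).prod (iidLaw μ)) hb
      (stronglyMeasurable_del (hfs i) j).aestronglyMeasurable
      ((hLg i).comp_measurable measurable_fst).aestronglyMeasurable
    have h2 : eLpNorm (Lg i ∘ Prod.fst) 4 ((iidLaw μ).prod (iidLaw μ)) =
        eLpNorm (Lg i) 4 (iidLaw μ) :=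
      eLpNorm_comp_measurePreserving (hLg i).aestronglyMeasurable measurePreserving_fst
    rw [h2] at h1
    rw [mul_comm, ← del_comp_shift hf i j 4]
    exact h1
  · refine (eLpNorm_fun_sum_le (fun k _ => (m2 k).aestronglyMeasurable) (by norm_num)).trans
      (Finset.sum_le_sum fun k _ => ?_)
    have h1 := eLpNorm_sesq_le (ν := (iidLaw μ).prod (iidLaw μ)) hb
      (stronglyMeasurable_comp_mix (hLf k) {j}ᶜ).aestronglyMeasurable
      (stronglyMeasurable_del (hgs k) j).aestronglyMeasurable
    rw [eLpNorm_comp_mix (hLf k)] at h1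
    rw [← del_comp_shift hg k j 4]
    exact h1

/-- Variance bound for sesquilinear forms of stationary processes. -/
theorem eLpNorm_qform_sub_integral_le {b : E →L[ℂ] E' →L⋆[ℂ] G}
    (hb : ∀ x y, ‖b x y‖ ≤ ‖x‖ * ‖y‖) {f : (ℤ → S) → E} {g : (ℤ → S) → E'}
    (hf : StronglyMeasurable f) (hg : StronglyMeasurable g)
    (hf4 : MemLp f 4 (iidLaw μ)) (hg4 : MemLp g 4 (iidLaw μ))
    (hf0 : ∫ e, f e ∂(iidLaw μ) = 0) (hg0 : ∫ e, g e ∂(iidLaw μ) = 0)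
    (s t : Finset ℤ) (w : ℤ → ℤ → ℂ) :
    eLpNorm (fun e => qform b f g s t w e - ∫ e', qform b f g s t w e' ∂(iidLaw μ)) 2
        (iidLaw μ) ^ 2 ≤
      16 * (theta μ f ^ 2 * theta μ g ^ 2 * ∑ i ∈ s, ∑ k ∈ t, ‖w i k‖ₑ ^ 2) := by
  -- Efron–Stein, then Young with the row norms R against the influences of f and the column norms C
  -- against those of g. The constant is 16 = 2·(4 + 4): the 2 from (x + y)² ≤ 2(x² + y²), each 4
  -- from `eLpNorm_linear_le`.
  refine (eLpNorm_sub_integral_two_le (stronglyMeasurable_qform b hf hg s t w)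
    (memLp_qform hb hf4 hg4 s t w)).trans ?_
  set R : ℤ → ℝ≥0∞ := fun i =>
    eLpNorm (fun e => ∑ k ∈ t, starRingEnd ℂ (w i k) • g (shift k e)) 4 (iidLaw μ)
  set C : ℤ → ℝ≥0∞ := fun k => eLpNorm (fun e => ∑ i ∈ s, w i k • f (shift i e)) 4 (iidLaw μ)
  have hR : ∀ i, R i ^ 2 ≤ 4 * (theta μ g ^ 2 * ∑ k ∈ t, ‖w i k‖ₑ ^ 2) := fun i => by
    have := eLpNorm_linear_le hg hg4 hg0 t fun k => starRingEnd ℂ (w i k)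
    simpa only [← ofReal_norm, RCLike.norm_conj] using this
  have hC : ∀ k, C k ^ 2 ≤ 4 * (theta μ f ^ 2 * ∑ i ∈ s, ‖w i k‖ₑ ^ 2) := fun k =>
    eLpNorm_linear_le hf hf4 hf0 s fun i => w i k
  have hsq : ∀ x y : ℝ≥0∞, (x + y) ^ 2 ≤ 2 * (x ^ 2 + y ^ 2) := fun x y => by
    have := ENNReal_sum_mul_sq_le Finset.univ ![x, y] 1
    simp only [Fin.sum_univ_two, Matrix.cons_val_zero, Matrix.cons_val_one, Pi.one_apply,
      mul_one, one_pow, one_add_one_eq_two] at this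
    rwa [mul_comm]
  calc ∑' j, del μ 2 j (qform b f g s t w) ^ 2
      ≤ ∑' j, 2 * ((∑ i ∈ s, R i * del μ 4 (j - i) f) ^ 2 +
          (∑ k ∈ t, C k * del μ 4 (j - k) g) ^ 2) := by
        refine ENNReal.tsum_le_tsum fun j => le_trans ?_ (hsq _ _)
        gcongr
        exact del_qform_le hb hf hg s t w j
    _ ≤ 2 * (theta μ f ^ 2 * ∑ i ∈ s, R i ^ 2 + theta μ g ^ 2 * ∑ k ∈ t, C k ^ 2) := by
        rw [ENNReal.tsum_mul_left, ENNReal.tsum_add]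
        gcongr
        · exact tsum_sum_mul_sq_le s R fun j => del μ 4 j f
        · exact tsum_sum_mul_sq_le t C fun j => del μ 4 j g
    _ ≤ 2 * (theta μ f ^ 2 * ∑ i ∈ s, 4 * (theta μ g ^ 2 * ∑ k ∈ t, ‖w i k‖ₑ ^ 2) +
          theta μ g ^ 2 * ∑ k ∈ t, 4 * (theta μ f ^ 2 * ∑ i ∈ s, ‖w i k‖ₑ ^ 2)) := by
        gcongr with i _ k _
        · exact hR i
        · exact hC k
    _ = _ := by
        rw [← Finset.mul_sum, ← Finset.mul_sum, ← Finset.mul_sum, ← Finset.mul_sum,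
          Finset.sum_comm (s := t) (t := s)]
        ring

end Forms

end QuadForm

end

noncomputable section

namespace QuadForm

/-! ### Closure properties of bounded measurable functions. -/

section BddMeas

variable {Ω : Type*} [MeasurableSpace Ω] {𝕜 : Type*} [RCLike 𝕜]

/-- Bounded measurable functions. -/
def BddMeas (f : Ω → 𝕜) : Prop := StronglyMeasurable f ∧ ∃ B : ℝ, ∀ ω, ‖f ω‖ ≤ B

theorem BddMeas.const (c : 𝕜) : BddMeas fun _ : Ω => c :=
  ⟨stronglyMeasurable_const, ‖c‖, fun _ => le_rfl⟩

theorem BddMeas.add {f g : Ω → 𝕜} (hf : BddMeas f) (hg : BddMeas g) :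
    BddMeas fun ω => f ω + g ω := by
  obtain ⟨hf, B, hB⟩ := hf
  obtain ⟨hg, C, hC⟩ := hg
  exact ⟨hf.add hg, B + C, fun ω => (norm_add_le _ _).trans (add_le_add (hB ω) (hC ω))⟩

theorem BddMeas.sub {f g : Ω → 𝕜} (hf : BddMeas f) (hg : BddMeas g) :
    BddMeas fun ω => f ω - g ω := by
  obtain ⟨hf, B, hB⟩ := hf
  obtain ⟨hg, C, hC⟩ := hg
  exact ⟨hf.sub hg, B + C, fun ω => (norm_sub_le _ _).trans (add_le_add (hB ω) (hC ω))⟩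

theorem BddMeas.mul {f g : Ω → 𝕜} (hf : BddMeas f) (hg : BddMeas g) :
    BddMeas fun ω => f ω * g ω := by
  obtain ⟨hf, B, hB⟩ := hf
  obtain ⟨hg, C, hC⟩ := hg
  refine ⟨hf.mul hg, B * C, fun ω => ?_⟩
  rw [norm_mul]
  exact mul_le_mul (hB ω) (hC ω) (norm_nonneg _) ((norm_nonneg _).trans (hB ω))

theorem BddMeas.pow {f : Ω → 𝕜} (hf : BddMeas f) (n : ℕ) : BddMeas fun ω => f ω ^ n := by
  induction n with
  | zero => simpa using BddMeas.const (Ω := Ω) (1 : 𝕜)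
  | succ n ih => simpa only [pow_succ] using ih.mul hf

theorem BddMeas.sum {ι : Type*} {f : ι → Ω → 𝕜} {s : Finset ι} (hf : ∀ i ∈ s, BddMeas (f i)) :
    BddMeas fun ω => ∑ i ∈ s, f i ω := by
  classical
  induction s using Finset.induction_on with
  | empty => simpa using BddMeas.const (Ω := Ω) (0 : 𝕜)
  | insert i s hi ih =>
    simp only [Finset.sum_insert hi]
    exact (hf i (Finset.mem_insert_self i s)).add
      (ih fun k hk => hf k (Finset.mem_insert_of_mem hk))

theorem BddMeas.norm {f : Ω → 𝕜} (hf : BddMeas f) : BddMeas fun ω => ‖f ω‖ := by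
  obtain ⟨hf, B, hB⟩ := hf
  exact ⟨hf.norm, B, fun ω => by simpa using hB ω⟩

theorem BddMeas.comp {Ω' : Type*} [MeasurableSpace Ω'] {f : Ω → 𝕜} (hf : BddMeas f) {g : Ω' → Ω}
    (hg : Measurable g) : BddMeas fun ω => f (g ω) :=
  ⟨hf.1.comp_measurable hg, hf.2.imp fun _ h ω => h (g ω)⟩

theorem BddMeas.ofReal {f : Ω → ℝ} (hf : BddMeas f) : BddMeas fun ω => (f ω : ℂ) := by
  obtain ⟨hf, B, hB⟩ := hf
  exact ⟨Complex.continuous_ofReal.comp_stronglyMeasurable hf, B, fun ω => by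
    rw [Complex.norm_real]; exact hB ω⟩

theorem BddMeas.conj {f : Ω → ℂ} (hf : BddMeas f) : BddMeas fun ω => starRingEnd ℂ (f ω) := by
  obtain ⟨hf, B, hB⟩ := hf
  exact ⟨Complex.continuous_conj.comp_stronglyMeasurable hf, B, fun ω => by
    rw [RCLike.norm_conj]; exact hB ω⟩

theorem BddMeas.re {f : Ω → ℂ} (hf : BddMeas f) : BddMeas fun ω => (f ω).re := by
  obtain ⟨hf, B, hB⟩ := hf
  exact ⟨Complex.continuous_re.comp_stronglyMeasurable hf, B, fun ω =>
    (Complex.abs_re_le_norm _).trans (hB ω)⟩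

theorem BddMeas.cexp {f : Ω → ℝ} (hf : StronglyMeasurable f) :
    BddMeas fun ω => Complex.exp (f ω * Complex.I) :=
  ⟨(by fun_prop : Continuous fun x : ℝ => Complex.exp (x * Complex.I)).comp_stronglyMeasurable hf,
    1, fun ω => by rw [Complex.norm_exp_ofReal_mul_I]⟩

theorem BddMeas.integrable {f : Ω → 𝕜} (hf : BddMeas f) {P : Measure Ω} [IsFiniteMeasure P] :
    Integrable f P := by
  obtain ⟨hf, B, hB⟩ := hf
  exact Integrable.of_bound hf.aestronglyMeasurable B (Eventually.of_forall hB)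

theorem BddMeas.memLp {f : Ω → 𝕜} (hf : BddMeas f) {P : Measure Ω} [IsFiniteMeasure P]
    (p : ℝ≥0∞) : MemLp f p P := by
  obtain ⟨hf, B, hB⟩ := hf
  exact MemLp.of_bound hf.aestronglyMeasurable B (Eventually.of_forall hB)

end BddMeas

/-! ### Taylor bounds for exponentials, valid on the whole line. -/

section Taylor

theorem norm_cexp_sub_one_le (x : ℝ) : ‖Complex.exp (x * Complex.I) - 1‖ ≤ |x| := by
  have := Real.norm_exp_I_mul_ofReal_sub_one_le (x := x)
  rwa [mul_comm, Real.norm_eq_abs] at this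

theorem norm_cexp_sub_le_sq (x : ℝ) :
    ‖Complex.exp (x * Complex.I) - 1 - x * Complex.I‖ ≤ 2 * x ^ 2 := by
  rcases le_total |x| 1 with h | h
  · have := Complex.norm_exp_sub_one_sub_id_le (x := x * Complex.I) (by simpa using h)
    refine this.trans ?_
    simp only [norm_mul, Complex.norm_real, Complex.norm_I, mul_one, Real.norm_eq_abs, sq_abs]
    nlinarith [sq_nonneg x]
  · have h1 : ‖Complex.exp (x * Complex.I) - 1 - x * Complex.I‖ ≤ |x| + |x| := by
      refine (norm_sub_le _ _).trans (add_le_add (norm_cexp_sub_one_le x) ?_)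
      simp
    refine h1.trans ?_
    rw [← sq_abs]
    nlinarith

/-- Taylor's formula serves for |x| ≤ 1; for |x| ≥ 1 the lower powers are dominated by |x|³. Only
the order of the bound matters later. -/
theorem norm_cexp_sub_le_cube (x : ℝ) :
    ‖Complex.exp (x * Complex.I) - 1 - x * Complex.I + x ^ 2 / 2‖ ≤ 4 * |x| ^ 3 := by
  rcases le_total |x| 1 with h | h
  · have h1 := Complex.norm_exp_sub_sum_le_norm_mul_exp (x * Complex.I) 3
    have h2 : ∑ m ∈ Finset.range 3, ((x : ℂ) * Complex.I) ^ m / (m.factorial : ℂ) =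
        1 + x * Complex.I - x ^ 2 / 2 := by
      simp only [Finset.sum_range_succ, Finset.sum_range_zero, Nat.factorial]
      push_cast
      linear_combination ((x : ℂ) ^ 2 / 2) * Complex.I_sq
    rw [h2] at h1
    have h3 : Complex.exp (x * Complex.I) - (1 + x * Complex.I - x ^ 2 / 2) =
        Complex.exp (x * Complex.I) - 1 - x * Complex.I + x ^ 2 / 2 := by ring
    rw [h3] at h1
    refine h1.trans ?_
    simp only [norm_mul, Complex.norm_real, Complex.norm_I, mul_one, Real.norm_eq_abs]
    have h4 : Real.exp |x| ≤ 4 :=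
      (Real.exp_le_exp.2 h).trans (Real.exp_one_lt_d9.le.trans (by norm_num))
    have h5 : 0 ≤ |x| ^ 3 := by positivity
    nlinarith
  · have h1 : ‖Complex.exp (x * Complex.I) - 1 - x * Complex.I + x ^ 2 / 2‖ ≤
        2 * x ^ 2 + x ^ 2 / 2 := by
      refine (norm_add_le _ _).trans (add_le_add (norm_cexp_sub_le_sq x) (le_of_eq ?_))
      rw [norm_div, norm_pow, Complex.norm_real, Real.norm_eq_abs, sq_abs]
      norm_num
    refine h1.trans ?_
    rw [← sq_abs]
    nlinarith [sq_nonneg |x|]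

theorem abs_exp_neg_sub_le {y : ℝ} (hy : 0 ≤ y) : |Real.exp (-y) - 1 + y| ≤ y ^ 2 := by
  rw [abs_of_nonneg (by linarith [Real.add_one_le_exp (-y)])]
  rcases le_total y 1 with h | h
  · have := Real.norm_exp_sub_one_sub_id_le (x := -y) (by rw [norm_neg, Real.norm_eq_abs, abs_of_nonneg hy]; exact h)
    rw [Real.norm_eq_abs, norm_neg, Real.norm_eq_abs, sq_abs] at this
    have h2 := (le_abs_self _).trans this
    linarith
  · have : Real.exp (-y) ≤ 1 := Real.exp_le_one_iff.2 (by linarith)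
    nlinarith

end Taylor

/-! ### A quantitative central limit theorem for bounded martingale differences. -/

section CLT

variable {Ω : Type*} [MeasurableSpace Ω] {P : Measure Ω} [IsProbabilityMeasure P]

theorem abs_integral_mul_le {f g : Ω → ℝ} (hf : BddMeas f) (hg : BddMeas g) {x y : ℝ}
    (hx : 0 ≤ x) (hy : 0 ≤ y) (h1 : ∫ ω, f ω ^ 2 ∂P ≤ x ^ 2) (h2 : ∫ ω, g ω ^ 2 ∂P ≤ y ^ 2) :
    ∫ ω, |f ω * g ω| ∂P ≤ x * y := by
  have h := integral_mul_norm_le_Lp_mul_Lq (μ := P) Real.HolderConjugate.two_two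
    (f := f) (g := g) (by simpa using hf.memLp 2) (by simpa using hg.memLp 2)
  simp only [abs_mul]
  refine h.trans ?_
  simp only [Real.norm_eq_abs, Real.rpow_two, sq_abs]
  rw [← Real.sqrt_eq_rpow, ← Real.sqrt_eq_rpow]
  refine mul_le_mul ?_ ?_ (Real.sqrt_nonneg _) hx
  · exact Real.sqrt_le_iff.2 ⟨hx, h1⟩
  · exact Real.sqrt_le_iff.2 ⟨hy, h2⟩

theorem integral_sq_le_of_integral_pow_four {f : Ω → ℝ} (hf : BddMeas f) {k : ℝ} (hk : 0 ≤ k)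
    (h : ∫ ω, f ω ^ 4 ∂P ≤ k ^ 2) : ∫ ω, f ω ^ 2 ∂P ≤ k := by
  have h1 := abs_integral_mul_le (P := P) (hf.pow 2) (BddMeas.const (1 : ℝ)) hk zero_le_one
    (by simpa only [← pow_mul] using h) (by simp)
  simpa using h1

/-- Pointwise |f|³ ≤ τf² + f⁴/τ, by comparing |f| with τ. This interpolates between the second and
fourth moments; τ is chosen as T^(-1/2) at the end. -/
theorem integral_abs_pow_three_le {f : Ω → ℝ} (hf : BddMeas f) {k τ : ℝ} (hk : 0 ≤ k) (hτ : 0 < τ)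
    (h : ∫ ω, f ω ^ 4 ∂P ≤ k ^ 2) : ∫ ω, |f ω| ^ 3 ∂P ≤ τ * k + k ^ 2 / τ := by
  have h2 := integral_sq_le_of_integral_pow_four hf hk h
  have i3 : Integrable (fun ω => |f ω| ^ 3) P := (hf.norm.pow 3).integrable
  have i2 : Integrable (fun ω => τ * f ω ^ 2) P := ((hf.pow 2).integrable).const_mul τ
  have i4 : Integrable (fun ω => f ω ^ 4 / τ) P := ((hf.pow 4).integrable).div_const τ
  have hm : ∫ ω, |f ω| ^ 3 ∂P ≤ ∫ ω, (τ * f ω ^ 2 + f ω ^ 4 / τ) ∂P := by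
    refine integral_mono i3 (i2.add i4) fun ω => ?_
    have e1 : f ω ^ 2 = |f ω| ^ 2 := (sq_abs _).symm
    have e2 : f ω ^ 4 = |f ω| ^ 4 := by
      rw [show (4 : ℕ) = 2 * 2 by norm_num, pow_mul, pow_mul, sq_abs]
    show |f ω| ^ 3 ≤ τ * f ω ^ 2 + f ω ^ 4 / τ
    rw [e1, e2]
    have h0 := abs_nonneg (f ω)
    set a := |f ω|
    rcases le_total a τ with h | h
    · have : a ^ 3 ≤ τ * a ^ 2 := by nlinarith [sq_nonneg a]
      have : 0 ≤ a ^ 4 / τ := by positivity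
      linarith
    · have : a ^ 3 ≤ a ^ 4 / τ := by
        rw [le_div_iff₀ hτ]; nlinarith [pow_nonneg h0 3]
      have : 0 ≤ τ * a ^ 2 := by positivity
      linarith
  rw [integral_add i2 i4, integral_const_mul, integral_div] at hm
  refine hm.trans ?_
  gcongr

theorem integral_abs_le {f : Ω → ℝ} (hf : BddMeas f) {k τ : ℝ} (hτ : 0 < τ)
    (h : ∫ ω, f ω ^ 2 ∂P ≤ k) : ∫ ω, |f ω| ∂P ≤ τ + k / τ := by
  have i1 : Integrable (fun ω => |f ω|) P := hf.norm.integrable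
  have i4 : Integrable (fun ω => f ω ^ 2 / τ) P := ((hf.pow 2).integrable).div_const τ
  have hm : ∫ ω, |f ω| ∂P ≤ ∫ ω, (τ + f ω ^ 2 / τ) ∂P := by
    refine integral_mono i1 ((integrable_const τ).add i4) fun ω => ?_
    show |f ω| ≤ τ + f ω ^ 2 / τ
    rw [← sq_abs]
    have h0 := abs_nonneg (f ω)
    set a := |f ω|
    rcases le_total a τ with h | h
    · have : 0 ≤ a ^ 2 / τ := by positivity
      linarith
    · have : a ≤ a ^ 2 / τ := by rw [le_div_iff₀ hτ]; nlinarith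
      linarith
  rw [integral_add (integrable_const τ) i4, integral_div] at hm
  simp only [integral_const, probReal_univ, smul_eq_mul, one_mul] at hm
  refine hm.trans ?_
  gcongr

/-- One step of the comparison with a Gaussian factor. The first-order term dies by the martingale
property and third-order terms are small. The second-order fluctuation φ(ξ² - v) is kept explicitly,
since it becomes small only after summation over the steps. -/
theorem norm_integral_mul_cexp_sub_le {φ : Ω → ℂ} {ξ : Ω → ℝ} (hφ : BddMeas φ)
    (hφ1 : ∀ ω, ‖φ ω‖ ≤ 1) (hξ : BddMeas ξ) (u : ℝ) (h1 : ∫ ω, φ ω * ξ ω ∂P = 0)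
    {k τ v : ℝ} (hk : 0 ≤ k) (hτ : 0 < τ) (h4 : ∫ ω, ξ ω ^ 4 ∂P ≤ k ^ 2) (hv : 0 ≤ v)
    (hvk : v ≤ k) :
    ‖∫ ω, φ ω * Complex.exp ((u * ξ ω : ℝ) * Complex.I) ∂P -
      Real.exp (-(u ^ 2 / 2 * v)) * ∫ ω, φ ω ∂P +
      u ^ 2 / 2 * ∫ ω, φ ω * ((ξ ω ^ 2 - v : ℝ) : ℂ) ∂P‖ ≤
      4 * |u| ^ 3 * (τ * k + k ^ 2 / τ) + u ^ 4 * k ^ 2 := by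
  have he : BddMeas fun ω => Complex.exp ((u * ξ ω : ℝ) * Complex.I) :=
    BddMeas.cexp (hξ.1.const_mul u)
  have hξc := hξ.ofReal
  have hz : BddMeas fun ω => ((ξ ω ^ 2 - v : ℝ) : ℂ) :=
    BddMeas.ofReal (f := fun ω => ξ ω ^ 2 - v) ((hξ.pow 2).sub (BddMeas.const v))
  set E : ℝ := Real.exp (-(u ^ 2 / 2 * v)) with hE
  have key : ∫ ω, φ ω * Complex.exp ((u * ξ ω : ℝ) * Complex.I) ∂P - E * ∫ ω, φ ω ∂P +
      u ^ 2 / 2 * ∫ ω, φ ω * ((ξ ω ^ 2 - v : ℝ) : ℂ) ∂P =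
      ∫ ω, φ ω * (Complex.exp ((u * ξ ω : ℝ) * Complex.I) - 1 -
        (u * ξ ω : ℝ) * Complex.I + ((u * ξ ω : ℝ) : ℂ) ^ 2 / 2) ∂P -
      ((E - 1 + u ^ 2 / 2 * v : ℝ) : ℂ) * ∫ ω, φ ω ∂P := by
    have h5 : ∫ ω, φ ω * (Complex.exp ((u * ξ ω : ℝ) * Complex.I) - 1 -
        (u * ξ ω : ℝ) * Complex.I + ((u * ξ ω : ℝ) : ℂ) ^ 2 / 2) ∂P =
        ∫ ω, φ ω * Complex.exp ((u * ξ ω : ℝ) * Complex.I) ∂P +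
        (((u : ℂ) ^ 2 / 2) * ∫ ω, φ ω * ((ξ ω ^ 2 - v : ℝ) : ℂ) ∂P +
        (((u : ℂ) ^ 2 / 2 * v - 1) * ∫ ω, φ ω ∂P +
        (-(u * Complex.I)) * ∫ ω, φ ω * ξ ω ∂P)) := by
      have i1 := (hφ.mul he).integrable (P := P)
      have i2 := ((hφ.mul hz).integrable (P := P)).const_mul ((u : ℂ) ^ 2 / 2)
      have i3 := (hφ.integrable (P := P)).const_mul ((u : ℂ) ^ 2 / 2 * v - 1)
      have i4 := ((hφ.mul hξc).integrable (P := P)).const_mul (-(u * Complex.I))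
      rw [← integral_const_mul, ← integral_const_mul, ← integral_const_mul, ← integral_add i3 i4,
        ← integral_add i2 (i3.fun_add i4), ← integral_add i1 (i2.fun_add (i3.fun_add i4))]
      refine integral_congr_ae (Eventually.of_forall fun ω => ?_)
      push_cast; ring
    rw [h5, h1]; push_cast; ring
  rw [key]
  refine (norm_sub_le _ _).trans (add_le_add ?_ ?_)
  · have h3 := integral_abs_pow_three_le hξ hk hτ h4
    calc _ ≤ ∫ ω, 4 * |u| ^ 3 * |ξ ω| ^ 3 ∂P := by
          refine norm_integral_le_of_norm_le (((hξ.norm.pow 3).integrable).const_mul _)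
            (Eventually.of_forall fun ω => ?_)
          rw [norm_mul]
          refine (mul_le_of_le_one_left (norm_nonneg _) (hφ1 ω)).trans ?_
          refine (norm_cexp_sub_le_cube _).trans (le_of_eq ?_)
          rw [abs_mul, mul_pow, mul_assoc]
      _ ≤ _ := by rw [integral_const_mul]; gcongr
  · rw [norm_mul, Complex.norm_real, Real.norm_eq_abs]
    have h6 : ‖∫ ω, φ ω ∂P‖ ≤ 1 := by
      have := norm_integral_le_of_norm_le_const (μ := P) (Eventually.of_forall hφ1)
      simpa using this
    have h7 := abs_exp_neg_sub_le (y := u ^ 2 / 2 * v) (by positivity)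
    refine (mul_le_of_le_one_right (abs_nonneg _) h6).trans (h7.trans ?_)
    have h8 : u ^ 2 / 2 * v ≤ u ^ 2 * k := by nlinarith [sq_nonneg u]
    calc _ ≤ (u ^ 2 * k) ^ 2 := by gcongr
      _ = _ := by ring

/-- The change of E[φR] in one step, apart from E[φ(ξ² - v)]. The part of e^{iuξ} - 1 that is linear
in ξ meets R in a martingale difference and vanishes, so R is multiplied by O(ξ²) only and costs kδ.
The rest is of third order. -/
theorem norm_integral_mul_cexp_sub_one_le {φ : Ω → ℂ} {ξ R : Ω → ℝ} (hφ : BddMeas φ)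
    (hφ1 : ∀ ω, ‖φ ω‖ ≤ 1) (hξ : BddMeas ξ) (hR : BddMeas R) (u : ℝ)
    (h2 : ∫ ω, φ ω * (R ω * ξ ω) ∂P = 0)
    {k τ δ v : ℝ} (hk : 0 ≤ k) (hδ : 0 ≤ δ) (hτ : 0 < τ) (h4 : ∫ ω, ξ ω ^ 4 ∂P ≤ k ^ 2)
    (hRδ : ∫ ω, R ω ^ 2 ∂P ≤ δ ^ 2) (hv : 0 ≤ v) (hvk : v ≤ k) :
    ‖∫ ω, φ ω * (Complex.exp ((u * ξ ω : ℝ) * Complex.I) - 1) * ((R ω + (ξ ω ^ 2 - v) : ℝ) : ℂ) ∂P‖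
      ≤ 2 * u ^ 2 * (k * δ) + |u| * (τ * k + k ^ 2 / τ + k * (τ + k / τ)) := by
  have he : BddMeas fun ω => Complex.exp ((u * ξ ω : ℝ) * Complex.I) :=
    BddMeas.cexp (hξ.1.const_mul u)
  have hξc := hξ.ofReal
  have hRc := hR.ofReal
  have hz : BddMeas fun ω => ((ξ ω ^ 2 - v : ℝ) : ℂ) :=
    BddMeas.ofReal (f := fun ω => ξ ω ^ 2 - v) ((hξ.pow 2).sub (BddMeas.const v))
  have key : ∫ ω, φ ω * (Complex.exp ((u * ξ ω : ℝ) * Complex.I) - 1) *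
      ((R ω + (ξ ω ^ 2 - v) : ℝ) : ℂ) ∂P =
      ∫ ω, φ ω * (Complex.exp ((u * ξ ω : ℝ) * Complex.I) - 1 - (u * ξ ω : ℝ) * Complex.I) * R ω ∂P
      + (∫ ω, φ ω * (Complex.exp ((u * ξ ω : ℝ) * Complex.I) - 1) * ((ξ ω ^ 2 - v : ℝ) : ℂ) ∂P
      + u * Complex.I * ∫ ω, φ ω * (R ω * ξ ω) ∂P) := by
    have i1 : Integrable (fun ω => φ ω * (Complex.exp ((u * ξ ω : ℝ) * Complex.I) - 1 -
        (u * ξ ω : ℝ) * Complex.I) * R ω) P := by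
      have h := (hφ.mul ((he.sub (BddMeas.const 1)).sub
        ((BddMeas.const (u * Complex.I)).mul hξc))).mul hRc
      refine (h.integrable (P := P)).congr (Eventually.of_forall fun ω => ?_)
      push_cast; ring
    have i2 := ((hφ.mul (he.sub (BddMeas.const 1))).mul hz).integrable (P := P)
    have i3 := ((hφ.mul (hRc.mul hξc)).integrable (P := P)).const_mul (u * Complex.I)
    rw [← integral_const_mul, ← integral_add i2 i3, ← integral_add i1 (i2.fun_add i3)]
    refine integral_congr_ae (Eventually.of_forall fun ω => ?_)
    push_cast; ring
  rw [key, h2, mul_zero, add_zero]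
  refine (norm_add_le _ _).trans (add_le_add ?_ ?_)
  · have h5 := abs_integral_mul_le (P := P) (hξ.pow 2) hR hk hδ
      (by simpa only [← pow_mul] using h4) hRδ
    calc _ ≤ ∫ ω, 2 * u ^ 2 * |ξ ω ^ 2 * R ω| ∂P := by
          refine norm_integral_le_of_norm_le (((hξ.pow 2).mul hR).norm.integrable.const_mul _)
            (Eventually.of_forall fun ω => ?_)
          rw [norm_mul, norm_mul, Complex.norm_real, Real.norm_eq_abs, abs_mul,
            abs_of_nonneg (sq_nonneg (ξ ω)), ← mul_assoc]
          refine mul_le_mul_of_nonneg_right ?_ (abs_nonneg _)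
          refine (mul_le_of_le_one_left (norm_nonneg _) (hφ1 ω)).trans ?_
          refine (norm_cexp_sub_le_sq _).trans (le_of_eq ?_)
          rw [mul_pow, mul_assoc]
      _ ≤ _ := by rw [integral_const_mul]; gcongr
  · have h3 := integral_abs_pow_three_le hξ hk hτ h4
    have h6 := integral_abs_le (P := P) hξ hτ (integral_sq_le_of_integral_pow_four hξ hk h4)
    have i3 : Integrable (fun ω => |ξ ω| ^ 3) P := (hξ.norm.pow 3).integrable
    have i1 : Integrable (fun ω => k * |ξ ω|) P := hξ.norm.integrable.const_mul k
    calc _ ≤ ∫ ω, |u| * (|ξ ω| ^ 3 + k * |ξ ω|) ∂P := by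
          refine norm_integral_le_of_norm_le ((i3.add i1).const_mul |u|)
            (Eventually.of_forall fun ω => ?_)
          rw [norm_mul, norm_mul, Complex.norm_real, Real.norm_eq_abs]
          have h7 : |ξ ω ^ 2 - v| ≤ |ξ ω| ^ 2 + k := by
            rw [sq_abs]
            exact abs_le.2 ⟨by nlinarith [sq_nonneg (ξ ω)], by nlinarith [sq_nonneg (ξ ω)]⟩
          have h8 : ‖φ ω‖ * ‖Complex.exp ((u * ξ ω : ℝ) * Complex.I) - 1‖ ≤ |u| * |ξ ω| := by
            refine (mul_le_of_le_one_left (norm_nonneg _) (hφ1 ω)).trans ?_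
            rw [← abs_mul]; exact norm_cexp_sub_one_le _
          refine (mul_le_mul h8 h7 (abs_nonneg _) (by positivity)).trans (le_of_eq ?_)
          ring
      _ ≤ _ := by
        rw [integral_const_mul, integral_add i3 i1, integral_const_mul]; gcongr

/-- The error in the normal approximation of the characteristic function of a sum of bounded
martingale differences. -/
theorem norm_charFun_sum_sub_le (n : ℕ) {ξ S R : ℕ → Ω → ℝ} (hξ : ∀ q, BddMeas (ξ q))
    (hS : ∀ q ω, S q ω = ∑ r ∈ Finset.range q, ξ r ω)
    (hR : ∀ q ω, R q ω = ∑ r ∈ Finset.range q, (ξ r ω ^ 2 - ∫ ω', ξ r ω' ^ 2 ∂P)) (u : ℝ)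
    (h1 : ∀ q < n, ∫ ω, Complex.exp ((u * S q ω : ℝ) * Complex.I) * ξ q ω ∂P = 0)
    (h2 : ∀ q < n, ∫ ω, Complex.exp ((u * S q ω : ℝ) * Complex.I) * (R q ω * ξ q ω) ∂P = 0)
    {k δ τ : ℝ} (hk : 0 ≤ k) (hδ : 0 ≤ δ) (hτ : 0 < τ)
    (h4 : ∀ q < n, ∫ ω, ξ q ω ^ 4 ∂P ≤ k ^ 2) (hRδ : ∀ q ≤ n, ∫ ω, R q ω ^ 2 ∂P ≤ δ ^ 2) :
    ‖∫ ω, Complex.exp ((u * S n ω : ℝ) * Complex.I) ∂P -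
        Real.exp (-(u ^ 2 / 2 * ∑ q ∈ Finset.range n, ∫ ω, ξ q ω ^ 2 ∂P))‖ ≤
      n * (4 * |u| ^ 3 * (τ * k + k ^ 2 / τ) + u ^ 4 * k ^ 2) + u ^ 2 / 2 * (2 * δ +
        n * (2 * u ^ 2 * (k * δ) + |u| * (τ * k + k ^ 2 / τ + k * (τ + k / τ)))) := by
  have hSm : ∀ q, BddMeas (S q) := fun q => by
    rw [show S q = fun ω => ∑ r ∈ Finset.range q, ξ r ω from funext (hS q)]
    exact BddMeas.sum fun i _ => hξ i
  have hRm : ∀ q, BddMeas (R q) := fun q => by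
    rw [show R q = fun ω => ∑ r ∈ Finset.range q, (ξ r ω ^ 2 - ∫ ω', ξ r ω' ^ 2 ∂P)
      from funext (hR q)]
    exact BddMeas.sum fun i _ => ((hξ i).pow 2).sub (BddMeas.const _)
  set φ : ℕ → Ω → ℂ := fun q ω => Complex.exp ((u * S q ω : ℝ) * Complex.I) with hφdef
  have hφ : ∀ q, BddMeas (φ q) := fun q => BddMeas.cexp ((hSm q).1.const_mul u)
  have hφ1 : ∀ q ω, ‖φ q ω‖ ≤ 1 := fun q ω => (Complex.norm_exp_ofReal_mul_I _).le
  set v : ℕ → ℝ := fun q => ∫ ω, ξ q ω ^ 2 ∂P with hvdef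
  have hv : ∀ q, 0 ≤ v q := fun q => integral_nonneg fun ω => sq_nonneg _
  have hvk : ∀ q < n, v q ≤ k := fun q hq =>
    integral_sq_le_of_integral_pow_four (hξ q) hk (h4 q hq)
  set V : ℕ → ℝ := fun q => ∑ r ∈ Finset.range q, v r with hVdef
  have hV1 : ∀ q, V (q + 1) = V q + v q := fun q => Finset.sum_range_succ _ _
  have hVm : Monotone V := monotone_nat_of_le_succ fun q => by rw [hV1]; linarith [hv q]
  -- Gaussian factor for the variance of the steps still to come. The numbers c_q E[φ_q] interpolate
  -- between the Gaussian value at q = 0 and the characteristic function at q = n.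
  set c : ℕ → ℝ := fun q => Real.exp (-(u ^ 2 / 2 * (V n - V q))) with hcdef
  have hc0 : ∀ q, 0 ≤ c q := fun q => (Real.exp_pos _).le
  have hc1 : ∀ q ≤ n, c q ≤ 1 := fun q hq => by
    refine Real.exp_le_one_iff.2 ?_
    have := hVm hq
    have : 0 ≤ u ^ 2 / 2 * (V n - V q) := mul_nonneg (by positivity) (by linarith)
    linarith
  have hcm : Monotone c := fun a b hab => by
    refine Real.exp_le_exp.2 (neg_le_neg (mul_le_mul_of_nonneg_left ?_ (by positivity)))
    linarith [hVm hab]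
  have hcn : c n = 1 := by simp [hcdef]
  have hcs : ∀ q, c q = c (q + 1) * Real.exp (-(u ^ 2 / 2 * v q)) := fun q => by
    simp only [hcdef]
    rw [← Real.exp_add, hV1]
    congr 1; ring
  have hφs : ∀ q ω, φ (q + 1) ω = φ q ω * Complex.exp ((u * ξ q ω : ℝ) * Complex.I) := fun q ω => by
    simp only [hφdef]
    rw [← Complex.exp_add, hS, hS, Finset.sum_range_succ]
    congr 1; push_cast; ring
  have hRs : ∀ q ω, R (q + 1) ω = R q ω + (ξ q ω ^ 2 - v q) := fun q ω => by
    rw [hR, hR, Finset.sum_range_succ]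
  have hRn : ∀ q ≤ n, ‖∫ ω, φ q ω * R q ω ∂P‖ ≤ δ := fun q hq => by
    have h5 := abs_integral_mul_le (P := P) (hRm q) (BddMeas.const (1 : ℝ)) hδ zero_le_one
      (hRδ q hq) (by simp)
    rw [mul_one] at h5
    refine le_trans ?_ h5
    refine norm_integral_le_of_norm_le (((hRm q).mul (BddMeas.const 1)).norm.integrable)
      (Eventually.of_forall fun ω => ?_)
    rw [norm_mul, Complex.norm_real, mul_one]
    exact mul_le_of_le_one_left (norm_nonneg _) (hφ1 q ω)
  set e₁ : ℝ := 4 * |u| ^ 3 * (τ * k + k ^ 2 / τ) + u ^ 4 * k ^ 2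
  set e₂ : ℝ := 2 * u ^ 2 * (k * δ) + |u| * (τ * k + k ^ 2 / τ + k * (τ + k / τ))
  -- the first telescoping sum
  set a : ℕ → ℂ := fun q => c q * ∫ ω, φ q ω ∂P with hadef
  set b : ℕ → ℂ := fun q => c q * ∫ ω, φ q ω * R q ω ∂P with hbdef
  set m : ℕ → ℂ := fun q => c (q + 1) * ∫ ω, φ q ω * ((ξ q ω ^ 2 - v q : ℝ) : ℂ) ∂P with hmdef
  have hstep : ∀ q < n, ‖a (q + 1) - a q + u ^ 2 / 2 * m q‖ ≤ e₁ := fun q hq => by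
    have h5 := norm_integral_mul_cexp_sub_le (hφ q) (hφ1 q) (hξ q) u (h1 q hq) hk hτ (h4 q hq)
      (hv q) (hvk q hq)
    have h6 : a (q + 1) - a q + u ^ 2 / 2 * m q = c (q + 1) *
        (∫ ω, φ q ω * Complex.exp ((u * ξ q ω : ℝ) * Complex.I) ∂P -
        Real.exp (-(u ^ 2 / 2 * v q)) * ∫ ω, φ q ω ∂P +
        u ^ 2 / 2 * ∫ ω, φ q ω * ((ξ q ω ^ 2 - v q : ℝ) : ℂ) ∂P) := by
      simp only [hadef, hmdef]
      rw [hcs q, integral_congr_ae (Eventually.of_forall (hφs q))]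
      push_cast; ring
    rw [h6, norm_mul, Complex.norm_real, Real.norm_eq_abs, abs_of_nonneg (hc0 _)]
    exact (mul_le_of_le_one_left (norm_nonneg _) (hc1 _ hq)).trans h5
  -- Summation by parts for the fluctuation terms m_q: they are increments of b_q = c_q E[φ_q R_q]
  -- up to third-order errors and the drift of c. So the accumulated R enters through its L² bound.
  have hstep2 : ∀ q < n, ‖b (q + 1) - b q - m q‖ ≤ e₂ + (c (q + 1) - c q) * δ := fun q hq => by
    have h5 := norm_integral_mul_cexp_sub_one_le (hφ q) (hφ1 q) (hξ q) (hRm q) u (h2 q hq) hk hδ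
      hτ (h4 q hq) (hRδ q hq.le) (hv q) (hvk q hq)
    have he : BddMeas fun ω => Complex.exp ((u * ξ q ω : ℝ) * Complex.I) :=
      BddMeas.cexp ((hξ q).1.const_mul u)
    have hz : BddMeas fun ω => ((ξ q ω ^ 2 - v q : ℝ) : ℂ) :=
      BddMeas.ofReal (f := fun ω => ξ q ω ^ 2 - v q) (((hξ q).pow 2).sub (BddMeas.const (v q)))
    have hRz : BddMeas fun ω => ((R q ω + (ξ q ω ^ 2 - v q) : ℝ) : ℂ) :=
      BddMeas.ofReal (f := fun ω => R q ω + (ξ q ω ^ 2 - v q))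
        ((hRm q).add (((hξ q).pow 2).sub (BddMeas.const (v q))))
    have i1 := (((hφ q).mul (he.sub (BddMeas.const 1))).mul hRz).integrable (P := P)
    have i2 := ((hφ q).mul (hRm q).ofReal).integrable (P := P)
    have i3 := ((hφ q).mul hz).integrable (P := P)
    have h7 : ∫ ω, φ (q + 1) ω * R (q + 1) ω ∂P =
        ∫ ω, φ q ω * (Complex.exp ((u * ξ q ω : ℝ) * Complex.I) - 1) *
          ((R q ω + (ξ q ω ^ 2 - v q) : ℝ) : ℂ) ∂P +
        (∫ ω, φ q ω * R q ω ∂P + ∫ ω, φ q ω * ((ξ q ω ^ 2 - v q : ℝ) : ℂ) ∂P) := by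
      rw [← integral_add i2 i3, ← integral_add i1 (i2.fun_add i3)]
      refine integral_congr_ae (Eventually.of_forall fun ω => ?_)
      beta_reduce
      rw [hφs, hRs]; push_cast; ring
    have h6 : b (q + 1) - b q - m q = c (q + 1) *
        ∫ ω, φ q ω * (Complex.exp ((u * ξ q ω : ℝ) * Complex.I) - 1) *
          ((R q ω + (ξ q ω ^ 2 - v q) : ℝ) : ℂ) ∂P +
        ((c (q + 1) - c q : ℝ) : ℂ) * ∫ ω, φ q ω * R q ω ∂P := by
      simp only [hbdef, hmdef]
      rw [h7]; push_cast; ring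
    rw [h6]
    refine (norm_add_le _ _).trans (add_le_add ?_ ?_)
    · rw [norm_mul, Complex.norm_real, Real.norm_eq_abs, abs_of_nonneg (hc0 _)]
      exact (mul_le_of_le_one_left (norm_nonneg _) (hc1 _ hq)).trans h5
    · have h8 : 0 ≤ c (q + 1) - c q := sub_nonneg.2 (hcm (Nat.le_succ q))
      rw [norm_mul, Complex.norm_real, Real.norm_eq_abs, abs_of_nonneg h8]
      exact mul_le_mul_of_nonneg_left (hRn q hq.le) h8
  have hb0 : b 0 = 0 := by simp [hbdef, hR]
  have hbn : ‖b n‖ ≤ δ := by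
    simp only [hbdef, hcn, Complex.ofReal_one, one_mul]; exact hRn n le_rfl
  -- c is monotone with c_n = 1, so its total increase is at most 1 and the drift costs δ once, not
  -- n times.
  have hsum2 : ‖b n - ∑ q ∈ Finset.range n, m q‖ ≤ n * e₂ + δ := by
    have h5 : b n - ∑ q ∈ Finset.range n, m q =
        ∑ q ∈ Finset.range n, (b (q + 1) - b q - m q) := by
      rw [Finset.sum_sub_distrib, Finset.sum_range_sub, hb0, sub_zero]
    rw [h5]
    refine (norm_sum_le_of_le _ fun q hq => hstep2 q (Finset.mem_range.1 hq)).trans ?_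
    rw [Finset.sum_add_distrib, ← Finset.sum_mul, Finset.sum_range_sub, hcn]
    simp only [Finset.sum_const, Finset.card_range, nsmul_eq_mul]
    nlinarith [hc0 0]
  have hsum1 : ‖a n - a 0 + u ^ 2 / 2 * ∑ q ∈ Finset.range n, m q‖ ≤ n * e₁ := by
    have h5 : a n - a 0 + u ^ 2 / 2 * ∑ q ∈ Finset.range n, m q =
        ∑ q ∈ Finset.range n, (a (q + 1) - a q + u ^ 2 / 2 * m q) := by
      rw [Finset.sum_add_distrib, Finset.sum_range_sub, Finset.mul_sum]
    rw [h5]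
    refine (norm_sum_le_of_le _ fun q hq => hstep q (Finset.mem_range.1 hq)).trans ?_
    simp
  have han : a n = ∫ ω, Complex.exp ((u * S n ω : ℝ) * Complex.I) ∂P := by
    simp [hadef, hcn, hφdef]
  have ha0 : a 0 = Real.exp (-(u ^ 2 / 2 * ∑ q ∈ Finset.range n, ∫ ω, ξ q ω ^ 2 ∂P)) := by
    simp [hadef, hφdef, hcdef, hVdef, hvdef, hS]
  rw [← han, ← ha0]
  have hfin : a n - a 0 = (a n - a 0 + u ^ 2 / 2 * ∑ q ∈ Finset.range n, m q) +
      u ^ 2 / 2 * ((b n - ∑ q ∈ Finset.range n, m q) - b n) := by ring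
  rw [hfin]
  refine (norm_add_le _ _).trans (add_le_add hsum1 ?_)
  have hu : ‖(u : ℂ) ^ 2 / 2‖ = u ^ 2 / 2 := by
    rw [norm_div, norm_pow, Complex.norm_real, Real.norm_eq_abs, sq_abs]; norm_num
  rw [norm_mul, hu]
  refine mul_le_mul_of_nonneg_left ((norm_sub_le _ _).trans ?_) (by positivity)
  linarith

end CLT

end QuadForm

end

noncomputable section

namespace QuadForm

/-! ### Functions of finitely many innovations, and martingale differences among them. -/

section Windows

set_option linter.unusedSectionVars false

variable {S : Type*}

theorem dependsOn_comp_shift {α : Type*} {f : (ℤ → S) → α} {I I' : Set ℤ} (hf : DependsOn f I)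
    (t : ℤ) (h : ∀ k ∈ I, k + t ∈ I') : DependsOn (fun e => f (shift t e)) I' :=
  fun _ _ hxy => hf fun k hk => hxy _ (h k hk)

theorem DependsOn.mul' {α : Type*} [Mul α] {f g : (ℤ → S) → α} {I : Set ℤ} (hf : DependsOn f I)
    (hg : DependsOn g I) : DependsOn (fun e => f e * g e) I :=
  fun _ _ hxy => congrArg₂ _ (hf hxy) (hg hxy)

theorem DependsOn.sub' {α : Type*} [Sub α] {f g : (ℤ → S) → α} {I : Set ℤ} (hf : DependsOn f I)
    (hg : DependsOn g I) : DependsOn (fun e => f e - g e) I :=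
  fun _ _ hxy => congrArg₂ _ (hf hxy) (hg hxy)

theorem DependsOn.sum' {α ι : Type*} [AddCommMonoid α] {f : ι → (ℤ → S) → α} {s : Finset ι}
    {I : Set ℤ} (hf : ∀ i ∈ s, DependsOn (f i) I) : DependsOn (fun e => ∑ i ∈ s, f i e) I :=
  fun _ _ hxy => Finset.sum_congr rfl fun i hi => hf i hi hxy

theorem DependsOn.comp' {α β : Type*} {f : (ℤ → S) → α} {I : Set ℤ} (hf : DependsOn f I)
    (g : α → β) : DependsOn (fun e => g (f e)) I :=
  fun _ _ hxy => congrArg g (hf hxy)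

theorem DependsOn.const' {α : Type*} (c : α) (I : Set ℤ) : DependsOn (fun _ : ℤ → S => c) I :=
  fun _ _ _ => rfl

variable [MeasurableSpace S] (μ : Measure S) [IsProbabilityMeasure μ]

/-- Bounded centred functions of the innovations at the times `-m, …, 0`. -/
structure IsWindow (m : ℕ) (U : (ℤ → S) → ℂ) : Prop where
  bdd : BddMeas U
  dep : DependsOn U (Set.Icc (-m : ℤ) 0)
  integral_eq_zero : ∫ e, U e ∂(iidLaw μ) = 0

/-- Bounded martingale differences that are functions of the innovations at the times
`-m, …, 0`. -/
structure IsMartDiff (m : ℕ) (U : (ℤ → S) → ℂ) : Prop where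
  bdd : BddMeas U
  dep : DependsOn U (Set.Icc (-m : ℤ) 0)
  integral_mul : ∀ W : (ℤ → S) → ℂ, BddMeas W → DependsOn W (Set.Iio 0) →
    ∫ e, W e * U e ∂(iidLaw μ) = 0

variable {μ}

/-- Coordinates outside s have no influence and the others at most 2‖f‖ each. On a fixed window, L⁴
approximation therefore implies approximation in `theta`. -/
theorem theta_le_of_dependsOn {E : Type*} [NormedAddCommGroup E] [NormedSpace ℝ E]
    [NormedSpace ℂ E] {f : (ℤ → S) → E} (hf : StronglyMeasurable f)
    {s : Finset ℤ} (hd : DependsOn f (s : Set ℤ)) :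
    theta μ f ≤ s.card * (2 * eLpNorm f 4 (iidLaw μ)) := by
  rw [theta, tsum_eq_sum (s := s) fun j hj => del_eq_zero hd (by simpa using hj) 4]
  refine (Finset.sum_le_card_nsmul _ _ _ fun j _ => del_le hf j (by norm_num)).trans ?_
  rw [nsmul_eq_mul]

theorem IsMartDiff.isWindow {m : ℕ} {U : (ℤ → S) → ℂ} (h : IsMartDiff μ m U) : IsWindow μ m U :=
  ⟨h.bdd, h.dep, by
    have := h.integral_mul (fun _ => 1) (BddMeas.const 1) (DependsOn.const' _ _)
    simpa using this⟩

theorem IsMartDiff.conj {m : ℕ} {U : (ℤ → S) → ℂ} (h : IsMartDiff μ m U) :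
    IsMartDiff μ m fun e => starRingEnd ℂ (U e) :=
  ⟨h.bdd.conj, DependsOn.comp' h.dep _, fun W hW hd => by
    have h1 := h.integral_mul (fun e => starRingEnd ℂ (W e)) hW.conj (DependsOn.comp' hd _)
    have h2 := congrArg (starRingEnd ℂ) h1
    rw [← integral_conj] at h2
    simpa using h2⟩

theorem IsMartDiff.const_mul {m : ℕ} {U : (ℤ → S) → ℂ} (h : IsMartDiff μ m U) (c : ℂ) :
    IsMartDiff μ m fun e => c * U e :=
  ⟨(BddMeas.const c).mul h.bdd, DependsOn.comp' h.dep _, fun W hW hd => by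
    have h1 := h.integral_mul W hW hd
    simp_rw [mul_left_comm _ c, integral_const_mul, h1, mul_zero]⟩

theorem IsMartDiff.sum {m : ℕ} {ι : Type*} {s : Finset ι} {U : ι → (ℤ → S) → ℂ}
    (h : ∀ i ∈ s, IsMartDiff μ m (U i)) : IsMartDiff μ m fun e => ∑ i ∈ s, U i e :=
  ⟨BddMeas.sum fun i hi => (h i hi).bdd, DependsOn.sum' fun i hi => (h i hi).dep, fun W hW hd => by
    simp_rw [Finset.mul_sum]
    rw [integral_finsetSum _ fun i hi => (hW.mul (h i hi).bdd).integrable]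
    exact Finset.sum_eq_zero fun i hi => (h i hi).integral_mul W hW hd⟩

theorem IsWindow.conj {m : ℕ} {U : (ℤ → S) → ℂ} (h : IsWindow μ m U) :
    IsWindow μ m fun e => starRingEnd ℂ (U e) :=
  ⟨h.bdd.conj, DependsOn.comp' h.dep _, by rw [integral_conj, h.integral_eq_zero, map_zero]⟩

theorem IsWindow.theta_ne_top {m : ℕ} {U : (ℤ → S) → ℂ} (h : IsWindow μ m U) :
    theta μ U ≠ ∞ := by
  refine ne_top_of_le_ne_top ?_ (theta_le_of_dependsOn h.bdd.1
    (s := Finset.Icc (-m : ℤ) 0) (by simpa using h.dep))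
  exact ENNReal.mul_ne_top (ENNReal.natCast_ne_top _)
    (ENNReal.mul_ne_top (by simp) (h.bdd.memLp 4).2.ne)

theorem IsWindow.integral_linear_pow_four_le {m : ℕ} {U : (ℤ → S) → ℂ} (h : IsWindow μ m U) :
    ∃ K : ℝ, 0 ≤ K ∧ ∀ (s : Finset ℤ) (c : ℤ → ℂ),
      ∫ e, ‖∑ r ∈ s, c r * U (shift r e)‖ ^ 4 ∂(iidLaw μ) ≤ K * (∑ r ∈ s, ‖c r‖ ^ 2) ^ 2 := by
  refine ⟨(4 * (theta μ U).toReal ^ 2) ^ 2, by positivity, fun s c => ?_⟩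
  have h1 := eLpNorm_linear_le h.bdd.1 (h.bdd.memLp 4) h.integral_eq_zero s c
  simp only [smul_eq_mul] at h1
  have h2 := integral_norm_pow_eq (n := 4) (by norm_num)
    (memLp_linear (h.bdd.memLp (P := iidLaw μ) 4) s c)
  simp only [smul_eq_mul, Nat.cast_ofNat] at h2
  rw [h2]
  have h3 := ENNReal.toReal_mono (ENNReal.mul_ne_top (by simp) (ENNReal.mul_ne_top
    (ENNReal.pow_ne_top h.theta_ne_top) (ENNReal.sum_ne_top.2 fun i _ => by simp))) h1
  rw [ENNReal.toReal_pow, ENNReal.toReal_mul, ENNReal.toReal_mul, ENNReal.toReal_sum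
    (fun i _ => by simp)] at h3
  simp only [ENNReal.toReal_pow, toReal_enorm, ENNReal.toReal_ofNat] at h3
  calc _ = ((eLpNorm (fun e => ∑ t ∈ s, c t * U (shift t e)) 4 (iidLaw μ)).toReal ^ 2) ^ 2 := by
        ring
    _ ≤ (4 * ((theta μ U).toReal ^ 2 * ∑ r ∈ s, ‖c r‖ ^ 2)) ^ 2 := by gcongr
    _ = _ := by ring

/-- The form `(x, y) ↦ x ȳ` on `ℂ`. -/
def mulConj : ℂ →L[ℂ] ℂ →L⋆[ℂ] ℂ := (innerSL ℂ).flip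

theorem mulConj_apply (x y : ℂ) : mulConj x y = x * starRingEnd ℂ y := by
  simp [mulConj, ContinuousLinearMap.flip_apply]

/-- The variance bound for sesquilinear forms, applied to U and the conjugate of U', so that the
form becomes bilinear. The weights enter only through their Frobenius norm. -/
theorem IsWindow.integral_qform_sub_sq_le {m m' : ℕ} {U U' : (ℤ → S) → ℂ} (h : IsWindow μ m U)
    (h' : IsWindow μ m' U') : ∃ K : ℝ, 0 ≤ K ∧ ∀ (s t : Finset ℤ) (w : ℤ → ℤ → ℂ),
      ∫ e, ‖∑ i ∈ s, ∑ k ∈ t, w i k * (U (shift i e) * U' (shift k e)) -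
        ∫ e', ∑ i ∈ s, ∑ k ∈ t, w i k * (U (shift i e') * U' (shift k e')) ∂(iidLaw μ)‖ ^ 2
          ∂(iidLaw μ) ≤ K * ∑ i ∈ s, ∑ k ∈ t, ‖w i k‖ ^ 2 := by
  refine ⟨16 * ((theta μ U).toReal ^ 2 * (theta μ (fun e => starRingEnd ℂ (U' e))).toReal ^ 2),
    by positivity, fun s t w => ?_⟩
  have hb : ∀ x y : ℂ, ‖mulConj x y‖ ≤ ‖x‖ * ‖y‖ := fun x y => by
    rw [mulConj_apply, norm_mul, RCLike.norm_conj]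
  have h1 := eLpNorm_qform_sub_integral_le hb h.bdd.1 h'.conj.bdd.1 (h.bdd.memLp 4)
    (h'.conj.bdd.memLp 4) h.integral_eq_zero h'.conj.integral_eq_zero s t w
  have hm := memLp_qform hb (h.bdd.memLp (P := iidLaw μ) 4) (h'.conj.bdd.memLp 4) s t w
  have hm2 := hm.sub (memLp_const (∫ e', qform mulConj U (fun e => starRingEnd ℂ (U' e)) s t w e'
    ∂(iidLaw μ)))
  have h2 := integral_norm_pow_eq (n := 2) (by norm_num) (by simpa using hm2)
  have h3 := ENNReal.toReal_mono (by
    refine ENNReal.mul_ne_top (by simp) (ENNReal.mul_ne_top (ENNReal.mul_ne_top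
      (ENNReal.pow_ne_top h.theta_ne_top) (ENNReal.pow_ne_top h'.conj.theta_ne_top)) ?_)
    exact ENNReal.sum_ne_top.2 fun i _ => ENNReal.sum_ne_top.2 fun i _ => by simp) h1
  have e1 : qform mulConj U (fun e => starRingEnd ℂ (U' e)) s t w = fun e =>
      ∑ i ∈ s, ∑ k ∈ t, w i k * (U (shift i e) * U' (shift k e)) := by
    funext e
    simp [qform, mulConj_apply]
  have e2 : (∑ i ∈ s, ∑ k ∈ t, ‖w i k‖ₑ ^ 2).toReal = ∑ i ∈ s, ∑ k ∈ t, ‖w i k‖ ^ 2 := by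
    rw [ENNReal.toReal_sum fun i _ => ENNReal.sum_ne_top.2 fun i _ => by simp]
    refine Finset.sum_congr rfl fun i _ => ?_
    rw [ENNReal.toReal_sum fun i _ => by simp]
    simp
  simp only [ENNReal.toReal_pow, ENNReal.toReal_mul, e2, ENNReal.toReal_ofNat] at h3
  rw [e1] at h2 h3
  refine (h2.trans ?_).trans_le (h3.trans (le_of_eq (by ring)))
  rfl

theorem IsMartDiff.integral_mul_shift {m : ℕ} {U : (ℤ → S) → ℂ} (h : IsMartDiff μ m U) (q : ℤ)
    {W : (ℤ → S) → ℂ} (hW : BddMeas W) (hd : DependsOn W (Set.Iio q)) :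
    ∫ e, W e * U (shift q e) ∂(iidLaw μ) = 0 := by
  have h1 := h.integral_mul (fun e => W (shift (-q) e)) (hW.comp (measurable_shift _))
    (dependsOn_comp_shift hd (-q) fun k hk => by simp only [Set.mem_Iio] at hk ⊢; omega)
  rw [← integral_comp_shift (((hW.comp (measurable_shift _)).mul h.bdd).1) q] at h1
  simpa [shift_shift, shift_zero] using h1

theorem IsMartDiff.dep_shift {m : ℕ} {U : (ℤ → S) → ℂ} (h : IsMartDiff μ m U) (q : ℤ) :
    DependsOn (fun e => U (shift q e)) (Set.Icc (q - m) q) :=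
  dependsOn_comp_shift h.dep q fun k hk => by simp only [Set.mem_Icc] at hk ⊢; omega

/-- The factor at the later time is a martingale difference and the earlier one is a function of its
past. -/
theorem IsMartDiff.integral_mul_of_ne {m : ℕ} {U U' : (ℤ → S) → ℂ} (h : IsMartDiff μ m U)
    (h' : IsMartDiff μ m U') {r r' : ℤ} (hr : r ≠ r') :
    ∫ e, U (shift r e) * U' (shift r' e) ∂(iidLaw μ) = 0 := by
  rcases lt_or_gt_of_ne hr with hlt | hlt
  · refine h'.integral_mul_shift r' (h.bdd.comp (measurable_shift r)) ((h.dep_shift r).mono ?_)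
    intro k hk; simp only [Set.mem_Icc, Set.mem_Iio] at hk ⊢; omega
  · have h1 := h.integral_mul_shift r (h'.bdd.comp (measurable_shift r')) ((h'.dep_shift r').mono
      fun k hk => by simp only [Set.mem_Icc, Set.mem_Iio] at hk ⊢; omega)
    simpa only [mul_comm] using h1

end Windows

end QuadForm

end

noncomputable section

namespace QuadForm

/-! ### Exponentials, resonance and summation by parts. -/

section Frequencies

/-- `e^{iλh}` -/
def ex (lam : ℝ) (h : ℤ) : ℂ := Complex.exp (Complex.I * (lam : ℂ) * (h : ℂ))

theorem norm_ex (lam : ℝ) (h : ℤ) : ‖ex lam h‖ = 1 := by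
  rw [ex, show Complex.I * (lam : ℂ) * (h : ℂ) = ((lam * h : ℝ) : ℂ) * Complex.I by
    push_cast; ring, Complex.norm_exp_ofReal_mul_I]

theorem ex_add (lam : ℝ) (h k : ℤ) : ex lam (h + k) = ex lam h * ex lam k := by
  rw [ex, ex, ex, ← Complex.exp_add]; congr 1; push_cast; ring

theorem ex_add_left (lam lam' : ℝ) (h : ℤ) : ex (lam + lam') h = ex lam h * ex lam' h := by
  rw [ex, ex, ex, ← Complex.exp_add]; congr 1; push_cast; ring

theorem ex_zero (lam : ℝ) : ex lam 0 = 1 := by simp [ex]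

theorem ex_neg_left (lam : ℝ) (h : ℤ) : ex (-lam) h = ex lam (-h) := by
  rw [ex, ex]; congr 1; push_cast; ring

theorem conj_ex (lam : ℝ) (h : ℤ) : starRingEnd ℂ (ex lam h) = ex lam (-h) := by
  rw [ex, ex, ← Complex.exp_conj]; congr 1; simp

theorem ex_natCast (lam : ℝ) (n : ℕ) : ex lam n = ex lam 1 ^ n := by
  rw [ex, ex, ← Complex.exp_nat_mul]; congr 1; push_cast; ring

/-- Recasts x ∈ 2πℤ as e^{ix} = 1, the condition that decides whether the sums against powers of
e^{ix} oscillate. -/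
theorem eta_eq_ite (x : ℝ) [Decidable (ex x 1 = 1)] : eta x = if ex x 1 = 1 then 1 else 0 := by
  have h : (∃ z : ℤ, x = 2 * Real.pi * z) ↔ ex x 1 = 1 := by
    rw [ex, Complex.exp_eq_one_iff]
    refine exists_congr fun z => ?_
    have h1 : Complex.I * (x : ℂ) * ((1 : ℤ) : ℂ) = (z : ℂ) * (2 * Real.pi * Complex.I) ↔
        (x : ℂ) = ((2 * Real.pi * z : ℝ) : ℂ) := by
      constructor
      · intro h
        apply mul_left_cancel₀ Complex.I_ne_zero
        rw [Int.cast_one, mul_one] at h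
        rw [h]; push_cast; ring
      · intro h
        rw [h]; push_cast; ring
    rw [h1, Complex.ofReal_inj]
  classical
  rw [eta]
  split_ifs <;> tauto

theorem eta_eq_one {x : ℝ} (h : ex x 1 = 1) : eta x = 1 := by
  classical rw [eta_eq_ite, if_pos h]

theorem eta_eq_zero {x : ℝ} (h : ex x 1 ≠ 1) : eta x = 0 := by
  classical rw [eta_eq_ite, if_neg h]

theorem eta_neg (x : ℝ) : eta (-x) = eta x := by
  by_cases h : ex x 1 = 1
  · rw [eta_eq_one h, eta_eq_one]
    rw [ex_neg_left, ← conj_ex, h, map_one]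
  · rw [eta_eq_zero h, eta_eq_zero]
    rwa [ex_neg_left, ← conj_ex, ne_eq, map_eq_one_iff _ (starRingEnd ℂ).injective]

/-- Summation by parts against powers of `z`. -/
theorem norm_sub_one_mul_sum_le {z : ℂ} (hz : ‖z‖ = 1) (b : ℕ → ℂ) (n : ℕ) :
    ‖1 - z‖ * ‖∑ q ∈ Finset.range n, b q * z ^ q‖ ≤
      ‖b 0‖ + ‖b n‖ + ∑ q ∈ Finset.range n, ‖b (q + 1) - b q‖ := by
  have h : (1 - z) * ∑ q ∈ Finset.range n, b q * z ^ q =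
      b 0 - b n * z ^ n + ∑ q ∈ Finset.range n, (b (q + 1) - b q) * z ^ (q + 1) := by
    induction n with
    | zero => simp
    | succ n ih =>
      rw [Finset.sum_range_succ, mul_add, ih, Finset.sum_range_succ]; ring
  rw [← norm_mul, h]
  refine (norm_add_le _ _).trans (add_le_add ((norm_sub_le _ _).trans (le_of_eq ?_)) ?_)
  · rw [norm_mul, norm_pow, hz, one_pow, mul_one]
  · refine norm_sum_le_of_le _ fun q _ => ?_
    rw [norm_mul, norm_pow, hz, one_pow, mul_one]

end Frequencies

/-! ### One-sided weights: oscillation, overlaps and limits. -/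

section Kernels

theorem sum_translate_le {f : ℤ → ℝ} {a : ℝ} (h : ∀ s : Finset ℤ, ∑ k ∈ s, f k ≤ a) (r : ℤ) (n : ℕ) :
    ∑ q ∈ Finset.range n, f (q - r) ≤ a := by
  have h1 := h ((Finset.range n).map ⟨fun q : ℕ => (q : ℤ) - r, fun x y hxy => by
    simpa using hxy⟩)
  rwa [Finset.sum_map] at h1

theorem sum_reflect_le {f : ℤ → ℝ} {a : ℝ} (h : ∀ s : Finset ℤ, ∑ k ∈ s, f k ≤ a) (q : ℤ)
    (s : Finset ℤ) : ∑ r ∈ s, f (q - r) ≤ a := by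
  have h1 := h (s.map ⟨fun r : ℤ => q - r, fun x y hxy => by simpa using hxy⟩)
  rwa [Finset.sum_map] at h1

/-- Summation by parts: the two boundary terms are at most c each, and Cauchy–Schwarz bounds the
variation of the product w(q-r)w(q-r') by 2√a√b. -/
theorem norm_sub_one_mul_sum_kernel_le {w : ℤ → ℝ} {a b c : ℝ}
    (ha : ∀ s : Finset ℤ, ∑ k ∈ s, w k ^ 2 ≤ a)
    (hb : ∀ s : Finset ℤ, ∑ k ∈ s, (w (k + 1) - w k) ^ 2 ≤ b)
    (hc : ∀ k, w k ^ 2 ≤ c) {z : ℂ} (hz : ‖z‖ = 1) (r r' : ℤ) (n : ℕ) :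
    ‖1 - z‖ * ‖∑ q ∈ Finset.range n, ((w (q - r) * w (q - r') : ℝ) : ℂ) * z ^ q‖ ≤
      2 * c + 2 * (√a * √b) := by
  refine (norm_sub_one_mul_sum_le hz _ n).trans ?_
  have h1 : ∀ k k' : ℤ, ‖((w k * w k' : ℝ) : ℂ)‖ ≤ c := fun k k' => by
    rw [Complex.norm_real, Real.norm_eq_abs, abs_mul]
    have := hc k; have := hc k'
    nlinarith [sq_abs (w k), sq_abs (w k'), sq_nonneg (|w k| - |w k'|)]
  have h2 : ∑ q ∈ Finset.range n, ‖((w ((q + 1 : ℕ) - r) * w ((q + 1 : ℕ) - r') : ℝ) : ℂ) -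
      ((w (q - r) * w (q - r') : ℝ) : ℂ)‖ ≤ 2 * (√a * √b) := by
    have h3 : ∀ q : ℕ, ‖((w ((q + 1 : ℕ) - r) * w ((q + 1 : ℕ) - r') : ℝ) : ℂ) -
        ((w (q - r) * w (q - r') : ℝ) : ℂ)‖ ≤
        |w (q - (r' - 1))| * |w (q - r + 1) - w (q - r)| +
          |w (q - r)| * |w (q - r' + 1) - w (q - r')| := fun q => by
      rw [← Complex.ofReal_sub, Complex.norm_real, Real.norm_eq_abs, ← abs_mul, ← abs_mul,
        show ((q + 1 : ℕ) : ℤ) - r = q - r + 1 by push_cast; ring,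
        show ((q + 1 : ℕ) : ℤ) - r' = q - r' + 1 by push_cast; ring,
        show (q : ℤ) - (r' - 1) = q - r' + 1 by ring]
      refine (le_of_eq ?_).trans (abs_add_le _ _)
      congr 1; ring
    refine (Finset.sum_le_sum fun q _ => h3 q).trans ?_
    rw [Finset.sum_add_distrib, two_mul]
    refine add_le_add ?_ ?_ <;>
    · refine (Real.sum_mul_le_sqrt_mul_sqrt _ _ _).trans ?_
      simp only [sq_abs]
      gcongr
      · exact sum_translate_le ha _ n
      · exact sum_translate_le (f := fun k => (w (k + 1) - w k) ^ 2) hb _ n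
  have := h1 ((0 : ℕ) - r) ((0 : ℕ) - r')
  have := h1 (n - r) (n - r')
  linarith

/-- Normalised one-sided weights that vanish at the lags up to `m`. -/
structure IsKernel (m : ℕ) (w : ℕ → ℤ → ℝ) : Prop where
  zero : ∀ (T : ℕ) (h : ℤ), h ≤ m → w T h = 0
  sq_le : ∃ C : ℝ, 0 ≤ C ∧ ∀ᶠ T : ℕ in atTop, ∀ s : Finset ℤ, T * ∑ h ∈ s, w T h ^ 2 ≤ C
  sup_le : ∀ r : ℝ, 0 < r → ∀ᶠ T : ℕ in atTop, ∀ h, T * w T h ^ 2 ≤ r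
  var_le : ∀ r : ℝ, 0 < r → ∀ᶠ T : ℕ in atTop, ∀ s : Finset ℤ,
    T * ∑ h ∈ s, (w T (h + 1) - w T h) ^ 2 ≤ r
  overlap_le : ∀ r : ℝ, 0 < r → ∀ᶠ T : ℕ in atTop,
    ∑ p ∈ (Finset.Icc (1 : ℤ) T ×ˢ Finset.Icc (1 : ℤ) T).filter (fun p => p.1 < p.2),
      (∑ q ∈ Finset.range (T + 1), w T (q - p.1) * w T (q - p.2)) ^ 2 ≤ r
  total : Tendsto (fun T : ℕ => ∑ q ∈ Finset.range (T + 1), ∑ r ∈ Finset.Icc (1 : ℤ) T,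
    w T (q - r) ^ 2) atTop (𝓝 (1 / 2))

variable {m : ℕ} {w : ℕ → ℤ → ℝ}

/-- Oscillating sums of products of weights are `o(1/T)`. -/
theorem IsKernel.oscillating (hw : IsKernel m w) {z : ℂ} (hz : ‖z‖ = 1) (hz1 : z ≠ 1) {r : ℝ}
    (hr : 0 < r) : ∀ᶠ T : ℕ in atTop, ∀ (n : ℕ) (i k : ℤ),
      T * ‖∑ q ∈ Finset.range n, ((w T (q - i) * w T (q - k) : ℝ) : ℂ) * z ^ q‖ ≤ r := by
  obtain ⟨C, hC, h1⟩ := hw.sq_le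
  have hz2 : 0 < ‖1 - z‖ := norm_pos_iff.2 (sub_ne_zero.2 hz1.symm)
  -- With sup bound x/T and variation x²/((C+1)T), both 2c and 2√a√b are at most 2x/T. Their sum
  -- 4x/T is r‖1 - z‖/T, and C + 1 avoids division by zero.
  set x : ℝ := r * ‖1 - z‖ / 4 with hx
  have hx0 : 0 < x := by positivity
  filter_upwards [h1, hw.sup_le x hx0, hw.var_le (x ^ 2 / (C + 1)) (by positivity),
    eventually_gt_atTop 0] with T h1 h2 h3 hT n i k
  have hT' : (0 : ℝ) < T := Nat.cast_pos.2 hT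
  have h4 := norm_sub_one_mul_sum_kernel_le (w := w T) (a := C / T) (b := x ^ 2 / (C + 1) / T)
    (c := x / T) (fun s => by rw [le_div_iff₀ hT', mul_comm]; exact h1 s)
    (fun s => by rw [le_div_iff₀ hT', mul_comm]; exact h3 s)
    (fun s => by rw [le_div_iff₀ hT', mul_comm]; exact h2 s) hz i k n
  have h5 : √(C / T) * √(x ^ 2 / (C + 1) / T) ≤ x / T := by
    rw [← Real.sqrt_mul (by positivity)]
    refine Real.sqrt_le_iff.2 ⟨by positivity, ?_⟩
    have : C / (C + 1) ≤ 1 := by rw [div_le_one (by positivity)]; linarith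
    calc C / T * (x ^ 2 / (C + 1) / T) = (C / (C + 1)) * (x / T) ^ 2 := by ring
      _ ≤ 1 * (x / T) ^ 2 := by gcongr
      _ = _ := one_mul _
  have h6 : ‖1 - z‖ * ‖∑ q ∈ Finset.range n, ((w T (q - i) * w T (q - k) : ℝ) : ℂ) * z ^ q‖ ≤
      4 * (x / T) := by linarith
  rw [← mul_le_mul_iff_right₀ hz2]
  calc _ = T * (‖1 - z‖ * ‖∑ q ∈ Finset.range n,
        ((w T (q - i) * w T (q - k) : ℝ) : ℂ) * z ^ q‖) := by ring
    _ ≤ T * (4 * (x / T)) := by gcongr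
    _ = _ := by field_simp; rw [hx]; ring

/-- The overlap hypothesis concerns full sums over q ≤ T. Weights depend on differences only, so a
partial sum over q < n equals the full sum for the indices translated by T + 1 - n; the extra terms
vanish since the weights are one-sided. Pairs i > k follow by symmetry, and the diagonal has T
entries of size O(1/T), whose squares sum to O(1/T). -/
theorem IsKernel.overlap_partial (hw : IsKernel m w) {r : ℝ} (hr : 0 < r) :
    ∀ᶠ T : ℕ in atTop, ∀ n ≤ T + 1, ∑ i ∈ Finset.Icc (1 : ℤ) T, ∑ k ∈ Finset.Icc (1 : ℤ) T,
      (∑ q ∈ Finset.range n, w T (q - i) * w T (q - k)) ^ 2 ≤ r := by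
  obtain ⟨C, hC, h1⟩ := hw.sq_le
  have h0 : Tendsto (fun T : ℕ => C ^ 2 / (T : ℝ)) atTop (𝓝 0) :=
    tendsto_const_div_atTop_nhds_zero_nat _
  filter_upwards [h1, hw.overlap_le (r / 4) (by positivity), eventually_gt_atTop 0,
    h0.eventually_lt_const (by positivity : (0 : ℝ) < r / 2)] with T h1 h2 hT h3 n hn
  have hT' : (0 : ℝ) < T := Nat.cast_pos.2 hT
  set D := Finset.Icc (1 : ℤ) T with hD
  set g : ℤ × ℤ → ℝ := fun p => (∑ q ∈ Finset.range n, w T (q - p.1) * w T (q - p.2)) ^ 2 with hg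
  have hup : ∑ p ∈ (D ×ˢ D).filter (fun p => p.1 < p.2), g p ≤ r / 4 := by
    refine le_trans ?_ h2
    set s : ℕ := T + 1 - n with hs
    have hsn : n + s = T + 1 := by omega
    set G : ℤ × ℤ → ℝ := fun p =>
      (∑ q ∈ Finset.range (T + 1), w T (q - p.1) * w T (q - p.2)) ^ 2 with hG
    have hgs : ∀ p : ℤ × ℤ, 1 ≤ p.1 → g p = G (p.1 + s, p.2 + s) := fun p hp => by
      simp only [hg, hG]
      congr 1
      rw [← hsn, add_comm n s, Finset.sum_range_add]
      have h5 : ∑ q ∈ Finset.range s, w T (q - (p.1 + s)) * w T (q - (p.2 + s)) = 0 :=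
        Finset.sum_eq_zero fun q hq => by
          rw [hw.zero T (q - (p.1 + s)) (by have := Finset.mem_range.1 hq; omega), zero_mul]
      rw [h5, zero_add]
      refine Finset.sum_congr rfl fun q _ => ?_
      congr 2 <;> push_cast <;> ring
    have hG0 : ∀ p : ℤ × ℤ, ¬ p.2 ≤ T → G p = 0 := fun p hp => by
      simp only [hG]
      rw [Finset.sum_eq_zero, zero_pow two_ne_zero]
      intro q hq
      rw [hw.zero T (q - p.2) (by have := Finset.mem_range.1 hq; omega), mul_zero]
    have hinj : Function.Injective fun p : ℤ × ℤ => (p.1 + (s : ℤ), p.2 + (s : ℤ)) :=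
      fun x y hxy => by simpa [Prod.ext_iff] using hxy
    have hmap := Finset.sum_map ((D ×ˢ D).filter (fun p => p.1 < p.2)) ⟨_, hinj⟩ G
    have hgG : ∑ p ∈ (D ×ˢ D).filter (fun p => p.1 < p.2), g p =
        ∑ p ∈ (D ×ˢ D).filter (fun p => p.1 < p.2), G (p.1 + s, p.2 + s) :=
      Finset.sum_congr rfl fun p hp => hgs p
        (Finset.mem_Icc.1 (Finset.mem_product.1 (Finset.mem_filter.1 hp).1).1).1
    rw [hgG]
    refine hmap.symm.trans_le ?_
    rw [← Finset.sum_filter_of_ne (p := fun p => p.2 ≤ (T : ℤ))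
        (fun p _ hp => by by_contra hc; exact hp (hG0 p hc))]
    refine Finset.sum_le_sum_of_subset_of_nonneg ?_ fun p _ _ => sq_nonneg _
    intro p hp
    simp only [Finset.mem_filter, Finset.mem_map, Finset.mem_product, hD, Finset.mem_Icc] at hp ⊢
    obtain ⟨⟨x, hx, rfl⟩, hp2⟩ := hp
    change x.2 + (s : ℤ) ≤ T at hp2
    change ((1 ≤ x.1 + (s : ℤ) ∧ x.1 + (s : ℤ) ≤ T) ∧ 1 ≤ x.2 + (s : ℤ) ∧ x.2 + (s : ℤ) ≤ T) ∧
      x.1 + (s : ℤ) < x.2 + s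
    omega
  have hlow : ∑ p ∈ (D ×ˢ D).filter (fun p => p.2 < p.1), g p ≤ r / 4 := by
    refine le_trans (le_of_eq ?_) hup
    refine Finset.sum_nbij' Prod.swap Prod.swap ?_ ?_ ?_ ?_ ?_
    · simp +contextual [hD]
    · simp +contextual [hD]
    · simp
    · simp
    · intro p _; simp only [hg, Prod.fst_swap, Prod.snd_swap]
      congr 1; exact Finset.sum_congr rfl fun q _ => mul_comm _ _
  have hdiag : ∑ p ∈ (D ×ˢ D).filter (fun p => p.1 = p.2), g p ≤ r / 2 := by
    have h4 : ∀ p ∈ (D ×ˢ D).filter (fun p => p.1 = p.2), g p ≤ (C / T) ^ 2 := fun p hp => by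
      have hp2 := (Finset.mem_filter.1 hp).2
      simp only [hg, hp2]
      refine pow_le_pow_left₀ (Finset.sum_nonneg fun q _ => mul_self_nonneg _) ?_ 2
      have := sum_translate_le (f := fun k => w T k ^ 2) (a := C / T) (fun s => by
        rw [le_div_iff₀ hT', mul_comm]; exact h1 s) p.2 n
      simpa only [sq] using this
    refine (Finset.sum_le_card_nsmul _ _ _ h4).trans ?_
    have h5 : ((D ×ˢ D).filter (fun p => p.1 = p.2)).card ≤ T := by
      have : ((D ×ˢ D).filter (fun p => p.1 = p.2)).card ≤ D.card :=
        Finset.card_le_card_of_injOn Prod.fst (fun p hp => by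
          simp only [Finset.coe_filter, Finset.mem_product, Set.mem_ofPred_eq] at hp
          exact hp.1.1) (fun p hp p' hp' h => by
          simp only [Finset.coe_filter, Finset.mem_product, Set.mem_ofPred_eq] at hp hp'
          exact Prod.ext h (by rw [← hp.2, ← hp'.2, h]))
      simpa [hD] using this
    rw [nsmul_eq_mul]
    calc _ ≤ (T : ℝ) * (C / T) ^ 2 := by gcongr
      _ = C ^ 2 / T := by field_simp
      _ ≤ r / 2 := h3.le
  have hsplit : ∑ i ∈ D, ∑ k ∈ D, (∑ q ∈ Finset.range n, w T (q - i) * w T (q - k)) ^ 2 =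
      ∑ p ∈ (D ×ˢ D).filter (fun p => p.1 < p.2), g p +
      (∑ p ∈ (D ×ˢ D).filter (fun p => p.2 < p.1), g p +
      ∑ p ∈ (D ×ˢ D).filter (fun p => p.1 = p.2), g p) := by
    rw [← Finset.sum_product', Finset.sum_filter, Finset.sum_filter, Finset.sum_filter,
      ← Finset.sum_add_distrib, ← Finset.sum_add_distrib]
    refine Finset.sum_congr rfl fun p _ => ?_
    rcases lt_trichotomy p.1 p.2 with h | h | h
    · simp [h, h.not_gt, h.ne, hg]
    · simp [h, hg]
    · simp [h, h.not_gt, h.ne', hg]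
  rw [hsplit]
  linarith

/-- The phases that depend on i and k factor out, so in modulus only the combined frequency λ + λ'
is visible. -/
theorem norm_sum_kernel_ex {w : ℤ → ℝ} (lam lam' : ℝ) (n : ℕ) (i k : ℤ) :
    ‖∑ q ∈ Finset.range n, (w (q - i) * ex lam (q - i)) * (w (q - k) * ex lam' (q - k))‖ =
      ‖∑ q ∈ Finset.range n, ((w (q - i) * w (q - k) : ℝ) : ℂ) * ex (lam + lam') 1 ^ q‖ := by
  have h : ∑ q ∈ Finset.range n, (w (q - i) * ex lam (q - i)) * (w (q - k) * ex lam' (q - k)) =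
      (ex lam (-i) * ex lam' (-k)) *
        ∑ q ∈ Finset.range n, ((w (q - i) * w (q - k) : ℝ) : ℂ) * ex (lam + lam') 1 ^ q := by
    rw [Finset.mul_sum]
    refine Finset.sum_congr rfl fun q _ => ?_
    rw [← ex_natCast, ex_add_left, sub_eq_add_neg, ex_add, sub_eq_add_neg, ex_add]
    push_cast; ring
  rw [h, norm_mul, norm_mul, norm_ex, norm_ex, one_mul, one_mul]

/-- The kernel of the conditional variance has small Frobenius norm. -/
theorem IsKernel.frobenius_le (hw : IsKernel m w) (lam lam' : ℝ) {r : ℝ} (hr : 0 < r) :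
    ∀ᶠ T : ℕ in atTop, ∀ n ≤ T + 1, ∑ i ∈ Finset.Icc (1 : ℤ) T, ∑ k ∈ Finset.Icc (1 : ℤ) T,
      ‖∑ q ∈ Finset.range n, (w T (q - i) * ex lam (q - i)) * (w T (q - k) * ex lam' (q - k))‖ ^ 2
        ≤ r := by
  -- In resonance the phases disappear and the overlap condition is used. Otherwise each of the T²
  -- entries is o(1/T) by oscillation.
  by_cases hz : ex (lam + lam') 1 = 1
  · filter_upwards [hw.overlap_partial hr] with T hT n hn
    refine le_trans (le_of_eq ?_) (hT n hn)
    refine Finset.sum_congr rfl fun i _ => Finset.sum_congr rfl fun k _ => ?_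
    rw [norm_sum_kernel_ex, hz]
    simp only [one_pow, mul_one]
    rw [← Complex.ofReal_sum, Complex.norm_real, Real.norm_eq_abs, sq_abs]
  · filter_upwards [hw.oscillating (norm_ex _ _) hz (Real.sqrt_pos.2 hr), eventually_gt_atTop 0]
      with T hT hT0 n hn
    have hT' : (0 : ℝ) < T := Nat.cast_pos.2 hT0
    have h1 : ∀ i k : ℤ, ‖∑ q ∈ Finset.range n,
        (w T (q - i) * ex lam (q - i)) * (w T (q - k) * ex lam' (q - k))‖ ^ 2 ≤ r / T ^ 2 :=
      fun i k => by
        have h2 := hT n i k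
        rw [norm_sum_kernel_ex, le_div_iff₀ (by positivity), mul_comm, ← mul_pow]
        calc _ ≤ √r ^ 2 := by gcongr
          _ = r := Real.sq_sqrt hr.le
    calc _ ≤ ∑ i ∈ Finset.Icc (1 : ℤ) T, ∑ k ∈ Finset.Icc (1 : ℤ) T, r / T ^ 2 :=
          Finset.sum_le_sum fun i _ => Finset.sum_le_sum fun k _ => h1 i k
      _ = r := by simp; field_simp

/-- In resonance all the phases equal 1 and the total mass tends to 1/2. Otherwise, for each of the
T values of r, the sum over q oscillates and is o(1/T). -/
theorem IsKernel.tendsto_sum_sq_ex (hw : IsKernel m w) (x : ℝ) :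
    Tendsto (fun T : ℕ => ∑ q ∈ Finset.range (T + 1), ∑ r ∈ Finset.Icc (1 : ℤ) T,
      ((w T (q - r) ^ 2 : ℝ) : ℂ) * ex x (q - r)) atTop (𝓝 (eta x / 2)) := by
  by_cases hz : ex x 1 = 1
  · have h1 : ∀ h : ℤ, ex x h = 1 := fun h => by
      obtain ⟨n, rfl | rfl⟩ := h.eq_nat_or_neg
      · rw [ex_natCast, hz, one_pow]
      · rw [← conj_ex, ex_natCast, hz, one_pow, map_one]
    simp only [h1, mul_one, eta_eq_one hz]
    have h2 := (Complex.continuous_ofReal.tendsto _).comp hw.total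
    have h3 : ((1 / 2 : ℝ) : ℂ) = 1 / 2 := by norm_num
    rw [h3] at h2
    refine h2.congr fun T => ?_
    simp
  · rw [eta_eq_zero hz, zero_div, Metric.tendsto_atTop']
    intro r hr
    obtain ⟨N, hN⟩ := eventually_atTop.1 (hw.oscillating (norm_ex _ _) hz (half_pos hr))
    refine ⟨N + 1, fun T hT => ?_⟩
    have hT' : (0 : ℝ) < T := Nat.cast_pos.2 (by omega)
    rw [dist_zero_right, Finset.sum_comm]
    have h1 : ∀ k ∈ Finset.Icc (1 : ℤ) T, ‖∑ q ∈ Finset.range (T + 1),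
        ((w T (q - k) ^ 2 : ℝ) : ℂ) * ex x (q - k)‖ ≤ r / 2 / T := fun k _ => by
      have h2 := hN T (by omega) (T + 1) k k
      rw [le_div_iff₀ hT', mul_comm]
      refine le_trans (le_of_eq ?_) h2
      have h3 := norm_sum_kernel_ex (w := w T) x 0 (T + 1) k k
      rw [add_zero] at h3
      rw [← h3]
      congr 2
      refine Finset.sum_congr rfl fun q _ => ?_
      simp only [ex, Complex.ofReal_zero, mul_zero, zero_mul, Complex.exp_zero]
      push_cast; ring
    refine (norm_sum_le_of_le _ h1).trans_lt ?_
    simp only [Finset.sum_const, Int.card_Icc, add_sub_cancel_right, Int.toNat_natCast, nsmul_eq_mul]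
    rw [mul_div_cancel₀ _ hT'.ne']
    linarith

end Kernels

end QuadForm

end

noncomputable section

namespace QuadForm

/-! ### Second moments of sums of nearly orthogonal variables. -/

section Orthogonal

variable {Ω : Type*} [MeasurableSpace Ω] {P : Measure Ω} [IsProbabilityMeasure P]

theorem norm_integral_mul_conj_le {X Y : Ω → ℂ} (hX : BddMeas X) (hY : BddMeas Y) {b : ℝ}
    (h1 : ∫ ω, ‖X ω‖ ^ 2 ∂P ≤ b) (h2 : ∫ ω, ‖Y ω‖ ^ 2 ∂P ≤ b) :
    ‖∫ ω, X ω * starRingEnd ℂ (Y ω) ∂P‖ ≤ b := by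
  have i1 : Integrable (fun ω => ‖X ω‖ ^ 2 / 2) P := ((hX.norm.pow 2).integrable).div_const 2
  have i2 : Integrable (fun ω => ‖Y ω‖ ^ 2 / 2) P := ((hY.norm.pow 2).integrable).div_const 2
  calc _ ≤ ∫ ω, (‖X ω‖ ^ 2 / 2 + ‖Y ω‖ ^ 2 / 2) ∂P := by
        refine norm_integral_le_of_norm_le (i1.add i2) (Eventually.of_forall fun ω => ?_)
        rw [norm_mul, RCLike.norm_conj]
        nlinarith [sq_nonneg (‖X ω‖ - ‖Y ω‖)]
    _ ≤ b := by rw [integral_add i1 i2, integral_div, integral_div]; linarith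

/-- The second moment of a sum of variables that are orthogonal at distances above `m`. -/
theorem integral_norm_sum_sq_le {Z : ℕ → Ω → ℂ} (hZ : ∀ q, BddMeas (Z q)) {m n : ℕ} {b : ℝ}
    (hb0 : 0 ≤ b) (h0 : ∀ q q', q + m < q' → ∫ ω, Z q ω * starRingEnd ℂ (Z q' ω) ∂P = 0)
    (hb : ∀ q < n, ∫ ω, ‖Z q ω‖ ^ 2 ∂P ≤ b) :
    ∫ ω, ‖∑ q ∈ Finset.range n, Z q ω‖ ^ 2 ∂P ≤ n * ((2 * m + 1) * b) := by
  have h1 : ((∫ ω, ‖∑ q ∈ Finset.range n, Z q ω‖ ^ 2 ∂P : ℝ) : ℂ) =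
      ∑ q ∈ Finset.range n, ∑ q' ∈ Finset.range n, ∫ ω, Z q ω * starRingEnd ℂ (Z q' ω) ∂P := by
    rw [← integral_complex_ofReal]
    have h2 : ∀ ω, ((‖∑ q ∈ Finset.range n, Z q ω‖ ^ 2 : ℝ) : ℂ) =
        ∑ q ∈ Finset.range n, ∑ q' ∈ Finset.range n, Z q ω * starRingEnd ℂ (Z q' ω) := fun ω => by
      rw [← Complex.normSq_eq_norm_sq, ← Complex.mul_conj, map_sum, Finset.sum_mul_sum]
    simp_rw [h2]
    rw [integral_finsetSum _ fun q _ => (BddMeas.sum fun q' _ => (hZ q).mul (hZ q').conj).integrable]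
    exact Finset.sum_congr rfl fun q _ => integral_finsetSum _ fun q' _ =>
      ((hZ q).mul (hZ q').conj).integrable
  have h3 : ∀ q ∈ Finset.range n, ‖∑ q' ∈ Finset.range n,
      ∫ ω, Z q ω * starRingEnd ℂ (Z q' ω) ∂P‖ ≤ (2 * m + 1) * b := fun q hq => by
    rw [← Finset.sum_filter_of_ne (p := fun q' => q' ∈ Finset.Icc (q - m) (q + m))]
    · refine (norm_sum_le_of_le _ (f := fun q' => ∫ ω, Z q ω * starRingEnd ℂ (Z q' ω) ∂P)
        (n := fun _ => b) fun q' hq' => ?_).trans ?_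
      · exact norm_integral_mul_conj_le (hZ q) (hZ q') (hb q (Finset.mem_range.1 hq))
          (hb q' (Finset.mem_range.1 (Finset.mem_filter.1 hq').1))
      · rw [Finset.sum_const, nsmul_eq_mul]
        refine mul_le_mul_of_nonneg_right ?_ hb0
        have h4 : ((Finset.range n).filter fun q' => q' ∈ Finset.Icc (q - m) (q + m)).card ≤
            2 * m + 1 := by
          refine (Finset.card_le_card (t := Finset.Icc (q - m) (q + m)) fun q' hq' =>
            (Finset.mem_filter.1 hq').2).trans ?_
          rw [Nat.card_Icc]; omega
        exact_mod_cast h4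
    · intro q' _ hne
      by_contra hc
      rw [Finset.mem_Icc] at hc
      rcases lt_or_ge (q + m) q' with h5 | h5
      · exact hne (h0 q q' h5)
      · have h6 := h0 q' q (by omega)
        apply hne
        have h7 := congrArg (starRingEnd ℂ) h6
        rw [← integral_conj] at h7
        simpa [mul_comm] using h7
  have h8 := norm_sum_le_of_le _ h3
  rw [← h1, Complex.norm_real, Real.norm_eq_abs] at h8
  refine (le_abs_self _).trans (h8.trans (le_of_eq ?_))
  simp

theorem integral_norm_sum_sq_le_card {ι : Type*} {Z : ι → Ω → ℂ} {s : Finset ι}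
    (hZ : ∀ i ∈ s, BddMeas (Z i)) {b : ℝ} (hb : ∀ i ∈ s, ∫ ω, ‖Z i ω‖ ^ 2 ∂P ≤ b) :
    ∫ ω, ‖∑ i ∈ s, Z i ω‖ ^ 2 ∂P ≤ s.card * (s.card * b) := by
  calc _ ≤ ∫ ω, s.card * ∑ i ∈ s, ‖Z i ω‖ ^ 2 ∂P := by
        refine integral_mono ((BddMeas.sum hZ).norm.pow 2).integrable
          ((BddMeas.const _).mul (BddMeas.sum fun i hi => (hZ i hi).norm.pow 2)).integrable
          fun ω => ?_
        refine (pow_le_pow_left₀ (norm_nonneg _) (norm_sum_le _ _) 2).trans ?_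
        exact sq_sum_le_card_mul_sum_sq
    _ ≤ _ := by
        rw [integral_const_mul, integral_finsetSum _ fun i hi =>
          ((hZ i hi).norm.pow 2).integrable]
        gcongr
        exact (Finset.sum_le_card_nsmul _ _ _ hb).trans (by rw [nsmul_eq_mul])

theorem integral_norm_add_sq_le {X Y : Ω → ℂ} (hX : BddMeas X) (hY : BddMeas Y) :
    ∫ ω, ‖X ω + Y ω‖ ^ 2 ∂P ≤ 2 * ∫ ω, ‖X ω‖ ^ 2 ∂P + 2 * ∫ ω, ‖Y ω‖ ^ 2 ∂P := by
  have i1 : Integrable (fun ω => 2 * ‖X ω‖ ^ 2) P := ((hX.norm.pow 2).integrable).const_mul 2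
  have i2 : Integrable (fun ω => 2 * ‖Y ω‖ ^ 2) P := ((hY.norm.pow 2).integrable).const_mul 2
  rw [← integral_const_mul, ← integral_const_mul, ← integral_add i1 i2]
  refine integral_mono ((hX.add hY).norm.pow 2).integrable (i1.add i2) fun ω => ?_
  have := norm_add_le (X ω) (Y ω)
  have h0 := norm_nonneg (X ω + Y ω)
  show ‖X ω + Y ω‖ ^ 2 ≤ 2 * ‖X ω‖ ^ 2 + 2 * ‖Y ω‖ ^ 2
  nlinarith [sq_nonneg (‖X ω‖ - ‖Y ω‖)]

end Orthogonal

/-! ### Linear forms in martingale differences and a law of large numbers. -/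

section Linear

set_option linter.unusedSectionVars false

variable {S : Type*} [MeasurableSpace S] {μ : Measure S} [IsProbabilityMeasure μ]

/-- The linear form `∑_{r=1}^T w_{q-r} e^{iλ(q-r)} U_r`. -/
def lin (w : ℤ → ℝ) (lam : ℝ) (U : (ℤ → S) → ℂ) (T : ℕ) (q : ℤ) (e : ℤ → S) : ℂ :=
  ∑ r ∈ Finset.Icc (1 : ℤ) T, (w (q - r) * ex lam (q - r)) * U (shift r e)

theorem bddMeas_lin {U : (ℤ → S) → ℂ} (hU : BddMeas U) (w : ℤ → ℝ) (lam : ℝ) (T : ℕ) (q : ℤ) :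
    BddMeas (lin w lam U T q) :=
  BddMeas.sum fun r _ => (BddMeas.const _).mul (hU.comp (measurable_shift r))

/-- Weights vanish at lags up to m, so only r ≤ q - m - 1 contribute. This gap makes the linear form
independent of anything that lives in the window q - m, …, q, and it is the reason for deleting the
band around the diagonal. -/
theorem dependsOn_lin {m : ℕ} {U : (ℤ → S) → ℂ} (hU : IsMartDiff μ m U) {w : ℤ → ℝ}
    (hw : ∀ h : ℤ, h ≤ m → w h = 0) (lam : ℝ) (T : ℕ) (q : ℤ) :
    DependsOn (lin w lam U T q) (Set.Iic (q - m - 1)) :=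
  DependsOn.sum' fun r _ => by
    by_cases hr : q - r ≤ m
    · rw [hw _ hr]
      simpa using DependsOn.const' _ _
    · refine DependsOn.comp' ((hU.dep_shift r).mono fun k hk => ?_) _
      simp only [Set.mem_Icc, Set.mem_Iic] at hk ⊢
      omega

theorem IsWindow.integral_lin_pow_four_le {m : ℕ} {U : (ℤ → S) → ℂ} (h : IsWindow μ m U) :
    ∃ K : ℝ, 0 ≤ K ∧ ∀ (w : ℤ → ℝ) (a : ℝ), (∀ s : Finset ℤ, ∑ h ∈ s, w h ^ 2 ≤ a) →
      ∀ (lam : ℝ) (T : ℕ) (q : ℤ), ∫ e, ‖lin w lam U T q e‖ ^ 4 ∂(iidLaw μ) ≤ K * a ^ 2 := by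
  obtain ⟨K, hK, h1⟩ := h.integral_linear_pow_four_le
  refine ⟨K, hK, fun w a ha lam T q => (h1 _ _).trans ?_⟩
  gcongr
  refine (Finset.sum_congr rfl fun r _ => ?_).trans_le (sum_reflect_le ha q (Finset.Icc (1 : ℤ) T))
  rw [norm_mul, norm_ex, mul_one, Complex.norm_real, Real.norm_eq_abs, sq_abs]

/-- Martingale differences at distinct times are orthogonal, so only r = k survives, with the phases
multiplied. -/
theorem integral_lin_mul_lin {m : ℕ} {U U' : (ℤ → S) → ℂ} (hU : IsMartDiff μ m U)
    (hU' : IsMartDiff μ m U') (w : ℤ → ℝ) (lam lam' : ℝ) (T : ℕ) (q : ℤ) :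
    ∫ e, lin w lam U T q e * lin w lam' U' T q e ∂(iidLaw μ) =
      (∑ r ∈ Finset.Icc (1 : ℤ) T, ((w (q - r) ^ 2 : ℝ) : ℂ) * ex (lam + lam') (q - r)) *
        ∫ e, U e * U' e ∂(iidLaw μ) := by
  have hb : ∀ r k : ℤ, BddMeas fun e : ℤ → S => (w (q - r) * ex lam (q - r) * U (shift r e)) *
      (w (q - k) * ex lam' (q - k) * U' (shift k e)) := fun r k =>
    ((BddMeas.const _).mul (hU.bdd.comp (measurable_shift r))).mul
      ((BddMeas.const _).mul (hU'.bdd.comp (measurable_shift k)))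
  simp_rw [lin, Finset.sum_mul_sum]
  rw [integral_finsetSum _ fun r _ => (BddMeas.sum fun k _ => hb r k).integrable, Finset.sum_mul]
  refine Finset.sum_congr rfl fun r hr => ?_
  rw [integral_finsetSum _ fun k _ => (hb r k).integrable, Finset.sum_eq_single_of_mem r hr]
  · have h1 : ∀ e : ℤ → S, (w (q - r) * ex lam (q - r) * U (shift r e)) *
        (w (q - r) * ex lam' (q - r) * U' (shift r e)) =
        (((w (q - r) ^ 2 : ℝ) : ℂ) * ex (lam + lam') (q - r)) *
          (U (shift r e) * U' (shift r e)) := fun e => by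
      rw [ex_add_left]; push_cast; ring
    simp_rw [h1]
    rw [integral_const_mul, integral_comp_shift (f := fun e => U e * U' e) (hU.bdd.mul hU'.bdd).1]
  · intro k _ hk
    have h1 : ∀ e : ℤ → S, (w (q - r) * ex lam (q - r) * U (shift r e)) *
        (w (q - k) * ex lam' (q - k) * U' (shift k e)) =
        (w (q - r) * ex lam (q - r) * (w (q - k) * ex lam' (q - k))) *
          (U (shift r e) * U' (shift k e)) := fun e => by ring
    simp_rw [h1]
    rw [integral_const_mul, hU.integral_mul_of_ne hU' hk.symm, mul_zero]

theorem integral_mul_shift_of_dependsOn {m : ℕ} {A V : (ℤ → S) → ℂ} {q : ℤ} (hA : BddMeas A)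
    (hAd : DependsOn A (Set.Iic (q - m - 1))) (hV : BddMeas V)
    (hVd : DependsOn V (Set.Icc (-m : ℤ) 0)) :
    ∫ e, A e * V (shift q e) ∂(iidLaw μ) = (∫ e, A e ∂(iidLaw μ)) * ∫ e, V e ∂(iidLaw μ) := by
  rw [integral_mul_of_disjoint hA.1 (hV.comp (measurable_shift q)).1 (I' := Set.Icc (q - m) q) ?_ hAd
    (dependsOn_comp_shift hVd q fun k hk => by simp only [Set.mem_Icc] at hk ⊢; omega),
    integral_comp_shift hV.1]
  rw [Set.disjoint_left]
  intro k hk hk'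
  simp only [Set.mem_Icc, Set.mem_Iic] at hk hk'
  omega

/-- The law of large numbers for products of two linear forms. -/
theorem integral_norm_sum_lin_mul_sub_sq_le {m : ℕ} {w : ℕ → ℤ → ℝ} (hw : IsKernel m w)
    {U U' V V' : (ℤ → S) → ℂ} (hU : IsMartDiff μ m U) (hU' : IsMartDiff μ m U')
    (hV : IsMartDiff μ m V) (hV' : IsMartDiff μ m V') (lam lam' : ℝ) {r : ℝ} (hr : 0 < r) :
    ∀ᶠ T : ℕ in atTop, ∀ n ≤ T + 1, ∫ e, ‖∑ q ∈ Finset.range n,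
      (lin (w T) lam U T q e * lin (w T) lam' U' T q e * (V (shift q e) * V' (shift q e)) -
        ∫ e', lin (w T) lam U T q e' * lin (w T) lam' U' T q e' *
          (V (shift q e') * V' (shift q e')) ∂(iidLaw μ))‖ ^ 2 ∂(iidLaw μ) ≤ r := by
  obtain ⟨C, hC, hC1⟩ := hw.sq_le
  obtain ⟨K, hK, hK1⟩ := hU.isWindow.integral_lin_pow_four_le
  obtain ⟨K', hK', hK1'⟩ := hU'.isWindow.integral_lin_pow_four_le
  obtain ⟨L, hL, hL1⟩ := hU.isWindow.integral_qform_sub_sq_le hU'.isWindow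
  have hVV := hV.bdd.mul hV'.bdd
  have hVVd : DependsOn (fun e => V e * V' e) (Set.Icc (-m : ℤ) 0) := DependsOn.mul' hV.dep hV'.dep
  set v : ℂ := ∫ e, V e * V' e ∂(iidLaw μ) with hv
  have hVc : BddMeas fun e => V e * V' e - v := hVV.sub (BddMeas.const v)
  have hVcd : DependsOn (fun e => V e * V' e - v) (Set.Icc (-m : ℤ) 0) :=
    DependsOn.sub' hVVd (DependsOn.const' _ _)
  have hVc0 : ∫ e, (V e * V' e - v) ∂(iidLaw μ) = 0 := by
    rw [integral_sub hVV.integrable (integrable_const v)]; simp [hv]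
  obtain ⟨B, hB⟩ := hVc.2
  set M : ℝ := B ^ 2 * ((K + K') * C ^ 2) with hM
  have hM0 : 0 ≤ M := by positivity
  have hlim : Tendsto (fun T : ℕ => (2 : ℝ) * ((2 * m + 1) * M * (2 / (T : ℝ)))) atTop (𝓝 0) := by
    have := ((tendsto_const_div_atTop_nhds_zero_nat (2 : ℝ)).const_mul ((2 * m + 1) * M)).const_mul
      (2 : ℝ)
    simpa using this
  set x : ℝ := r / (4 * (‖v‖ ^ 2 * L + 1)) with hx
  have hx0 : 0 < x := by positivity
  filter_upwards [hC1, hw.frobenius_le lam lam' hx0, eventually_gt_atTop 0,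
    hlim.eventually_lt_const (half_pos hr)] with T hT hF hT0 hTr n hn
  have hT' : (0 : ℝ) < T := Nat.cast_pos.2 hT0
  set A : ℕ → (ℤ → S) → ℂ := fun q e => lin (w T) lam U T q e * lin (w T) lam' U' T q e with hA
  have hAb : ∀ q, BddMeas (A q) := fun q =>
    (bddMeas_lin hU.bdd _ _ _ _).mul (bddMeas_lin hU'.bdd _ _ _ _)
  have hAd : ∀ q : ℕ, DependsOn (A q) (Set.Iic ((q : ℤ) - m - 1)) := fun q =>
    DependsOn.mul' (dependsOn_lin hU (hw.zero T) _ _ _) (dependsOn_lin hU' (hw.zero T) _ _ _)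
  have hYint : ∀ q : ℕ, ∫ e', A q e' * (V (shift q e') * V' (shift q e')) ∂(iidLaw μ) =
      (∫ e, A q e ∂(iidLaw μ)) * v := fun q =>
    integral_mul_shift_of_dependsOn (V := fun e => V e * V' e) (hAb q) (hAd q) hVV hVVd
  -- Split VV' into its mean v and a centred part. The terms Z_q with the centred part are
  -- orthogonal at distances above m and have second moment O(T⁻²), so their sum is O(T^(-1/2)) in
  -- L².
  set Z : ℕ → (ℤ → S) → ℂ := fun q e => A q e * (V (shift q e) * V' (shift q e) - v) with hZ
  have hZb : ∀ q, BddMeas (Z q) := fun q => (hAb q).mul (hVc.comp (measurable_shift q))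
  have hZd : ∀ q : ℕ, DependsOn (Z q) (Set.Iic (q : ℤ)) := fun q =>
    DependsOn.mul' ((hAd q).mono fun k hk => by simp only [Set.mem_Iic] at hk ⊢; omega)
      (dependsOn_comp_shift hVcd q fun k hk => by simp only [Set.mem_Icc, Set.mem_Iic] at hk ⊢; omega)
  have ha : ∀ s : Finset ℤ, ∑ h ∈ s, w T h ^ 2 ≤ C / T := fun s => by
    rw [le_div_iff₀ hT', mul_comm]; exact hT s
  have hA2 : ∀ q, ∫ e, ‖A q e‖ ^ 2 ∂(iidLaw μ) ≤ (K + K') * (C / T) ^ 2 := fun q => by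
    have b1 := bddMeas_lin hU.bdd (w T) lam T q
    have b2 := bddMeas_lin hU'.bdd (w T) lam' T q
    have i1 := ((b1.norm.pow 4).integrable (P := iidLaw μ))
    have i2 := ((b2.norm.pow 4).integrable (P := iidLaw μ))
    calc _ ≤ ∫ e, (‖lin (w T) lam U T q e‖ ^ 4 + ‖lin (w T) lam' U' T q e‖ ^ 4) ∂(iidLaw μ) := by
          refine integral_mono ((hAb q).norm.pow 2).integrable (i1.add i2) fun e => ?_
          simp only [hA, norm_mul, mul_pow]
          nlinarith [sq_nonneg (‖lin (w T) lam U T q e‖ ^ 2 - ‖lin (w T) lam' U' T q e‖ ^ 2),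
            sq_nonneg (‖lin (w T) lam U T q e‖ ^ 2 + ‖lin (w T) lam' U' T q e‖ ^ 2)]
      _ ≤ _ := by
          rw [integral_add i1 i2, add_mul]
          exact add_le_add (hK1 _ _ ha _ _ _) (hK1' _ _ ha _ _ _)
  have hZ2 : ∀ q < n, ∫ e, ‖Z q e‖ ^ 2 ∂(iidLaw μ) ≤ M / T ^ 2 := fun q _ => by
    calc _ ≤ ∫ e, B ^ 2 * ‖A q e‖ ^ 2 ∂(iidLaw μ) := by
          refine integral_mono ((hZb q).norm.pow 2).integrable
            (((hAb q).norm.pow 2).integrable.const_mul _) fun e => ?_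
          simp only [hZ, norm_mul, mul_pow]
          rw [mul_comm]
          gcongr
          exact hB (shift q e)
      _ ≤ B ^ 2 * ((K + K') * (C / T) ^ 2) := by
          rw [integral_const_mul]; gcongr; exact hA2 q
      _ = _ := by rw [hM]; ring
  have hZ0 : ∀ q q' : ℕ, q + m < q' → ∫ e, Z q e * starRingEnd ℂ (Z q' e) ∂(iidLaw μ) = 0 := by
    intro q q' hq
    have h1 : ∀ e, Z q e * starRingEnd ℂ (Z q' e) = (Z q e * starRingEnd ℂ (A q' e)) *
        starRingEnd ℂ (V (shift q' e) * V' (shift q' e) - v) := fun e => by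
      simp only [hZ, map_mul, mul_assoc]
    simp_rw [h1]
    rw [integral_mul_shift_of_dependsOn (m := m)
      (V := fun e => starRingEnd ℂ (V e * V' e - v)) ((hZb q).mul (hAb q').conj)
      (DependsOn.mul' ((hZd q).mono fun k hk => by simp only [Set.mem_Iic] at hk ⊢; omega)
        (DependsOn.comp' (hAd q') _)) hVc.conj (DependsOn.comp' hVcd _), integral_conj, hVc0,
      map_zero, mul_zero]
  have hpart1 : 2 * ∫ e, ‖∑ q ∈ Finset.range n, Z q e‖ ^ 2 ∂(iidLaw μ) ≤ r / 2 := by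
    refine le_trans ?_ hTr.le
    refine mul_le_mul_of_nonneg_left ?_ zero_le_two
    refine (integral_norm_sum_sq_le hZb (by positivity) hZ0 hZ2).trans ?_
    have h1 : (n : ℝ) ≤ 2 * T := by exact_mod_cast (by omega : n ≤ 2 * T)
    calc (n : ℝ) * ((2 * m + 1) * (M / T ^ 2)) ≤ (2 * T) * ((2 * m + 1) * (M / T ^ 2)) := by
          gcongr
      _ = _ := by field_simp
  -- Exchanging the sums makes Σ_q A_q a quadratic form in U, U' whose weights are the overlap
  -- kernel. Its variance is bounded by the Frobenius norm, which `IsKernel.frobenius_le` makes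
  -- small.
  have hpart2 : 2 * ∫ e, ‖v * (∑ q ∈ Finset.range n, A q e -
      ∫ e', ∑ q ∈ Finset.range n, A q e' ∂(iidLaw μ))‖ ^ 2 ∂(iidLaw μ) ≤ r / 2 := by
    have h1 : ∀ e, ∑ q ∈ Finset.range n, A q e = ∑ i ∈ Finset.Icc (1 : ℤ) T,
        ∑ k ∈ Finset.Icc (1 : ℤ) T, (∑ q ∈ Finset.range n,
          (w T (q - i) * ex lam (q - i)) * (w T (q - k) * ex lam' (q - k))) *
          (U (shift i e) * U' (shift k e)) := fun e => by
      simp only [hA, lin, Finset.sum_mul]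
      rw [Finset.sum_comm]
      refine Finset.sum_congr rfl fun i _ => ?_
      rw [Finset.sum_comm]
      refine Finset.sum_congr rfl fun k _ => ?_
      rw [Finset.mul_sum]
      refine Finset.sum_congr rfl fun q _ => ?_
      ring
    simp_rw [norm_mul, mul_pow]
    rw [integral_const_mul]
    simp_rw [h1]
    have h2 := hL1 (Finset.Icc (1 : ℤ) T) (Finset.Icc (1 : ℤ) T) (fun i k => ∑ q ∈ Finset.range n,
          (w T (q - i) * ex lam (q - i)) * (w T (q - k) * ex lam' (q - k)))
    have h3 := hF n hn
    calc _ ≤ 2 * (‖v‖ ^ 2 * (L * x)) := by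
          gcongr
          exact h2.trans (by gcongr)
      _ = (‖v‖ ^ 2 * L) / (‖v‖ ^ 2 * L + 1) * (r / 2) := by rw [hx]; field_simp; ring
      _ ≤ 1 * (r / 2) := by
          gcongr
          rw [div_le_one (by positivity)]; linarith
      _ = r / 2 := one_mul _
  have hsum : ∀ e, ∑ q ∈ Finset.range n, (A q e * (V (shift q e) * V' (shift q e)) -
      ∫ e', A q e' * (V (shift q e') * V' (shift q e')) ∂(iidLaw μ)) =
      ∑ q ∈ Finset.range n, Z q e + v * (∑ q ∈ Finset.range n, A q e -
      ∫ e', ∑ q ∈ Finset.range n, A q e' ∂(iidLaw μ)) := fun e => by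
    rw [integral_finsetSum _ fun q _ => (hAb q).integrable, ← Finset.sum_sub_distrib,
      Finset.mul_sum, ← Finset.sum_add_distrib]
    refine Finset.sum_congr rfl fun q _ => ?_
    rw [hYint]; simp only [hZ]; ring
  simp only [hA] at hsum
  simp_rw [hsum]
  refine (integral_norm_add_sq_le (BddMeas.sum fun q _ => hZb q) ((BddMeas.const v).mul
    ((BddMeas.sum fun q _ => hAb q).sub (BddMeas.const _)))).trans ?_
  linarith

end Linear

end QuadForm

end

noncomputable section

namespace QuadForm

/-! ### The central limit theorem for real forms in martingale differences. -/

section ScalarCLT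

variable {S : Type*} [MeasurableSpace S] {μ : Measure S} [IsProbabilityMeasure μ]

theorem sum_pow_four_le {ι : Type*} (s : Finset ι) (x : ι → ℝ) :
    (∑ i ∈ s, x i) ^ 4 ≤ s.card ^ 3 * ∑ i ∈ s, x i ^ 4 := by
  have h1 : (∑ i ∈ s, x i) ^ 2 ≤ s.card * ∑ i ∈ s, x i ^ 2 := sq_sum_le_card_mul_sum_sq
  have h2 : (∑ i ∈ s, x i ^ 2) ^ 2 ≤ s.card * ∑ i ∈ s, (x i ^ 2) ^ 2 := sq_sum_le_card_mul_sum_sq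
  calc (∑ i ∈ s, x i) ^ 4 = ((∑ i ∈ s, x i) ^ 2) ^ 2 := by ring
    _ ≤ (s.card * ∑ i ∈ s, x i ^ 2) ^ 2 := by gcongr
    _ = s.card ^ 2 * (∑ i ∈ s, x i ^ 2) ^ 2 := by ring
    _ ≤ s.card ^ 2 * (s.card * ∑ i ∈ s, (x i ^ 2) ^ 2) := by gcongr
    _ = _ := by simp only [← pow_mul]; ring

variable {Γ : Type*} [Fintype Γ] {m : ℕ} {w : ℕ → ℤ → ℝ} {lam : Γ → ℝ} {U V : Γ → (ℤ → S) → ℂ}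

/-- The coefficients of each linear form have squared ℓ² norm at most C/T, which gives a fourth
moment O(T⁻²); the bounded present factor costs a constant. This serves as the Lyapunov condition.
-/
theorem exists_integral_pow_four_le (hw : IsKernel m w) (hU : ∀ γ, IsMartDiff μ m (U γ))
    (hV : ∀ γ, IsMartDiff μ m (V γ)) {ξ : ℕ → ℕ → (ℤ → S) → ℝ}
    (hξ : ∀ T q e, (ξ T q e : ℂ) = ∑ γ, lin (w T) (lam γ) (U γ) T q e * V γ (shift q e)) :
    ∃ K : ℝ, 0 ≤ K ∧ ∀ᶠ T : ℕ in atTop, ∀ q, ∫ e, ξ T q e ^ 4 ∂(iidLaw μ) ≤ (K / T) ^ 2 := by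
  obtain ⟨C, hC, hC1⟩ := hw.sq_le
  choose K hK hK1 using fun γ => (hU γ).isWindow.integral_lin_pow_four_le
  choose B hB using fun γ => (hV γ).bdd.2
  set c : ℝ := ((Finset.univ : Finset Γ).card : ℝ) with hc
  set M : ℝ := c ^ 3 * ∑ γ, B γ ^ 4 * K γ with hM
  have hM0 : 0 ≤ M := mul_nonneg (by positivity)
    (Finset.sum_nonneg fun γ _ => mul_nonneg (by positivity) (hK γ))
  refine ⟨√M * C, by positivity, ?_⟩
  filter_upwards [hC1, eventually_gt_atTop 0] with T hT hT0 q
  have hT' : (0 : ℝ) < T := Nat.cast_pos.2 hT0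
  have ha : ∀ s : Finset ℤ, ∑ h ∈ s, w T h ^ 2 ≤ C / T := fun s => by
    rw [le_div_iff₀ hT', mul_comm]; exact hT s
  have hlin : ∀ γ, BddMeas (lin (w T) (lam γ) (U γ) T q) := fun γ => bddMeas_lin (hU γ).bdd _ _ _ _
  have hi : Integrable (fun e => c ^ 3 * ∑ γ, B γ ^ 4 * ‖lin (w T) (lam γ) (U γ) T q e‖ ^ 4)
      (iidLaw μ) := ((BddMeas.const (c ^ 3)).mul (BddMeas.sum fun γ _ =>
        (BddMeas.const (B γ ^ 4)).mul ((hlin γ).norm.pow 4))).integrable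
  calc _ ≤ ∫ e, c ^ 3 * ∑ γ, B γ ^ 4 * ‖lin (w T) (lam γ) (U γ) T q e‖ ^ 4 ∂(iidLaw μ) := by
        refine integral_mono_of_nonneg (Eventually.of_forall fun e => by positivity) hi
          (Eventually.of_forall fun e => ?_)
        have h1 : |ξ T q e| ≤ ∑ γ, B γ * ‖lin (w T) (lam γ) (U γ) T q e‖ := by
          rw [← Real.norm_eq_abs, ← Complex.norm_real, hξ]
          refine norm_sum_le_of_le _ fun γ _ => ?_
          rw [norm_mul, mul_comm]
          gcongr
          exact hB γ _
        calc ξ T q e ^ 4 = |ξ T q e| ^ 4 := by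
              rw [show (4 : ℕ) = 2 * 2 by norm_num, pow_mul, pow_mul, sq_abs]
          _ ≤ (∑ γ, B γ * ‖lin (w T) (lam γ) (U γ) T q e‖) ^ 4 := by gcongr
          _ ≤ _ := by
            refine (sum_pow_four_le _ _).trans (le_of_eq ?_)
            simp only [mul_pow, hc]
    _ ≤ c ^ 3 * ∑ γ, B γ ^ 4 * (K γ * (C / T) ^ 2) := by
        rw [integral_const_mul, integral_finsetSum _ fun γ _ =>
          ((BddMeas.const (B γ ^ 4)).mul ((hlin γ).norm.pow 4)).integrable]
        gcongr with γ _
        rw [integral_const_mul]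
        gcongr
        exact hK1 γ _ _ ha _ _ _
    _ = M * (C / T) ^ 2 := by
        simp only [← mul_assoc, ← Finset.sum_mul, hM]
    _ = _ := by rw [mul_div_assoc, mul_pow, Real.sq_sqrt hM0]

theorem bddMeas_of_ofReal {Ω : Type*} [MeasurableSpace Ω] {f : Ω → ℝ}
    (h : BddMeas fun ω => (f ω : ℂ)) : BddMeas f := by
  simpa using h.re

/-- The past factors end at time q - m - 1, where the windows of the present factors begin one step
later. Hence each expectation factorises, and the past one reduces to its diagonal. -/
theorem integral_sq_forms {w : ℤ → ℝ} (hw : ∀ h : ℤ, h ≤ m → w h = 0)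
    (hU : ∀ γ, IsMartDiff μ m (U γ)) (hV : ∀ γ, IsMartDiff μ m (V γ)) {ξ : (ℤ → S) → ℝ} {T q : ℕ}
    (hξ : ∀ e, (ξ e : ℂ) = ∑ γ, lin w (lam γ) (U γ) T q e * V γ (shift q e)) :
    ((∫ e, ξ e ^ 2 ∂(iidLaw μ) : ℝ) : ℂ) = ∑ γ, ∑ γ',
      (∑ r ∈ Finset.Icc (1 : ℤ) T, ((w (q - r) ^ 2 : ℝ) : ℂ) * ex (lam γ + lam γ') (q - r)) *
        ((∫ e, U γ e * U γ' e ∂(iidLaw μ)) * ∫ e, V γ e * V γ' e ∂(iidLaw μ)) := by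
  have hb : ∀ γ γ', BddMeas fun e => lin w (lam γ) (U γ) T q e * lin w (lam γ') (U γ') T q e *
      (V γ (shift q e) * V γ' (shift q e)) := fun γ γ' =>
    ((bddMeas_lin (hU γ).bdd _ _ _ _).mul (bddMeas_lin (hU γ').bdd _ _ _ _)).mul
      (((hV γ).bdd.comp (measurable_shift _)).mul ((hV γ').bdd.comp (measurable_shift _)))
  have h1 : ∀ e, ((ξ e ^ 2 : ℝ) : ℂ) = ∑ γ, ∑ γ', lin w (lam γ) (U γ) T q e *
      lin w (lam γ') (U γ') T q e * (V γ (shift q e) * V γ' (shift q e)) := fun e => by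
    rw [Complex.ofReal_pow, hξ, sq, Finset.sum_mul_sum]
    refine Finset.sum_congr rfl fun γ _ => Finset.sum_congr rfl fun γ' _ => by ring
  rw [← integral_complex_ofReal]
  simp_rw [h1]
  rw [integral_finsetSum _ fun γ _ => (BddMeas.sum fun γ' _ => hb γ γ').integrable]
  refine Finset.sum_congr rfl fun γ _ => ?_
  rw [integral_finsetSum _ fun γ' _ => (hb γ γ').integrable]
  refine Finset.sum_congr rfl fun γ' _ => ?_
  rw [integral_mul_shift_of_dependsOn (m := m) (V := fun e => V γ e * V γ' e)
    ((bddMeas_lin (hU γ).bdd _ _ _ _).mul (bddMeas_lin (hU γ').bdd _ _ _ _))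
    (DependsOn.mul' (dependsOn_lin (hU γ) hw _ _ _) (dependsOn_lin (hU γ') hw _ _ _))
    ((hV γ).bdd.mul (hV γ').bdd) (DependsOn.mul' (hV γ).dep (hV γ').dep),
    integral_lin_mul_lin (hU γ) (hU γ'), mul_assoc]

/-- ξ² is a double sum over Γ × Γ, and the law of large numbers for products of two linear forms
handles each pair. -/
theorem integral_sum_sq_sub_sq_le (hw : IsKernel m w) (hU : ∀ γ, IsMartDiff μ m (U γ))
    (hV : ∀ γ, IsMartDiff μ m (V γ)) {ξ : ℕ → ℕ → (ℤ → S) → ℝ}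
    (hξ : ∀ T q e, (ξ T q e : ℂ) = ∑ γ, lin (w T) (lam γ) (U γ) T q e * V γ (shift q e))
    {r : ℝ} (hr : 0 < r) :
    ∀ᶠ T : ℕ in atTop, ∀ n ≤ T + 1, ∫ e, (∑ q ∈ Finset.range n,
      (ξ T q e ^ 2 - ∫ e', ξ T q e' ^ 2 ∂(iidLaw μ))) ^ 2 ∂(iidLaw μ) ≤ r := by
  set c : ℝ := ((Finset.univ : Finset (Γ × Γ)).card : ℝ) with hc
  set x : ℝ := r / (c * c + 1) with hx
  have hx0 : 0 < x := by positivity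
  filter_upwards [eventually_all.2 fun p : Γ × Γ => integral_norm_sum_lin_mul_sub_sq_le hw
    (hU p.1) (hU p.2) (hV p.1) (hV p.2) (lam p.1) (lam p.2) hx0] with T hT n hn
  have hb : ∀ (p : Γ × Γ) (q : ℕ), BddMeas fun e => lin (w T) (lam p.1) (U p.1) T q e *
      lin (w T) (lam p.2) (U p.2) T q e * (V p.1 (shift q e) * V p.2 (shift q e)) := fun p q =>
    ((bddMeas_lin (hU _).bdd _ _ _ _).mul (bddMeas_lin (hU _).bdd _ _ _ _)).mul
      (((hV _).bdd.comp (measurable_shift _)).mul ((hV _).bdd.comp (measurable_shift _)))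
  have h1 : ∀ q e, ((ξ T q e ^ 2 : ℝ) : ℂ) = ∑ p : Γ × Γ, lin (w T) (lam p.1) (U p.1) T q e *
      lin (w T) (lam p.2) (U p.2) T q e * (V p.1 (shift q e) * V p.2 (shift q e)) := fun q e => by
    rw [Complex.ofReal_pow, hξ, sq, Finset.sum_mul_sum, Fintype.sum_prod_type]
    refine Finset.sum_congr rfl fun γ _ => Finset.sum_congr rfl fun γ' _ => by ring
  have h2 : ∀ e, (∑ q ∈ Finset.range n, (ξ T q e ^ 2 - ∫ e', ξ T q e' ^ 2 ∂(iidLaw μ))) ^ 2 =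
      ‖∑ p : Γ × Γ, ∑ q ∈ Finset.range n, (lin (w T) (lam p.1) (U p.1) T q e *
      lin (w T) (lam p.2) (U p.2) T q e * (V p.1 (shift q e) * V p.2 (shift q e)) -
      ∫ e', lin (w T) (lam p.1) (U p.1) T q e' *
      lin (w T) (lam p.2) (U p.2) T q e' * (V p.1 (shift q e') * V p.2 (shift q e'))
        ∂(iidLaw μ))‖ ^ 2 := fun e => by
    rw [← sq_abs, ← Real.norm_eq_abs, ← Complex.norm_real, Finset.sum_comm, Complex.ofReal_sum]
    congr 2
    refine Finset.sum_congr rfl fun q _ => ?_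
    rw [Complex.ofReal_sub, ← integral_complex_ofReal, Finset.sum_sub_distrib,
      ← integral_finsetSum _ fun p _ => (hb p q).integrable, h1]
    simp_rw [h1]
  simp_rw [h2]
  refine (integral_norm_sum_sq_le_card (b := x) (fun p _ => BddMeas.sum fun q _ =>
    (hb p q).sub (BddMeas.const _)) fun p _ => hT p n hn).trans ?_
  calc _ = (c * c) / (c * c + 1) * r := by rw [hx]; ring
    _ ≤ 1 * r := by
      gcongr
      rw [div_le_one (by positivity)]; linarith
    _ = r := one_mul r

/-- The central limit theorem for real quadratic forms in martingale differences. -/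
theorem tendsto_charFun_forms (hw : IsKernel m w) (hU : ∀ γ, IsMartDiff μ m (U γ))
    (hV : ∀ γ, IsMartDiff μ m (V γ)) {ξ : ℕ → ℕ → (ℤ → S) → ℝ}
    (hξ : ∀ T q e, (ξ T q e : ℂ) = ∑ γ, lin (w T) (lam γ) (U γ) T q e * V γ (shift q e))
    {v : ℝ} (hv : (v : ℂ) = ∑ γ, ∑ γ', eta (lam γ + lam γ') / 2 *
      ((∫ e, U γ e * U γ' e ∂(iidLaw μ)) * ∫ e, V γ e * V γ' e ∂(iidLaw μ))) :
    Tendsto (fun T : ℕ => ∫ e, Complex.exp ((∑ q ∈ Finset.range (T + 1), ξ T q e : ℝ) * Complex.I)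
      ∂(iidLaw μ)) atTop (𝓝 (Real.exp (-(v / 2)) : ℂ)) := by
  have hξb : ∀ T q, BddMeas (ξ T q) := fun T q => bddMeas_of_ofReal (by
    simp_rw [hξ]
    exact BddMeas.sum fun γ _ => (bddMeas_lin (hU γ).bdd _ _ _ _).mul
      ((hV γ).bdd.comp (measurable_shift _)))
  have hξd : ∀ T q : ℕ, DependsOn (ξ T q) (Set.Iic (q : ℤ)) := fun T q => by
    have h1 : DependsOn (fun e => (ξ T q e : ℂ)) (Set.Iic (q : ℤ)) := by
      simp_rw [hξ]
      refine DependsOn.sum' fun γ _ => DependsOn.mul' ((dependsOn_lin (hU γ) (hw.zero T) _ _ _).mono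
        fun k hk => ?_) (((hV γ).dep_shift q).mono fun k hk => ?_)
      · simp only [Set.mem_Iic] at hk ⊢; omega
      · simp only [Set.mem_Iic, Set.mem_Icc] at hk ⊢; omega
    simpa using DependsOn.comp' h1 Complex.re
  have hvar : Tendsto (fun T : ℕ => ∑ q ∈ Finset.range (T + 1), ∫ e, ξ T q e ^ 2 ∂(iidLaw μ))
      atTop (𝓝 v) := by
    have h1 : Tendsto (fun T : ℕ => ∑ γ, ∑ γ', (∑ q ∈ Finset.range (T + 1),
        ∑ r ∈ Finset.Icc (1 : ℤ) T, ((w T (q - r) ^ 2 : ℝ) : ℂ) * ex (lam γ + lam γ') (q - r)) *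
        ((∫ e, U γ e * U γ' e ∂(iidLaw μ)) * ∫ e, V γ e * V γ' e ∂(iidLaw μ))) atTop
        (𝓝 (v : ℂ)) := by
      rw [hv]
      exact tendsto_finsetSum _ fun γ _ => tendsto_finsetSum _ fun γ' _ =>
        (hw.tendsto_sum_sq_ex _).mul_const _
    have h2 := (Complex.continuous_re.tendsto _).comp h1
    rw [Complex.ofReal_re] at h2
    refine h2.congr fun T => ?_
    simp only [Function.comp_apply, Finset.sum_mul]
    rw [← Complex.ofReal_re (∑ q ∈ Finset.range (T + 1), ∫ e, ξ T q e ^ 2 ∂(iidLaw μ)),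
      Complex.ofReal_sum]
    congr 1
    simp_rw [fun q => integral_sq_forms (hw.zero T) hU hV (hξ T q), Finset.sum_mul]
    rw [Finset.sum_comm' (t' := Finset.univ) (s' := fun _ => Finset.range (T + 1)) (by simp)]
    refine Finset.sum_congr rfl fun γ _ => ?_
    rw [Finset.sum_comm]
  obtain ⟨K, hK, hK4⟩ := exists_integral_pow_four_le hw hU hV hξ
  have hmd : ∀ T q : ℕ, ∀ W : (ℤ → S) → ℂ, BddMeas W → DependsOn W (Set.Iio (q : ℤ)) →
      ∫ e, W e * ξ T q e ∂(iidLaw μ) = 0 := fun T q W hW hWd => by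
    simp_rw [hξ, Finset.mul_sum]
    rw [integral_finsetSum _ fun γ _ => (hW.mul ((bddMeas_lin (hU γ).bdd _ _ _ _).mul
      ((hV γ).bdd.comp (measurable_shift _)))).integrable]
    refine Finset.sum_eq_zero fun γ _ => ?_
    simp_rw [← mul_assoc]
    refine (hV γ).integral_mul_shift q (hW.mul (bddMeas_lin (hU γ).bdd _ _ _ _))
      (DependsOn.mul' hWd ((dependsOn_lin (hU γ) (hw.zero T) _ _ _).mono fun k hk => ?_))
    simp only [Set.mem_Iic, Set.mem_Iio] at hk ⊢; omega
  have hlim1 : Tendsto (fun T : ℕ => (Real.exp (-(1 ^ 2 / 2 * ∑ q ∈ Finset.range (T + 1),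
      ∫ e, ξ T q e ^ 2 ∂(iidLaw μ))) : ℂ)) atTop (𝓝 (Real.exp (-(v / 2)) : ℂ)) := by
    have h1 : Continuous fun x : ℝ => (Real.exp (-(1 ^ 2 / 2 * x)) : ℂ) := by fun_prop
    have h2 := (h1.tendsto v).comp hvar
    rw [show -(1 ^ 2 / 2 * v) = -(v / 2) by ring] at h2
    exact h2
  refine tendsto_of_tendsto_of_dist hlim1 ?_
  rw [Metric.tendsto_atTop']
  intro r hr
  -- The error bound contains δ with total factor at most 1 + 2K, so these terms contribute r/4.
  set δ : ℝ := r / (4 * (1 + 2 * K)) with hδ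
  have hδ0 : 0 < δ := by positivity
  -- the terms of the error that do not involve `δ`
  have hlim2 : Tendsto (fun T : ℕ => (10 * (K + K ^ 2) * (√(T : ℝ))⁻¹ + 2 * K ^ 2 * (T : ℝ)⁻¹))
      atTop (𝓝 0) := by
    have h1 : Tendsto (fun T : ℕ => (√(T : ℝ))⁻¹) atTop (𝓝 0) :=
      tendsto_inv_atTop_zero.comp (Real.tendsto_sqrt_atTop.comp tendsto_natCast_atTop_atTop)
    have h2 : Tendsto (fun T : ℕ => (T : ℝ)⁻¹) atTop (𝓝 0) :=
      tendsto_inv_atTop_zero.comp tendsto_natCast_atTop_atTop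
    simpa using (h1.const_mul (10 * (K + K ^ 2))).add (h2.const_mul (2 * K ^ 2))
  obtain ⟨N, hN⟩ := eventually_atTop.1 ((hK4.and (integral_sum_sq_sub_sq_le hw hU hV hξ
    (pow_pos hδ0 2))).and ((hlim2.eventually_lt_const (half_pos hr)).and (eventually_gt_atTop 0)))
  refine ⟨N, fun T hT => ?_⟩
  obtain ⟨⟨h4, hR⟩, h5, hT0⟩ := hN T hT.le
  have hT' : (0 : ℝ) < T := Nat.cast_pos.2 hT0
  set S' : ℕ → (ℤ → S) → ℝ := fun q e => ∑ r ∈ Finset.range q, ξ T r e with hS'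
  set R' : ℕ → (ℤ → S) → ℝ := fun q e =>
    ∑ r ∈ Finset.range q, (ξ T r e ^ 2 - ∫ e', ξ T r e' ^ 2 ∂(iidLaw μ)) with hR'
  have hSb : ∀ q, BddMeas (S' q) := fun q => BddMeas.sum fun i _ => hξb T i
  have hRb : ∀ q, BddMeas (R' q) := fun q => BddMeas.sum fun i _ =>
    ((hξb T i).pow 2).sub (BddMeas.const _)
  have hξd' : ∀ q, ∀ i ∈ Finset.range q, DependsOn (ξ T i) (Set.Iio (q : ℤ)) := fun q i hi =>
    (hξd T i).mono fun k hk => by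
      have := Finset.mem_range.1 hi
      simp only [Set.mem_Iic, Set.mem_Iio] at hk ⊢; omega
  have hSd : ∀ q : ℕ, DependsOn (S' q) (Set.Iio (q : ℤ)) := fun q =>
    DependsOn.sum' fun i hi => hξd' q i hi
  have hRd : ∀ q : ℕ, DependsOn (R' q) (Set.Iio (q : ℤ)) := fun q =>
    DependsOn.sum' fun i hi => DependsOn.comp' (hξd' q i hi)
      (fun x => x ^ 2 - ∫ e', ξ T i e' ^ 2 ∂(iidLaw μ))
  have hφb : ∀ q, BddMeas fun e => Complex.exp ((1 * S' q e : ℝ) * Complex.I) := fun q =>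
    BddMeas.cexp (f := fun e => 1 * S' q e) ((hSb q).1.const_mul 1)
  have hφd : ∀ q : ℕ, DependsOn (fun e => Complex.exp ((1 * S' q e : ℝ) * Complex.I))
      (Set.Iio (q : ℤ)) := fun q => DependsOn.comp' (hSd q) fun x =>
        Complex.exp ((1 * x : ℝ) * Complex.I)
  -- With k = K/T and τ = T^(-1/2) the third-order error of a step is O(T^(-3/2)). The T + 1 steps
  -- together cost O(T^(-1/2)) besides the terms in δ.
  have hmain := norm_charFun_sum_sub_le (P := iidLaw μ) (T + 1) (hξb T) (S := S') (R := R')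
    (fun _ _ => rfl) (fun _ _ => rfl) 1 (fun q _ => hmd T q _ (hφb q) (hφd q))
    (fun q _ => by
      simp_rw [← mul_assoc]
      exact hmd T q _ ((hφb q).mul (hRb q).ofReal) (DependsOn.mul' (hφd q)
        (DependsOn.comp' (hRd q) _)))
    (k := K / T) (δ := δ) (τ := (√(T : ℝ))⁻¹) (by positivity) hδ0.le (by positivity)
    (fun q _ => h4 q) (fun q hq => hR q hq)
  rw [Real.dist_eq, sub_zero, abs_of_nonneg dist_nonneg, dist_comm, dist_eq_norm]
  simp only [hS', one_mul] at hmain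
  refine hmain.trans_lt ?_
  set y := (√(T : ℝ))⁻¹ with hy
  have hy0 : 0 < y := by positivity
  have hyy : (T : ℝ)⁻¹ = y * y := by
    rw [hy, ← mul_inv, Real.mul_self_sqrt hT'.le]
  have hk : K / T = K * (y * y) := by rw [div_eq_mul_inv, hyy]
  have hk2 : (K * (y * y)) ^ 2 / y = K ^ 2 * (y * y * y) := by field_simp
  have hk3 : K * (y * y) / y = K * y := by field_simp
  have hTy : (T : ℝ) * (y * y) = 1 := by rw [← hyy]; exact mul_inv_cancel₀ hT'.ne'
  have hT1 : (1 : ℝ) ≤ T := by exact_mod_cast hT0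
  have hT2 : ((T + 1 : ℕ) : ℝ) * (y * y) ≤ 2 := by
    push_cast
    nlinarith [mul_pos hy0 hy0]
  rw [hyy] at h5
  rw [hk, hk2, hk3]
  simp only [abs_one, one_pow, mul_one, one_mul]
  set n : ℝ := ((T + 1 : ℕ) : ℝ)
  have e1 : n * (4 * (y * (K * (y * y)) + K ^ 2 * (y * y * y)) + (K * (y * y)) ^ 2) +
      1 / 2 * (2 * δ + n * (2 * (K * (y * y) * δ) +
        (y * (K * (y * y)) + K ^ 2 * (y * y * y) + K * (y * y) * (y + K * y)))) =
      δ + n * (y * y) * (5 * (K + K ^ 2) * y + K ^ 2 * (y * y) + K * δ) := by ring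
  rw [e1]
  have e2 : n * (y * y) * (5 * (K + K ^ 2) * y + K ^ 2 * (y * y) + K * δ) ≤
      2 * (5 * (K + K ^ 2) * y + K ^ 2 * (y * y) + K * δ) := by gcongr
  have e3 : δ * (1 + 2 * K) = r / 4 := by rw [hδ]; field_simp
  linarith

end ScalarCLT

end QuadForm

end

noncomputable section

namespace QuadForm

/-! ### Normalised two-sided weights and their one-sided truncations. -/

section Weights

/-- Normalised real weights. -/
structure IsWeights (β : ℕ → ℤ → ℝ) : Prop where
  even : ∀ T h, β T (-h) = β T h
  zero : ∀ (T : ℕ) (h : ℤ), (T : ℤ) ≤ |h| → β T h = 0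
  sq_le : ∃ C : ℝ, 0 ≤ C ∧ ∀ᶠ T : ℕ in atTop, ∀ s : Finset ℤ, T * ∑ h ∈ s, β T h ^ 2 ≤ C
  sup_le : ∀ r : ℝ, 0 < r → ∀ᶠ T : ℕ in atTop, ∀ h, T * β T h ^ 2 ≤ r
  var_le : ∀ r : ℝ, 0 < r → ∀ᶠ T : ℕ in atTop, ∀ s : Finset ℤ,
    T * ∑ h ∈ s, (β T (h + 1) - β T h) ^ 2 ≤ r
  overlap_le : ∀ r : ℝ, 0 < r → ∀ᶠ T : ℕ in atTop,
    ∑ p ∈ (Finset.Icc (1 : ℤ) T ×ˢ Finset.Icc (1 : ℤ) T).filter (fun p => p.1 < p.2),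
      (∑ q ∈ Finset.Icc (p.2 + 1) (T : ℤ), β T (q - p.1) * β T (q - p.2)) ^ 2 ≤ r
  total_le : ∀ T : ℕ, ∑ t ∈ Finset.Icc (1 : ℤ) T, ∑ s ∈ Finset.Icc (1 : ℤ) T, β T (t - s) ^ 2 ≤ 1
  total : ∀ᶠ T : ℕ in atTop,
    ∑ t ∈ Finset.Icc (1 : ℤ) T, ∑ s ∈ Finset.Icc (1 : ℤ) T, β T (t - s) ^ 2 = 1

theorem sum_range_succ_eq_sum_Icc {α : Type*} [AddCommMonoid α] (f : ℤ → α) (T : ℕ) (h0 : f 0 = 0) :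
    ∑ q ∈ Finset.range (T + 1), f q = ∑ q ∈ Finset.Icc (1 : ℤ) T, f q := by
  rw [Finset.sum_range_succ']
  simp only [Nat.cast_zero, h0, add_zero]
  refine Finset.sum_nbij' (fun q : ℕ => ((q + 1 : ℕ) : ℤ)) (fun q : ℤ => (q - 1).toNat)
    ?_ ?_ ?_ ?_ ?_
  · intro q hq; simp only [Finset.mem_range, Finset.mem_Icc] at hq ⊢; omega
  · intro q hq; simp only [Finset.mem_range, Finset.mem_Icc] at hq ⊢; omega
  · intro q hq; simp
  · intro q hq; simp only [Finset.mem_Icc] at hq; omega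
  · intro q hq; rfl

/-- The band has at most T(2m + 1) entries, and each squared weight is o(1/T). -/
theorem IsWeights.tendsto_near {β : ℕ → ℤ → ℝ} (hβ : IsWeights β) (m : ℕ) :
    Tendsto (fun T : ℕ => ∑ t ∈ Finset.Icc (1 : ℤ) T, ∑ s ∈ Finset.Icc (1 : ℤ) T,
      (if |t - s| ≤ m then β T (t - s) ^ 2 else 0)) atTop (𝓝 0) := by
  rw [Metric.tendsto_atTop']
  intro r hr
  obtain ⟨N, hN⟩ := eventually_atTop.1 (hβ.sup_le (r / (2 * (2 * m + 1))) (by positivity))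
  refine ⟨N + 1, fun T hT => ?_⟩
  have hT' : (0 : ℝ) < T := Nat.cast_pos.2 (by omega)
  have h2 := hN T (by omega)
  rw [Real.dist_eq, sub_zero, abs_of_nonneg (Finset.sum_nonneg fun t _ =>
    Finset.sum_nonneg fun s _ => by split_ifs <;> positivity)]
  have h3 : ∀ t ∈ Finset.Icc (1 : ℤ) T, ∑ s ∈ Finset.Icc (1 : ℤ) T,
      (if |t - s| ≤ m then β T (t - s) ^ 2 else 0) ≤ r / 2 / T := fun t _ => by
    rw [← Finset.sum_filter]
    refine (Finset.sum_le_card_nsmul _ _ (r / (2 * (2 * m + 1)) / T) fun s _ => ?_).trans ?_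
    · rw [le_div_iff₀ hT', mul_comm]; exact h2 _
    · rw [nsmul_eq_mul]
      have : (((Finset.Icc (1 : ℤ) T).filter fun s => |t - s| ≤ m).card : ℝ) ≤ 2 * m + 1 := by
        have : ((Finset.Icc (1 : ℤ) T).filter fun s => |t - s| ≤ m).card ≤ 2 * m + 1 := by
          refine (Finset.card_le_card (t := Finset.Icc (t - m) (t + m)) fun q hq => ?_).trans ?_
          · simp only [Finset.mem_filter, Finset.mem_Icc, abs_le] at hq ⊢; omega
          · rw [Int.card_Icc]; omega
        exact_mod_cast this
      calc _ ≤ (2 * m + 1) * (r / (2 * (2 * m + 1)) / T) := by gcongr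
        _ = _ := by field_simp
  refine (Finset.sum_le_card_nsmul _ _ _ h3).trans_lt ?_
  rw [nsmul_eq_mul, Int.card_Icc]
  simp only [add_sub_cancel_right, Int.toNat_natCast]
  rw [mul_div_cancel₀ _ hT'.ne']
  linarith

/-- Cutting off the lags h ≤ m is harmless because single weights are small: it adds one jump at m +
1 to the variation and removes at most m terms from each overlap sum. -/
theorem IsWeights.isKernel {β : ℕ → ℤ → ℝ} (hβ : IsWeights β) (m : ℕ) :
    IsKernel m fun T h => if (m : ℤ) < h then β T h else 0 := by
  set w : ℕ → ℤ → ℝ := fun T h => if (m : ℤ) < h then β T h else 0 with hw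
  have hw0 : ∀ (T : ℕ) (h : ℤ), h ≤ m → w T h = 0 := fun T h hh => by simp [hw, hh]
  have hw1 : ∀ (T : ℕ) (h : ℤ), m < h → w T h = β T h := fun T h hh => by simp [hw, hh]
  have hle : ∀ T h, w T h ^ 2 ≤ β T h ^ 2 := fun T h => by
    simp only [hw]; split_ifs
    · exact le_rfl
    · simpa using sq_nonneg (β T h)
  refine ⟨hw0, ?_, ?_, ?_, ?_, ?_⟩
  · obtain ⟨C, hC, h⟩ := hβ.sq_le
    refine ⟨C, hC, ?_⟩
    filter_upwards [h] with T hT s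
    exact (mul_le_mul_of_nonneg_left (Finset.sum_le_sum fun h _ => hle T h) T.cast_nonneg).trans (hT s)
  · intro r hr
    filter_upwards [hβ.sup_le r hr] with T hT h
    exact (mul_le_mul_of_nonneg_left (hle T h) T.cast_nonneg).trans (hT h)
  · intro r hr
    filter_upwards [hβ.sup_le (r / 2) (half_pos hr), hβ.var_le (r / 2) (half_pos hr)]
      with T h1 h2 s
    have h3 : ∀ h ∈ s, (w T (h + 1) - w T h) ^ 2 ≤
        (if h = m then β T (m + 1) ^ 2 else 0) + (β T (h + 1) - β T h) ^ 2 := fun h _ => by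
      rcases lt_trichotomy h m with hlt | rfl | hlt
      · rw [hw0 T h hlt.le, hw0 T (h + 1) (by omega), if_neg hlt.ne]
        simp only [sub_zero, ne_eq, OfNat.ofNat_ne_zero, not_false_eq_true, zero_pow, zero_add]
        positivity
      · rw [hw0 T _ le_rfl, hw1 T _ (by omega), if_pos rfl, sub_zero]
        nlinarith [sq_nonneg (β T (m + 1) - β T m)]
      · rw [hw1 T h hlt, hw1 T (h + 1) (by omega), if_neg hlt.ne', zero_add]
    have h4 : ∑ h ∈ s, (if h = m then β T (m + 1) ^ 2 else 0) ≤ β T (m + 1) ^ 2 := by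
      rw [Finset.sum_ite_eq']
      split_ifs
      · exact le_rfl
      · positivity
    calc _ ≤ T * (β T (m + 1) ^ 2 + ∑ h ∈ s, (β T (h + 1) - β T h) ^ 2) := by
          gcongr
          refine (Finset.sum_le_sum h3).trans ?_
          rw [Finset.sum_add_distrib]
          gcongr
      _ ≤ r / 2 + r / 2 := by rw [mul_add]; exact add_le_add (h1 _) (h2 s)
      _ = r := add_halves r
  · intro r hr
    -- Truncation changes each of at most T² overlap sums by at most m x/T, which costs 2m²x² ≤ r/2
    -- in total.
    set x : ℝ := √(r / (4 * (m ^ 2 + 1))) with hx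
    have hx0 : 0 < x := Real.sqrt_pos.2 (by positivity)
    filter_upwards [hβ.overlap_le (r / 4) (by positivity), hβ.sup_le x hx0, eventually_gt_atTop 0]
      with T h1 h2 hT0
    have hT' : (0 : ℝ) < T := Nat.cast_pos.2 hT0
    have hprod : ∀ k k' : ℤ, |β T k * β T k'| ≤ x / T := fun k k' => by
      have a1 : β T k ^ 2 ≤ x / T := by rw [le_div_iff₀ hT', mul_comm]; exact h2 k
      have a2 : β T k' ^ 2 ≤ x / T := by rw [le_div_iff₀ hT', mul_comm]; exact h2 k'
      rw [abs_mul]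
      nlinarith [sq_abs (β T k), sq_abs (β T k'), sq_nonneg (|β T k| - |β T k'|)]
    have h3 : ∀ p ∈ (Finset.Icc (1 : ℤ) T ×ˢ Finset.Icc (1 : ℤ) T).filter (fun p => p.1 < p.2),
        (∑ q ∈ Finset.range (T + 1), w T (q - p.1) * w T (q - p.2)) ^ 2 ≤
        2 * (∑ q ∈ Finset.Icc (p.2 + 1) (T : ℤ), β T (q - p.1) * β T (q - p.2)) ^ 2 +
          2 * (m * (x / T)) ^ 2 := fun p hp => by
      simp only [Finset.mem_filter, Finset.mem_product, Finset.mem_Icc] at hp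
      rw [sum_range_succ_eq_sum_Icc (fun q => w T (q - p.1) * w T (q - p.2)) T
        (by rw [hw0 T (0 - p.1) (by omega), zero_mul])]
      have e1 : ∑ q ∈ Finset.Icc (1 : ℤ) T, w T (q - p.1) * w T (q - p.2) =
          ∑ q ∈ Finset.Icc (p.2 + 1) (T : ℤ), β T (q - p.1) * β T (q - p.2) -
          ∑ q ∈ (Finset.Icc (p.2 + 1) (T : ℤ)).filter (fun q => q ≤ p.2 + m),
            β T (q - p.1) * β T (q - p.2) := by
        rw [Finset.sum_filter, ← Finset.sum_sub_distrib]
        symm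
        refine Finset.sum_subset_zero_on_sdiff ?_ ?_ ?_
        · intro q hq; simp only [Finset.mem_Icc] at hq ⊢; omega
        · intro q hq
          simp only [Finset.mem_sdiff, Finset.mem_Icc] at hq
          rw [hw0 T (q - p.2) (by omega), mul_zero]
        · intro q hq
          simp only [Finset.mem_Icc] at hq
          split_ifs with hqm
          · rw [hw0 T (q - p.2) (by omega), mul_zero, sub_self]
          · rw [hw1 T (q - p.2) (by omega), hw1 T (q - p.1) (by omega), sub_zero]
      have e2 : |∑ q ∈ (Finset.Icc (p.2 + 1) (T : ℤ)).filter (fun q => q ≤ p.2 + m),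
            β T (q - p.1) * β T (q - p.2)| ≤ m * (x / T) := by
        refine (Finset.abs_sum_le_sum_abs _ _).trans ((Finset.sum_le_card_nsmul _ _ _
          fun q _ => hprod _ _).trans ?_)
        rw [nsmul_eq_mul]
        gcongr
        refine (Finset.card_le_card (t := Finset.Icc (p.2 + 1) (p.2 + m)) fun q hq => ?_).trans ?_
        · simp only [Finset.mem_filter, Finset.mem_Icc] at hq ⊢; omega
        · rw [Int.card_Icc]; omega
      rw [e1]
      have e3 := abs_le.1 e2
      have e4 := sq_le_sq' e3.1 e3.2
      set X := ∑ q ∈ Finset.Icc (p.2 + 1) (T : ℤ), β T (q - p.1) * β T (q - p.2)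
      set Y := ∑ q ∈ (Finset.Icc (p.2 + 1) (T : ℤ)).filter (fun q => q ≤ p.2 + m),
            β T (q - p.1) * β T (q - p.2)
      nlinarith [sq_nonneg (X + Y)]
    have hcard : (((Finset.Icc (1 : ℤ) T ×ˢ Finset.Icc (1 : ℤ) T).filter
        (fun p => p.1 < p.2)).card : ℝ) ≤ T ^ 2 := by
      refine (Nat.cast_le.2 (Finset.card_filter_le _ _)).trans ?_
      simp [sq]
    refine (Finset.sum_le_sum h3).trans ?_
    rw [Finset.sum_add_distrib, ← Finset.mul_sum, Finset.sum_const, nsmul_eq_mul]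
    have hxx : x ^ 2 = r / (4 * (m ^ 2 + 1)) := Real.sq_sqrt (by positivity)
    calc _ ≤ 2 * (r / 4) + T ^ 2 * (2 * (m * (x / T)) ^ 2) := by gcongr
      _ = r / 2 + (m ^ 2 / (m ^ 2 + 1)) * (r / 2) := by
          rw [show (T : ℝ) ^ 2 * (2 * (m * (x / T)) ^ 2) = 2 * m ^ 2 * x ^ 2 by field_simp, hxx]
          field_simp; ring
      _ ≤ r / 2 + 1 * (r / 2) := by
          gcongr
          rw [div_le_one (by positivity)]; linarith
      _ = r := by ring
  -- By evenness the total mass 1 is the mass of the band plus twice the mass of the one-sided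
  -- kernel. The band disappears in the limit, which leaves 1/2.
  · have hkey : ∀ᶠ T : ℕ in atTop, ∑ t ∈ Finset.Icc (1 : ℤ) T, ∑ s ∈ Finset.Icc (1 : ℤ) T,
        (if |t - s| ≤ m then β T (t - s) ^ 2 else 0) = 1 - 2 * ∑ q ∈ Finset.range (T + 1),
        ∑ r ∈ Finset.Icc (1 : ℤ) T, w T (q - r) ^ 2 := by
      filter_upwards [hβ.total] with T hT
      rw [sum_range_succ_eq_sum_Icc (fun q => ∑ r ∈ Finset.Icc (1 : ℤ) T, w T (q - r) ^ 2) T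
        (Finset.sum_eq_zero fun r hr => by
          rw [hw0 T (0 - r) (by have := Finset.mem_Icc.1 hr; omega), zero_pow two_ne_zero]),
        ← hT]
      have hsym : 2 * ∑ t ∈ Finset.Icc (1 : ℤ) T, ∑ s ∈ Finset.Icc (1 : ℤ) T, w T (t - s) ^ 2 =
          ∑ t ∈ Finset.Icc (1 : ℤ) T, ∑ s ∈ Finset.Icc (1 : ℤ) T,
            (w T (t - s) ^ 2 + w T (s - t) ^ 2) := by
        simp_rw [Finset.sum_add_distrib]
        rw [two_mul]
        congr 1
        exact Finset.sum_comm
      rw [hsym]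
      simp_rw [← Finset.sum_sub_distrib]
      refine Finset.sum_congr rfl fun t _ => Finset.sum_congr rfl fun s _ => ?_
      have hev : β T (s - t) = β T (t - s) := by rw [← neg_sub t s, hβ.even]
      split_ifs with h
      · have := abs_le.1 h
        rw [hw0 T (t - s) (by omega), hw0 T (s - t) (by omega)]; ring
      · rcases le_or_gt (t - s) m with h1 | h1
        · have h2 : (m : ℤ) < s - t := by
            by_contra hc; exact h (abs_le.2 ⟨by omega, h1⟩)
          rw [hw0 T (t - s) h1, hw1 T (s - t) h2, hev]; ring
        · rw [hw1 T (t - s) h1, hw0 T (s - t) (by omega)]; ring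
    have h5 := ((hβ.tendsto_near m).congr' hkey).const_sub 1
    have h6 := h5.div_const 2
    rw [sub_zero] at h6
    refine h6.congr fun T => ?_
    ring

end Weights

/-! ### From operator weights to normalised real scalars. -/

section Admissible

variable {H : Type*} [NormedAddCommGroup H] [InnerProductSpace ℂ H] [CompleteSpace H]

theorem norm_phi (A : ℕ → ℤ → (H →L[ℂ] H)) (lam : ℝ) (T : ℕ) (h : ℤ) :
    ‖phi A lam T h‖ = ‖A T h‖ := by
  rw [phi, norm_smul]
  change ‖ex lam h‖ * _ = _
  rw [norm_ex, one_mul]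

theorem kron_tensor (A B : H →L[ℂ] H) (x y : H) : kron A B (tensor x y) = tensor (A x) (B y) := by
  apply HS.op_injective
  rw [kron_op]
  ext v
  simp [tensor, ContinuousLinearMap.adjoint_inner_right]

theorem kron_smul_id (a b : ℂ) :
    kron (a • ContinuousLinearMap.id ℂ H) (b • ContinuousLinearMap.id ℂ H) =
      (a * starRingEnd ℂ b) • ContinuousLinearMap.id ℂ (HS H) := by
  ext C : 1
  apply HS.op_injective
  rw [kron_op, map_smulₛₗ]
  ext v
  have : ContinuousLinearMap.adjoint (ContinuousLinearMap.id ℂ H) = ContinuousLinearMap.id ℂ H :=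
    ContinuousLinearMap.adjoint_id
  simp only [this, ContinuousLinearMap.coe_comp, Function.comp_apply, smul_apply,
    ContinuousLinearMap.id_apply, map_smul, mul_smul]
  exact smul_comm _ _ _

theorem nontrivial_HS [Nontrivial H] : Nontrivial (HS H) := by
  obtain ⟨x, hx⟩ := exists_ne (0 : H)
  refine ⟨tensor x x, 0, fun h => ?_⟩
  have h1 := congrArg (fun C : HS H => C.op x) h
  simp [tensor, hx] at h1

/-- Balance says φx ⊗ y = x ⊗ φ†y; evaluated at a unit vector y it shows that φx is a fixed multiple
of x. Hermitian symmetry conjugates the multiple when the lag changes sign, and evenness of A then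
forces the scalar of A, freed from its phase, to be real. -/
theorem AdmissibleWeights.exists_scalar [Nontrivial H] {A : ℕ → ℤ → (H →L[ℂ] H)} {lam : ℝ}
    (hA : AdmissibleWeights A lam) {T : ℕ} {h : ℤ} (hh : |h| < T) :
    ∃ a : ℝ, A T h = (a : ℂ) • ContinuousLinearMap.id ℂ H := by
  obtain ⟨s, t, hs, ht, hst⟩ : ∃ s t : ℤ, s ∈ Finset.Icc (1 : ℤ) T ∧ t ∈ Finset.Icc (1 : ℤ) T ∧
      t - s = h := by
    have := abs_lt.1 hh
    rcases le_total 0 h with h0 | h0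
    · exact ⟨1, 1 + h, by simp; omega, by simp; omega, by ring⟩
    · exact ⟨1 - h, 1, by simp; omega, by simp; omega, by ring⟩
  obtain ⟨y, hy⟩ := exists_norm_eq H zero_le_one
  have hscal : ∀ s ∈ Finset.Icc (1 : ℤ) T, ∀ t ∈ Finset.Icc (1 : ℤ) T, ∃ c : ℂ,
      phi A lam T (t - s) = c • ContinuousLinearMap.id ℂ H := fun s hs t ht => by
    refine ⟨inner ℂ y (phi A lam T (t - s) y), ?_⟩
    ext x
    have h1 := hA.balanced T s hs t ht x y
    rw [Phi, kron_tensor] at h1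
    have h2 := congrArg (fun C : HS H => C.op y) h1
    simp only [tensor, HS.op_mk, InnerProductSpace.rankOne_apply, ContinuousLinearMap.id_apply,
      ContinuousLinearMap.adjoint_inner_left] at h2
    rw [inner_self_eq_norm_sq_to_K, hy] at h2
    simpa using h2
  obtain ⟨c, hc⟩ := hscal s hs t ht
  obtain ⟨c', hc'⟩ := hscal t ht s hs
  have hherm := hA.hermitian T s hs t ht
  have e1 : ∀ c : ℂ, kron (c • ContinuousLinearMap.id ℂ H) (ContinuousLinearMap.id ℂ H) =
      c • ContinuousLinearMap.id ℂ (HS H) := fun c => by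
    have := kron_smul_id (H := H) c 1
    simpa using this
  rw [Phi, Phi, hc, hc', e1, e1, map_smulₛₗ] at hherm
  have hcc : starRingEnd ℂ c = c' := by
    have := nontrivial_HS (H := H)
    obtain ⟨C, hC⟩ := exists_ne (0 : HS H)
    have h1 := congrArg (fun L : HS H →L[ℂ] HS H => L C) hherm
    have h2 : ContinuousLinearMap.adjoint (ContinuousLinearMap.id ℂ (HS H)) =
        ContinuousLinearMap.id ℂ (HS H) := ContinuousLinearMap.adjoint_id
    simp only [h2, smul_apply, ContinuousLinearMap.id_apply] at h1
    exact smul_left_injective ℂ hC h1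
  have hphi : ∀ k : ℤ, A T k = ex lam (-k) • phi A lam T k := fun k => by
    rw [phi, smul_smul]
    change _ = (ex lam (-k) * ex lam k) • _
    rw [← ex_add, neg_add_cancel, ex_zero, one_smul]
  have hst' : s - t = -h := by rw [← hst]; ring
  have hA1 : A T h = (ex lam (-h) * c) • ContinuousLinearMap.id ℂ H := by
    rw [hphi, ← hst, hc, smul_smul]
  have hA2 : A T h = (ex lam h * c') • ContinuousLinearMap.id ℂ H := by
    rw [← hA.even, hphi, ← hst', hc', smul_smul, hst', neg_neg]
  refine ⟨(ex lam (-h) * c).re, ?_⟩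
  have hreal : starRingEnd ℂ (ex lam (-h) * c) = ex lam (-h) * c := by
    have h1 := hA1.symm.trans hA2
    have h2 := congrArg (fun L : H →L[ℂ] H => L y) h1
    simp only [smul_apply, ContinuousLinearMap.id_apply] at h2
    have hy0 : y ≠ 0 := by rintro rfl; simp at hy
    rw [map_mul, conj_ex, neg_neg, hcc]
    exact (smul_left_injective ℂ hy0 h2).symm
  rw [hA1, Complex.conj_eq_iff_re.1 hreal]

theorem sum_le_sum_of_support {f : ℤ → ℝ} (hf : ∀ h, 0 ≤ f h) {D : Finset ℤ}
    (hD : ∀ h, h ∉ D → f h = 0) (s : Finset ℤ) : ∑ h ∈ s, f h ≤ ∑ h ∈ D, f h := by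
  rw [← Finset.sum_filter_of_ne (p := fun h => h ∈ D)
    (fun h _ hne => by by_contra hc; exact hne (hD h hc))]
  exact Finset.sum_le_sum_of_subset_of_nonneg (fun h hh => (Finset.mem_filter.1 hh).2)
    fun h _ _ => hf h

theorem sum_even_le {f : ℤ → ℝ} (hf : ∀ h, 0 ≤ f h) (hev : ∀ h, f (-h) = f h) {T : ℕ}
    (hT : ∀ h : ℤ, (T : ℤ) ≤ |h| → f h = 0) (s : Finset ℤ) :
    ∑ h ∈ s, f h ≤ f 0 + 2 * ∑ h ∈ Finset.Icc (1 : ℤ) T, f h := by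
  refine (sum_le_sum_of_support hf (D := {0} ∪ (Finset.Icc (1 : ℤ) T ∪ Finset.Icc (-T : ℤ) (-1)))
    (fun h hh => hT h ?_) s).trans ?_
  · simp only [Finset.mem_union, Finset.mem_singleton, Finset.mem_Icc] at hh
    rcases abs_cases h with h1 | h1 <;> omega
  · rw [Finset.sum_union (by simp), Finset.sum_singleton, two_mul, Finset.sum_union (s₁ := Finset.Icc (1 : ℤ) T)]
    · refine add_le_add le_rfl (add_le_add le_rfl (le_of_eq ?_))
      refine Finset.sum_nbij' (fun h : ℤ => -h) (fun h : ℤ => -h) ?_ ?_ ?_ ?_ ?_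
      · intro h hh; simp only [Finset.mem_Icc] at hh ⊢; omega
      · intro h hh; simp only [Finset.mem_Icc] at hh ⊢; omega
      · simp
      · simp
      · intro h _; exact (hev h).symm
    · rw [Finset.disjoint_left]
      intro h hh hh'
      simp only [Finset.mem_Icc] at hh hh'
      omega

theorem sum_increment_le {f : ℤ → ℝ} (hev : ∀ h, f (-h) = f h) {T : ℕ}
    (hT : ∀ h : ℤ, (T : ℤ) ≤ |h| → f h = 0) (s : Finset ℤ) :
    ∑ h ∈ s, (f (h + 1) - f h) ^ 2 ≤ 2 * ∑ h ∈ Finset.Icc (1 : ℤ) T, (f h - f (h - 1)) ^ 2 := by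
  refine (sum_le_sum_of_support (f := fun h => (f (h + 1) - f h) ^ 2) (fun h => sq_nonneg _)
    (D := Finset.Icc (0 : ℤ) (T - 1) ∪ Finset.Icc (-T : ℤ) (-1)) (fun h hh => ?_) s).trans ?_
  · simp only [Finset.mem_union, Finset.mem_Icc] at hh
    rw [hT h, hT (h + 1)]
    · simp
    · rcases abs_cases (h + 1) with h1 | h1 <;> omega
    · rcases abs_cases h with h1 | h1 <;> omega
  · rw [Finset.sum_union, two_mul]
    · refine add_le_add (le_of_eq ?_) (le_of_eq ?_)
      · refine Finset.sum_nbij' (fun h => h + 1) (fun h => h - 1) ?_ ?_ ?_ ?_ ?_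
        · intro h hh; simp only [Finset.mem_Icc] at hh ⊢; omega
        · intro h hh; simp only [Finset.mem_Icc] at hh ⊢; omega
        · simp
        · simp
        · intro h _; simp
      · refine Finset.sum_nbij' (fun h => -h) (fun h => -h) ?_ ?_ ?_ ?_ ?_
        · intro h hh; simp only [Finset.mem_Icc] at hh ⊢; omega
        · intro h hh; simp only [Finset.mem_Icc] at hh ⊢; omega
        · simp
        · simp
        · intro h _
          rw [hev, show -h - 1 = -(h + 1) by ring, hev]; ring
    · rw [Finset.disjoint_left]
      intro h hh hh'
      simp only [Finset.mem_Icc] at hh hh'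
      omega

theorem sum_smul_id {E ι : Type*} [NormedAddCommGroup E] [NormedSpace ℂ E] (s : Finset ι)
    (c : ι → ℂ) : ∑ i ∈ s, c i • ContinuousLinearMap.id ℂ E =
      (∑ i ∈ s, c i) • ContinuousLinearMap.id ℂ E :=
  (Finset.sum_smul ..).symm

-- β is the scalar of A_{T,h} divided by ‖Φ_T‖_F. The phase does not affect norms, so the same β
-- serves every frequency. Condition (i) converts bounds by ϱ_T² into bounds by ‖Φ_T‖_F²/T, and
-- (ii), (iii), (iv) become the sup, variation and overlap bounds.
set_option maxHeartbeats 1000000 in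
theorem AdmissibleWeights.exists_isWeights [Nontrivial H] {A : ℕ → ℤ → (H →L[ℂ] H)} {lam : ℝ}
    (hA : AdmissibleWeights A lam) : ∃ β : ℕ → ℤ → ℝ, IsWeights β ∧
      ∀ (lam' : ℝ) (T : ℕ) (h : ℤ), |h| < T →
        ((√(frobSq (phi A lam') T))⁻¹ : ℂ) • A T h = (β T h : ℂ) • ContinuousLinearMap.id ℂ H := by
  -- Lags |h| ≥ T do not occur in the form, and A need not be scalar there. The value 0 gives β
  -- finite support.
  have hex : ∀ (T : ℕ) (h : ℤ), ∃ a : ℝ,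
      (|h| < T → A T h = (a : ℂ) • ContinuousLinearMap.id ℂ H) ∧ ((T : ℤ) ≤ |h| → a = 0) := by
    intro T h
    by_cases hh : |h| < T
    · obtain ⟨a, ha⟩ := hA.exists_scalar hh
      exact ⟨a, fun _ => ha, fun h' => absurd hh h'.not_gt⟩
    · exact ⟨0, fun h' => absurd h' hh, fun _ => rfl⟩
  choose a ha ha0 using hex
  have hn : ∀ c : ℂ, ‖c • ContinuousLinearMap.id ℂ H‖ = ‖c‖ := fun c => by
    rw [norm_smul, ContinuousLinearMap.norm_id, mul_one]
  have han : ∀ (T : ℕ) (h : ℤ), |h| < T → ‖A T h‖ = |a T h| := fun T h hh => by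
    rw [ha T h hh, hn, Complex.norm_real, Real.norm_eq_abs]
  have hev : ∀ T h, a T (-h) = a T h := fun T h => by
    by_cases hh : |h| < T
    · obtain ⟨y, hy⟩ := exists_ne (0 : H)
      have h1 := (ha T (-h) (by rwa [abs_neg])).symm.trans ((hA.even T h).trans (ha T h hh))
      have h2 := congrArg (fun L : H →L[ℂ] H => L y) h1
      simp only [smul_apply, ContinuousLinearMap.id_apply] at h2
      exact Complex.ofReal_injective (smul_left_injective ℂ hy h2)
    · rw [ha0 T h (not_lt.1 hh), ha0 T (-h) (by rw [abs_neg]; exact not_lt.1 hh)]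
  set F : ℕ → ℝ := fun T => frobSq (phi A lam) T with hFdef
  have hFlam : ∀ lam' T, frobSq (phi A lam') T = F T := fun lam' T => by
    simp only [hFdef, frobSq, norm_phi]
  have hF : ∀ T, F T = ∑ t ∈ Finset.Icc (1 : ℤ) T, ∑ s ∈ Finset.Icc (1 : ℤ) T, a T (t - s) ^ 2 :=
    fun T => by
      simp only [hFdef, frobSq, norm_phi]
      refine Finset.sum_congr rfl fun t ht => Finset.sum_congr rfl fun s hs => ?_
      simp only [Finset.mem_Icc] at ht hs
      rw [han T (t - s) (abs_lt.2 ⟨by omega, by omega⟩), sq_abs]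
  have hF0 : ∀ T, 0 ≤ F T := fun T => by rw [hF]; positivity
  have hFpos : ∀ᶠ T in atTop, 0 < F T := hA.nondegenerate
  set ρ : ℕ → ℝ := fun T => rhoSq (phi A lam) T with hρ
  have hρ0 : ∀ T, 0 ≤ ρ T := fun T => by simp only [hρ, rhoSq]; positivity
  have hρa : ∀ T : ℕ, ∑ h ∈ Finset.Icc (1 : ℤ) T, a T h ^ 2 ≤ ρ T := fun T => by
    simp only [hρ, rhoSq, norm_phi]
    refine Finset.sum_le_sum fun h hh => ?_
    simp only [Finset.mem_Icc] at hh
    by_cases hhT : |h| < T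
    · rw [han T h hhT, sq_abs]
    · rw [ha0 T h (not_lt.1 hhT), zero_pow two_ne_zero]; positivity
  obtain ⟨c, hc0, hc⟩ := hA.balance.exists_pos
  have hc' : ∀ᶠ T : ℕ in atTop, T * ρ T ≤ c * F T := by
    filter_upwards [hc.bound] with T hT
    rw [Real.norm_of_nonneg (mul_nonneg T.cast_nonneg (hρ0 T)), Real.norm_of_nonneg (hF0 T)] at hT
    exact hT
  set Mx : ℕ → ℝ := fun T => ⨆ t : Finset.Icc (1 : ℤ) T, ‖phi A lam T t‖ ^ 2 with hMx
  set Sm : ℕ → ℝ := fun T => ∑ t ∈ Finset.Icc (1 : ℤ) T, ‖A T t - A T (t - 1)‖ ^ 2 with hSm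
  have hMx0 : ∀ T, 0 ≤ Mx T := fun T => Real.iSup_nonneg fun _ => by positivity
  have hSm0 : ∀ T, 0 ≤ Sm T := fun T => by simp only [hSm]; positivity
  have hMxa : ∀ (T : ℕ) (h : ℤ), 1 ≤ h → a T h ^ 2 ≤ Mx T := fun T h h1 => by
    by_cases hhT : |h| < T
    · have hmem : h ∈ Finset.Icc (1 : ℤ) T := by
        rw [Finset.mem_Icc]; have := abs_lt.1 hhT; omega
      have := le_ciSup (f := fun t : Finset.Icc (1 : ℤ) T => ‖phi A lam T t‖ ^ 2)
        (Set.finite_range _).bddAbove ⟨h, hmem⟩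
      refine le_trans (le_of_eq ?_) this
      rw [norm_phi, han T h hhT, sq_abs]
    · rw [ha0 T h (not_lt.1 hhT)]; simpa using hMx0 T
  have hdiff : ∀ (T : ℕ) (h : ℤ), 1 ≤ h → h < T → ‖A T h - A T (h - 1)‖ ^ 2 =
      (a T h - a T (h - 1)) ^ 2 := fun T h h1 h2 => by
    rw [ha T h (abs_lt.2 ⟨by omega, by omega⟩), ha T (h - 1) (abs_lt.2 ⟨by omega, by omega⟩),
      ← sub_smul, hn, ← Complex.ofReal_sub, Complex.norm_real, Real.norm_eq_abs, sq_abs]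
  -- Condition (ii) does not cover lag 0. It is recovered from lag 1 and the first increment in
  -- (iii): a₀² ≤ 2a₁² + 2(a₁ - a₀)².
  have hsup : ∀ (T : ℕ), 2 ≤ T → ∀ h : ℤ, a T h ^ 2 ≤ 2 * Mx T + 2 * Sm T := fun T hT h => by
    rcases lt_trichotomy h 0 with h1 | rfl | h1
    · rw [← hev]
      have := hMxa T (-h) (by omega)
      linarith [hMx0 T, hSm0 T]
    · have h2 := hMxa T 1 le_rfl
      have h3 := hdiff T 1 le_rfl (by omega)
      have h4 : ‖A T 1 - A T (1 - 1)‖ ^ 2 ≤ Sm T :=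
        Finset.single_le_sum (f := fun t : ℤ => ‖A T t - A T (t - 1)‖ ^ 2)
          (fun _ _ => by positivity) (by rw [Finset.mem_Icc]; omega)
      rw [h3, sub_self] at h4
      nlinarith [sq_nonneg (2 * a T 1 - a T 0)]
    · have := hMxa T h (by omega)
      linarith [hMx0 T, hSm0 T]
  have hMxρ : ∀ r : ℝ, 0 < r → ∀ᶠ T in atTop, Mx T ≤ r * ρ T := fun r hr => by
    filter_upwards [hA.negligible.bound hr] with T hT
    rwa [Real.norm_of_nonneg (hMx0 T), Real.norm_of_nonneg (hρ0 T)] at hT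
  have hSmρ : ∀ r : ℝ, 0 < r → ∀ᶠ T in atTop, Sm T ≤ r * ρ T := fun r hr => by
    filter_upwards [hA.smooth.bound hr] with T hT
    rwa [Real.norm_of_nonneg (hSm0 T), Real.norm_of_nonneg (hρ0 T)] at hT
  -- At h = T the increment of a is not that of A, since a is zero there by convention. That jump is
  -- a_{T-1}², bounded by `hsup`.
  have hinc : ∀ (T : ℕ), 2 ≤ T → ∑ h ∈ Finset.Icc (1 : ℤ) T, (a T h - a T (h - 1)) ^ 2 ≤
      2 * Mx T + 3 * Sm T := fun T hT => by
    have h1 : ∀ h ∈ Finset.Icc (1 : ℤ) T, (a T h - a T (h - 1)) ^ 2 ≤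
        ‖A T h - A T (h - 1)‖ ^ 2 + if h = T then 2 * Mx T + 2 * Sm T else 0 := fun h hh => by
      simp only [Finset.mem_Icc] at hh
      split_ifs with he
      · rw [he, ha0 T T (le_abs_self _), zero_sub, neg_sq]
        have := hsup T hT (T - 1)
        have : 0 ≤ ‖A T (T : ℤ) - A T ((T : ℤ) - 1)‖ ^ 2 := by positivity
        linarith
      · rw [hdiff T h hh.1 (lt_of_le_of_ne hh.2 he), add_zero]
    refine (Finset.sum_le_sum h1).trans ?_
    rw [Finset.sum_add_distrib, Finset.sum_ite_eq', if_pos (by rw [Finset.mem_Icc]; omega)]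
    change Sm T + _ ≤ _
    linarith
  have hsq : ∀ T h, (a T h / √(F T)) ^ 2 = a T h ^ 2 / F T := fun T h => by
    rw [div_pow, Real.sq_sqrt (hF0 T)]
  refine ⟨fun T h => a T h / √(F T), ⟨?_, ?_, ?_, ?_, ?_, ?_, ?_, ?_⟩, ?_⟩
  · intro T h; simp only [hev]
  · intro T h hh; simp only [ha0 T h hh, zero_div]
  -- Six is 4 + 2: lag 0 gives at most 2Mx + 2Sm ≤ 4ρ, and the lags of both signs at most 2ρ.
  · refine ⟨6 * c, by positivity, ?_⟩
    filter_upwards [hc', hFpos, hMxρ 1 one_pos, hSmρ 1 one_pos, eventually_ge_atTop 2]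
      with T h1 h2 h3 h4 h5 s
    simp_rw [hsq]
    rw [← Finset.sum_div, ← mul_div_assoc, div_le_iff₀ h2]
    have h6 := sum_even_le (T := T) (f := fun h => a T h ^ 2) (fun h => sq_nonneg _)
      (fun h => by simp only [hev]) (fun h hh => by simp only [ha0 T h hh]; norm_num) s
    have h7 := hsup T h5 0
    have h8 := hρa T
    have h9 : ∑ h ∈ s, a T h ^ 2 ≤ 6 * ρ T := by linarith
    calc (T : ℝ) * ∑ h ∈ s, a T h ^ 2 ≤ T * (6 * ρ T) := by gcongr
      _ ≤ _ := by linarith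
  · intro r hr
    filter_upwards [hc', hFpos, hMxρ (r / (4 * c)) (by positivity),
      hSmρ (r / (4 * c)) (by positivity), eventually_ge_atTop 2] with T h1 h2 h3 h4 h5 h
    rw [hsq, ← mul_div_assoc, div_le_iff₀ h2]
    have h6 := hsup T h5 h
    calc (T : ℝ) * a T h ^ 2 ≤ T * (r / c * ρ T) := by
          gcongr
          calc _ ≤ _ := h6
            _ ≤ 4 * (r / (4 * c) * ρ T) := by linarith
            _ = _ := by field_simp
      _ = r / c * (T * ρ T) := by ring
      _ ≤ r / c * (c * F T) := by gcongr
      _ = r * F T := by field_simp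
  · intro r hr
    -- Ten is 2·(2 + 3): reflection to negative lags doubles the bound `hinc`.
    filter_upwards [hc', hFpos, hMxρ (r / (10 * c)) (by positivity),
      hSmρ (r / (10 * c)) (by positivity), eventually_ge_atTop 2] with T h1 h2 h3 h4 h5 s
    have h6 : ∑ h ∈ s, (a T (h + 1) / √(F T) - a T h / √(F T)) ^ 2 =
        (∑ h ∈ s, (a T (h + 1) - a T h) ^ 2) / F T := by
      rw [Finset.sum_div]
      refine Finset.sum_congr rfl fun h _ => ?_
      rw [← sub_div, div_pow, Real.sq_sqrt (hF0 T)]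
    rw [h6, ← mul_div_assoc, div_le_iff₀ h2]
    have h7 := sum_increment_le (f := a T) (hev T) (ha0 T) s
    have h8 := hinc T h5
    calc (T : ℝ) * ∑ h ∈ s, (a T (h + 1) - a T h) ^ 2 ≤ T * (r / c * ρ T) := by
          gcongr
          calc _ ≤ 10 * (r / (10 * c) * ρ T) := by linarith
            _ = _ := by field_simp
      _ = r / c * (T * ρ T) := by ring
      _ ≤ r / c * (c * F T) := by gcongr
      _ = r * F T := by field_simp
  · intro r hr
    filter_upwards [hA.overlap.bound hr, hFpos] with T h1 h2
    have hnHS := nontrivial_HS (H := H)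
    have h3 : ∀ j ∈ Finset.Icc (1 : ℤ) T, ∀ s ∈ Finset.Icc (1 : ℤ) T, s < j →
        ‖∑ t ∈ Finset.Icc (j + 1) (T : ℤ), kron (phi A lam T (s - t)) (phi A lam T (j - t))‖ ^ 2 =
          (∑ q ∈ Finset.Icc (j + 1) (T : ℤ), a T (q - s) * a T (q - j)) ^ 2 := by
      intro j hj s hs hsj
      simp only [Finset.mem_Icc] at hj hs
      have h4 : ∑ t ∈ Finset.Icc (j + 1) (T : ℤ), kron (phi A lam T (s - t)) (phi A lam T (j - t)) =
          (ex lam (s - j) * ((∑ q ∈ Finset.Icc (j + 1) (T : ℤ), a T (q - s) * a T (q - j) : ℝ) : ℂ)) •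
            ContinuousLinearMap.id ℂ (HS H) := by
        rw [Complex.ofReal_sum, Finset.mul_sum, ← sum_smul_id]
        refine Finset.sum_congr rfl fun t ht => ?_
        simp only [Finset.mem_Icc] at ht
        have hphi : ∀ k : ℤ, |k| < T → phi A lam T k =
            (ex lam k * a T k) • ContinuousLinearMap.id ℂ H := fun k hk => by
          rw [phi, ha T k hk, smul_smul]; rfl
        rw [hphi (s - t) (abs_lt.2 ⟨by omega, by omega⟩),
          hphi (j - t) (abs_lt.2 ⟨by omega, by omega⟩), kron_smul_id]
        congr 1
        rw [map_mul, conj_ex, Complex.conj_ofReal, ← neg_sub t s, hev, ← neg_sub t j, hev, neg_neg,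
          show s - j = -(t - s) + (t - j) by ring, ex_add]
        push_cast; ring
      rw [h4, norm_smul, ContinuousLinearMap.norm_id, mul_one, norm_mul, norm_ex, one_mul,
        Complex.norm_real, Real.norm_eq_abs, sq_abs]
    have h5 : ∑ p ∈ (Finset.Icc (1 : ℤ) T ×ˢ Finset.Icc (1 : ℤ) T).filter (fun p => p.1 < p.2),
        (∑ q ∈ Finset.Icc (p.2 + 1) (T : ℤ), a T (q - p.1) * a T (q - p.2)) ^ 2 =
        ∑ j ∈ Finset.Icc (1 : ℤ) (T - 1), ∑ s ∈ Finset.Icc (1 : ℤ) (j - 1),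
          ‖∑ t ∈ Finset.Icc (j + 1) (T : ℤ),
            kron (phi A lam T (s - t)) (phi A lam T (j - t))‖ ^ 2 := by
      rw [Finset.sum_filter, Finset.sum_product_right]
      symm
      refine Finset.sum_subset_zero_on_sdiff ?_ ?_ ?_
      · intro j hj; simp only [Finset.mem_Icc] at hj ⊢; omega
      · intro j hj
        simp only [Finset.mem_sdiff, Finset.mem_Icc] at hj
        refine Finset.sum_eq_zero fun s _ => ?_
        rw [Finset.Icc_eq_empty (by omega)]
        simp
      · intro j hj
        simp only [Finset.mem_Icc] at hj
        refine Finset.sum_subset_zero_on_sdiff ?_ ?_ ?_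
        · intro s hs; simp only [Finset.mem_Icc] at hs ⊢; omega
        · intro s hs
          simp only [Finset.mem_sdiff, Finset.mem_Icc] at hs
          rw [if_neg (by omega)]
        · intro s hs
          simp only [Finset.mem_Icc] at hs
          rw [if_pos (by omega), h3 j (by rw [Finset.mem_Icc]; omega) s
            (by rw [Finset.mem_Icc]; omega) (by omega)]
    have h6 : ∀ p : ℤ × ℤ, (∑ q ∈ Finset.Icc (p.2 + 1) (T : ℤ),
        a T (q - p.1) / √(F T) * (a T (q - p.2) / √(F T))) ^ 2 =
        (∑ q ∈ Finset.Icc (p.2 + 1) (T : ℤ), a T (q - p.1) * a T (q - p.2)) ^ 2 / F T ^ 2 :=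
      fun p => by
        rw [← div_pow, Finset.sum_div]
        congr 1
        refine Finset.sum_congr rfl fun q _ => ?_
        rw [div_mul_div_comm, Real.mul_self_sqrt (hF0 T)]
    simp_rw [h6]
    rw [← Finset.sum_div, h5, div_le_iff₀ (by positivity)]
    rw [Real.norm_of_nonneg (by positivity), Real.norm_of_nonneg (by positivity)] at h1
    exact h1
  · intro T
    simp_rw [hsq, ← Finset.sum_div]
    rw [← hF]
    exact div_self_le_one _
  · filter_upwards [hFpos] with T hT
    simp_rw [hsq, ← Finset.sum_div]
    rw [← hF]
    exact div_self hT.ne'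
  · intro lam' T h hh
    rw [hFlam, ha T h hh, smul_smul]
    congr 1
    push_cast
    rw [div_eq_inv_mul]

end Admissible

end QuadForm

end

noncomputable section

namespace QuadForm

/-! ### Martingale approximation of a window at a given frequency. -/

section MartingaleApproximation

set_option linter.unusedSectionVars false

variable {S : Type*} [MeasurableSpace S] (μ : Measure S) [IsProbabilityMeasure μ]

/-- The projections of `χ` onto the martingale differences at time `-k`, moved to time `0`. -/
def mdiff (χ : (ℤ → S) → ℂ) (k : ℕ) (e : ℤ → S) : ℂ :=
  avg μ (Set.Iic (-k : ℤ)) χ (shift k e) - avg μ (Set.Iio (-k : ℤ)) χ (shift k e)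

/-- The martingale difference that approximates `χ` at frequency `λ`. -/
def mdTrans (m : ℕ) (lam : ℝ) (χ : (ℤ → S) → ℂ) (e : ℤ → S) : ℂ :=
  ∑ k ∈ Finset.range (m + 1), ex lam (-k) * mdiff μ χ k e

variable {μ}

theorem dependsOn_avg_of_dependsOn {G : Type*} [NormedAddCommGroup G] [NormedSpace ℝ G]
    {f : (ℤ → S) → G} {I I' K : Set ℤ} (hf : DependsOn f I')
    (hK : I ∩ I' ⊆ K) : DependsOn (avg μ I f) K := by
  intro x y hxy
  simp only [avg]
  congr 1
  funext e'
  refine hf fun k hk => ?_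
  simp only [mix]
  split_ifs with hkI
  · exact hxy k (hK ⟨hkI, hk⟩)
  · rfl

theorem bddMeas_avg {f : (ℤ → S) → ℂ} (hf : BddMeas f) (I : Set ℤ) : BddMeas (avg μ I f) := by
  obtain ⟨hf, B, hB⟩ := hf
  refine ⟨stronglyMeasurable_avg hf I, B, fun e => ?_⟩
  have := norm_integral_le_of_norm_le_const (μ := iidLaw μ) (f := fun e' => f (mix I e e'))
    (Eventually.of_forall fun e' => hB _)
  simpa [avg] using this

theorem avg_of_disjoint {G : Type*} [NormedAddCommGroup G] [NormedSpace ℝ G]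
    {f : (ℤ → S) → G} {I I' : Set ℤ} (hf : DependsOn f I')
    (hI : Disjoint I I') (e : ℤ → S) : avg μ I f e = ∫ e', f e' ∂(iidLaw μ) := by
  simp only [avg]
  congr 1
  funext e'
  refine hf fun k hk => ?_
  simp only [mix]
  rw [if_neg fun hkI => Set.disjoint_left.1 hI hkI hk]

theorem isMartDiff_mdiff {m : ℕ} {χ : (ℤ → S) → ℂ} (hχ : IsWindow μ m χ) (k : ℕ) :
    IsMartDiff μ m (mdiff μ χ k) := by
  have b1 := bddMeas_avg (μ := μ) hχ.bdd (Set.Iic (-k : ℤ))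
  have b2 := bddMeas_avg (μ := μ) hχ.bdd (Set.Iio (-k : ℤ))
  refine ⟨(b1.comp (measurable_shift _)).sub (b2.comp (measurable_shift _)), ?_, ?_⟩
  · refine DependsOn.sub' (dependsOn_comp_shift (dependsOn_avg_of_dependsOn hχ.dep (K :=
      Set.Icc (-m : ℤ) (-k)) ?_) k ?_) (dependsOn_comp_shift (dependsOn_avg_of_dependsOn hχ.dep (K :=
      Set.Icc (-m : ℤ) (-k)) ?_) k ?_)
    all_goals
      intro j hj
      simp only [Set.mem_inter_iff, Set.mem_Iic, Set.mem_Iio, Set.mem_Icc] at hj ⊢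
      omega
  · intro W hW hWd
    set V : (ℤ → S) → ℂ := fun e => starRingEnd ℂ (W (shift (-k) e)) with hV
    have hVb : BddMeas V := (hW.comp (measurable_shift _)).conj
    have hVd : DependsOn V (Set.Iio (-k : ℤ)) := DependsOn.comp' (dependsOn_comp_shift hWd (-k)
      fun j hj => by simp only [Set.mem_Iio] at hj ⊢; omega) _
    have hin : ∀ {f : (ℤ → S) → ℂ}, BddMeas f →
        Integrable (fun e => inner ℂ (V e) (f e)) (iidLaw μ) := fun hf => by
      refine ((hf.mul hVb.conj).integrable (P := iidLaw μ)).congr (Eventually.of_forall fun e => ?_)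
      simp
    have h1 := integral_inner_avg_sub_avg (μ := μ) hVb.1 hχ.bdd.1 (I := Set.Iic (-k : ℤ))
      (I' := Set.Iio (-k : ℤ)) Set.Iio_subset_Iic_self hVd hχ.bdd.integrable (hin hχ.bdd) (hin b1)
      (hin b2)
    rw [← integral_comp_shift (f := fun e => inner ℂ (V e) ((avg μ (Set.Iic (-k : ℤ)) χ -
      avg μ (Set.Iio (-k : ℤ)) χ) e)) ?_ k] at h1
    · rw [← h1]
      refine integral_congr_ae (Eventually.of_forall fun e => ?_)
      simp [hV, shift_shift, shift_zero, mdiff, mul_comm]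
    · refine cast (congrArg _ (funext fun e => ?_)) ((b1.sub b2).mul hVb.conj).1
      simp

theorem isMartDiff_mdTrans {m : ℕ} {χ : (ℤ → S) → ℂ} (hχ : IsWindow μ m χ) (lam : ℝ) :
    IsMartDiff μ m (mdTrans μ m lam χ) :=
  IsMartDiff.sum fun k _ => (isMartDiff_mdiff hχ k).const_mul _

/-- Telescoping of conditional expectations: conditioning on all times ≤ 0 gives χ itself,
conditioning on times ≤ -m-1 gives its mean, which is zero. -/
theorem sum_mdiff {m : ℕ} {χ : (ℤ → S) → ℂ} (hχ : IsWindow μ m χ) (e : ℤ → S) :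
    ∑ k ∈ Finset.range (m + 1), mdiff μ χ k (shift (-k) e) = χ e := by
  have h1 : ∀ k : ℕ, mdiff μ χ k (shift (-k) e) =
      avg μ (Set.Iic (-k : ℤ)) χ e - avg μ (Set.Iic (-(k + 1 : ℕ) : ℤ)) χ e := fun k => by
    have : Set.Iio (-k : ℤ) = Set.Iic (-(k + 1 : ℕ) : ℤ) := by
      ext j; simp only [Set.mem_Iio, Set.mem_Iic]; omega
    rw [mdiff, this]
    simp [shift_shift, shift_zero]
  simp_rw [h1]
  rw [Finset.sum_range_sub', avg_of_disjoint hχ.dep (I := Set.Iic (-(m + 1 : ℕ) : ℤ)),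
    hχ.integral_eq_zero, sub_zero]
  · rw [avg_of_dependsOn (hχ.dep.mono fun j hj => by simpa using hj.2)]
  · rw [Set.disjoint_left]
    intro j hj hj'
    simp only [Set.mem_Iic, Set.mem_Icc] at hj hj'
    omega

theorem conj_mdiff {χ : (ℤ → S) → ℂ} (hχ : ∀ e, starRingEnd ℂ (χ e) = χ e) (k : ℕ) (e : ℤ → S) :
    starRingEnd ℂ (mdiff μ χ k e) = mdiff μ χ k e := by
  simp only [mdiff, avg, map_sub, ← integral_conj, hχ]

/-- For real χ conjugation reverses the frequency. Hence, when λ + λ' ∈ 2πℤ, the martingale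
differences at λ' are the conjugates of those at λ; this is the source of the transposed terms in
the covariance. -/
theorem conj_mdTrans {χ : (ℤ → S) → ℂ} (hχ : ∀ e, starRingEnd ℂ (χ e) = χ e) (m : ℕ) (lam : ℝ)
    (e : ℤ → S) : starRingEnd ℂ (mdTrans μ m lam χ e) = mdTrans μ m (-lam) χ e := by
  simp only [mdTrans, map_sum, map_mul, conj_mdiff hχ, conj_ex, ex_neg_left]

theorem mdTrans_congr {lam lam' : ℝ} (h : ex (lam - lam') 1 = 1) (m : ℕ) (χ : (ℤ → S) → ℂ) :
    mdTrans μ m lam χ = mdTrans μ m lam' χ := by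
  funext e
  refine Finset.sum_congr rfl fun k _ => ?_
  have h1 : ex lam (-k) = ex (lam - lam') (-k) * ex lam' (-k) := by
    rw [← ex_add_left, sub_add_cancel]
  rw [h1, ← conj_ex (lam - lam'), ex_natCast, h, one_pow, map_one, one_mul]

/-- The spectral density of `(χ, χ')` is the covariance of the martingale approximations. -/
theorem sum_integral_mul_ex {m : ℕ} {χ χ' : (ℤ → S) → ℂ} (hχ : IsWindow μ m χ)
    (hχ' : IsWindow μ m χ') (hr' : ∀ e, starRingEnd ℂ (χ' e) = χ' e) (lam : ℝ) :
    ∑ h ∈ Finset.Icc (-m : ℤ) m, ex lam (-h) * ∫ e, χ (shift h e) * χ' e ∂(iidLaw μ) =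
      ∫ e, mdTrans μ m lam χ e * starRingEnd ℂ (mdTrans μ m lam χ' e) ∂(iidLaw μ) := by
  have hp := isMartDiff_mdiff hχ
  have hp' := isMartDiff_mdiff hχ'
  have h1 : ∀ h : ℤ, ∫ e, χ (shift h e) * χ' e ∂(iidLaw μ) =
      ∑ k ∈ Finset.range (m + 1), ∑ l ∈ Finset.range (m + 1),
        if h = k - l then ∫ e, mdiff μ χ k e * mdiff μ χ' l e ∂(iidLaw μ) else 0 := fun h => by
    have h2 : ∀ e, χ (shift h e) * χ' e = ∑ k ∈ Finset.range (m + 1), ∑ l ∈ Finset.range (m + 1),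
        mdiff μ χ k (shift (h - k) e) * mdiff μ χ' l (shift (-l) e) := fun e => by
      rw [← sum_mdiff hχ (shift h e), ← sum_mdiff hχ' e, Finset.sum_mul_sum]
      simp only [shift_shift, neg_add_eq_sub]
    have hb : ∀ k l : ℕ, BddMeas fun e => mdiff μ χ k (shift (h - k) e) *
        mdiff μ χ' l (shift (-l) e) := fun k l =>
      ((hp k).bdd.comp (measurable_shift _)).mul ((hp' l).bdd.comp (measurable_shift _))
    simp_rw [h2]
    rw [integral_finsetSum _ fun k _ => (BddMeas.sum fun l _ => hb k l).integrable]
    refine Finset.sum_congr rfl fun k _ => ?_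
    rw [integral_finsetSum _ fun l _ => (hb k l).integrable]
    refine Finset.sum_congr rfl fun l _ => ?_
    split_ifs with hh
    · have : h - k = -l := by omega
      rw [this]
      exact integral_comp_shift (f := fun e => mdiff μ χ k e * mdiff μ χ' l e)
        ((hp k).bdd.mul (hp' l).bdd).1 _
    · exact (hp k).integral_mul_of_ne (hp' l) (by omega)
  have h3 : ∀ e, mdTrans μ m lam χ e * starRingEnd ℂ (mdTrans μ m lam χ' e) =
      ∑ k ∈ Finset.range (m + 1), ∑ l ∈ Finset.range (m + 1),
        ex lam (-(k - l : ℤ)) * (mdiff μ χ k e * mdiff μ χ' l e) := fun e => by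
    simp only [mdTrans, map_sum, map_mul, conj_mdiff hr', conj_ex, Finset.sum_mul_sum]
    refine Finset.sum_congr rfl fun k _ => Finset.sum_congr rfl fun l _ => ?_
    rw [show -(k - l : ℤ) = -k + - -l by ring, ex_add]; ring
  simp_rw [h3]
  rw [integral_finsetSum _ fun k _ => (BddMeas.sum fun l _ =>
    (BddMeas.const _).mul ((hp k).bdd.mul (hp' l).bdd)).integrable]
  simp_rw [h1, Finset.mul_sum]
  rw [Finset.sum_comm]
  refine Finset.sum_congr rfl fun k hk => ?_
  rw [integral_finsetSum _ fun l _ => ((BddMeas.const _).mul ((hp k).bdd.mul (hp' l).bdd)).integrable,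
    Finset.sum_comm]
  refine Finset.sum_congr rfl fun l hl => ?_
  rw [integral_const_mul, Finset.sum_eq_single_of_mem (k - l : ℤ), if_pos rfl]
  · simp only [Finset.mem_range, Finset.mem_Icc] at hk hl ⊢; omega
  · intro h _ hne; rw [if_neg hne, mul_zero]

end MartingaleApproximation

end QuadForm

end

noncomputable section

namespace QuadForm

/-! ### Replacing windows by martingale differences in the form. -/

section Replacement

/-- An increment of length n is a sum of n unit increments; Cauchy–Schwarz and translation give a
factor n each. -/
theorem sum_sq_shift_sub_le {f : ℤ → ℝ} {v : ℝ}
    (hv : ∀ s : Finset ℤ, ∑ h ∈ s, (f (h + 1) - f h) ^ 2 ≤ v) (n : ℕ) (s : Finset ℤ) :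
    ∑ h ∈ s, (f (h + n) - f h) ^ 2 ≤ n ^ 2 * v := by
  have h1 : ∀ h : ℤ, (f (h + n) - f h) ^ 2 ≤
      n * ∑ i ∈ Finset.range n, (f (h + i + 1) - f (h + i)) ^ 2 := fun h => by
    have h2 : f (h + n) - f h = ∑ i ∈ Finset.range n, (f (h + i + 1) - f (h + i)) := by
      have := Finset.sum_range_sub (fun i : ℕ => f (h + i)) n
      simp only [Nat.cast_zero, add_zero, Nat.cast_add, Nat.cast_one, ← add_assoc] at this
      exact this.symm
    rw [h2]
    have := sq_sum_le_card_mul_sum_sq (s := Finset.range n)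
      (f := fun i : ℕ => f (h + i + 1) - f (h + i))
    simpa using this
  refine (Finset.sum_le_sum fun h _ => h1 h).trans ?_
  rw [← Finset.mul_sum, Finset.sum_comm, sq, mul_assoc]
  gcongr
  refine (Finset.sum_le_card_nsmul _ _ v fun i _ => ?_).trans (by simp)
  have := hv (s.map ⟨fun h : ℤ => h + i, add_left_injective _⟩)
  rwa [Finset.sum_map] at this

theorem sum_sq_int_shift_sub_le {f : ℤ → ℝ} {v : ℝ}
    (hv : ∀ s : Finset ℤ, ∑ h ∈ s, (f (h + 1) - f h) ^ 2 ≤ v) (δ : ℤ) (s : Finset ℤ) :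
    ∑ h ∈ s, (f (h + δ) - f h) ^ 2 ≤ δ ^ 2 * v := by
  obtain ⟨n, rfl | rfl⟩ := δ.eq_nat_or_neg
  · simpa using sum_sq_shift_sub_le hv n s
  · have := sum_sq_shift_sub_le hv n (s.map ⟨fun h : ℤ => h + (-n), add_left_injective _⟩)
    rw [Finset.sum_map] at this
    simp only [Function.Embedding.coeFn_mk, neg_add_cancel_right] at this
    push_cast
    rw [neg_sq]
    refine (Finset.sum_congr rfl fun h _ => ?_).trans_le this
    ring

/-- The projection number k of χ at time s belongs to time s - k. The range from 1 - m to T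
accommodates all k ≤ m at once. -/
theorem sum_Icc_eq_sum_shift {α : Type*} [AddCommMonoid α] {T m k : ℕ} (hk : k ≤ m) {f : ℤ → α}
    (hf : ∀ s : ℤ, s ∉ Finset.Icc (1 : ℤ) T → f s = 0) :
    ∑ s ∈ Finset.Icc (1 : ℤ) T, f s = ∑ s ∈ Finset.Icc (1 - m : ℤ) T, f (s + k) := by
  have h1 : ∑ s ∈ Finset.Icc (1 : ℤ) T, f s = ∑ s ∈ Finset.Icc (1 - k : ℤ) (T - k), f (s + k) := by
    refine Finset.sum_nbij' (fun s => s - k) (fun s => s + k) ?_ ?_ ?_ ?_ ?_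
    · intro s hs; simp only [Finset.mem_Icc] at hs ⊢; omega
    · intro s hs; simp only [Finset.mem_Icc] at hs ⊢; omega
    · simp
    · simp
    · simp
  rw [h1]
  refine Finset.sum_subset (fun s hs => ?_) fun s _ hs => hf _ fun hc => hs ?_
  · simp only [Finset.mem_Icc] at hs ⊢; omega
  · simp only [Finset.mem_Icc] at hc ⊢; omega

/-- The weights of the quadratic form. -/
def wgt (β : ℤ → ℝ) (lam : ℝ) (T : ℕ) (s t : ℤ) : ℂ :=
  if s ∈ Finset.Icc (1 : ℤ) T ∧ t ∈ Finset.Icc (1 : ℤ) T then β (t - s) * ex lam (t - s) else 0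

/-- The weights of the quadratic form away from the diagonal. -/
def wgtOff (m : ℕ) (β : ℤ → ℝ) (lam : ℝ) (T : ℕ) (s t : ℤ) : ℂ :=
  if |t - s| ≤ m then 0 else wgt β lam T s t

/-- After the phase e^{iλ(l-k)} is accounted for, the weights differ for three reasons only: the lag
has moved by l - k, an index is near the ends of the sample, or the pair lies in the deleted band.
-/
theorem norm_wgt_sub_sq_le (m : ℕ) (β : ℤ → ℝ) (lam : ℝ) (T : ℕ) {k l : ℕ} (hk : k ≤ m) (hl : l ≤ m)
    (s t : ℤ) : ‖wgt β lam T (s + k) (t + l) - ex lam (l - k) * wgtOff m β lam T s t‖ ^ 2 ≤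
      2 * (β (t - s + (l - k)) - β (t - s)) ^ 2 +
      (2 * ((if s ∈ Finset.Icc (1 : ℤ) (T - m) then 0 else β (t - s) ^ 2) +
        (if t ∈ Finset.Icc (1 : ℤ) (T - m) then 0 else β (t - s) ^ 2)) +
      2 * (if s ∈ Finset.Icc (1 : ℤ) T then if t ∈ Finset.Icc (1 : ℤ) T then
        if |t - s| ≤ m then β (t - s) ^ 2 else 0 else 0 else 0)) := by
  set b := β (t - s) with hb
  set b' := β (t - s + (l - k)) with hb'
  set x : ℝ := if s + k ∈ Finset.Icc (1 : ℤ) T ∧ t + l ∈ Finset.Icc (1 : ℤ) T then 1 else 0 with hx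
  set y : ℝ := if |t - s| ≤ m then 0 else
    if s ∈ Finset.Icc (1 : ℤ) T ∧ t ∈ Finset.Icc (1 : ℤ) T then 1 else 0 with hy
  have h1 : wgt β lam T (s + k) (t + l) - ex lam (l - k) * wgtOff m β lam T s t =
      ((x * b' - y * b : ℝ) : ℂ) * ex lam (t - s + (l - k)) := by
    have e1 : wgt β lam T (s + k) (t + l) = ((x * b' : ℝ) : ℂ) * ex lam (t - s + (l - k)) := by
      simp only [wgt, hx, hb', show t + l - (s + k) = t - s + ((l : ℤ) - k) by ring]
      split_ifs <;> simp
    have e2 : wgtOff m β lam T s t = ((y * b : ℝ) : ℂ) * ex lam (t - s) := by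
      simp only [wgtOff, wgt, hy, hb]
      split_ifs <;> simp
    rw [e1, e2, ex_add]; push_cast; ring
  rw [h1, norm_mul, norm_ex, mul_one, Complex.norm_real, Real.norm_eq_abs, sq_abs]
  have hx01 : x = 0 ∨ x = 1 := by simp only [hx]; split_ifs <;> simp
  have hy01 : y = 0 ∨ y = 1 := by simp only [hy]; split_ifs <;> simp
  have hgen : (x * b' - y * b) ^ 2 ≤ 2 * (b' - b) ^ 2 + 2 * b ^ 2 := by
    rcases hx01 with h | h <;> rcases hy01 with h' | h' <;> rw [h, h'] <;>
      nlinarith [sq_nonneg (b' - b), sq_nonneg b, sq_nonneg (b' - 2 * b), sq_nonneg b']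
  have hb0 : 0 ≤ b ^ 2 := sq_nonneg b
  have hnear : (0 : ℝ) ≤ if s ∈ Finset.Icc (1 : ℤ) T then if t ∈ Finset.Icc (1 : ℤ) T then
        if |t - s| ≤ m then b ^ 2 else 0 else 0 else 0 := by split_ifs <;> simp [hb0]
  by_cases hs : s ∈ Finset.Icc (1 : ℤ) (T - m)
  · by_cases ht : t ∈ Finset.Icc (1 : ℤ) (T - m)
    · rw [if_pos hs, if_pos ht]
      simp only [Finset.mem_Icc] at hs ht
      have hs' : s ∈ Finset.Icc (1 : ℤ) T := by rw [Finset.mem_Icc]; omega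
      have ht' : t ∈ Finset.Icc (1 : ℤ) T := by rw [Finset.mem_Icc]; omega
      have hx1 : x = 1 := by
        simp only [hx]
        rw [if_pos]
        simp only [Finset.mem_Icc]; omega
      rw [if_pos hs', if_pos ht']
      simp only [hy, hs', ht', and_self, if_true]
      split_ifs with hm
      · rw [hx1]; nlinarith [sq_nonneg (b' - 2 * b)]
      · rw [hx1]; nlinarith [sq_nonneg (b' - b)]
    · rw [if_pos hs, if_neg ht]
      linarith
  · rw [if_neg hs]
    have : (0 : ℝ) ≤ if t ∈ Finset.Icc (1 : ℤ) (T - m) then 0 else b ^ 2 := by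
      split_ifs <;> simp [hb0]
    linarith

/-- The moved lag is paid by the variation bound, the at most 2m boundary rows and as many columns
by O(1/T) each, and the band by `IsWeights.tendsto_near`. -/
theorem IsWeights.frobenius_sub_le {β : ℕ → ℤ → ℝ} (hβ : IsWeights β) {m k l : ℕ} (hk : k ≤ m)
    (hl : l ≤ m) (lam : ℝ) {r : ℝ} (hr : 0 < r) :
    ∀ᶠ T : ℕ in atTop, ∑ s ∈ Finset.Icc (1 - m : ℤ) T, ∑ t ∈ Finset.Icc (1 - m : ℤ) T,
      ‖wgt (β T) lam T (s + k) (t + l) - ex lam (l - k) * wgtOff m (β T) lam T s t‖ ^ 2 ≤ r := by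
  obtain ⟨C, hC, hC1⟩ := hβ.sq_le
  -- There are T + m ≤ (m + 1)T rows, each costing (l - k)² r/(4MT). M makes the total at most r/8,
  -- and the 1 keeps it positive when k = l.
  set M : ℝ := 2 * (m + 1) * ((l : ℤ) - k : ℤ) ^ 2 + 1 with hM
  have hM0 : 0 < M := by positivity
  have hlim : Tendsto (fun T : ℕ => 8 * m * C / (T : ℝ)) atTop (𝓝 0) :=
    tendsto_const_div_atTop_nhds_zero_nat _
  filter_upwards [hC1, hβ.var_le (r / (4 * M)) (by positivity), eventually_gt_atTop 0,
    (hβ.tendsto_near m).eventually_lt_const (by positivity : (0 : ℝ) < r / 8),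
    hlim.eventually_lt_const (by positivity : (0 : ℝ) < r / 4)] with T h1 h2 hT0 h3 h4
  have hT' : (0 : ℝ) < T := Nat.cast_pos.2 hT0
  have hT1 : (1 : ℝ) ≤ T := by exact_mod_cast hT0
  have ha : ∀ s : Finset ℤ, ∑ h ∈ s, β T h ^ 2 ≤ C / T := fun s => by
    rw [le_div_iff₀ hT', mul_comm]; exact h1 s
  have hv : ∀ s : Finset ℤ, ∑ h ∈ s, (β T (h + 1) - β T h) ^ 2 ≤ r / (4 * M) / T := fun s => by
    rw [le_div_iff₀ hT', mul_comm]; exact h2 s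
  set D := Finset.Icc (1 - m : ℤ) T with hD
  have hcard : (D.card : ℝ) = T + m := by
    simp only [hD, Int.card_Icc]
    have : ((T : ℤ) + 1 - (1 - m)).toNat = T + m := by omega
    rw [this]; push_cast; ring
  refine (Finset.sum_le_sum fun s _ => Finset.sum_le_sum fun t _ =>
    norm_wgt_sub_sq_le m (β T) lam T hk hl s t).trans ?_
  simp only [Finset.sum_add_distrib, ← Finset.mul_sum]
  -- the three contributions
  have p1 : ∑ s ∈ D, ∑ t ∈ D, (β T (t - s + (l - k)) - β T (t - s)) ^ 2 ≤ r / 8 := by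
    have h5 : ∀ s ∈ D, ∑ t ∈ D, (β T (t - s + (l - k)) - β T (t - s)) ^ 2 ≤
        ((l : ℤ) - k : ℤ) ^ 2 * (r / (4 * M) / T) := fun s _ => by
      have := sum_sq_int_shift_sub_le hv ((l : ℤ) - k) (D.map ⟨fun t : ℤ => t - s,
        sub_left_injective⟩)
      rwa [Finset.sum_map] at this
    refine (Finset.sum_le_card_nsmul _ _ _ h5).trans ?_
    rw [nsmul_eq_mul, hcard]
    have h6 : (T : ℝ) + m ≤ (m + 1) * T := by nlinarith [(Nat.cast_nonneg m : (0 : ℝ) ≤ m)]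
    calc _ ≤ ((m + 1) * T) * (((l : ℤ) - k : ℤ) ^ 2 * (r / (4 * M) / T)) := by gcongr
      _ = (2 * (m + 1) * ((l : ℤ) - k : ℤ) ^ 2) / M * (r / 8) := by field_simp; ring
      _ ≤ 1 * (r / 8) := by
          gcongr
          rw [div_le_one hM0]; linarith
      _ = r / 8 := one_mul _
  have hedge : ((D.filter fun s => s ∉ Finset.Icc (1 : ℤ) (T - m)).card : ℝ) ≤ 2 * m := by
    have h5 : (D.filter fun s => s ∉ Finset.Icc (1 : ℤ) (T - m)) ⊆
        Finset.Icc (1 - m : ℤ) 0 ∪ Finset.Icc (T - m + 1 : ℤ) T := fun s hs => by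
      simp only [hD, Finset.mem_filter, Finset.mem_Icc, Finset.mem_union] at hs ⊢; omega
    have h6 := (Finset.card_le_card h5).trans (Finset.card_union_le _ _)
    simp only [Int.card_Icc] at h6
    have h7 : (D.filter fun s => s ∉ Finset.Icc (1 : ℤ) (T - m)).card ≤ 2 * m := by omega
    exact_mod_cast h7
  have p2 : ∑ s ∈ D, ∑ t ∈ D, (if s ∈ Finset.Icc (1 : ℤ) (T - m) then 0 else β T (t - s) ^ 2) ≤
      r / 16 := by
    have h5 : ∑ s ∈ D, ∑ t ∈ D, (if s ∈ Finset.Icc (1 : ℤ) (T - m) then 0 else β T (t - s) ^ 2) =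
        ∑ s ∈ D.filter (fun s => s ∉ Finset.Icc (1 : ℤ) (T - m)), ∑ t ∈ D, β T (t - s) ^ 2 := by
      rw [Finset.sum_filter]
      refine Finset.sum_congr rfl fun s _ => ?_
      split_ifs <;> simp_all
    rw [h5]
    refine (Finset.sum_le_card_nsmul _ _ (C / T) fun s _ => ?_).trans ?_
    · have := ha (D.map ⟨fun t : ℤ => t - s, sub_left_injective⟩)
      rwa [Finset.sum_map] at this
    · rw [nsmul_eq_mul]
      calc _ ≤ 2 * m * (C / T) := by gcongr
        _ = 8 * m * C / T / 4 := by ring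
        _ ≤ r / 16 := by linarith
  have p3 : ∑ s ∈ D, ∑ t ∈ D, (if t ∈ Finset.Icc (1 : ℤ) (T - m) then 0 else β T (t - s) ^ 2) ≤
      r / 16 := by
    refine le_trans (le_of_eq ?_) p2
    rw [Finset.sum_comm]
    refine Finset.sum_congr rfl fun s _ => Finset.sum_congr rfl fun t _ => ?_
    rw [← neg_sub t s, hβ.even]
  have p4 : ∑ s ∈ D, ∑ t ∈ D, (if s ∈ Finset.Icc (1 : ℤ) T then if t ∈ Finset.Icc (1 : ℤ) T then
        if |t - s| ≤ m then β T (t - s) ^ 2 else 0 else 0 else 0) ≤ r / 8 := by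
    refine le_trans (le_of_eq ?_) h3.le
    rw [Finset.sum_comm (s := Finset.Icc (1 : ℤ) T)]
    have hsub : Finset.Icc (1 : ℤ) T ⊆ D := fun s hs => by
      simp only [hD, Finset.mem_Icc] at hs ⊢; omega
    symm
    refine Finset.sum_subset_zero_on_sdiff hsub (fun s hs => ?_) fun s hs => ?_
    · refine Finset.sum_eq_zero fun t _ => ?_
      rw [if_neg (Finset.mem_sdiff.1 hs).2]
    · refine Finset.sum_subset_zero_on_sdiff hsub (fun t ht => ?_) fun t ht => ?_
      · rw [if_pos hs, if_neg (Finset.mem_sdiff.1 ht).2]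
      · rw [if_pos hs, if_pos ht]
  linarith

set_option linter.unusedSectionVars false

variable {S : Type*} [MeasurableSpace S] {μ : Measure S} [IsProbabilityMeasure μ]

theorem integral_norm_sub_integral_sub_sq_le {Ω : Type*} [MeasurableSpace Ω] {P : Measure Ω}
    [IsProbabilityMeasure P] {ι : Type*} {s : Finset ι} {Z : ι → Ω → ℂ}
    (hZ : ∀ i ∈ s, BddMeas (Z i)) {b : ℝ}
    (hb : ∀ i ∈ s, ∫ ω, ‖Z i ω - ∫ ω', Z i ω' ∂P‖ ^ 2 ∂P ≤ b) {Y N : Ω → ℂ} (hY : BddMeas Y)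
    (hN : BddMeas N) (hN0 : ∫ ω, N ω ∂P = 0) (hYN : ∀ ω, Y ω - N ω = ∑ i ∈ s, Z i ω) :
    ∫ ω, ‖Y ω - ∫ ω', Y ω' ∂P - N ω‖ ^ 2 ∂P ≤ s.card * (s.card * b) := by
  have h1 : ∀ ω, Y ω - ∫ ω', Y ω' ∂P - N ω = ∑ i ∈ s, (Z i ω - ∫ ω', Z i ω' ∂P) := fun ω => by
    rw [Finset.sum_sub_distrib, ← integral_finsetSum _ fun i hi => (hZ i hi).integrable, ← hYN ω]
    simp_rw [← hYN]
    rw [integral_sub hY.integrable hN.integrable, hN0]; ring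
  simp_rw [h1]
  exact integral_norm_sum_sq_le_card (fun i hi => (hZ i hi).sub (BddMeas.const _)) hb

/-- Each pair off the band is charged to its later index. Pairs with s < t give a linear form in the
past of D times the conjugate of D' at t. Pairs with s > t give the conjugate of the same expression
with D and D' exchanged, since β is even and the phase is conjugated. -/
theorem sum_wgtOff_eq {β : ℕ → ℤ → ℝ} (hβ : IsWeights β) (m : ℕ) (lam : ℝ) (T : ℕ)
    (D D' : (ℤ → S) → ℂ) (e : ℤ → S) :
    ∑ s ∈ Finset.Icc (1 - m : ℤ) T, ∑ t ∈ Finset.Icc (1 - m : ℤ) T, wgtOff m (β T) lam T s t *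
        (D (shift s e) * starRingEnd ℂ (D' (shift t e))) =
      ∑ q ∈ Finset.range (T + 1),
        (lin (fun h => if (m : ℤ) < h then β T h else 0) lam D T q e *
          starRingEnd ℂ (D' (shift q e)) +
        starRingEnd ℂ (lin (fun h => if (m : ℤ) < h then β T h else 0) lam D' T q e *
          starRingEnd ℂ (D (shift q e)))) := by
  set w : ℤ → ℝ := fun h => if (m : ℤ) < h then β T h else 0 with hw
  have hsub : Finset.Icc (1 : ℤ) T ⊆ Finset.Icc (1 - m : ℤ) T := fun s hs => by
    simp only [Finset.mem_Icc] at hs ⊢; omega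
  have h1 : ∑ s ∈ Finset.Icc (1 - m : ℤ) T, ∑ t ∈ Finset.Icc (1 - m : ℤ) T,
      wgtOff m (β T) lam T s t * (D (shift s e) * starRingEnd ℂ (D' (shift t e))) =
      ∑ s ∈ Finset.Icc (1 : ℤ) T, ∑ t ∈ Finset.Icc (1 : ℤ) T,
        ((w (t - s) + w (s - t) : ℝ) * ex lam (t - s)) *
          (D (shift s e) * starRingEnd ℂ (D' (shift t e))) := by
    symm
    refine Finset.sum_subset_zero_on_sdiff hsub (fun s hs => ?_) fun s hs => ?_
    · refine Finset.sum_eq_zero fun t _ => ?_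
      simp [wgtOff, wgt, (Finset.mem_sdiff.1 hs).2]
    · refine Finset.sum_subset_zero_on_sdiff hsub (fun t ht => ?_) fun t ht => ?_
      · simp [wgtOff, wgt, (Finset.mem_sdiff.1 ht).2]
      · congr 1
        simp only [wgtOff, wgt, hs, ht, and_self, if_true]
        have hev : β T (s - t) = β T (t - s) := by rw [← neg_sub t s, hβ.even]
        split_ifs with h
        · have := abs_le.1 h
          simp only [hw]
          rw [if_neg (by omega), if_neg (by omega)]; simp
        · rcases le_or_gt (t - s) m with h1 | h1
          · have h2 : (m : ℤ) < s - t := by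
              by_contra hc; exact h (abs_le.2 ⟨by omega, h1⟩)
            simp only [hw]
            rw [if_neg (by omega), if_pos h2, hev, zero_add]
          · simp only [hw]
            rw [if_pos h1, if_neg (by omega), add_zero]
  rw [h1, sum_range_succ_eq_sum_Icc (fun q => lin w lam D T q e * starRingEnd ℂ (D' (shift q e)) +
        starRingEnd ℂ (lin w lam D' T q e * starRingEnd ℂ (D (shift q e)))) T ?_,
    Finset.sum_add_distrib]
  · have e1 : ∀ s t : ℤ, ((w (t - s) + w (s - t) : ℝ) * ex lam (t - s)) *
        (D (shift s e) * starRingEnd ℂ (D' (shift t e))) =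
        (w (t - s) * ex lam (t - s) * D (shift s e)) * starRingEnd ℂ (D' (shift t e)) +
        (w (s - t) * starRingEnd ℂ (ex lam (s - t)) * starRingEnd ℂ (D' (shift t e))) *
          D (shift s e) := fun s t => by
      rw [conj_ex, neg_sub]; push_cast; ring
    simp_rw [e1, Finset.sum_add_distrib]
    congr 1
    · rw [Finset.sum_comm]
      refine Finset.sum_congr rfl fun q _ => ?_
      rw [lin, Finset.sum_mul]
    · refine Finset.sum_congr rfl fun q _ => ?_
      simp only [lin, map_mul, map_sum, Complex.conj_conj, Complex.conj_ofReal, Finset.sum_mul]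
  · have h0 : ∀ D : (ℤ → S) → ℂ, lin w lam D T 0 e = 0 := fun D =>
      Finset.sum_eq_zero fun r hr => by
        simp only [hw]
        rw [if_neg (by have := Finset.mem_Icc.1 hr; omega)]; simp
    simp only [h0]; simp

/-- Quadratic forms in windows are approximated by quadratic forms in martingale differences. -/
theorem integral_form_sub_sq_le {β : ℕ → ℤ → ℝ} (hβ : IsWeights β) {m : ℕ} {χ χ' : (ℤ → S) → ℂ}
    (hχ : IsWindow μ m χ) (hχ' : IsWindow μ m χ') (hr' : ∀ e, starRingEnd ℂ (χ' e) = χ' e)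
    (lam : ℝ) {r : ℝ} (hr : 0 < r) :
    ∀ᶠ T : ℕ in atTop, ∫ e, ‖∑ s ∈ Finset.Icc (1 : ℤ) T, ∑ t ∈ Finset.Icc (1 : ℤ) T,
        (β T (t - s) * ex lam (t - s)) * (χ (shift s e) * χ' (shift t e)) -
      ∫ e', ∑ s ∈ Finset.Icc (1 : ℤ) T, ∑ t ∈ Finset.Icc (1 : ℤ) T,
        (β T (t - s) * ex lam (t - s)) * (χ (shift s e') * χ' (shift t e')) ∂(iidLaw μ) -
      ∑ q ∈ Finset.range (T + 1),
        (lin (fun h => if (m : ℤ) < h then β T h else 0) lam (mdTrans μ m lam χ) T q e *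
          starRingEnd ℂ (mdTrans μ m lam χ' (shift q e)) +
        starRingEnd ℂ (lin (fun h => if (m : ℤ) < h then β T h else 0) lam (mdTrans μ m lam χ') T q e
          * starRingEnd ℂ (mdTrans μ m lam χ (shift q e))))‖ ^ 2 ∂(iidLaw μ) ≤ r := by
  have hp := isMartDiff_mdiff hχ
  have hp' := isMartDiff_mdiff hχ'
  choose K hK hK1 using fun p : ℕ × ℕ =>
    (hp p.1).isWindow.integral_qform_sub_sq_le (hp' p.2).isWindow
  set I := Finset.range (m + 1) ×ˢ Finset.range (m + 1) with hI
  set c : ℝ := (I.card : ℝ) with hc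
  set b : ℝ := r / (c * c + 1) with hb
  have hb0 : 0 < b := by positivity
  have hev : ∀ p ∈ I, ∀ᶠ T : ℕ in atTop, ∑ s ∈ Finset.Icc (1 - m : ℤ) T,
      ∑ t ∈ Finset.Icc (1 - m : ℤ) T, ‖wgt (β T) lam T (s + p.1) (t + p.2) -
        ex lam (p.2 - p.1) * wgtOff m (β T) lam T s t‖ ^ 2 ≤ b / (K p + 1) := fun p hpI => by
    simp only [hI, Finset.mem_product, Finset.mem_range] at hpI
    exact hβ.frobenius_sub_le (by omega) (by omega) lam (div_pos hb0 (by have := hK p; positivity))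
  filter_upwards [(Finset.eventually_all I).2 hev] with T hT
  set D := Finset.Icc (1 - m : ℤ) T with hD
  -- Once s is moved by k and t by l, the projections sit at times s and t for every pair p = (k,
  -- l). The form and its martingale version then differ only by the weights dw, which have small
  -- Frobenius norm for each of the (m + 1)² pairs.
  set dw : ℕ × ℕ → ℤ → ℤ → ℂ := fun p s t => wgt (β T) lam T (s + p.1) (t + p.2) -
        ex lam (p.2 - p.1) * wgtOff m (β T) lam T s t with hdw
  have hbYp : ∀ (c : ℂ) (s t : ℤ), BddMeas fun e => c * (χ (shift s e) * χ' (shift t e)) :=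
    fun c s t => (BddMeas.const _).mul
      ((hχ.bdd.comp (measurable_shift _)).mul (hχ'.bdd.comp (measurable_shift _)))
  have hbZp : ∀ (p : ℕ × ℕ) (c : ℂ) (s t : ℤ), BddMeas fun e => c *
      (mdiff μ χ p.1 (shift s e) * mdiff μ χ' p.2 (shift t e)) :=
    fun p c s t => (BddMeas.const _).mul
      (((hp _).bdd.comp (measurable_shift _)).mul ((hp' _).bdd.comp (measurable_shift _)))
  have hm := isMartDiff_mdTrans hχ lam
  have hm' := (isMartDiff_mdTrans hχ' lam).conj
  simp_rw [← sum_wgtOff_eq hβ]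
  refine (integral_norm_sub_integral_sub_sq_le (s := I) (b := b)
    (Z := fun p e => ∑ s ∈ D, ∑ t ∈ D, dw p s t *
      (mdiff μ χ p.1 (shift s e) * mdiff μ χ' p.2 (shift t e)))
    (fun p _ => BddMeas.sum fun s _ => BddMeas.sum fun t _ => hbZp p _ s t) (fun p hpI => ?_)
    (BddMeas.sum fun s _ => BddMeas.sum fun t _ => hbYp _ s t)
    (BddMeas.sum fun s _ => BddMeas.sum fun t _ => (BddMeas.const _).mul
      ((hm.bdd.comp (measurable_shift _)).mul (hm'.bdd.comp (measurable_shift _)))) ?_ ?_).trans ?_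
  · refine (hK1 p D D (dw p)).trans ?_
    have h1 := hT p hpI
    have h2 := hK p
    calc _ ≤ K p * (b / (K p + 1)) := by gcongr
      _ = K p / (K p + 1) * b := by ring
      _ ≤ 1 * b := by
          gcongr
          rw [div_le_one (by positivity)]; linarith
      _ = b := one_mul b
  · have hbN : ∀ s t : ℤ, BddMeas fun e => wgtOff m (β T) lam T s t * (mdTrans μ m lam χ (shift s e) *
        starRingEnd ℂ (mdTrans μ m lam χ' (shift t e))) := fun s t => (BddMeas.const _).mul
      ((hm.bdd.comp (measurable_shift _)).mul (hm'.bdd.comp (measurable_shift _)))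
    rw [integral_finsetSum _ fun s _ => (BddMeas.sum fun t _ => hbN s t).integrable]
    refine Finset.sum_eq_zero fun s _ => ?_
    rw [integral_finsetSum _ fun t _ => (hbN s t).integrable]
    refine Finset.sum_eq_zero fun t _ => ?_
    rw [integral_const_mul]
    by_cases hst : s = t
    · simp [wgtOff, hst]
    · rw [hm.integral_mul_of_ne hm' hst, mul_zero]
  · intro e
    have e1 : ∑ s ∈ Finset.Icc (1 : ℤ) T, ∑ t ∈ Finset.Icc (1 : ℤ) T,
        (β T (t - s) * ex lam (t - s)) * (χ (shift s e) * χ' (shift t e)) =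
        ∑ p ∈ I, ∑ s ∈ D, ∑ t ∈ D, wgt (β T) lam T (s + p.1) (t + p.2) *
          (mdiff μ χ p.1 (shift s e) * mdiff μ χ' p.2 (shift t e)) := by
      have f1 : ∀ s ∈ Finset.Icc (1 : ℤ) T, ∀ t ∈ Finset.Icc (1 : ℤ) T,
          (β T (t - s) * ex lam (t - s)) * (χ (shift s e) * χ' (shift t e)) =
          ∑ p ∈ I, wgt (β T) lam T s t *
            (mdiff μ χ p.1 (shift (s - p.1) e) * mdiff μ χ' p.2 (shift (t - p.2) e)) := by
        intro s hs t ht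
        rw [← Finset.mul_sum, wgt, if_pos ⟨hs, ht⟩, hI, Finset.sum_product,
          ← sum_mdiff hχ (shift s e), ← sum_mdiff hχ' (shift t e), Finset.sum_mul_sum]
        simp only [shift_shift, neg_add_eq_sub]
      rw [Finset.sum_congr rfl fun s hs => Finset.sum_congr rfl fun t ht => f1 s hs t ht]
      rw [Finset.sum_congr rfl fun s _ => Finset.sum_comm, Finset.sum_comm]
      refine Finset.sum_congr rfl fun p hpI => ?_
      simp only [hI, Finset.mem_product, Finset.mem_range] at hpI
      rw [sum_Icc_eq_sum_shift (m := m) (k := p.1) (by omega) (fun s hs =>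
        Finset.sum_eq_zero fun t _ => by rw [wgt, if_neg fun h => hs h.1, zero_mul])]
      refine Finset.sum_congr rfl fun s _ => ?_
      rw [sum_Icc_eq_sum_shift (m := m) (k := p.2) (by omega) (fun t ht =>
        by rw [wgt, if_neg fun h => ht h.2, zero_mul])]
      simp only [add_sub_cancel_right, hD]
    have e2 : ∑ s ∈ D, ∑ t ∈ D, wgtOff m (β T) lam T s t * (mdTrans μ m lam χ (shift s e) *
        starRingEnd ℂ (mdTrans μ m lam χ' (shift t e))) =
        ∑ p ∈ I, ∑ s ∈ D, ∑ t ∈ D, (ex lam (p.2 - p.1) * wgtOff m (β T) lam T s t) *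
          (mdiff μ χ p.1 (shift s e) * mdiff μ χ' p.2 (shift t e)) := by
      rw [Finset.sum_comm (s := I), Finset.sum_congr rfl fun s _ => Finset.sum_comm (s := I)]
      refine Finset.sum_congr rfl fun s _ => Finset.sum_congr rfl fun t _ => ?_
      simp only [mdTrans, map_sum, map_mul, conj_mdiff hr', conj_ex]
      rw [Finset.sum_mul_sum, hI, Finset.sum_product, Finset.mul_sum]
      simp only [Finset.mul_sum]
      refine Finset.sum_congr rfl fun k _ => Finset.sum_congr rfl fun l _ => ?_
      rw [show (l - k : ℤ) = -k + - -l by ring, ex_add]; ring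
    rw [e1, e2, ← Finset.sum_sub_distrib]
    refine Finset.sum_congr rfl fun p _ => ?_
    rw [← Finset.sum_sub_distrib]
    refine Finset.sum_congr rfl fun s _ => ?_
    rw [← Finset.sum_sub_distrib]
    refine Finset.sum_congr rfl fun t _ => ?_
    simp only [hdw]; ring
  · calc _ = (c * c) / (c * c + 1) * r := by rw [hb]; ring
      _ ≤ 1 * r := by
        gcongr
        rw [div_le_one (by positivity)]; linarith
      _ = r := one_mul r

end Replacement

end QuadForm

end

noncomputable section
namespace QuadForm

/-! ### Comparison of characteristic functions in L¹. -/

section CharFunDiff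

variable {Ω : Type*} [MeasurableSpace Ω] {P : Measure Ω} [IsProbabilityMeasure P]

theorem norm_cexp_sub_cexp_le (x y : ℝ) :
    ‖Complex.exp (x * Complex.I) - Complex.exp (y * Complex.I)‖ ≤ |x - y| := by
  have h : Complex.exp (x * Complex.I) - Complex.exp (y * Complex.I) =
      Complex.exp (y * Complex.I) * (Complex.exp ((x - y : ℝ) * Complex.I) - 1) := by
    rw [mul_sub, ← Complex.exp_add, mul_one]
    congr 2; push_cast; ring
  rw [h, norm_mul, Complex.norm_exp_ofReal_mul_I, one_mul]
  exact norm_cexp_sub_one_le _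

theorem integrable_cexp {x : Ω → ℝ} (hx : AEStronglyMeasurable x P) :
    Integrable (fun ω => Complex.exp (x ω * Complex.I)) P := by
  refine Integrable.of_bound (C := 1) ?_ (Eventually.of_forall fun ω => ?_)
  · exact (by fun_prop : Continuous fun t : ℝ =>
      Complex.exp (t * Complex.I)).comp_aestronglyMeasurable hx
  · rw [Complex.norm_exp_ofReal_mul_I]

theorem norm_integral_cexp_sub_le {x y z : Ω → ℝ} (hx : AEStronglyMeasurable x P)
    (hy : AEStronglyMeasurable y P) (hz : Integrable z P) (h : ∀ ω, |x ω - y ω| ≤ z ω) :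
    ‖∫ ω, Complex.exp (x ω * Complex.I) ∂P - ∫ ω, Complex.exp (y ω * Complex.I) ∂P‖ ≤
      ∫ ω, z ω ∂P := by
  rw [← integral_sub (integrable_cexp hx) (integrable_cexp hy)]
  exact norm_integral_le_of_norm_le hz
    (Eventually.of_forall fun ω => (norm_cexp_sub_cexp_le _ _).trans (h ω))

theorem integral_norm_le_of_integral_sq_le {E : Type*} [NormedAddCommGroup E] {Z : Ω → E}
    (hZ : MemLp Z 2 P) {δ : ℝ} (hδ : 0 < δ) (h : ∫ ω, ‖Z ω‖ ^ 2 ∂P ≤ δ ^ 2) :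
    ∫ ω, ‖Z ω‖ ∂P ≤ δ := by
  have h2 := hZ.integrable_norm_pow two_ne_zero
  have h1 : ∫ ω, ‖Z ω‖ ∂P ≤ ∫ ω, (δ / 2 + 1 / (2 * δ) * ‖Z ω‖ ^ 2) ∂P := by
    refine integral_mono (hZ.integrable one_le_two).norm
      ((integrable_const _).add (h2.const_mul _)) fun ω => ?_
    have : δ / 2 + 1 / (2 * δ) * ‖Z ω‖ ^ 2 - ‖Z ω‖ = 1 / (2 * δ) * (‖Z ω‖ - δ) ^ 2 := by
      field_simp; ring
    have h3 : 0 ≤ 1 / (2 * δ) * (‖Z ω‖ - δ) ^ 2 := by positivity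
    simp only []
    linarith
  rw [integral_add (integrable_const _) (h2.const_mul _), integral_const, integral_const_mul] at h1
  simp only [probReal_univ, one_smul] at h1
  have h4 : 1 / (2 * δ) * ∫ ω, ‖Z ω‖ ^ 2 ∂P ≤ 1 / (2 * δ) * δ ^ 2 := by gcongr
  have h5 : 1 / (2 * δ) * δ ^ 2 = δ / 2 := by field_simp
  linarith

end CharFunDiff

/-! ### The limit theorem for combinations of scalar windows. -/

section WindowForms

set_option linter.unusedSectionVars false

variable {S : Type*} [MeasurableSpace S] {μ : Measure S} [IsProbabilityMeasure μ]
variable {ι κ : Type*} [Fintype ι] [Fintype κ]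

/-- The frequencies of the linear forms in the martingale approximation and its conjugate. -/
def formFreq (lam : ι → ℝ) (γ : ι × κ × κ × Bool) : ℝ := if γ.2.2.2 then lam γ.1 else -lam γ.1

/-- The past factor in the martingale approximation and its conjugate. -/
def formPast (D : ι → κ → (ℤ → S) → ℂ) (γ : ι × κ × κ × Bool) (e : ℤ → S) : ℂ :=
  if γ.2.2.2 then D γ.1 γ.2.1 e else starRingEnd ℂ (D γ.1 γ.2.1 e)

/-- The present factor in the martingale approximation and its conjugate. -/
def formPresent (D : ι → κ → (ℤ → S) → ℂ) (M : ι → κ → κ → ℂ) (γ : ι × κ × κ × Bool)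
    (e : ℤ → S) : ℂ :=
  if γ.2.2.2 then M γ.1 γ.2.1 γ.2.2.1 / 2 * starRingEnd ℂ (D γ.1 γ.2.2.1 e)
  else starRingEnd ℂ (M γ.1 γ.2.1 γ.2.2.1 / 2) * D γ.1 γ.2.2.1 e

variable (μ) in
/-- The asymptotic covariance of the martingale forms with coefficients `M` and `M'`. -/
def formCov (lam : ι → ℝ) (D : ι → κ → (ℤ → S) → ℂ) (M M' : ι → κ → κ → ℂ) : ℂ :=
  ∑ γ, ∑ γ', eta (formFreq lam γ + formFreq lam γ') / 2 *
    ((∫ e, formPast D γ e * formPast D γ' e ∂(iidLaw μ)) *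
      ∫ e, formPresent D M γ e * formPresent D M' γ' e ∂(iidLaw μ))

theorem formCov_comm (lam : ι → ℝ) (D : ι → κ → (ℤ → S) → ℂ) (M M' : ι → κ → κ → ℂ) :
    formCov μ lam D M M' = formCov μ lam D M' M := by
  rw [formCov, formCov, Finset.sum_comm]
  refine Finset.sum_congr rfl fun γ _ => Finset.sum_congr rfl fun γ' _ => ?_
  simp_rw [add_comm (formFreq lam γ'), mul_comm (formPast D γ' _), mul_comm (formPresent D M γ' _)]

/-- The asymptotic covariance in terms of the spectral densities of the windows `χ`. -/
theorem formCov_eq {m : ℕ} {χ : κ → (ℤ → S) → ℂ} (hr : ∀ a e, starRingEnd ℂ (χ a e) = χ a e)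
    (lam : ι → ℝ) (M M' : ι → κ → κ → ℂ) {f : ι → κ → κ → ℂ}
    (hf : ∀ j a b, f j a b = ∫ e, mdTrans μ m (lam j) (χ a) e *
      starRingEnd ℂ (mdTrans μ m (lam j) (χ b) e) ∂(iidLaw μ)) :
    formCov μ lam (fun j a => mdTrans μ m (lam j) (χ a)) M M' =
      ((1 / 4 * (∑ j, ∑ a, ∑ c, ∑ k, ∑ b, ∑ e, f j a b * starRingEnd ℂ (f j c e) * M j a c *
        (eta (lam j - lam k) * starRingEnd ℂ (M' k b e) +
          eta (lam j + lam k) * M' k b e)).re : ℝ) : ℂ) := by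
  set D : ι → κ → (ℤ → S) → ℂ := fun j a => mdTrans μ m (lam j) (χ a) with hD
  have hre : ∀ z : ℂ, ((1 / 4 * z.re : ℝ) : ℂ) = 1 / 8 * (z + starRingEnd ℂ z) := fun z => by
    rw [Complex.add_conj]; push_cast; ring
  rw [hre, formCov]
  simp only [Fintype.sum_prod_type, Fintype.sum_bool, map_sum, ← Finset.sum_add_distrib,
    Finset.mul_sum]
  refine Finset.sum_congr rfl fun j _ => Finset.sum_congr rfl fun a _ =>
    Finset.sum_congr rfl fun c _ => Finset.sum_congr rfl fun k _ => Finset.sum_congr rfl fun b _ =>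
    Finset.sum_congr rfl fun e _ => ?_
  have hconj : ∀ a b, ∫ e, starRingEnd ℂ (D j a e) * D j b e ∂(iidLaw μ) =
      starRingEnd ℂ (f j a b) := fun a b => by
    rw [hf, ← integral_conj]; simp [hD]
  have hf' : ∀ a b, ∫ e, D j a e * starRingEnd ℂ (D j b e) ∂(iidLaw μ) = f j a b :=
    fun a b => (hf j a b).symm
  -- the terms with `λ_j + λ_k`
  have hp : eta (lam j + lam k) / 2 * ((∫ e, D j a e * D k b e ∂(iidLaw μ)) *
        ∫ e', M j a c / 2 * starRingEnd ℂ (D j c e') *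
          (M' k b e / 2 * starRingEnd ℂ (D k e e')) ∂(iidLaw μ)) =
      1 / 8 * (f j a b * starRingEnd ℂ (f j c e) * M j a c * (eta (lam j + lam k) * M' k b e)) := by
    by_cases h : ex (lam j + lam k) 1 = 1
    · have h1 : ∀ b e, D k b e = starRingEnd ℂ (D j b e) := fun b e => by
        rw [hD]
        simp only []
        rw [conj_mdTrans (hr b), mdTrans_congr (lam := lam k) (lam' := -lam j)]
        rwa [sub_neg_eq_add, add_comm]
      simp_rw [h1, Complex.conj_conj, hf', mul_mul_mul_comm, integral_const_mul, hconj]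
      ring
    · rw [eta_eq_zero h]; simp
  have hm : eta (lam j + -lam k) / 2 * ((∫ e, D j a e * starRingEnd ℂ (D k b e) ∂(iidLaw μ)) *
        ∫ e', M j a c / 2 * starRingEnd ℂ (D j c e') *
          (starRingEnd ℂ (M' k b e / 2) * D k e e') ∂(iidLaw μ)) =
      1 / 8 * (f j a b * starRingEnd ℂ (f j c e) * M j a c *
        (eta (lam j - lam k) * starRingEnd ℂ (M' k b e))) := by
    rw [← sub_eq_add_neg]
    by_cases h : ex (lam j - lam k) 1 = 1
    · have h1 : ∀ b e, D k b e = D j b e := fun b e => by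
        rw [hD]
        simp only []
        rw [mdTrans_congr h]
      simp_rw [h1, hf', mul_mul_mul_comm, integral_const_mul, hconj, map_div₀, Complex.conj_ofNat]
      ring
    · rw [eta_eq_zero h]; simp
  have hec : ∀ x, starRingEnd ℂ (eta x) = eta x := fun x => by
    by_cases h : ex x 1 = 1
    · rw [eta_eq_one h, map_one]
    · rw [eta_eq_zero h, map_zero]
  have hp' : eta (-lam j + -lam k) / 2 *
        ((∫ e, starRingEnd ℂ (D j a e) * starRingEnd ℂ (D k b e) ∂(iidLaw μ)) *
        ∫ e', starRingEnd ℂ (M j a c / 2) * D j c e' *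
          (starRingEnd ℂ (M' k b e / 2) * D k e e') ∂(iidLaw μ)) =
      starRingEnd ℂ (1 / 8 * (f j a b * starRingEnd ℂ (f j c e) * M j a c *
        (eta (lam j + lam k) * M' k b e))) := by
    rw [← hp, ← neg_add, eta_neg]
    simp only [map_mul, map_div₀, hec, ← integral_conj, Complex.conj_conj, Complex.conj_ofNat]
  have hm' : eta (-lam j + lam k) / 2 *
        ((∫ e, starRingEnd ℂ (D j a e) * D k b e ∂(iidLaw μ)) *
        ∫ e', starRingEnd ℂ (M j a c / 2) * D j c e' *
          (M' k b e / 2 * starRingEnd ℂ (D k e e')) ∂(iidLaw μ)) =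
      starRingEnd ℂ (1 / 8 * (f j a b * starRingEnd ℂ (f j c e) * M j a c *
        (eta (lam j - lam k) * starRingEnd ℂ (M' k b e)))) := by
    rw [← hm, ← eta_neg (lam j + -lam k), neg_add, neg_neg]
    simp only [map_mul, map_div₀, hec, ← integral_conj, Complex.conj_conj, Complex.conj_ofNat]
  simp only [formFreq, formPast, formPresent, if_true, Bool.false_eq_true, if_false]
  rw [hp, hm, hp', hm']
  simp only [map_mul, map_add, map_div₀, map_one, Complex.conj_ofNat, Complex.conj_conj]
  ring

/-- The central limit theorem for quadratic forms in finitely many windows. -/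
theorem tendsto_charFun_window {β : ℕ → ℤ → ℝ} (hβ : IsWeights β) {m : ℕ}
    {χ : κ → (ℤ → S) → ℂ} (hχ : ∀ a, IsWindow μ m (χ a))
    (hr : ∀ a e, starRingEnd ℂ (χ a e) = χ a e) (lam : ι → ℝ) (C : ι → κ → κ → ℂ)
    {Y : ℕ → ι → κ → κ → (ℤ → S) → ℂ}
    (hY : ∀ T j a c e, Y T j a c e = ∑ s ∈ Finset.Icc (1 : ℤ) T, ∑ t ∈ Finset.Icc (1 : ℤ) T,
      (β T (t - s) * ex (lam j) (t - s)) * (χ a (shift s e) * χ c (shift t e)))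
    {M : ι → κ → κ → ℂ} (hM : ∀ j a c, M j a c = C j a c + starRingEnd ℂ (C j c a)) {v : ℝ}
    (hv : (v : ℂ) = formCov μ lam (fun j a => mdTrans μ m (lam j) (χ a)) M M) :
    Tendsto (fun T : ℕ => ∫ e, Complex.exp (((∑ j, ∑ a, ∑ c, C j a c *
        (Y T j a c e - ∫ e', Y T j a c e' ∂(iidLaw μ))).re : ℝ) * Complex.I) ∂(iidLaw μ))
      atTop (𝓝 (Real.exp (-(v / 2)) : ℂ)) := by
  set w : ℕ → ℤ → ℝ := fun T h => if (m : ℤ) < h then β T h else 0 with hw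
  set D : ι → κ → (ℤ → S) → ℂ := fun j a => mdTrans μ m (lam j) (χ a) with hD
  have hDm : ∀ j a, IsMartDiff μ m (D j a) := fun j a => isMartDiff_mdTrans (hχ a) (lam j)
  set L : ℕ → ι → κ → ℤ → (ℤ → S) → ℂ := fun T j a q e => lin (w T) (lam j) (D j a) T q e with hL
  set ξ : ℕ → ℕ → (ℤ → S) → ℝ := fun T q e =>
    (∑ j, ∑ a, ∑ c, M j a c * (L T j a q e * starRingEnd ℂ (D j c (shift q e)))).re with hξ
  have hconjlin : ∀ T j a q e, lin (w T) (-lam j) (fun e => starRingEnd ℂ (D j a e)) T q e =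
      starRingEnd ℂ (L T j a q e) := fun T j a q e => by
    simp only [hL, lin, map_sum, map_mul, Complex.conj_ofReal, conj_ex, ex_neg_left]
  have hlim := tendsto_charFun_forms (μ := μ) (hβ.isKernel m) (lam := formFreq (κ := κ) lam)
    (U := formPast D) (V := formPresent D M) (fun γ => ?_) (fun γ => ?_) (ξ := ξ) (fun T q e => ?_)
    (v := v) hv
  rotate_left
  · rcases γ with ⟨j, a, c, b⟩
    cases b
    · exact (hDm j a).conj
    · exact hDm j a
  · rcases γ with ⟨j, a, c, b⟩
    cases b
    · exact (hDm j c).const_mul _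
    · exact (hDm j c).conj.const_mul _
  · have hre : ∀ z : ℂ, ((z.re : ℝ) : ℂ) = 1 / 2 * (z + starRingEnd ℂ z) := fun z => by
      rw [Complex.add_conj]; push_cast; ring
    simp only [hξ]
    rw [hre]
    simp only [Fintype.sum_prod_type, Fintype.sum_bool, map_sum, ← Finset.sum_add_distrib,
      Finset.mul_sum]
    refine Finset.sum_congr rfl fun j _ => Finset.sum_congr rfl fun a _ =>
      Finset.sum_congr rfl fun c _ => ?_
    simp only [formFreq, formPresent, if_true, Bool.false_eq_true, if_false]
    have h1 : lin (w T) (lam j) (formPast D (j, a, c, true)) T q e = L T j a q e := rfl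
    have h2 : lin (w T) (-lam j) (formPast D (j, a, c, false)) T q e =
        starRingEnd ℂ (L T j a q e) := hconjlin T j a q e
    rw [h1, h2]
    simp only [ map_mul, map_div₀, Complex.conj_ofNat, Complex.conj_conj]
    ring
  -- comparison
  set N : ℕ → ι → κ → κ → (ℤ → S) → ℂ := fun T j a c e => ∑ q ∈ Finset.range (T + 1),
    (L T j a q e * starRingEnd ℂ (D j c (shift q e)) +
      starRingEnd ℂ (L T j c q e * starRingEnd ℂ (D j a (shift q e)))) with hN
  -- N carries each pair (a, c) together with the conjugate of (c, a). Under the real part that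
  -- conjugate may be undone and the labels exchanged, which merges the coefficients into M = C +
  -- C*.
  have hξN : ∀ T e, ∑ q ∈ Finset.range (T + 1), ξ T q e =
      (∑ j, ∑ a, ∑ c, C j a c * N T j a c e).re := fun T e => by
    simp only [hξ, hN, Finset.mul_sum, ← Complex.re_sum]
    have h1 : ∀ j, ∑ a, ∑ c, ∑ q ∈ Finset.range (T + 1), C j a c *
        (L T j a q e * starRingEnd ℂ (D j c (shift q e)) +
          starRingEnd ℂ (L T j c q e * starRingEnd ℂ (D j a (shift q e)))) =
        ∑ q ∈ Finset.range (T + 1), ∑ a, ∑ c, C j a c *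
        (L T j a q e * starRingEnd ℂ (D j c (shift q e)) +
          starRingEnd ℂ (L T j c q e * starRingEnd ℂ (D j a (shift q e)))) := fun j => by
      rw [Finset.sum_comm]
      rw [Finset.sum_congr rfl fun c _ => Finset.sum_comm]
      rw [Finset.sum_comm]
      exact Finset.sum_congr rfl fun q _ => Finset.sum_comm
    rw [Finset.sum_congr rfl fun j _ => h1 j, Finset.sum_comm]
    simp only [Complex.re_sum]
    refine Finset.sum_congr rfl fun j _ => Finset.sum_congr rfl fun q _ => ?_
    simp only [hM, mul_add, add_mul, Complex.add_re, Finset.sum_add_distrib]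
    congr 1
    rw [Finset.sum_comm]
    refine Finset.sum_congr rfl fun a _ => Finset.sum_congr rfl fun c _ => ?_
    rw [← Complex.conj_re]
    congr 1
    simp only [map_mul, Complex.conj_conj]
  have hYb : ∀ T j a c, BddMeas (Y T j a c) := fun T j a c => by
    have h0 : Y T j a c = fun e => ∑ s ∈ Finset.Icc (1 : ℤ) T, ∑ t ∈ Finset.Icc (1 : ℤ) T,
      (β T (t - s) * ex (lam j) (t - s)) * (χ a (shift s e) * χ c (shift t e)) :=
      funext fun e => hY T j a c e
    rw [h0]
    exact BddMeas.sum fun s _ => BddMeas.sum fun t _ => (BddMeas.const _).mul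
      (((hχ a).bdd.comp (measurable_shift _)).mul ((hχ c).bdd.comp (measurable_shift _)))
  have hLb : ∀ T j a q, BddMeas (L T j a q) := fun T j a q => bddMeas_lin (hDm j a).bdd _ _ _ _
  have hNb : ∀ T j a c, BddMeas (N T j a c) := fun T j a c => BddMeas.sum fun q _ =>
    ((hLb T j a q).mul ((hDm j c).bdd.comp (measurable_shift _)).conj).add
      ((hLb T j c q).mul ((hDm j a).bdd.comp (measurable_shift _)).conj).conj
  set Z : ℕ → ι → κ → κ → (ℤ → S) → ℂ := fun T j a c e =>
    Y T j a c e - ∫ e', Y T j a c e' ∂(iidLaw μ) - N T j a c e with hZ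
  have hZb : ∀ T j a c, BddMeas (Z T j a c) := fun T j a c =>
    ((hYb T j a c).sub (BddMeas.const _)).sub (hNb T j a c)
  have hcmp : ∀ T, ‖∫ e, Complex.exp (((∑ j, ∑ a, ∑ c, C j a c *
        (Y T j a c e - ∫ e', Y T j a c e' ∂(iidLaw μ))).re : ℝ) * Complex.I) ∂(iidLaw μ) -
      ∫ e, Complex.exp ((∑ q ∈ Finset.range (T + 1), ξ T q e : ℝ) * Complex.I) ∂(iidLaw μ)‖ ≤
      ∑ j, ∑ a, ∑ c, ‖C j a c‖ * ∫ e, ‖Z T j a c e‖ ∂(iidLaw μ) := fun T => by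
    refine (norm_integral_cexp_sub_le (z := fun e => ∑ j, ∑ a, ∑ c, ‖C j a c‖ * ‖Z T j a c e‖)
      ?_ ?_ ?_ fun e => ?_).trans (le_of_eq ?_)
    · exact (BddMeas.sum fun j _ => BddMeas.sum fun a _ => BddMeas.sum fun c _ =>
        (BddMeas.const _).mul ((hYb T j a c).sub (BddMeas.const _))).re.1.aestronglyMeasurable
    · simp_rw [hξN]
      exact (BddMeas.sum fun j _ => BddMeas.sum fun a _ => BddMeas.sum fun c _ =>
        (BddMeas.const _).mul (hNb T j a c)).re.1.aestronglyMeasurable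
    · exact (BddMeas.sum fun j _ => BddMeas.sum fun a _ => BddMeas.sum fun c _ =>
        (BddMeas.const _).mul (hZb T j a c).norm).integrable
    · rw [hξN, ← Complex.sub_re]
      refine (Complex.abs_re_le_norm _).trans ?_
      simp only [← Finset.sum_sub_distrib]
      refine norm_sum_le_of_le _ fun j _ => norm_sum_le_of_le _ fun a _ =>
        norm_sum_le_of_le _ fun c _ => ?_
      rw [← mul_sub, norm_mul]
    · rw [integral_finsetSum _ fun j _ => (BddMeas.sum fun a _ => BddMeas.sum fun c _ =>
        (BddMeas.const _).mul (hZb T j a c).norm).integrable]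
      refine Finset.sum_congr rfl fun j _ => ?_
      rw [integral_finsetSum _ fun a _ => (BddMeas.sum fun c _ =>
        (BddMeas.const _).mul (hZb T j a c).norm).integrable]
      refine Finset.sum_congr rfl fun a _ => ?_
      rw [integral_finsetSum _ fun c _ => ((BddMeas.const _).mul (hZb T j a c).norm).integrable]
      exact Finset.sum_congr rfl fun c _ => integral_const_mul _ _
  have hZ0 : ∀ j a c, Tendsto (fun T => ∫ e, ‖Z T j a c e‖ ∂(iidLaw μ)) atTop (𝓝 0) := by
    intro j a c
    rw [Metric.tendsto_nhds]
    intro r hr0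
    have h := integral_form_sub_sq_le hβ (hχ a) (hχ c) (hr c) (lam j) (pow_pos (half_pos hr0) 2)
    filter_upwards [h] with T hT
    have h1 : ∫ e, ‖Z T j a c e‖ ^ 2 ∂(iidLaw μ) ≤ (r / 2) ^ 2 := by
      refine le_trans (le_of_eq ?_) hT
      simp only [hZ, hY, hN, hL, hD, hw]
    have h2 := integral_norm_le_of_integral_sq_le ((hZb T j a c).memLp 2) (half_pos hr0) h1
    rw [dist_zero_right, Real.norm_of_nonneg (integral_nonneg fun _ => norm_nonneg _)]
    linarith
  have hsum : Tendsto (fun T => ∑ j, ∑ a, ∑ c, ‖C j a c‖ * ∫ e, ‖Z T j a c e‖ ∂(iidLaw μ)) atTop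
      (𝓝 0) := by
    have h := tendsto_finsetSum (Finset.univ : Finset ι) fun j _ =>
      tendsto_finsetSum (Finset.univ : Finset κ) fun a _ =>
      tendsto_finsetSum (Finset.univ : Finset κ) fun c _ => (hZ0 j a c).const_mul ‖C j a c‖
    simpa using h
  have hdiff := squeeze_zero_norm hcmp hsum
  simpa using hdiff.add hlim

end WindowForms

end QuadForm

end

noncomputable section
namespace QuadForm

/-! ### Approximation of the process by finitely many real scalar windows. -/

section Approximation

set_option linter.unusedSectionVars false

variable {S : Type*} [MeasurableSpace S] {μ : Measure S} [IsProbabilityMeasure μ]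
variable {H : Type*} [NormedAddCommGroup H] [InnerProductSpace ℂ H] [CompleteSpace H]

theorem del_congr_ae {f g : (ℤ → S) → H} (h : f =ᵐ[iidLaw μ] g) (p : ℝ≥0∞) (j : ℤ) :
    del μ p j f = del μ p j g :=
  eLpNorm_congr_ae ((Measure.quasiMeasurePreserving_fst.ae_eq_comp h).sub
    ((measurePreserving_mix μ {j}ᶜ).quasiMeasurePreserving.ae_eq_comp h))

theorem theta_congr_ae {f g : (ℤ → S) → H} (h : f =ᵐ[iidLaw μ] g) : theta μ f = theta μ g :=
  tsum_congr fun j => del_congr_ae h 4 j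

theorem theta_add_le {f g : (ℤ → S) → H} (hf : StronglyMeasurable f) (hg : StronglyMeasurable g) :
    theta μ (f + g) ≤ theta μ f + theta μ g := by
  rw [theta, theta, theta, ← ENNReal.tsum_add]
  exact ENNReal.tsum_le_tsum fun j => del_add_le hf hg j (by norm_num)

theorem theta_sub_le {f g : (ℤ → S) → H} (hf : StronglyMeasurable f) (hg : StronglyMeasurable g) :
    theta μ (f - g) ≤ theta μ f + theta μ g := by
  rw [theta, theta, theta, ← ENNReal.tsum_add]
  exact ENNReal.tsum_le_tsum fun j => del_sub_le hf hg j (by norm_num)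

/-- Dominated convergence over j: each influence of the difference tends to 0 because the window
averages converge in L⁴, and it is at most twice the influence of f, which is summable. -/
theorem tendsto_theta_sub_avg {f : (ℤ → S) → H} (hf : StronglyMeasurable f)
    (h4 : MemLp f 4 (iidLaw μ)) (hθ : theta μ f ≠ ∞) :
    Tendsto (fun n : ℕ => theta μ (f - avg μ (Set.Icc (-n : ℤ) n) f)) atTop (𝓝 0) := by
  have hi := h4.integrable (by norm_num)
  have h : Tendsto (fun n : ℕ => ∫⁻ j, del μ 4 j (f - avg μ (Set.Icc (-n : ℤ) n) f)
      ∂(Measure.count : Measure ℤ)) atTop (𝓝 (∫⁻ _ : ℤ, 0 ∂(Measure.count : Measure ℤ))) := by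
    refine tendsto_lintegral_of_dominated_convergence (fun j => 2 * del μ 4 j f)
      (fun n => measurable_of_countable _) (fun n => Eventually.of_forall fun j => ?_) ?_
      (Eventually.of_forall fun j => ?_)
    · refine (del_sub_le hf (stronglyMeasurable_avg hf _) j (by norm_num)).trans ?_
      simp only [two_mul]
      gcongr
      exact del_avg_le hf hi _ j (by norm_num) (by norm_num)
    · rw [lintegral_count, ENNReal.tsum_mul_left]
      exact ENNReal.mul_ne_top (by simp) hθ
    · have h1 := (ENNReal.Tendsto.const_mul (a := 2)
        (tendsto_avg_window hf (by norm_num : (1 : ℝ≥0∞) ≤ 4) (by norm_num) h4) (by simp))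
      rw [mul_zero] at h1
      refine tendsto_of_tendsto_of_tendsto_of_le_of_le tendsto_const_nhds h1
        (fun _ => zero_le) fun n => ?_
      refine (del_le (hf.sub (stronglyMeasurable_avg hf _)) j (by norm_num)).trans (le_of_eq ?_)
      rw [eLpNorm_sub_comm]
  simpa [lintegral_count, theta] using h

/-- A conjugation as a real-linear map. -/
def Conjugation.conjCLE (J : Conjugation H) : H ≃L[ℝ] H where
  toFun := J.conj
  invFun := J.conj
  map_add' := map_add J.conj
  map_smul' c x := by
    rw [← Complex.coe_smul, map_smulₛₗ, Complex.conj_ofReal, Complex.coe_smul, RingHom.id_apply]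
  left_inv := J.conj_conj
  right_inv := J.conj_conj
  continuous_toFun := J.conj.continuous
  continuous_invFun := J.conj.continuous

/-- The real part of a vector with respect to a conjugation. -/
def Conjugation.realPart (J : Conjugation H) (x : H) : H := (1 / 2 : ℂ) • (x + J.conj x)

theorem Conjugation.conj_realPart (J : Conjugation H) (x : H) :
    J.conj (J.realPart x) = J.realPart x := by
  rw [realPart, map_smulₛₗ, map_add, J.conj_conj, add_comm]
  simp only [map_div₀, map_one, Complex.conj_ofNat]

theorem Conjugation.realPart_of_conj_eq (J : Conjugation H) {x : H} (h : J.conj x = x) :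
    J.realPart x = x := by
  rw [realPart, h, ← two_smul ℂ, smul_smul]; norm_num

theorem Conjugation.norm_realPart_sub_le (J : Conjugation H) (x y : H) :
    ‖J.realPart x - J.realPart y‖ ≤ ‖x - y‖ := by
  rw [realPart, realPart, ← smul_sub, norm_smul, add_sub_add_comm, ← map_sub]
  have h2 : ‖(1 / 2 : ℂ)‖ = 1 / 2 := by norm_num
  rw [h2]
  have := norm_add_le (x - y) (J.conj (x - y))
  rw [J.norm_conj] at this
  linarith

theorem Conjugation.continuous_realPart (J : Conjugation H) : Continuous J.realPart :=
  (continuous_id.add J.conj.continuous).const_smul _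

/-- The approximation of a window by a combination of finitely many scalar windows. -/
theorem exists_approx_of_dependsOn [TopologicalSpace.SeparableSpace H] (J : Conjugation H)
    {g : (ℤ → S) → H} (hg : StronglyMeasurable g) (h4 : MemLp g 4 (iidLaw μ))
    (hr : ∀ e, J.conj (g e) = g e) {m : ℕ} (hd : DependsOn g (Set.Icc (-m : ℤ) 0)) {r : ℝ≥0∞}
    (hr0 : r ≠ 0) :
    ∃ (K : Finset H) (χ : K → (ℤ → S) → ℂ) (x : K → H), (∀ a, IsWindow μ m (χ a)) ∧
      (∀ a e, starRingEnd ℂ (χ a e) = χ a e) ∧ (∀ a, J.conj (x a) = x a) ∧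
      theta μ (g - fun e => ∑ a, χ a e • x a) ≤ r := by
  borelize H
  have : SecondCountableTopology H := UniformSpace.secondCountable_of_separable H
  set I := Finset.Icc (-m : ℤ) 0 with hI
  -- Simple functions of g inherit its window. With finitely many coordinates the L⁴ error bounds
  -- `theta` up to the factor 2·card I, which is built into the choice of n.
  have hlim := SimpleFunc.tendsto_approxOn_range_Lp_eLpNorm (p := 4) (by norm_num) hg.measurable h4.2
  have hlim2 := ENNReal.Tendsto.const_mul (a := (I.card : ℝ≥0∞) * 2) hlim
    (Or.inr (ENNReal.mul_ne_top (ENNReal.natCast_ne_top _) (by simp)))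
  rw [mul_zero] at hlim2
  obtain ⟨n, hn⟩ := (hlim2.eventually (ge_mem_nhds (pos_iff_ne_zero.2 hr0))).exists
  set s := SimpleFunc.approxOn g hg.measurable (Set.range g ∪ {0}) 0 (by simp) n with hs
  have hsd : ∀ F : H → ℂ, DependsOn (fun e => F (s e)) (Set.Icc (-m : ℤ) 0) := fun F e e' hee => by
    have : s e = s e' := by
      simp only [hs, SimpleFunc.approxOn, SimpleFunc.coe_comp, Function.comp]
      rw [hd hee]
    simp only [this]
  classical
  set ind : H → H → ℂ := fun y z => if z = y then 1 else 0 with hind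
  have hindm : ∀ y, StronglyMeasurable fun e => ind y (s e) := fun y => by
    have h1 : (fun e => ind y (s e)) = s.map (ind y) := by ext e; simp
    rw [h1]
    exact SimpleFunc.stronglyMeasurable _
  have hindb : ∀ y, BddMeas fun e => ind y (s e) := fun y => ⟨hindm y, 1, fun e => by
    simp only [hind]; split_ifs <;> simp⟩
  set p : H → ℂ := fun y => ∫ e, ind y (s e) ∂(iidLaw μ) with hp
  have hindr : ∀ y z, starRingEnd ℂ (ind y z) = ind y z := fun y z => by
    simp only [hind]; split_ifs <;> simp
  have hpr : ∀ y, starRingEnd ℂ (p y) = p y := fun y => by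
    simp only [hp, ← integral_conj, hindr]
  refine ⟨s.range, fun a e => ind a (s e) - p a, fun a => J.realPart a, fun a => ⟨?_, ?_, ?_⟩,
    fun a e => ?_, fun a => J.conj_realPart _, ?_⟩
  · exact (hindb a).sub (BddMeas.const _)
  · exact hsd fun z => ind a z - p a
  · rw [integral_sub (hindb a).integrable (integrable_const _)]
    simp [hp]
  · rw [map_sub, hindr, hpr]
  -- Centring the indicators subtracts the constant vector c, which has no influence on any
  -- coordinate.
  · set c : H := ∑ a : s.range, p a • J.realPart a with hc
    have h1 : ∀ e, ∑ a : s.range, (ind a (s e) - p a) • J.realPart a = J.realPart (s e) - c := by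
      intro e
      simp only [sub_smul, Finset.sum_sub_distrib, hc]
      congr 1
      rw [Finset.sum_eq_single (⟨s e, SimpleFunc.mem_range_self s e⟩ : s.range)]
      · simp [hind]
      · intro b _ hb
        have : s e ≠ b := fun h => hb (Subtype.ext h.symm)
        simp [hind, this]
      · simp
    have h2 : (g - fun e => ∑ a : s.range, (ind a (s e) - p a) • J.realPart a) =
        fun e => (fun e => g e - J.realPart (s e)) e - (-c) := by
      funext e
      simp only [Pi.sub_apply, h1]; abel
    have h3 : theta μ (g - fun e => ∑ a : s.range, (ind a (s e) - p a) • J.realPart a) =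
        theta μ (fun e => g e - J.realPart (s e)) := by
      rw [h2]
      exact tsum_congr fun j => del_const_sub _ _ _ _
    have hm : StronglyMeasurable fun e => g e - J.realPart (s e) :=
      hg.sub (J.continuous_realPart.comp_stronglyMeasurable s.stronglyMeasurable)
    rw [h3]
    refine (theta_le_of_dependsOn hm (s := I) ?_).trans (le_trans ?_ hn)
    · intro e e' hee
      have h5 : DependsOn g (I : Set ℤ) := by simpa [hI] using hd
      have h6 : s e = s e' := by
        simp only [hs, SimpleFunc.approxOn, SimpleFunc.coe_comp, Function.comp]
        rw [h5 hee]
      simp only [h5 hee, h6]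
    · rw [mul_assoc]
      gcongr
      refine eLpNorm_mono fun e => ?_
      rw [Pi.sub_apply, norm_sub_rev]
      nth_rw 1 [← J.realPart_of_conj_eq (hr e)]
      exact J.norm_realPart_sub_le _ _

/-- Real centred functions of the past with summable influences are approximated by combinations
of finitely many real scalar windows. -/
theorem exists_approx [TopologicalSpace.SeparableSpace H] (J : Conjugation H)
    {f : (ℤ → S) → H} (hf : StronglyMeasurable f) (h4 : MemLp f 4 (iidLaw μ))
    (hr : ∀ᵐ e ∂(iidLaw μ), J.conj (f e) = f e) (hθ : theta μ f ≠ ∞)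
    (hd : DependsOn f (Set.Iic (0 : ℤ))) {r : ℝ≥0∞} (hr0 : r ≠ 0) :
    ∃ (m : ℕ) (K : Finset H) (χ : K → (ℤ → S) → ℂ) (x : K → H), (∀ a, IsWindow μ m (χ a)) ∧
      (∀ a e, starRingEnd ℂ (χ a e) = χ a e) ∧ (∀ a, J.conj (x a) = x a) ∧
      theta μ (f - fun e => ∑ a, χ a e • x a) ≤ r := by
  -- f is real almost everywhere only. Its real part is a version that is real at every point and
  -- still depends on the past, so its window averages are real everywhere.
  set f' : (ℤ → S) → H := fun e => J.realPart (f e) with hf'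
  have hff' : f =ᵐ[iidLaw μ] f' := hr.mono fun e he => (J.realPart_of_conj_eq he).symm
  have hfm : StronglyMeasurable f' := J.continuous_realPart.comp_stronglyMeasurable hf
  have h4' : MemLp f' 4 (iidLaw μ) := h4.ae_eq hff'
  have hθ' : theta μ f' ≠ ∞ := by rwa [← theta_congr_ae hff']
  have hd' : DependsOn f' (Set.Iic (0 : ℤ)) := DependsOn.comp' hd _
  have hi := h4'.integrable (by norm_num)
  have hr2 : r / 2 ≠ 0 := by simp [hr0]
  obtain ⟨n, hn⟩ := ((tendsto_theta_sub_avg hfm h4' hθ').eventually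
    (ge_mem_nhds (pos_iff_ne_zero.2 hr2))).exists
  set g := avg μ (Set.Icc (-n : ℤ) n) f' with hg
  have hgm : StronglyMeasurable g := stronglyMeasurable_avg hfm _
  have hgr : ∀ e, J.conj (g e) = g e := fun e => by
    have : J.conj (g e) = ∫ e', J.conj (f' (mix (Set.Icc (-n : ℤ) n) e e')) ∂(iidLaw μ) := by
      simp only [hg, avg]
      exact (ContinuousLinearEquiv.integral_comp_comm J.conjCLE _).symm
    rw [this]
    simp only [hf', J.conj_realPart]
    rfl
  have hgd : DependsOn g (Set.Icc (-n : ℤ) 0) := dependsOn_avg_of_dependsOn hd' fun k hk => by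
    simp only [Set.mem_inter_iff, Set.mem_Icc, Set.mem_Iic] at hk ⊢; omega
  obtain ⟨K, χ, x, h1, h2, h3, h5⟩ := exists_approx_of_dependsOn J hgm
    (memLp_avg hfm _ (by norm_num) (by norm_num) h4') hgr hgd hr2
  refine ⟨n, K, χ, x, h1, h2, h3, ?_⟩
  set h : (ℤ → S) → H := fun e => ∑ a, χ a e • x a with hh
  have hhm : StronglyMeasurable h := Finset.stronglyMeasurable_fun_sum _ fun a _ =>
    (h1 a).bdd.1.smul_const _
  have e1 : theta μ (f - h) = theta μ ((f' - g) + (g - h)) := by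
    rw [sub_add_sub_cancel]
    exact theta_congr_ae (hff'.sub (ae_eq_refl h))
  rw [e1, ← ENNReal.add_halves r]
  exact (theta_add_le (hfm.sub hgm) (hgm.sub hhm)).trans (add_le_add hn h5)

end Approximation

end QuadForm

end

noncomputable section
namespace QuadForm

/-! ### Covariances bounded by influences. -/

section CovarianceInequality

set_option linter.unusedSectionVars false

variable {S : Type*} [MeasurableSpace S] {μ : Measure S} [IsProbabilityMeasure μ]
variable {G : Type*} [NormedAddCommGroup G] [InnerProductSpace ℂ G] [CompleteSpace G]

theorem enorm_integral_inner_le {α : Type*} [MeasurableSpace α] {ν : Measure α} {V f : α → G}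
    (hV : AEStronglyMeasurable V ν) (hf : AEStronglyMeasurable f ν) :
    ‖∫ a, inner ℂ (V a) (f a) ∂ν‖ₑ ≤ eLpNorm V 2 ν * eLpNorm f 2 ν := by
  refine (enorm_integral_le_lintegral_enorm _).trans ?_
  rw [← eLpNorm_one_eq_lintegral_enorm]
  refine (eLpNorm_le_eLpNorm_mul_eLpNorm_of_nnnorm (p := 2) (q := 2) (r := 1) hV hf
    (fun x y => inner ℂ x y) 1 (Eventually.of_forall fun a => ?_)).trans (by simp)
  rw [one_mul]
  exact nnnorm_inner_le_nnnorm _ _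

theorem integrable_inner {α : Type*} [MeasurableSpace α] {ν : Measure α} {V f : α → G}
    (hV : MemLp V 2 ν) (hf : MemLp f 2 ν) : Integrable (fun a => inner ℂ (V a) (f a)) ν :=
  ⟨hV.1.inner hf.1, by
    have h := (eLpNorm_le_eLpNorm_mul_eLpNorm_of_nnnorm (p := 2) (q := 2) (r := 1) hV.1 hf.1
      (fun x y => (inner ℂ x y : ℂ)) 1 (Eventually.of_forall fun a => by
        rw [one_mul]; exact nnnorm_inner_le_nnnorm _ _))
    rw [eLpNorm_one_eq_lintegral_enorm] at h
    exact h.trans_lt (ENNReal.mul_lt_top (ENNReal.mul_lt_top (by simp) hV.2) hf.2)⟩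

/-- Expose the coordinates one by one. The increment of V is orthogonal to everything in f except
the increment of f at the same step, so each coordinate contributes the product of its two
influences. -/
theorem enorm_integral_inner_avg_le {V f : (ℤ → S) → G} (hV : StronglyMeasurable V)
    (hf : StronglyMeasurable f) (hV2 : MemLp V 2 (iidLaw μ)) (hf2 : MemLp f 2 (iidLaw μ))
    (hV0 : ∫ e, V e ∂(iidLaw μ) = 0) (s : Finset ℤ) :
    ‖∫ e, inner ℂ (avg μ s V e) (f e) ∂(iidLaw μ)‖ₑ ≤ ∑ j ∈ s, del μ 2 j V * del μ 2 j f := by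
  classical
  induction s using Finset.induction_on with
  | empty => simp [avg_empty, hV0]
  | insert j s hj ih =>
    have hVa := fun I => memLp_avg (μ := μ) hV I (by norm_num) (by norm_num) hV2
    have hfa := fun I => memLp_avg (μ := μ) hf I (by norm_num) (by norm_num) hf2
    have hVi := hV2.integrable (by norm_num)
    have hfi := hf2.integrable (by norm_num)
    set I : Set ℤ := insert j (s : Set ℤ) with hI
    have hIc : ((insert j s : Finset ℤ) : Set ℤ) = I := by simp [hI]
    set dV := avg μ I V - avg μ s V with hdV
    set df := avg μ I f - avg μ s f with hdf
    have hdVm : StronglyMeasurable dV := (stronglyMeasurable_avg hV _).sub (stronglyMeasurable_avg hV _)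
    have hdfm : StronglyMeasurable df := (stronglyMeasurable_avg hf _).sub (stronglyMeasurable_avg hf _)
    have hdV2 : MemLp dV 2 (iidLaw μ) := (hVa _).sub (hVa _)
    have hdf2 : MemLp df 2 (iidLaw μ) := (hfa _).sub (hfa _)
    have hsI : (s : Set ℤ) ⊆ I := Set.subset_insert _ _
    have hdep : DependsOn dV I := fun e e' h => by
      simp only [hdV, Pi.sub_apply, dependsOn_avg (μ := μ) V I h,
        dependsOn_avg (μ := μ) V s (fun k hk => h k (hsI hk))]
    have h1 : ∫ e, inner ℂ (avg μ I V e) (f e) ∂(iidLaw μ) =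
        ∫ e, inner ℂ (avg μ s V e) (f e) ∂(iidLaw μ) + ∫ e, inner ℂ (dV e) (f e) ∂(iidLaw μ) := by
      rw [← integral_add (integrable_inner (hVa _) hf2) (integrable_inner hdV2 hf2)]
      refine integral_congr_ae (Eventually.of_forall fun e => ?_)
      simp only [hdV, Pi.sub_apply]
      rw [← inner_add_left, add_sub_cancel]
    have h2 : ∫ e, inner ℂ (dV e) (f e) ∂(iidLaw μ) = ∫ e, inner ℂ (dV e) (df e) ∂(iidLaw μ) := by
      rw [← integral_inner_avg hdVm hf le_rfl hdep hfi (integrable_inner hdV2 hf2)]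
      have h3 : ∀ e, inner ℂ (dV e) (avg μ I f e) =
          inner ℂ (dV e) (df e) + inner ℂ (dV e) (avg μ s f e) := fun e => by
        rw [← inner_add_right]; simp [hdf]
      simp_rw [h3]
      rw [integral_add (integrable_inner hdV2 hdf2) (integrable_inner hdV2 (hfa _))]
      have h4 : ∫ e, inner ℂ (dV e) (avg μ s f e) ∂(iidLaw μ) = 0 := by
        have h5 := integral_inner_avg_sub_avg (stronglyMeasurable_avg hf s) hV hsI
          (dependsOn_avg f s) hVi (integrable_inner (hfa _) hV2)
          (integrable_inner (hfa _) (hVa _)) (integrable_inner (hfa _) (hVa _))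
        have h6 := congrArg (starRingEnd ℂ) h5
        rw [← integral_conj, map_zero] at h6
        simpa only [inner_conj_symm] using h6
      rw [h4, add_zero]
    rw [hIc, h1, Finset.sum_insert hj, add_comm]
    refine (enorm_add_le _ _).trans (add_le_add ?_ ih)
    rw [h2]
    refine (enorm_integral_inner_le hdV2.1 hdf2.1).trans ?_
    have hj' : j ∉ (s : Set ℤ) := by simpa using hj
    gcongr
    · exact eLpNorm_avg_insert_sub_le hV hVi hj' (by norm_num) (by norm_num)
    · exact eLpNorm_avg_insert_sub_le hf hfi hj' (by norm_num) (by norm_num)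

/-- The covariance of two functions of independent variables is bounded by their influences. -/
theorem enorm_integral_inner_le_tsum {V f : (ℤ → S) → G} (hV : StronglyMeasurable V)
    (hf : StronglyMeasurable f) (hV2 : MemLp V 2 (iidLaw μ)) (hf2 : MemLp f 2 (iidLaw μ))
    (hV0 : ∫ e, V e ∂(iidLaw μ) = 0) :
    ‖∫ e, inner ℂ (V e) (f e) ∂(iidLaw μ)‖ₑ ≤ ∑' j, del μ 2 j V * del μ 2 j f := by
  have hlim : Tendsto (fun n : ℕ => ∑' j, del μ 2 j V * del μ 2 j f +
      eLpNorm (avg μ (Set.Icc (-n : ℤ) n) V - V) 2 (iidLaw μ) * eLpNorm f 2 (iidLaw μ)) atTop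
      (𝓝 (∑' j, del μ 2 j V * del μ 2 j f + 0 * eLpNorm f 2 (iidLaw μ))) :=
    tendsto_const_nhds.add (ENNReal.Tendsto.mul_const
      (tendsto_avg_window hV (by norm_num) (by norm_num) hV2) (Or.inr hf2.2.ne))
  rw [zero_mul, add_zero] at hlim
  refine ge_of_tendsto' hlim fun n => ?_
  have hVa := memLp_avg (μ := μ) hV (Set.Icc (-n : ℤ) n) (by norm_num) (by norm_num) hV2
  have h1 : ∫ e, inner ℂ (V e) (f e) ∂(iidLaw μ) =
      ∫ e, inner ℂ (avg μ (Set.Icc (-n : ℤ) n) V e) (f e) ∂(iidLaw μ) -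
      ∫ e, inner ℂ ((avg μ (Set.Icc (-n : ℤ) n) V - V) e) (f e) ∂(iidLaw μ) := by
    rw [← integral_sub (integrable_inner hVa hf2) (integrable_inner (hVa.sub hV2) hf2)]
    refine integral_congr_ae (Eventually.of_forall fun e => ?_)
    simp only [Pi.sub_apply]
    rw [← inner_sub_left, sub_sub_cancel]
  rw [h1]
  refine (enorm_sub_le).trans (add_le_add ?_ (enorm_integral_inner_le (hVa.sub hV2).1 hf2.1))
  have h2 := enorm_integral_inner_avg_le hV hf hV2 hf2 hV0 (Finset.Icc (-n : ℤ) n)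
  rw [Finset.coe_Icc] at h2
  exact h2.trans (ENNReal.sum_le_tsum _)

end CovarianceInequality

/-! ### The tensor product as a sesquilinear map into S₂(H). -/

section Tensor

set_option linter.unusedSectionVars false

variable {H : Type*} [NormedAddCommGroup H] [InnerProductSpace ℂ H] [CompleteSpace H]

theorem tensor_op (x y : H) : (tensor x y).op = InnerProductSpace.rankOne ℂ x y := rfl

theorem tensor_op_apply (x y v : H) : (tensor x y).op v = (inner ℂ y v : ℂ) • x := by
  rw [tensor_op, InnerProductSpace.rankOne_apply]

theorem norm_tensor (x y : H) : ‖tensor x y‖ = ‖x‖ * ‖y‖ := by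
  have h : ‖tensor x y‖ₑ ^ 2 = (‖x‖ₑ * ‖y‖ₑ) ^ 2 := by
    rw [HS.enorm_sq, mul_pow, ← isParseval_hilbertBasis (stdBasis H) y, ← ENNReal.tsum_mul_left]
    refine tsum_congr fun i => ?_
    rw [tensor_op_apply, enorm_smul, mul_pow, mul_comm,
        ← inner_conj_symm y, ← ofReal_norm (starRingEnd ℂ _), RCLike.norm_conj, ofReal_norm]
  have h1 : ‖tensor x y‖ₑ = ‖x‖ₑ * ‖y‖ₑ :=
    le_antisymm ((ENNReal.pow_le_pow_left_iff two_ne_zero).1 h.le)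
      ((ENNReal.pow_le_pow_left_iff two_ne_zero).1 h.ge)
  have h2 := congrArg ENNReal.toReal h1
  simpa [ENNReal.toReal_mul] using h2

theorem inner_tensor_left (x y : H) (M : HS H) :
    inner ℂ (tensor x y) M = inner ℂ x (M.op y) := by
  have h1 := (stdBasis H).hasSum_repr y
  have h2 := (h1.mapL M.op).mapL (innerSL ℂ x)
  rw [HS.inner_eq]
  have h3 : (fun i => inner ℂ ((tensor x y).op (stdBasis H i)) (M.op (stdBasis H i))) =
      fun i => innerSL ℂ x (M.op ((stdBasis H).repr y i • stdBasis H i)) := by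
    funext i
    rw [tensor_op_apply, inner_smul_left, map_smul, map_smul, inner_conj_symm,
      (stdBasis H).repr_apply_apply, innerSL_apply_apply, smul_eq_mul]
  rw [h3, h2.tsum_eq, innerSL_apply_apply]

theorem inner_tensor_right (x y : H) (M : HS H) :
    inner ℂ M (tensor x y) = inner ℂ (M.op y) x := by
  rw [← inner_conj_symm, inner_tensor_left, inner_conj_symm]

variable (H) in
/-- The tensor product as a bounded sesquilinear map. -/
def tensorL : H →L[ℂ] H →L⋆[ℂ] HS H :=
  LinearMap.mkContinuous₂ (LinearMap.mk₂'ₛₗ (RingHom.id ℂ) (starRingEnd ℂ) (tensor : H → H → HS H)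
    (fun x x' y => HS.op_injective (by ext v; simp [tensor_op_apply]))
    (fun c x y => HS.op_injective (by ext v; simpa [tensor_op_apply] using smul_comm _ _ _))
    (fun x y y' => HS.op_injective (by ext v; simp [tensor_op_apply, add_smul]))
    (fun c x y => HS.op_injective (by ext v; simpa [tensor_op_apply, mul_smul] using smul_comm _ _ _)))
    1 (fun x y => by
      rw [LinearMap.mk₂'ₛₗ_apply, norm_tensor, one_mul])

theorem tensorL_apply (x y : H) : tensorL H x y = tensor x y := rfl

theorem norm_tensorL_le (x y : H) : ‖tensorL H x y‖ ≤ ‖x‖ * ‖y‖ := (norm_tensor x y).le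

theorem norm_kron_apply_le (A B : H →L[ℂ] H) (C : HS H) : ‖kron A B C‖ ≤ ‖A‖ * ‖B‖ * ‖C‖ :=
  (kron A B).le_of_opNorm_le (LinearMap.mkContinuous_norm_le _ (by positivity) _) C

theorem kron_sub_left (A A' B : H →L[ℂ] H) (C : HS H) :
    kron (A - A') B C = kron A B C - kron A' B C :=
  HS.op_injective (by simp only [kron_op, map_sub]; ext v; simp)

theorem kron_sub_right (A B B' : H →L[ℂ] H) (C : HS H) :
    kron A (B - B') C = kron A B C - kron A B' C :=
  HS.op_injective (by simp only [kron_op, map_sub]; ext v; simp)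

theorem continuous_kron_self (C : HS H) : Continuous fun F : HS H => kron F.op F.op C := by
  have hop : Continuous fun F : HS H => F.op :=
    AddMonoidHomClass.continuous_of_bound (HS.op : HS H →ₗ[ℂ] (H →L[ℂ] H)) 1 fun F => by
      rw [one_mul]; exact HS.norm_op_le F
  refine Continuous.comp (g := fun A : H →L[ℂ] H => kron A A C) ?_ hop
  refine continuous_iff_continuousAt.2 fun A => ?_
  refine tendsto_iff_norm_sub_tendsto_zero.2 ?_
  have h1 : Tendsto (fun A' : H →L[ℂ] H => ‖A' - A‖ * ‖A'‖ * ‖C‖ + ‖A‖ * ‖A' - A‖ * ‖C‖) (𝓝 A)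
      (𝓝 (‖A - A‖ * ‖A‖ * ‖C‖ + ‖A‖ * ‖A - A‖ * ‖C‖)) := Continuous.tendsto (by fun_prop) A
  rw [sub_self, norm_zero] at h1
  simp only [zero_mul, mul_zero, add_zero] at h1
  refine squeeze_zero (fun _ => norm_nonneg _) (fun A' => ?_) h1
  have h2 : kron A' A' C - kron A A C = kron (A' - A) A' C + kron A (A' - A) C := by
    rw [kron_sub_left, kron_sub_right]; abel
  rw [h2]
  exact (norm_add_le _ _).trans (add_le_add (norm_kron_apply_le _ _ _) (norm_kron_apply_le _ _ _))

end Tensor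

/-! ### Cross-covariances and continuity of the spectral density. -/

section CrossCov

set_option linter.unusedSectionVars false

variable {S : Type*} [MeasurableSpace S] {μ : Measure S} [IsProbabilityMeasure μ]
variable {H : Type*} [NormedAddCommGroup H] [InnerProductSpace ℂ H] [CompleteSpace H]

variable (μ) in
/-- The lag-`h` cross-covariance `E[f(h) ⊗ g(0)]`. -/
def crossCov (f g : (ℤ → S) → H) (h : ℤ) : HS H :=
  ∫ e, tensor (f (shift h e)) (g e) ∂(iidLaw μ)

theorem integrable_tensor {α : Type*} [MeasurableSpace α] {ν : Measure α} [IsProbabilityMeasure ν]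
    {f g : α → H} (hf : MemLp f 4 ν) (hg : MemLp g 4 ν) :
    Integrable (fun a => tensor (f a) (g a)) ν :=
  (memLp_sesq norm_tensorL_le hf hg).integrable one_le_two

theorem del_two_le_four {f : (ℤ → S) → H} (hf : StronglyMeasurable f) (j : ℤ) :
    del μ 2 j f ≤ del μ 4 j f :=
  eLpNorm_le_eLpNorm_of_exponent_le (by norm_num) (stronglyMeasurable_del hf j).aestronglyMeasurable

/-- Test C = E[f(h) ⊗ g(0)] against itself: ‖C‖² is the covariance of Cg and f(h). The influences of
Cg are at most ‖C‖ times those of g, and one factor ‖C‖ cancels. -/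
theorem enorm_crossCov_le {f g : (ℤ → S) → H} (hf : StronglyMeasurable f)
    (hg : StronglyMeasurable g) (hf4 : MemLp f 4 (iidLaw μ)) (hg4 : MemLp g 4 (iidLaw μ))
    (hg0 : ∫ e, g e ∂(iidLaw μ) = 0) (h : ℤ) :
    ‖crossCov μ f g h‖ₑ ≤ ∑' j, del μ 4 j g * del μ 4 (j - h) f := by
  set C := crossCov μ f g h with hC
  by_cases hC0 : C = 0
  · simp [hC0]
  have hfs := memLp_comp_shift hf4 h
  have h24 : (2 : ℝ≥0∞) ≤ 4 := by norm_num
  have hCg2 : MemLp (fun e => C.op (g e)) 2 (iidLaw μ) := C.op.comp_memLp' (hg4.mono_exponent h24)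
  have h1 : inner ℂ C C = ∫ e, inner ℂ (C.op (g e)) (f (shift h e)) ∂(iidLaw μ) := by
    have h0 : inner ℂ C C = inner ℂ C (∫ e, tensor (f (shift h e)) (g e) ∂(iidLaw μ)) := rfl
    rw [h0, ← integral_inner (integrable_tensor hfs hg4)]
    simp_rw [inner_tensor_right]
  have h2 := enorm_integral_inner_le_tsum (V := fun e => C.op (g e)) (f := fun e => f (shift h e))
    (C.op.continuous.comp_stronglyMeasurable hg) (hf.comp_measurable (measurable_shift h))
    hCg2 (hfs.mono_exponent h24) (by
      rw [ContinuousLinearMap.integral_comp_comm _ (hg4.integrable (by norm_num)), hg0, map_zero])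
  rw [← h1] at h2
  have h3 : ∀ j, del μ 2 j (fun e => C.op (g e)) ≤ ‖C‖ₑ * del μ 4 j g := fun j => by
    refine le_trans ?_ (mul_le_mul_right (del_two_le_four hg j) _)
    rw [del, del]
    refine (eLpNorm_le_nnreal_smul_eLpNorm_of_ae_le_mul (c := ‖C‖₊)
      (Eventually.of_forall fun q => ?_) 2).trans le_rfl
    rw [← map_sub]
    refine (C.op.le_opNNNorm _).trans ?_
    gcongr
    exact HS.norm_op_le C
  have h4 : ∀ j, del μ 2 j (fun e => f (shift h e)) ≤ del μ 4 (j - h) f := fun j => by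
    rw [← del_comp_shift hf]
    exact del_two_le_four (f := f ∘ shift h) (hf.comp_measurable (measurable_shift h)) j
  have h5 : ‖C‖ₑ * ‖C‖ₑ ≤ ‖C‖ₑ * ∑' j, del μ 4 j g * del μ 4 (j - h) f := by
    have : ‖(inner ℂ C C : ℂ)‖ₑ = ‖C‖ₑ * ‖C‖ₑ := by
      rw [inner_self_eq_norm_sq_to_K, ← ofReal_norm, ← ofReal_norm,
        ← ENNReal.ofReal_mul (norm_nonneg _)]
      congr 1
      simp [sq]
    rw [← this, ← ENNReal.tsum_mul_left]
    refine h2.trans (ENNReal.tsum_le_tsum fun j => ?_)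
    rw [← mul_assoc]
    exact mul_le_mul' (h3 j) (h4 j)
  exact (ENNReal.mul_le_mul_iff_right (by simpa using hC0) enorm_ne_top).1 h5

/-- Summing the bound over h decouples the convolution of the influences into the product of their
sums. -/
theorem tsum_enorm_crossCov_le {f g : (ℤ → S) → H} (hf : StronglyMeasurable f)
    (hg : StronglyMeasurable g) (hf4 : MemLp f 4 (iidLaw μ)) (hg4 : MemLp g 4 (iidLaw μ))
    (hg0 : ∫ e, g e ∂(iidLaw μ) = 0) :
    ∑' h, ‖crossCov μ f g h‖ₑ ≤ theta μ f * theta μ g := by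
  refine (ENNReal.tsum_le_tsum fun h => enorm_crossCov_le hf hg hf4 hg4 hg0 h).trans (le_of_eq ?_)
  rw [ENNReal.tsum_comm]
  have : ∀ j, ∑' h, del μ 4 j g * del μ 4 (j - h) f = del μ 4 j g * theta μ f := fun j => by
    rw [ENNReal.tsum_mul_left]
    congr 1
    exact (Equiv.subLeft j).tsum_eq fun k => del μ 4 k f
  simp_rw [this]
  rw [ENNReal.tsum_mul_right, mul_comm]
  rfl

theorem crossCov_self_sub {f g : (ℤ → S) → H} (hf4 : MemLp f 4 (iidLaw μ))
    (hg4 : MemLp g 4 (iidLaw μ)) (h : ℤ) :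
    crossCov μ f f h - crossCov μ g g h = crossCov μ (f - g) f h + crossCov μ g (f - g) h := by
  have hfs := memLp_comp_shift hf4 h
  have hgs := memLp_comp_shift hg4 h
  have hds := memLp_comp_shift (hf4.sub hg4) h
  rw [crossCov, crossCov, crossCov, crossCov, ← integral_sub (integrable_tensor hfs hf4)
    (integrable_tensor hgs hg4), ← integral_add (integrable_tensor hds hf4)
    (integrable_tensor hgs (hf4.sub hg4))]
  refine integral_congr_ae (Eventually.of_forall fun e => ?_)
  simp only [← tensorL_apply, Pi.sub_apply, map_sub, sub_apply]
  abel

theorem summable_norm_of_tsum_enorm {E : Type*} [NormedAddCommGroup E] {c : ℤ → E}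
    (h : ∑' k, ‖c k‖ₑ ≠ ∞) : Summable fun k => ‖c k‖ := by
  have := ENNReal.summable_toReal h
  simpa using this

theorem ex_eq_cexp (lam : ℝ) (h : ℤ) :
    Complex.exp (-(Complex.I * (lam : ℂ) * (h : ℂ))) = ex lam (-h) := by
  rw [ex]; congr 1; push_cast; ring

theorem specDens_eq (f : (ℤ → S) → H) (lam : ℝ) :
    specDens (iidLaw μ) (fun t e => f (shift t e)) lam =
      (1 / (2 * (Real.pi : ℂ))) • ∑' h : ℤ, ex lam (-h) • crossCov μ f f h := by
  simp only [specDens, lagCov, ex_eq_cexp, shift_zero, crossCov]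

/-- The covariance is sesquilinear in the process, so the difference of the two series is a sum of
cross-covariances with one factor f - g_n, hence bounded by θ(f - g_n) times bounded quantities. -/
theorem tendsto_specDens {f : (ℤ → S) → H} (hf : StronglyMeasurable f)
    (hf4 : MemLp f 4 (iidLaw μ)) (hf0 : ∫ e, f e ∂(iidLaw μ) = 0) (hθ : theta μ f ≠ ∞)
    {g : ℕ → (ℤ → S) → H} (hg : ∀ n, StronglyMeasurable (g n))
    (hg4 : ∀ n, MemLp (g n) 4 (iidLaw μ)) (hg0 : ∀ n, ∫ e, g n e ∂(iidLaw μ) = 0)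
    (hθg : ∀ n, theta μ (g n) ≠ ∞)
    (hlim : Tendsto (fun n => theta μ (f - g n)) atTop (𝓝 0)) (lam : ℝ) :
    Tendsto (fun n => specDens (iidLaw μ) (fun t e => g n (shift t e)) lam) atTop
      (𝓝 (specDens (iidLaw μ) (fun t e => f (shift t e)) lam)) := by
  simp_rw [specDens_eq]
  refine Tendsto.const_smul ?_ _
  have hsum : ∀ u : (ℤ → S) → H, StronglyMeasurable u → MemLp u 4 (iidLaw μ) →
      ∫ e, u e ∂(iidLaw μ) = 0 → theta μ u ≠ ∞ →
      Summable fun h : ℤ => ex lam (-h) • crossCov μ u u h := fun u hu hu4 hu0 hθu => by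
    refine Summable.of_norm ?_
    simp only [norm_smul, norm_ex, one_mul]
    exact summable_norm_of_tsum_enorm (ne_top_of_le_ne_top (ENNReal.mul_ne_top hθu hθu)
      (tsum_enorm_crossCov_le hu hu hu4 hu4 hu0))
  rw [tendsto_iff_norm_sub_tendsto_zero]
  have hb : ∀ n, ‖∑' h : ℤ, ex lam (-h) • crossCov μ (g n) (g n) h -
      ∑' h : ℤ, ex lam (-h) • crossCov μ f f h‖ₑ ≤
      theta μ (f - g n) * theta μ f + (theta μ f + theta μ (f - g n)) * theta μ (f - g n) := by
    intro n
    have hd4 := hf4.sub (hg4 n)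
    have hd0 : ∫ e, (f - g n) e ∂(iidLaw μ) = 0 := by
      simp only [Pi.sub_apply]
      rw [integral_sub (hf4.integrable (by norm_num)) ((hg4 n).integrable (by norm_num)), hf0, hg0,
        sub_zero]
    rw [← enorm_neg, neg_sub, ← (hsum f hf hf4 hf0 hθ).tsum_sub (hsum _ (hg n) (hg4 n) (hg0 n) (hθg n))]
    refine enorm_tsum_le_tsum_enorm.trans ?_
    refine (ENNReal.tsum_le_tsum (g := fun h => ‖crossCov μ (f - g n) f h‖ₑ +
      ‖crossCov μ (g n) (f - g n) h‖ₑ) fun h => ?_).trans ?_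
    · rw [← smul_sub, crossCov_self_sub hf4 (hg4 n), enorm_smul, ← ofReal_norm (ex _ _), norm_ex,
        ENNReal.ofReal_one, one_mul]
      exact enorm_add_le _ _
    · rw [ENNReal.tsum_add]
      refine add_le_add (tsum_enorm_crossCov_le (hf.sub (hg n)) hf hd4 hf4 hf0)
        ((tsum_enorm_crossCov_le (hg n) (hf.sub (hg n)) (hg4 n) hd4 hd0).trans ?_)
      gcongr
      have := theta_sub_le (μ := μ) hf (hf.sub (hg n))
      rwa [sub_sub_cancel] at this
  have h0 : Tendsto (fun n => theta μ (f - g n) * theta μ f +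
      (theta μ f + theta μ (f - g n)) * theta μ (f - g n)) atTop (𝓝 0) := by
    have h1 := ENNReal.Tendsto.mul_const (b := theta μ f) hlim (Or.inr hθ)
    have h2 := ENNReal.Tendsto.mul (tendsto_const_nhds (x := theta μ f) |>.add hlim)
      (Or.inr (by simp)) hlim (Or.inr (by simpa using hθ))
    simpa using h1.add h2
  have h3 := tendsto_of_tendsto_of_tendsto_of_le_of_le tendsto_const_nhds h0
    (fun _ => zero_le) hb
  have h4 := (ENNReal.tendsto_toReal ENNReal.zero_ne_top).comp h3
  simpa [Function.comp_def] using h4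

end CrossCov

end QuadForm

end

noncomputable section
namespace QuadForm

/-! ### The covariance of the limit and its value for windows. -/

section LimitForm

set_option linter.unusedSectionVars false

variable {H : Type*} [NormedAddCommGroup H] [InnerProductSpace ℂ H] [CompleteSpace H]
variable {ι κ : Type*} [Fintype ι] [Fintype κ]

/-- The covariance of the real linear functionals of the limit that are given by `B` and `B'`. -/
def limForm (J : Conjugation H) (F : ℝ → HS H) (lam : ι → ℝ) (B B' : ι → HS H) : ℝ :=
  1 / 2 * (∑ j, ∑ k, (inner ℂ (B j) (Gam J F (lam j) (lam k) (B' k)) +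
    inner ℂ (B j) (Sig J F (lam j) (lam k) (J.barHS (B' k))))).re

theorem inner_Gam (J : Conjugation H) (F : ℝ → HS H) (lam lam' : ℝ) (B M : HS H) :
    inner ℂ B (Gam J F lam lam' M) =
      eta (lam - lam') * (4 * (Real.pi : ℂ) ^ 2 * inner ℂ B (kron (F lam).op (F lam).op M)) +
      eta (lam + lam') *
        (4 * (Real.pi : ℂ) ^ 2 * inner ℂ B (kron (F lam).op (F lam).op (J.transpose M))) := by
  simp only [Gam, kronT, smul_apply, add_apply, ContinuousLinearMap.coe_comp,
    Function.comp_apply, inner_smul_right, inner_add_right]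
  ring

theorem inner_Sig (J : Conjugation H) (F : ℝ → HS H) (lam lam' : ℝ) (B M : HS H) :
    inner ℂ B (Sig J F lam lam' M) =
      eta (lam + lam') * (4 * (Real.pi : ℂ) ^ 2 * inner ℂ B (kron (F lam).op (F lam).op M)) +
      eta (lam - lam') *
        (4 * (Real.pi : ℂ) ^ 2 * inner ℂ B (kron (F lam).op (F lam).op (J.transpose M))) := by
  simp only [Sig, kronT, smul_apply, add_apply, ContinuousLinearMap.coe_comp,
    Function.comp_apply, inner_smul_right, inner_add_right]
  ring

theorem tendsto_limForm (J : Conjugation H) {F : ℝ → HS H} {Fn : ℕ → ℝ → HS H}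
    (h : ∀ lam, Tendsto (fun n => Fn n lam) atTop (𝓝 (F lam))) (lam : ι → ℝ) (B B' : ι → HS H) :
    Tendsto (fun n => limForm J (Fn n) lam B B') atTop (𝓝 (limForm J F lam B B')) := by
  simp only [limForm, inner_Gam, inner_Sig]
  have hk : ∀ j (M : HS H), Tendsto (fun n => inner ℂ (B j)
      (kron (Fn n (lam j)).op (Fn n (lam j)).op M)) atTop
      (𝓝 (inner ℂ (B j) (kron (F (lam j)).op (F (lam j)).op M))) := fun j M =>
    tendsto_const_nhds.inner (((continuous_kron_self M).tendsto _).comp (h (lam j)))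
  refine Tendsto.const_mul _ ((Complex.continuous_re.tendsto _).comp ?_)
  refine tendsto_finsetSum _ fun j _ => tendsto_finsetSum _ fun k _ => ?_
  exact ((((hk _ _).const_mul _).const_mul _).add (((hk _ _).const_mul _).const_mul _)).add
    ((((hk _ _).const_mul _).const_mul _).add (((hk _ _).const_mul _).const_mul _))

theorem op_sum_smul_tensor_apply (x : κ → H) (f : κ → κ → ℂ) (v : H) :
    (∑ a, ∑ b, f a b • tensor (x a) (x b)).op v = ∑ a, ∑ b, (f a b * inner ℂ (x b) v) • x a := by
  simp only [map_sum, map_smul, sum_apply, smul_apply, tensor_op_apply, smul_smul]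

/-- The factor 4π² of Γ and Σ cancels the two factors 1/(2π) of the spectral densities, which leaves
the plain coefficient matrix f. -/
theorem inner_kron_sum_tensor (x : κ → H) (f : κ → κ → ℂ) (B M : HS H) {F : HS H}
    (hF : F = (1 / (2 * (Real.pi : ℂ))) • ∑ a, ∑ b, f a b • tensor (x a) (x b)) :
    4 * (Real.pi : ℂ) ^ 2 * inner ℂ B (kron F.op F.op M) =
      ∑ a, ∑ c, ∑ b, ∑ e, f a b * starRingEnd ℂ (f c e) * inner ℂ B (tensor (x a) (x c)) *
        inner ℂ (x b) (M.op (x e)) := by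
  have hadj : ∀ v, ContinuousLinearMap.adjoint (∑ a, ∑ b, f a b • tensor (x a) (x b)).op v =
      ∑ c, ∑ e, (starRingEnd ℂ (f c e) * inner ℂ (x c) v) • x e := fun v => by
    simp only [map_sum, map_smul, map_smulₛₗ, sum_apply, smul_apply, tensor_op,
      InnerProductSpace.adjoint_rankOne, InnerProductSpace.rankOne_apply, smul_smul]
  have h1 : 4 * (Real.pi : ℂ) ^ 2 * inner ℂ B (kron F.op F.op M) =
      inner ℂ B (kron (∑ a, ∑ b, f a b • tensor (x a) (x b)).op
        (∑ a, ∑ b, f a b • tensor (x a) (x b)).op M) := by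
    set G := ∑ a, ∑ b, f a b • tensor (x a) (x b)
    have h2 : kron G.op G.op M = (4 * (Real.pi : ℂ) ^ 2) • kron F.op F.op M := by
      apply HS.op_injective
      rw [map_smul, kron_op, kron_op, hF, map_smul, map_smulₛₗ]
      ext v
      simp only [ContinuousLinearMap.coe_comp, Function.comp_apply, smul_apply, map_smul, smul_smul]
      rw [show (4 * (Real.pi : ℂ) ^ 2 *
        ((starRingEnd ℂ) (1 / (2 * (Real.pi : ℂ))) * (1 / (2 * Real.pi)))) = 1 by
          simp only [map_div₀, map_one, map_mul, Complex.conj_ofReal, Complex.conj_ofNat]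
          have : (Real.pi : ℂ) ≠ 0 := by exact_mod_cast Real.pi_ne_zero
          field_simp; norm_num]
      rw [one_smul]
    rw [h2, inner_smul_right]
  have h3 : kron (∑ a, ∑ b, f a b • tensor (x a) (x b)).op
        (∑ a, ∑ b, f a b • tensor (x a) (x b)).op M =
      ∑ a, ∑ c, ∑ b, ∑ e, (f a b * starRingEnd ℂ (f c e) * inner ℂ (x b) (M.op (x e))) •
        tensor (x a) (x c) := by
    apply HS.op_injective
    ext v
    rw [kron_op, ContinuousLinearMap.comp_apply, ContinuousLinearMap.comp_apply, hadj,
      op_sum_smul_tensor_apply]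
    simp only [map_sum, map_smul, sum_apply, smul_apply, tensor_op_apply, smul_smul, inner_sum,
      inner_smul_right, Finset.mul_sum, Finset.sum_smul]
    refine Finset.sum_congr rfl fun a _ => ?_
    rw [Finset.sum_comm]
    refine Finset.sum_congr rfl fun c _ => Finset.sum_congr rfl fun b _ =>
      Finset.sum_congr rfl fun e _ => ?_
    congr 1; ring
  rw [h1, h3]
  simp only [inner_sum, inner_smul_right]
  refine Finset.sum_congr rfl fun a _ => Finset.sum_congr rfl fun c _ =>
    Finset.sum_congr rfl fun b _ => Finset.sum_congr rfl fun e _ => by ring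

theorem inner_op_of_conj (x y : H) (M : HS H) :
    inner ℂ x (M.op y) = starRingEnd ℂ (inner ℂ M (tensor x y)) := by
  rw [inner_tensor_right, inner_conj_symm]

theorem inner_transpose_op {J : Conjugation H} {x y : H} (hx : J.conj x = x) (hy : J.conj y = y)
    (M : HS H) :
    inner ℂ x ((J.transpose M).op y) = starRingEnd ℂ (inner ℂ M (tensor y x)) := by
  rw [J.transpose_op, ContinuousLinearMap.adjoint_inner_right, J.bar_apply, hx, ← inner_op_of_conj]
  nth_rw 1 [← hy]
  rw [J.inner_conj_conj]

theorem inner_barHS_tensor {J : Conjugation H} {x y : H} (hx : J.conj x = x) (hy : J.conj y = y)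
    (M : HS H) : inner ℂ (J.barHS M) (tensor x y) = starRingEnd ℂ (inner ℂ M (tensor x y)) := by
  rw [inner_tensor_right, inner_tensor_right, inner_conj_symm]
  have : (J.barHS M).op = J.bar M.op := rfl
  rw [this, J.bar_apply, hy]
  nth_rw 1 [← hx]
  rw [J.inner_conj_conj]

variable {S : Type*} [MeasurableSpace S] {μ : Measure S} [IsProbabilityMeasure μ]

/-- Exchanging a with c' and b with e conjugates the sum when Z is Hermitian, so the two halves of c
+ c* have equal real parts. The factor 2 turns the 1/4 of `formCov_eq` into the 1/2 of `limForm`. -/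
theorem re_sum_symm (f : κ → κ → ℂ) (c : κ → κ → ℂ) {Z : κ → κ → ℂ}
    (hZ : ∀ b e, starRingEnd ℂ (Z e b) = Z b e) :
    (∑ a, ∑ c', ∑ b, ∑ e, f a b * starRingEnd ℂ (f c' e) * (c a c' + starRingEnd ℂ (c c' a)) *
      Z b e).re =
    2 * (∑ a, ∑ c', ∑ b, ∑ e, f a b * starRingEnd ℂ (f c' e) * c a c' * Z b e).re := by
  have h1 : ∑ a, ∑ c', ∑ b, ∑ e, f a b * starRingEnd ℂ (f c' e) * starRingEnd ℂ (c c' a) * Z b e =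
      starRingEnd ℂ (∑ a, ∑ c', ∑ b, ∑ e, f a b * starRingEnd ℂ (f c' e) * c a c' * Z b e) := by
    simp only [map_sum, map_mul, Complex.conj_conj]
    rw [Finset.sum_comm]
    refine Finset.sum_congr rfl fun a _ => Finset.sum_congr rfl fun c' _ => ?_
    rw [Finset.sum_comm]
    refine Finset.sum_congr rfl fun b _ => Finset.sum_congr rfl fun e _ => ?_
    rw [hZ]; ring
  simp only [mul_add, add_mul, Finset.sum_add_distrib, Complex.add_re, h1, Complex.conj_re]
  ring

theorem conj_eta (x : ℝ) : starRingEnd ℂ (eta x) = eta x := by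
  by_cases h : ex x 1 = 1
  · rw [eta_eq_one h, map_one]
  · rw [eta_eq_zero h, map_zero]

/-- The limit covariance for a process that is a combination of scalar windows. -/
theorem limForm_window {J : Conjugation H} {m : ℕ} {χ : κ → (ℤ → S) → ℂ}
    (hr : ∀ a e, starRingEnd ℂ (χ a e) = χ a e) {x : κ → H} (hx : ∀ a, J.conj (x a) = x a)
    {F : ℝ → HS H} (lam : ι → ℝ)
    (hF : ∀ lam, F lam = (1 / (2 * (Real.pi : ℂ))) • ∑ a, ∑ b,
      (∫ e, mdTrans μ m lam (χ a) e * starRingEnd ℂ (mdTrans μ m lam (χ b) e) ∂(iidLaw μ)) •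
        tensor (x a) (x b)) (B B' : ι → HS H) :
    (limForm J F lam B B' : ℂ) = formCov μ lam (fun j a => mdTrans μ m (lam j) (χ a))
      (fun j a c => inner ℂ (B j) (tensor (x a) (x c)) +
        starRingEnd ℂ (inner ℂ (B j) (tensor (x c) (x a))))
      (fun j a c => inner ℂ (B' j) (tensor (x a) (x c)) +
        starRingEnd ℂ (inner ℂ (B' j) (tensor (x c) (x a)))) := by
  rw [formCov_eq hr lam _ _ (f := fun j a b => ∫ e, mdTrans μ m (lam j) (χ a) e *
      starRingEnd ℂ (mdTrans μ m (lam j) (χ b) e) ∂(iidLaw μ)) fun _ _ _ => rfl]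
  congr 1
  set f : ι → κ → κ → ℂ := fun j a b => ∫ e, mdTrans μ m (lam j) (χ a) e *
      starRingEnd ℂ (mdTrans μ m (lam j) (χ b) e) ∂(iidLaw μ) with hf
  set c : ι → κ → κ → ℂ := fun j a c => inner ℂ (B j) (tensor (x a) (x c)) with hc
  set c' : ι → κ → κ → ℂ := fun j a c => inner ℂ (B' j) (tensor (x a) (x c)) with hc'
  set Z : ι → ι → κ → κ → ℂ := fun j k b e =>
    eta (lam j - lam k) * starRingEnd ℂ (c' k b e + starRingEnd ℂ (c' k e b)) +
      eta (lam j + lam k) * (c' k b e + starRingEnd ℂ (c' k e b)) with hZ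
  have h1 : ∑ j, ∑ a, ∑ c'', ∑ k, ∑ b, ∑ e, f j a b * starRingEnd ℂ (f j c'' e) *
      (c j a c'' + starRingEnd ℂ (c j c'' a)) * Z j k b e =
      ∑ j, ∑ k, ∑ a, ∑ c'', ∑ b, ∑ e, f j a b * starRingEnd ℂ (f j c'' e) *
      (c j a c'' + starRingEnd ℂ (c j c'' a)) * Z j k b e := by
    refine Finset.sum_congr rfl fun j _ => ?_
    rw [Finset.sum_congr rfl fun a _ => Finset.sum_comm, Finset.sum_comm]
  rw [h1, limForm, Complex.re_sum, Complex.re_sum, Finset.mul_sum, Finset.mul_sum]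
  refine Finset.sum_congr rfl fun j _ => ?_
  rw [Complex.re_sum, Complex.re_sum, Finset.mul_sum, Finset.mul_sum]
  refine Finset.sum_congr rfl fun k _ => ?_
  rw [re_sum_symm (f j) (c j) (Z := Z j k) fun b e => ?_]
  · have hk : ∀ M, 4 * (Real.pi : ℂ) ^ 2 * inner ℂ (B j) (kron (F (lam j)).op (F (lam j)).op M) =
        ∑ a, ∑ c'', ∑ b, ∑ e, f j a b * starRingEnd ℂ (f j c'' e) * c j a c'' *
          inner ℂ (x b) (M.op (x e)) := fun M => inner_kron_sum_tensor x (f j) (B j) M (hF (lam j))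
    have h2 : inner ℂ (B j) (Gam J F (lam j) (lam k) (B' k)) +
        inner ℂ (B j) (Sig J F (lam j) (lam k) (J.barHS (B' k))) =
        ∑ a, ∑ c'', ∑ b, ∑ e, f j a b * starRingEnd ℂ (f j c'' e) * c j a c'' * Z j k b e := by
      rw [inner_Gam, inner_Sig, hk, hk, hk, hk]
      simp only [inner_transpose_op (hx _) (hx _), inner_barHS_tensor (hx _) (hx _),
        inner_op_of_conj, Complex.conj_conj, Finset.mul_sum, ← Finset.sum_add_distrib]
      refine Finset.sum_congr rfl fun a _ => Finset.sum_congr rfl fun c'' _ =>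
        Finset.sum_congr rfl fun b _ => Finset.sum_congr rfl fun e _ => ?_
      simp only [hZ, hc', map_add, Complex.conj_conj]
      ring
    rw [h2]; ring
  · simp only [hZ, map_add, map_mul, conj_eta, Complex.conj_conj]
    ring

theorem crossCov_window {χ : κ → (ℤ → S) → ℂ} (hb : ∀ a, BddMeas (χ a))
    (hr : ∀ a e, starRingEnd ℂ (χ a e) = χ a e) (x : κ → H) (h : ℤ) :
    crossCov μ (fun e => ∑ a, χ a e • x a) (fun e => ∑ a, χ a e • x a) h =
      ∑ a, ∑ b, (∫ e, χ a (shift h e) * χ b e ∂(iidLaw μ)) • tensor (x a) (x b) := by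
  have hi : ∀ a b, Integrable (fun e => (χ a (shift h e) * χ b e) • tensor (x a) (x b))
      (iidLaw μ) := fun a b =>
    (((hb a).comp (measurable_shift h)).mul (hb b)).integrable.smul_const _
  have h1 : ∀ e, tensor (∑ a, χ a (shift h e) • x a) (∑ a, χ a e • x a) =
      ∑ a, ∑ b, (χ a (shift h e) * χ b e) • tensor (x a) (x b) := fun e => by
    simp only [← tensorL_apply, map_sum, sum_apply, map_smul, map_smulₛₗ, smul_apply, hr,
      Finset.smul_sum, smul_smul, mul_comm]
    exact Finset.sum_comm
  simp only [crossCov, h1]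
  rw [integral_finsetSum _ fun a _ => integrable_finsetSum _ fun b _ => hi a b]
  refine Finset.sum_congr rfl fun a _ => ?_
  rw [integral_finsetSum _ fun b _ => hi a b]
  exact Finset.sum_congr rfl fun b _ => integral_smul_const _ _

/-- Beyond lag m the windows are disjoint and centred, so the series is finite. Its sum is a second
moment of the martingale approximations. -/
theorem specDens_window {m : ℕ} {χ : κ → (ℤ → S) → ℂ} (hχ : ∀ a, IsWindow μ m (χ a))
    (hr : ∀ a e, starRingEnd ℂ (χ a e) = χ a e) (x : κ → H) (lam : ℝ) :
    specDens (iidLaw μ) (fun t e => ∑ a, χ a (shift t e) • x a) lam =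
      (1 / (2 * (Real.pi : ℂ))) • ∑ a, ∑ b,
      (∫ e, mdTrans μ m lam (χ a) e * starRingEnd ℂ (mdTrans μ m lam (χ b) e) ∂(iidLaw μ)) •
        tensor (x a) (x b) := by
  rw [specDens_eq (μ := μ) (fun e => ∑ a, χ a e • x a)]
  congr 1
  simp only [crossCov_window (fun a => (hχ a).bdd) hr]
  have h0 : ∀ h : ℤ, h ∉ Finset.Icc (-m : ℤ) m → ∀ a b,
      ∫ e, χ a (shift h e) * χ b e ∂(iidLaw μ) = 0 := fun h hh a b => by
    rw [integral_mul_of_disjoint (U := fun e => χ a (shift h e)) (V := χ b)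
      ((hχ a).bdd.comp (measurable_shift h)).1 (hχ b).bdd.1 (I := Set.Icc (-m + h : ℤ) h)
      (I' := Set.Icc (-m : ℤ) 0) ?_
      (dependsOn_comp_shift (hχ a).dep h fun k hk => ?_) (hχ b).dep, (hχ b).integral_eq_zero,
      mul_zero]
    · rw [Set.disjoint_left]
      intro k hk hk'
      simp only [Finset.mem_Icc, Set.mem_Icc] at hh hk hk'
      omega
    · simp only [Set.mem_Icc] at hk ⊢; omega
  rw [tsum_eq_sum (s := Finset.Icc (-m : ℤ) m) fun h hh => by simp [h0 h hh]]
  simp_rw [← sum_integral_mul_ex (hχ _) (hχ _) (hr _) lam, Finset.sum_smul, Finset.smul_sum,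
    smul_smul]
  rw [Finset.sum_comm]
  exact Finset.sum_congr rfl fun a _ => Finset.sum_comm

end LimitForm

end QuadForm

end

noncomputable section
namespace QuadForm

/-! ### Centred forms in S₂(H) and their characteristic functionals. -/

section CanonicalForm

set_option linter.unusedSectionVars false

variable {S : Type*} [MeasurableSpace S] {μ : Measure S} [IsProbabilityMeasure μ]
variable {H : Type*} [NormedAddCommGroup H] [InnerProductSpace ℂ H] [CompleteSpace H]
variable {β : ℕ → ℤ → ℝ}

/-- The cross quadratic form `∑_{s,t ≤ T} β_{t-s} e^{iλ(t-s)} f(s) ⊗ g(t)`. -/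
def canonForm (β : ℕ → ℤ → ℝ) (lam : ℝ) (f g : (ℤ → S) → H) (T : ℕ) (e : ℤ → S) : HS H :=
  qform (tensorL H) f g (Finset.Icc (1 : ℤ) T) (Finset.Icc (1 : ℤ) T)
    (fun s t => β T (t - s) * ex lam (t - s)) e

variable (μ) in
/-- The centred cross quadratic form. -/
def centForm (β : ℕ → ℤ → ℝ) (lam : ℝ) (f g : (ℤ → S) → H) (T : ℕ) (e : ℤ → S) : HS H :=
  canonForm β lam f g T e - ∫ e', canonForm β lam f g T e' ∂(iidLaw μ)

theorem stronglyMeasurable_centForm {f g : (ℤ → S) → H} (hf : StronglyMeasurable f)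
    (hg : StronglyMeasurable g) (lam : ℝ) (T : ℕ) :
    StronglyMeasurable (centForm μ β lam f g T) :=
  (stronglyMeasurable_qform _ hf hg _ _ _).sub stronglyMeasurable_const

theorem memLp_canonForm {f g : (ℤ → S) → H} (hf : MemLp f 4 (iidLaw μ))
    (hg : MemLp g 4 (iidLaw μ)) (lam : ℝ) (T : ℕ) :
    MemLp (canonForm β lam f g T) 2 (iidLaw μ) :=
  memLp_qform norm_tensorL_le hf hg _ _ _

theorem memLp_centForm {f g : (ℤ → S) → H} (hf : MemLp f 4 (iidLaw μ))
    (hg : MemLp g 4 (iidLaw μ)) (lam : ℝ) (T : ℕ) :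
    MemLp (centForm μ β lam f g T) 2 (iidLaw μ) :=
  (memLp_canonForm hf hg lam T).sub (memLp_const _)

/-- The variance bound with total squared weight at most 1. As this holds for every T, and not just
eventually, the estimate is uniform in T, which tightness requires. -/
theorem eLpNorm_centForm_le (hβ : IsWeights β) {f g : (ℤ → S) → H} (hf : StronglyMeasurable f)
    (hg : StronglyMeasurable g) (hf4 : MemLp f 4 (iidLaw μ)) (hg4 : MemLp g 4 (iidLaw μ))
    (hf0 : ∫ e, f e ∂(iidLaw μ) = 0) (hg0 : ∫ e, g e ∂(iidLaw μ) = 0) (lam : ℝ) (T : ℕ) :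
    eLpNorm (centForm μ β lam f g T) 2 (iidLaw μ) ≤ 4 * (theta μ f * theta μ g) := by
  have h1 := eLpNorm_qform_sub_integral_le (b := tensorL H) norm_tensorL_le hf hg hf4 hg4 hf0 hg0
    (Finset.Icc (1 : ℤ) T) (Finset.Icc (1 : ℤ) T) (fun s t => β T (t - s) * ex lam (t - s))
  have h2 : ∑ i ∈ Finset.Icc (1 : ℤ) T, ∑ k ∈ Finset.Icc (1 : ℤ) T,
      ‖((β T (k - i) : ℂ) * ex lam (k - i))‖ₑ ^ 2 ≤ 1 := by
    have h3 := hβ.total_le T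
    rw [Finset.sum_comm] at h3
    have h4 := ENNReal.ofReal_le_ofReal h3
    rw [ENNReal.ofReal_one, ENNReal.ofReal_sum_of_nonneg
      (fun i _ => Finset.sum_nonneg fun k _ => sq_nonneg _)] at h4
    refine le_trans (le_of_eq ?_) h4
    refine Finset.sum_congr rfl fun i _ => ?_
    rw [ENNReal.ofReal_sum_of_nonneg fun k _ => sq_nonneg _]
    refine Finset.sum_congr rfl fun k _ => ?_
    rw [← ofReal_norm, norm_mul, norm_ex, mul_one, Complex.norm_real, ← ENNReal.ofReal_pow
      (norm_nonneg _), Real.norm_eq_abs, sq_abs]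
  have h5 : eLpNorm (centForm μ β lam f g T) 2 (iidLaw μ) ^ 2 ≤
      (4 * (theta μ f * theta μ g)) ^ 2 := by
    refine h1.trans ?_
    calc _ ≤ 16 * (theta μ f ^ 2 * theta μ g ^ 2 * 1) := by gcongr
      _ = _ := by rw [mul_one, mul_pow, mul_pow]; norm_num
  exact (ENNReal.pow_le_pow_left_iff two_ne_zero).1 h5

theorem centForm_self_sub {f g : (ℤ → S) → H} (hf4 : MemLp f 4 (iidLaw μ))
    (hg4 : MemLp g 4 (iidLaw μ)) (lam : ℝ) (T : ℕ) (e : ℤ → S) :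
    centForm μ β lam f f T e - centForm μ β lam g g T e =
      centForm μ β lam (f - g) f T e + centForm μ β lam g (f - g) T e := by
  have hi : ∀ {u v : (ℤ → S) → H}, MemLp u 4 (iidLaw μ) → MemLp v 4 (iidLaw μ) →
      Integrable (canonForm β lam u v T) (iidLaw μ) := fun hu hv =>
    (memLp_canonForm hu hv lam T).integrable one_le_two
  have h1 : ∀ e, canonForm β lam f f T e - canonForm β lam g g T e =
      canonForm β lam (f - g) f T e + canonForm β lam g (f - g) T e := fun e => by
    simp only [canonForm, qform, ← Finset.sum_sub_distrib, ← Finset.sum_add_distrib]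
    refine Finset.sum_congr rfl fun s _ => Finset.sum_congr rfl fun t _ => ?_
    rw [← smul_sub, ← smul_add]
    simp only [Pi.sub_apply, map_sub, sub_apply]
    congr 1; abel
  have h2 : ∫ e, canonForm β lam f f T e ∂(iidLaw μ) - ∫ e, canonForm β lam g g T e ∂(iidLaw μ) =
      ∫ e, canonForm β lam (f - g) f T e ∂(iidLaw μ) +
        ∫ e, canonForm β lam g (f - g) T e ∂(iidLaw μ) := by
    rw [← integral_sub (hi hf4 hf4) (hi hg4 hg4), ← integral_add (hi (hf4.sub hg4) hf4)
      (hi hg4 (hf4.sub hg4))]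
    exact integral_congr_ae (Eventually.of_forall h1)
  rw [centForm, centForm, centForm, centForm, sub_sub_sub_comm, h1, h2]
  abel

/-- The bound for the error in replacing `f` by `g`. -/
def replErr (μ : Measure S) [IsProbabilityMeasure μ] (f g : (ℤ → S) → H) : ℝ≥0∞ :=
  4 * (theta μ (f - g) * theta μ f) + 4 * (theta μ g * theta μ (f - g))

theorem eLpNorm_centForm_sub_le (hβ : IsWeights β) {f g : (ℤ → S) → H} (hf : StronglyMeasurable f)
    (hg : StronglyMeasurable g) (hf4 : MemLp f 4 (iidLaw μ)) (hg4 : MemLp g 4 (iidLaw μ))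
    (hf0 : ∫ e, f e ∂(iidLaw μ) = 0) (hg0 : ∫ e, g e ∂(iidLaw μ) = 0) (lam : ℝ) (T : ℕ) :
    eLpNorm (fun e => centForm μ β lam f f T e - centForm μ β lam g g T e) 2 (iidLaw μ) ≤
      replErr μ f g := by
  have hd4 := hf4.sub hg4
  have hd0 : ∫ e, (f - g) e ∂(iidLaw μ) = 0 := by
    simp only [Pi.sub_apply]
    rw [integral_sub (hf4.integrable (by norm_num)) (hg4.integrable (by norm_num)), hf0, hg0,
      sub_zero]
  simp_rw [centForm_self_sub hf4 hg4]
  refine (eLpNorm_add_le (memLp_centForm hd4 hf4 lam T).1 (memLp_centForm hg4 hd4 lam T).1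
    one_le_two).trans (add_le_add ?_ ?_)
  · exact eLpNorm_centForm_le hβ (hf.sub hg) hf hd4 hf4 hd0 hf0 lam T
  · exact eLpNorm_centForm_le hβ hg (hf.sub hg) hg4 hd4 hg0 hd0 lam T

/-- A sequence of combinations of finitely many real scalar windows that approximates `f`. -/
structure IsApprox (μ : Measure S) [IsProbabilityMeasure μ] (J : Conjugation H)
    (f : (ℤ → S) → H) (m : ℕ → ℕ) (K : ℕ → Finset H) (χ : ∀ n, K n → (ℤ → S) → ℂ)
    (x : ∀ n, K n → H) : Prop where
  window : ∀ n a, IsWindow μ (m n) (χ n a)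
  real : ∀ n a e, starRingEnd ℂ (χ n a e) = χ n a e
  conj_eq : ∀ n a, J.conj (x n a) = x n a
  tendsto : Tendsto (fun n => theta μ (f - fun e => ∑ a, χ n a e • x n a)) atTop (𝓝 0)

theorem exists_isApprox [TopologicalSpace.SeparableSpace H] (J : Conjugation H)
    {f : (ℤ → S) → H} (hf : StronglyMeasurable f) (h4 : MemLp f 4 (iidLaw μ))
    (hr : ∀ᵐ e ∂(iidLaw μ), J.conj (f e) = f e) (hθ : theta μ f ≠ ∞)
    (hd : DependsOn f (Set.Iic (0 : ℤ))) :
    ∃ m K χ x, IsApprox μ J f m K χ x := by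
  have h := fun n : ℕ => exists_approx J hf h4 hr hθ hd (r := ((n : ℝ≥0∞) + 1)⁻¹) (by simp)
  choose m K χ x h1 h2 h3 h5 using h
  refine ⟨m, K, χ, x, h1, h2, h3, ?_⟩
  refine tendsto_of_tendsto_of_tendsto_of_le_of_le tendsto_const_nhds ?_ (fun _ => zero_le) h5
  have := ENNReal.tendsto_inv_nat_nhds_zero.comp (tendsto_add_atTop_nat 1)
  refine this.congr fun n => ?_
  simp

variable {J : Conjugation H} {f : (ℤ → S) → H} {m : ℕ → ℕ} {K : ℕ → Finset H}
  {χ : ∀ n, K n → (ℤ → S) → ℂ} {x : ∀ n, K n → H}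

namespace IsApprox

theorem stronglyMeasurable (h : IsApprox μ J f m K χ x) (n : ℕ) :
    StronglyMeasurable fun e => ∑ a, χ n a e • x n a :=
  Finset.stronglyMeasurable_fun_sum _ fun a _ => (h.window n a).bdd.1.smul_const _

theorem memLp (h : IsApprox μ J f m K χ x) (n : ℕ) :
    MemLp (fun e => ∑ a, χ n a e • x n a) 4 (iidLaw μ) :=
  memLp_finsetSum _ fun a _ => MemLp.of_bound
    ((h.window n a).bdd.1.smul_const _).aestronglyMeasurable
    ((h.window n a).bdd.2.choose * ‖x n a‖) (Eventually.of_forall fun e => by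
      rw [norm_smul]
      gcongr
      exact (h.window n a).bdd.2.choose_spec e)

theorem integral_eq_zero (h : IsApprox μ J f m K χ x) (n : ℕ) :
    ∫ e, ∑ a, χ n a e • x n a ∂(iidLaw μ) = 0 := by
  rw [integral_finsetSum _ fun a _ => (h.window n a).bdd.integrable.smul_const _]
  refine Finset.sum_eq_zero fun a _ => ?_
  rw [integral_smul_const, (h.window n a).integral_eq_zero, zero_smul]

theorem theta_ne_top (h : IsApprox μ J f m K χ x) (n : ℕ) :
    theta μ (fun e => ∑ a, χ n a e • x n a) ≠ ∞ := by
  refine ne_top_of_le_ne_top ?_ (theta_le_of_dependsOn (h.stronglyMeasurable n)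
    (s := Finset.Icc (-(m n) : ℤ) 0) ?_)
  · exact ENNReal.mul_ne_top (ENNReal.natCast_ne_top _)
      (ENNReal.mul_ne_top (by simp) (h.memLp n).2.ne)
  · refine DependsOn.sum' fun a _ => DependsOn.comp' (f := χ n a) ?_ fun z => z • x n a
    simpa using (h.window n a).dep

theorem tendsto_replErr (h : IsApprox μ J f m K χ x) (hf : StronglyMeasurable f)
    (hθ : theta μ f ≠ ∞) :
    Tendsto (fun n => replErr μ f fun e => ∑ a, χ n a e • x n a) atTop (𝓝 0) := by
  have hlim := h.tendsto
  have h0 : Tendsto (fun n => 4 * (theta μ (f - fun e => ∑ a, χ n a e • x n a) * theta μ f) +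
      4 * ((theta μ f + theta μ (f - fun e => ∑ a, χ n a e • x n a)) *
        theta μ (f - fun e => ∑ a, χ n a e • x n a))) atTop (𝓝 0) := by
    have h1 := ENNReal.Tendsto.mul_const (b := theta μ f) hlim (Or.inr hθ)
    have h2 := ENNReal.Tendsto.mul (tendsto_const_nhds (x := theta μ f) |>.add hlim)
      (Or.inr (by simp)) hlim (Or.inr (by simpa using hθ))
    have h3 := (ENNReal.Tendsto.const_mul (a := 4) h1 (Or.inr (by simp))).add
      (ENNReal.Tendsto.const_mul (a := 4) h2 (Or.inr (by simp)))
    simpa using h3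
  refine tendsto_of_tendsto_of_tendsto_of_le_of_le tendsto_const_nhds h0 (fun _ => zero_le)
    fun n => ?_
  simp only [replErr]
  gcongr
  have := theta_sub_le (μ := μ) hf (hf.sub (h.stronglyMeasurable n))
  rwa [sub_sub_cancel] at this

end IsApprox

variable {ι : Type*} [Fintype ι]

/-- Puts the form in the span of the tensors x_a ⊗ x_c, with centred scalar forms as coefficients.
This feeds both the scalar limit theorem and the finite-dimensional approximation behind tightness.
-/
theorem centForm_window {κ : Type*} [Fintype κ] {χ : κ → (ℤ → S) → ℂ} (hb : ∀ a, BddMeas (χ a))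
    (hr : ∀ a e, starRingEnd ℂ (χ a e) = χ a e) (x : κ → H) (lam : ℝ) (T : ℕ)
    (e : ℤ → S) {Y : κ → κ → (ℤ → S) → ℂ}
    (hY : ∀ a c e, Y a c e = ∑ s ∈ Finset.Icc (1 : ℤ) T, ∑ t ∈ Finset.Icc (1 : ℤ) T,
      (β T (t - s) * ex lam (t - s)) * (χ a (shift s e) * χ c (shift t e))) :
    centForm μ β lam (fun e => ∑ a, χ a e • x a) (fun e => ∑ a, χ a e • x a) T e =
      ∑ a, ∑ c, (Y a c e - ∫ e', Y a c e' ∂(iidLaw μ)) • tensor (x a) (x c) := by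
  have hYb : ∀ a c, BddMeas (Y a c) := fun a c => by
    have h0 : Y a c = fun e => ∑ s ∈ Finset.Icc (1 : ℤ) T, ∑ t ∈ Finset.Icc (1 : ℤ) T,
      (β T (t - s) * ex lam (t - s)) * (χ a (shift s e) * χ c (shift t e)) :=
      funext fun e => hY a c e
    rw [h0]
    exact BddMeas.sum fun s _ => BddMeas.sum fun t _ => (BddMeas.const _).mul
      (((hb a).comp (measurable_shift _)).mul ((hb c).comp (measurable_shift _)))
  have h1 : ∀ e, canonForm β lam (fun e => ∑ a, χ a e • x a) (fun e => ∑ a, χ a e • x a) T e =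
      ∑ a, ∑ c, Y a c e • tensor (x a) (x c) := fun e => by
    have h2 : ∀ s t : ℤ, (β T (t - s) * ex lam (t - s)) •
        tensorL H (∑ a, χ a (shift s e) • x a) (∑ a, χ a (shift t e) • x a) =
        ∑ a, ∑ c, ((β T (t - s) * ex lam (t - s)) * (χ a (shift s e) * χ c (shift t e))) •
          tensor (x a) (x c) := fun s t => by
      simp only [map_sum, sum_apply, map_smul, map_smulₛₗ, smul_apply, hr, Finset.smul_sum,
        smul_smul, tensorL_apply]
      rw [Finset.sum_comm]
      refine Finset.sum_congr rfl fun a _ => Finset.sum_congr rfl fun c _ => ?_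
      congr 1; ring
    simp only [canonForm, qform, h2, hY, Finset.sum_smul]
    rw [Finset.sum_congr rfl fun s _ => Finset.sum_comm, Finset.sum_comm]
    refine Finset.sum_congr rfl fun a _ => ?_
    rw [Finset.sum_congr rfl fun s _ => Finset.sum_comm, Finset.sum_comm]
  have h3 : ∫ e, canonForm β lam (fun e => ∑ a, χ a e • x a) (fun e => ∑ a, χ a e • x a) T e
      ∂(iidLaw μ) = ∑ a, ∑ c, (∫ e', Y a c e' ∂(iidLaw μ)) • tensor (x a) (x c) := by
    simp only [h1]
    rw [integral_finsetSum _ fun a _ => integrable_finsetSum _ fun c _ =>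
      (hYb a c).integrable.smul_const _]
    refine Finset.sum_congr rfl fun a _ => ?_
    rw [integral_finsetSum _ fun c _ => (hYb a c).integrable.smul_const _]
    exact Finset.sum_congr rfl fun c _ => integral_smul_const _ _
  rw [centForm, h1, h3]
  simp only [← Finset.sum_sub_distrib, ← sub_smul]

/-- For each approximation g_n the limit is known, its variance converges to that of f, and
replacing f by g_n costs an error that is uniform in T. A three-term estimate lets n be fixed before
T grows. -/
theorem tendsto_charFun_canonForm (hβ : IsWeights β) (hf : StronglyMeasurable f)
    (hf4 : MemLp f 4 (iidLaw μ)) (hf0 : ∫ e, f e ∂(iidLaw μ) = 0) (hθ : theta μ f ≠ ∞)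
    (h : IsApprox μ J f m K χ x) (lam : ι → ℝ) (B : ι → HS H) :
    Tendsto (fun T : ℕ => ∫ e, Complex.exp (((∑ j, inner ℂ (B j)
        (centForm μ β (lam j) f f T e)).re : ℝ) * Complex.I) ∂(iidLaw μ)) atTop
      (𝓝 (Real.exp (-(limForm J (specDens (iidLaw μ) fun t e => f (shift t e)) lam B B / 2)) : ℂ)) := by
  set g : ℕ → (ℤ → S) → H := fun n e => ∑ a, χ n a e • x n a with hg
  set F : ℝ → HS H := specDens (iidLaw μ) fun t e => f (shift t e)
  set Fn : ℕ → ℝ → HS H := fun n => specDens (iidLaw μ) fun t e => g n (shift t e)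
  set cf : ((ℤ → S) → H) → ℕ → ℂ := fun u T => ∫ e, Complex.exp (((∑ j, inner ℂ (B j)
        (centForm μ β (lam j) u u T e)).re : ℝ) * Complex.I) ∂(iidLaw μ) with hcf
  have hn : ∀ n, Tendsto (cf (g n)) atTop
      (𝓝 (Real.exp (-(limForm J (Fn n) lam B B / 2)) : ℂ)) := fun n => by
    have h1 := tendsto_charFun_window hβ (h.window n) (h.real n) lam
      (fun j a c => inner ℂ (B j) (tensor (x n a) (x n c)))
      (Y := fun T j a c e => ∑ s ∈ Finset.Icc (1 : ℤ) T, ∑ t ∈ Finset.Icc (1 : ℤ) T,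
        (β T (t - s) * ex (lam j) (t - s)) * (χ n a (shift s e) * χ n c (shift t e)))
      (fun _ _ _ _ _ => rfl) (fun _ _ _ => rfl)
      (limForm_window (μ := μ) (m := m n) (F := Fn n) (h.real n) (h.conj_eq n) lam
        (specDens_window (h.window n) (h.real n) (x n)) B B)
    refine h1.congr fun T => ?_
    simp only [hcf, hg]
    refine integral_congr_ae (Eventually.of_forall fun e => ?_)
    simp only []
    congr 4
    refine Finset.sum_congr rfl fun j _ => ?_
    rw [centForm_window (fun a => (h.window n a).bdd) (h.real n) (x n) (lam j) T e
      (fun _ _ _ => rfl)]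
    simp only [inner_sum, inner_smul_right, mul_comm]
  have hv : Tendsto (fun n => (Real.exp (-(limForm J (Fn n) lam B B / 2)) : ℂ)) atTop
      (𝓝 (Real.exp (-(limForm J F lam B B / 2)) : ℂ)) := by
    have h1 := tendsto_limForm J (tendsto_specDens hf hf4 hf0 hθ h.stronglyMeasurable h.memLp
      h.integral_eq_zero h.theta_ne_top h.tendsto) lam B B
    exact ((by fun_prop : Continuous fun v : ℝ => ((Real.exp (-(v / 2)) : ℝ) : ℂ)).tendsto _).comp h1
  set err : ℕ → ℝ := fun n => (∑ j, ‖B j‖) * (replErr μ f (g n)).toReal with herr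
  have herr0 : Tendsto err atTop (𝓝 0) := by
    have h1 := (ENNReal.tendsto_toReal ENNReal.zero_ne_top).comp (h.tendsto_replErr hf hθ)
    have h2 := h1.const_mul (∑ j, ‖B j‖)
    rwa [ENNReal.toReal_zero, mul_zero] at h2
  have hcmp : ∀ n T, ‖cf f T - cf (g n) T‖ ≤ err n := fun n T => by
    have hgm := h.stronglyMeasurable n
    have hg4 := h.memLp n
    have hmeas : ∀ u : (ℤ → S) → H, StronglyMeasurable u → AEStronglyMeasurable (fun e =>
        (∑ j, inner ℂ (B j) (centForm μ β (lam j) u u T e)).re) (iidLaw μ) := fun u hu =>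
      (Complex.continuous_re.comp_stronglyMeasurable (Finset.stronglyMeasurable_fun_sum _ fun j _ =>
        stronglyMeasurable_const.inner
          (stronglyMeasurable_centForm hu hu (lam j) T))).aestronglyMeasurable
    set Z : ι → (ℤ → S) → HS H := fun j e =>
      centForm μ β (lam j) f f T e - centForm μ β (lam j) (g n) (g n) T e with hZ
    have hZ2 : ∀ j, MemLp (Z j) 2 (iidLaw μ) := fun j =>
      (memLp_centForm hf4 hf4 (lam j) T).sub (memLp_centForm hg4 hg4 (lam j) T)
    have hZi : ∀ j, Integrable (Z j) (iidLaw μ) := fun j => (hZ2 j).integrable one_le_two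
    have hne : replErr μ f (g n) ≠ ∞ := by
      have hd : theta μ (f - g n) ≠ ∞ := ne_top_of_le_ne_top
        (ENNReal.add_ne_top.2 ⟨hθ, h.theta_ne_top n⟩) (theta_sub_le hf hgm)
      exact ENNReal.add_ne_top.2 ⟨ENNReal.mul_ne_top (by simp) (ENNReal.mul_ne_top hd hθ),
        ENNReal.mul_ne_top (by simp) (ENNReal.mul_ne_top (h.theta_ne_top n) hd)⟩
    have hZn : ∀ j, ∫ e, ‖Z j e‖ ∂(iidLaw μ) ≤ (replErr μ f (g n)).toReal := fun j => by
      rw [integral_norm_eq_lintegral_enorm (hZi j).1]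
      refine ENNReal.toReal_mono hne ?_
      rw [← eLpNorm_one_eq_lintegral_enorm]
      exact (eLpNorm_le_eLpNorm_of_exponent_le one_le_two (hZi j).1).trans
        (eLpNorm_centForm_sub_le hβ hf hgm hf4 hg4 hf0 (h.integral_eq_zero n) (lam j) T)
    refine (norm_integral_cexp_sub_le (z := fun e => ∑ j, ‖B j‖ * ‖Z j e‖) (hmeas f hf)
      (hmeas _ hgm) (integrable_finsetSum _ fun j _ => (hZi j).norm.const_mul _)
      fun e => ?_).trans ?_
    · rw [← Complex.sub_re]
      refine (Complex.abs_re_le_norm _).trans ?_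
      rw [← Finset.sum_sub_distrib]
      refine norm_sum_le_of_le _ fun j _ => ?_
      rw [← inner_sub_right]
      exact norm_inner_le_norm _ _
    · rw [integral_finsetSum _ fun j _ => (hZi j).norm.const_mul _, herr]
      simp only [Finset.sum_mul, integral_const_mul]
      exact Finset.sum_le_sum fun j _ => by gcongr; exact hZn j
  rw [Metric.tendsto_nhds]
  intro r hr
  have hr3 : 0 < r / 3 := by positivity
  obtain ⟨n, hn1, hn2⟩ := ((herr0.eventually (gt_mem_nhds hr3)).and
    (Metric.tendsto_nhds.1 hv (r / 3) hr3)).exists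
  filter_upwards [Metric.tendsto_nhds.1 (hn n) (r / 3) hr3] with T hT
  have h1 : dist (cf f T) (cf (g n) T) ≤ err n := by rw [dist_eq_norm]; exact hcmp n T
  calc dist (cf f T) _ ≤ dist (cf f T) (cf (g n) T) +
        dist (cf (g n) T) (Real.exp (-(limForm J (Fn n) lam B B / 2)) : ℂ) +
        dist (Real.exp (-(limForm J (Fn n) lam B B / 2)) : ℂ) _ := dist_triangle4 _ _ _ _
    _ < r := by linarith

/-- Symmetry is not visible from Γ and Σ for arbitrary operators. It holds for window
approximations, where the form is `formCov`, and passes to the limit. -/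
theorem limForm_comm (hf : StronglyMeasurable f)
    (hf4 : MemLp f 4 (iidLaw μ)) (hf0 : ∫ e, f e ∂(iidLaw μ) = 0) (hθ : theta μ f ≠ ∞)
    (h : IsApprox μ J f m K χ x) (lam : ι → ℝ) (B B' : ι → HS H) :
    limForm J (specDens (iidLaw μ) fun t e => f (shift t e)) lam B B' =
      limForm J (specDens (iidLaw μ) fun t e => f (shift t e)) lam B' B := by
  have h1 := tendsto_limForm J (tendsto_specDens hf hf4 hf0 hθ h.stronglyMeasurable h.memLp
      h.integral_eq_zero h.theta_ne_top h.tendsto) lam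
  refine tendsto_nhds_unique (h1 B B') ((h1 B' B).congr fun n => ?_)
  have h2 := limForm_window (μ := μ) (m := m n) (F := specDens (iidLaw μ) fun t e =>
    ∑ a, χ n a (shift t e) • x n a) (h.real n) (h.conj_eq n) lam
        (specDens_window (h.window n) (h.real n) (x n))
  have h3 := (h2 B' B).trans ((formCov_comm _ _ _ _).trans (h2 B B').symm)
  exact_mod_cast h3

end CanonicalForm

end QuadForm

end

noncomputable section
namespace QuadForm

/-! ### Tightness by approximation in finite-dimensional subspaces. -/

section Tightness

/-- Intersect the closed thickenings of radii 1/(n + 1) with summable exceptional masses. The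
intersection is closed and totally bounded, hence compact by completeness. -/
theorem isTightMeasureSet_of_forall_cthickening {E : Type*} [MeasurableSpace E] [PseudoMetricSpace E]
    [CompleteSpace E] {𝓜 : Set (Measure E)}
    (h : ∀ r : ℝ, 0 < r → ∀ ε : ℝ≥0∞, 0 < ε →
      ∃ K : Set E, IsCompact K ∧ ∀ ν ∈ 𝓜, ν (Metric.cthickening r K)ᶜ ≤ ε) :
    IsTightMeasureSet 𝓜 := by
  rw [isTightMeasureSet_iff_exists_isCompact_measure_compl_le]
  intro ε hε
  obtain ⟨ε', hε', hsum⟩ := ENNReal.exists_pos_sum_of_countable' hε.ne' ℕ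
  choose K hK hK' using fun n : ℕ => h (1 / ((n : ℝ) + 1)) (by positivity) (ε' n) (hε' n)
  refine ⟨⋂ n : ℕ, Metric.cthickening (1 / ((n : ℝ) + 1)) (K n), ?_, fun ν hν => ?_⟩
  · refine TotallyBounded.isCompact_of_isClosed ?_
      (isClosed_iInter fun n => Metric.isClosed_cthickening)
    refine Metric.totallyBounded_iff.2 fun δ hδ => ?_
    obtain ⟨n, hn⟩ := exists_nat_one_div_lt (half_pos hδ)
    obtain ⟨t, ht, hcov⟩ := Metric.totallyBounded_iff.1 (hK n).totallyBounded (δ / 2) (half_pos hδ)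
    refine ⟨t, ht, fun y hy => ?_⟩
    have hy' := Set.mem_iInter.1 hy n
    rw [(hK n).cthickening_eq_biUnion_closedBall (by positivity)] at hy'
    obtain ⟨z, hz, hyz⟩ := Set.mem_iUnion₂.1 hy'
    obtain ⟨w, hw, hzw⟩ := Set.mem_iUnion₂.1 (hcov hz)
    refine Set.mem_iUnion₂.2 ⟨w, hw, ?_⟩
    rw [Metric.mem_ball] at hzw ⊢
    have := dist_triangle y z w
    have h2 := Metric.mem_closedBall.1 hyz
    linarith
  · rw [Set.compl_iInter]
    exact (measure_iUnion_le _).trans ((ENNReal.tsum_le_tsum fun n => hK' n ν hν).trans hsum.le)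

theorem measure_lt_enorm_le {Ω G : Type*} [MeasurableSpace Ω] {P : Measure Ω}
    [IsProbabilityMeasure P] [NormedAddCommGroup G] {X : Ω → G} (hX : AEStronglyMeasurable X P)
    {R : ℝ} (hR : 0 < R) :
    P {ω | R < ‖X ω‖} ≤ eLpNorm X 2 P / ENNReal.ofReal R := by
  have h1 : {ω | R < ‖X ω‖} ⊆ {ω | ENNReal.ofReal R ≤ ‖X ω‖ₑ} := fun ω hω => by
    simp only [Set.mem_ofPred_eq] at hω ⊢
    rw [← ofReal_norm]
    exact ENNReal.ofReal_le_ofReal hω.le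
  refine (measure_mono h1).trans ((meas_ge_le_lintegral_div hX.enorm (by simpa using hR)
    ENNReal.ofReal_ne_top).trans ?_)
  gcongr
  rw [← eLpNorm_one_eq_lintegral_enorm]
  exact eLpNorm_le_eLpNorm_of_exponent_le one_le_two hX

/-- Closed balls of a finite-dimensional subspace are compact. Markov's inequality bounds the
probability that an approximation W leaves such a ball, and that Z is farther than r from W,
uniformly in T. -/
theorem isTightMeasureSet_of_finiteDimensional_approx {Ω G ι : Type*} [MeasurableSpace Ω]
    {P : Measure Ω} [IsProbabilityMeasure P] [Fintype ι] [NormedAddCommGroup G] [NormedSpace ℂ G]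
    [CompleteSpace G] [MeasurableSpace G] [BorelSpace G] [SecondCountableTopology G]
    {Z : ℕ → ι → Ω → G} (hZ : ∀ T j, StronglyMeasurable (Z T j))
    (h : ∀ δ : ℝ≥0∞, δ ≠ 0 → ∃ (V : Submodule ℂ G) (_ : FiniteDimensional ℂ V)
      (W : ℕ → ι → Ω → G) (C : ℝ≥0∞), C ≠ ∞ ∧ ∀ T j, (∀ ω, W T j ω ∈ V) ∧
        StronglyMeasurable (W T j) ∧ eLpNorm (W T j) 2 P ≤ C ∧
        eLpNorm (Z T j - W T j) 2 P ≤ δ) :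
    IsTightMeasureSet (Set.range fun T => P.map fun ω j => Z T j ω) := by
  refine isTightMeasureSet_of_forall_cthickening fun r hr ε hε => ?_
  rcases eq_or_ne ε ∞ with rfl | hεt
  · exact ⟨∅, isCompact_empty, fun _ _ => le_top⟩
  set d : ℝ≥0∞ := (Fintype.card ι : ℝ≥0∞) + 1 with hd
  have hd0 : d ≠ 0 := by simp [hd]
  have hdt : d ≠ ∞ := by simp [hd]
  have hε2 : ε / 2 / d ≠ 0 := by
    simp [ENNReal.div_eq_zero_iff, hε.ne', hdt]
  have hrne : ENNReal.ofReal r ≠ 0 := by simpa using hr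
  obtain ⟨V, _, W, C, hC, hW⟩ := h (ε / 2 / d * ENNReal.ofReal r) (mul_ne_zero hε2 hrne)
  -- a radius for the approximations
  set R : ℝ := (C / (ε / 2 / d)).toReal + 1 with hR
  have hR0 : 0 < R := by positivity
  have hCR : C / ENNReal.ofReal R ≤ ε / 2 / d := by
    have hεdt : ε / 2 / d ≠ ∞ := ENNReal.div_ne_top (ENNReal.div_ne_top hεt (by simp)) hd0
    rw [ENNReal.div_le_iff (by simpa using hR0) ENNReal.ofReal_ne_top, mul_comm,
      ← ENNReal.div_le_iff hε2 hεdt, hR]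
    refine (ENNReal.ofReal_toReal (ENNReal.div_ne_top hC hε2)).ge.trans ?_
    exact ENNReal.ofReal_le_ofReal (by linarith)
  have : ProperSpace V := FiniteDimensional.proper ℂ V
  refine ⟨Set.univ.pi fun _ : ι => (Subtype.val '' (Metric.closedBall (0 : V) R) : Set G), ?_, ?_⟩
  · exact isCompact_univ_pi fun _ => (isCompact_closedBall _ _).image continuous_subtype_val
  rintro _ ⟨T, rfl⟩
  simp only []
  set K : Set (ι → G) := Set.univ.pi fun _ : ι => (Subtype.val '' (Metric.closedBall (0 : V) R) : Set G)
    with hK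
  have hmeas : Measurable fun ω j => Z T j ω := measurable_pi_lambda _ fun j => (hZ T j).measurable
  rw [Measure.map_apply hmeas Metric.isClosed_cthickening.measurableSet.compl]
  have hsub : (fun ω j => Z T j ω) ⁻¹' (Metric.cthickening r K)ᶜ ⊆
      (⋃ j, {ω | R < ‖W T j ω‖}) ∪ ⋃ j, {ω | r < ‖(Z T j - W T j) ω‖} := by
    intro ω hω
    by_contra hc
    simp only [Set.mem_union, Set.mem_iUnion, Set.mem_ofPred_eq, not_or, not_exists, not_lt,
      Pi.sub_apply] at hc
    apply hω
    refine Metric.mem_cthickening_of_dist_le _ (fun j => W T j ω) _ _ ?_ ?_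
    · intro j _
      exact ⟨⟨W T j ω, (hW T j).1 ω⟩, by simpa using hc.1 j, rfl⟩
    · rw [dist_pi_le_iff hr.le]
      intro j
      rw [dist_eq_norm]
      exact hc.2 j
  refine (measure_mono hsub).trans ((measure_union_le _ _).trans ?_)
  have hb : ∀ (A : ι → Set Ω), (∀ j, P (A j) ≤ ε / 2 / d) → P (⋃ j, A j) ≤ ε / 2 := fun A hA => by
    refine (measure_iUnion_le A).trans ((ENNReal.tsum_le_tsum hA).trans ?_)
    rw [tsum_fintype, Finset.sum_const, nsmul_eq_mul, Finset.card_univ]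
    calc _ ≤ d * (ε / 2 / d) := by gcongr; simp [hd]
      _ = ε / 2 := ENNReal.mul_div_cancel hd0 hdt
  refine (add_le_add (hb _ fun j => ?_) (hb _ fun j => ?_)).trans (ENNReal.add_halves ε).le
  · refine (measure_lt_enorm_le (hW T j).2.1.aestronglyMeasurable hR0).trans (le_trans ?_ hCR)
    gcongr
    exact (hW T j).2.2.1
  · refine (measure_lt_enorm_le ((hZ T j).sub (hW T j).2.1).aestronglyMeasurable hr).trans ?_
    rw [ENNReal.div_le_iff hrne ENNReal.ofReal_ne_top]
    exact (hW T j).2.2.2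

end Tightness

/-! ### Gaussian limits from tightness and characteristic functionals. -/

section GaussianLimit

set_option linter.unusedSectionVars false

variable {E : Type*} [NormedAddCommGroup E] [NormedSpace ℝ E] [CompleteSpace E] [MeasurableSpace E]
  [BorelSpace E] [SecondCountableTopology E]

/-- V ≥ 0 is forced by the bound 1 on characteristic functions. Homogeneity of V then identifies the
whole characteristic function of each one-dimensional marginal. -/
theorem gaussian_of_charFunDual {μ : Measure E} [IsProbabilityMeasure μ] {V : StrongDual ℝ E → ℝ}
    (hV : ∀ (u : ℝ) L, V (u • L) = u ^ 2 * V L)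
    (h : ∀ L, charFunDual μ L = (Real.exp (-(V L / 2)) : ℂ)) (L : StrongDual ℝ E) :
    ∃ v : NNReal, (v : ℝ) = V L ∧ μ.map L = gaussianReal 0 v := by
  have hV0 : 0 ≤ V L := by
    have := Measure.isProbabilityMeasure_map (μ := μ) (f := L) L.continuous.measurable.aemeasurable
    have h1 := norm_charFun_le_one (μ := μ.map L) (1 : ℝ)
    rw [← charFunDual_eq_charFun_map_one, h, Complex.norm_real,
      Real.norm_of_nonneg (Real.exp_pos _).le, Real.exp_le_one_iff] at h1
    linarith
  refine ⟨(V L).toNNReal, Real.coe_toNNReal _ hV0, ?_⟩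
  refine Measure.ext_of_charFun (funext fun u => ?_)
  rw [charFun_map_eq_charFunDual_smul, h, hV, charFun_gaussianReal, Real.coe_toNNReal _ hV0]
  push_cast
  congr 1
  ring

/-- Prokhorov gives a cluster point. The characteristic functional is weakly continuous, so all
cluster points share the given one, hence coincide, and the sequence converges. -/
theorem exists_gaussian_limit {ν : ℕ → ProbabilityMeasure E}
    (ht : IsTightMeasureSet (Set.range fun n => (ν n : Measure E))) {V : StrongDual ℝ E → ℝ}
    (hV : ∀ (u : ℝ) L, V (u • L) = u ^ 2 * V L)
    (h : ∀ L, Tendsto (fun n => charFunDual (ν n : Measure E) L) atTop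
      (𝓝 (Real.exp (-(V L / 2)) : ℂ))) :
    ∃ μ : ProbabilityMeasure E, Tendsto ν atTop (𝓝 μ) ∧ ∀ L : StrongDual ℝ E,
      ∃ v : NNReal, (v : ℝ) = V L ∧ (μ : Measure E).map L = gaussianReal 0 v := by
  have hcpt : IsCompact (closure (Set.range ν)) := isCompact_closure_of_isTightMeasureSet (by
    convert ht using 1
    ext x; simp)
  have hmem : ∀ n, ν n ∈ closure (Set.range ν) := fun n => subset_closure ⟨n, rfl⟩
  have hcl : ∀ μ : ProbabilityMeasure E, MapClusterPt μ atTop ν → ∀ L,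
      charFunDual (μ : Measure E) L = (Real.exp (-(V L / 2)) : ℂ) := fun μ hμ L => by
    have hc : Continuous fun μ : ProbabilityMeasure E => charFunDual (μ : Measure E) L := by
      refine continuous_iff_continuousAt.2 fun μ => ?_
      exact (ProbabilityMeasure.tendsto_iff_forall_integral_rclike_tendsto ℂ).1 tendsto_id
        (BoundedContinuousFunction.probCharDual L)
    have h1 : MapClusterPt (charFunDual (μ : Measure E) L) atTop
        ((fun μ : ProbabilityMeasure E => charFunDual (μ : Measure E) L) ∘ ν) :=
      hμ.continuousAt_comp hc.continuousAt
    have h2 : ClusterPt (charFunDual (μ : Measure E) L) (𝓝 (Real.exp (-(V L / 2)) : ℂ)) :=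
      ClusterPt.mono h1 (h L)
    exact eq_of_nhds_neBot h2
  obtain ⟨μ, -, hμ⟩ := hcpt.exists_mapClusterPt (f := atTop) (u := ν) (by simp [hmem])
  refine ⟨μ, hcpt.tendsto_nhds_of_unique_mapClusterPt (Eventually.of_forall hmem) fun μ' _ hμ' => ?_,
    gaussian_of_charFunDual hV (hcl μ hμ)⟩
  refine Subtype.ext (?_ : (μ' : Measure E) = μ)
  refine Measure.ext_of_charFunDual (funext fun L => ?_)
  rw [hcl μ hμ, hcl μ' hμ']

end GaussianLimit

end QuadForm

end

noncomputable section
namespace QuadForm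

/-! ### Real linear functionals on powers of a complex Hilbert space. -/

section RealFunctionals

set_option linter.unusedSectionVars false

variable {ι G : Type*} [Fintype ι] [NormedAddCommGroup G] [InnerProductSpace ℂ G]

/-- The real linear functional `q ↦ Re ∑ⱼ ⟪Bⱼ, qⱼ⟫`. -/
def reInner (B : ι → G) : StrongDual ℝ (ι → G) :=
  ∑ j, (Complex.reCLM.comp ((innerSL ℂ (B j)).restrictScalars ℝ)).comp (ContinuousLinearMap.proj j)

theorem reInner_apply (B q : ι → G) : reInner B q = (∑ j, inner ℂ (B j) (q j)).re := by
  simp [reInner, sum_apply]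

theorem reInner_add (B B' q : ι → G) : reInner (B + B') q = reInner B q + reInner B' q := by
  simp [reInner_apply, Finset.sum_add_distrib]

theorem reInner_single [DecidableEq ι] (i : ι) (B : G) (q : ι → G) :
    reInner (Pi.single i B) q = (inner ℂ B (q i)).re := by
  rw [reInner_apply, Finset.sum_eq_single i (fun j _ hj => by simp [hj]) (by simp), Pi.single_eq_same]

variable [CompleteSpace G] [DecidableEq ι]

/-- The vector that represents a real linear functional. -/
def reDual (L : StrongDual ℝ G) : G :=
  letI := InnerProductSpace.rclikeToReal ℂ G
  (InnerProductSpace.toDual ℝ G).symm L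

theorem re_inner_reDual (L : StrongDual ℝ G) (x : G) : (inner ℂ (reDual L) x).re = L x :=
  let := InnerProductSpace.rclikeToReal ℂ G
  InnerProductSpace.toDual_symm_apply (𝕜 := ℝ) (x := x) (y := L)

theorem reDual_smul (u : ℝ) (L : StrongDual ℝ G) : reDual (u • L) = u • reDual L := by
  let := InnerProductSpace.rclikeToReal ℂ G
  exact ((InnerProductSpace.toDual ℝ G).symm.map_smulₛₗ u L).trans (by simp [reDual])

theorem reDual_eq {L : StrongDual ℝ G} {z : G} (h : ∀ x, (inner ℂ z x).re = L x) :
    reDual L = z := by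
  have h1 : ∀ x, (inner ℂ (reDual L - z) x).re = 0 := fun x => by
    rw [inner_sub_left, Complex.sub_re, re_inner_reDual, h, sub_self]
  have h2 := h1 (reDual L - z)
  rw [inner_self_eq_norm_sq_to_K, ← RCLike.ofReal_pow] at h2
  exact sub_eq_zero.1 (norm_eq_zero.1 (pow_eq_zero_iff two_ne_zero |>.1 (by exact_mod_cast h2)))

/-- The vectors that represent a real linear functional. -/
def rieszRep (L : StrongDual ℝ (ι → G)) (j : ι) : G :=
  reDual (L.comp (ContinuousLinearMap.single ℝ (fun _ : ι => G) j))

theorem reInner_rieszRep (L : StrongDual ℝ (ι → G)) : reInner (rieszRep L) = L := by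
  ext q
  rw [reInner_apply, Complex.re_sum]
  simp_rw [rieszRep, re_inner_reDual]
  simp only [ContinuousLinearMap.coe_comp, Function.comp_apply, ContinuousLinearMap.single_apply,
    ← map_sum]
  rw [Finset.univ_sum_single]

theorem rieszRep_reInner (B : ι → G) : rieszRep (reInner B) = B :=
  funext fun j => reDual_eq fun x => by
    rw [ContinuousLinearMap.comp_apply, ContinuousLinearMap.single_apply, reInner_apply,
      Finset.sum_eq_single j (fun k _ hk => by simp [hk]) (by simp), Pi.single_eq_same]

theorem rieszRep_smul (u : ℝ) (L : StrongDual ℝ (ι → G)) : rieszRep (u • L) = u • rieszRep L :=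
  funext fun j => by
    rw [Pi.smul_apply, rieszRep, rieszRep, ← reDual_smul, ContinuousLinearMap.smul_comp]

end RealFunctionals

/-! ### Conjugation on S₂(H). -/

section ConjugateHS

variable {H : Type*} [NormedAddCommGroup H] [InnerProductSpace ℂ H] [CompleteSpace H]
  (J : Conjugation H)

theorem Conjugation.barHS_add (C D : HS H) : J.barHS (C + D) = J.barHS C + J.barHS D :=
  HS.op_injective (by ext v; simp [Conjugation.barHS, Conjugation.bar_apply])

theorem Conjugation.barHS_smul (c : ℂ) (C : HS H) :
    J.barHS (c • C) = starRingEnd ℂ c • J.barHS C :=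
  HS.op_injective (by ext v; simp [Conjugation.barHS, Conjugation.bar_apply, map_smulₛₗ])

theorem Conjugation.barHS_barHS (C : HS H) : J.barHS (J.barHS C) = C :=
  HS.op_injective (by ext v; simp [Conjugation.barHS, Conjugation.bar_apply, J.conj_conj])

theorem Conjugation.barHS_zero : J.barHS 0 = 0 := by
  simpa using J.barHS_smul 0 0

theorem Conjugation.norm_barHS (C : HS H) : ‖J.barHS C‖ = ‖C‖ := by
  have h : ‖J.barHS C‖ₑ ^ 2 = ‖C‖ₑ ^ 2 := by
    rw [HS.enorm_sq, HS.enorm_sq]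
    exact J.hsSum_bar (isParseval_hilbertBasis _) _
  rw [← toReal_enorm, ← toReal_enorm, le_antisymm
    ((ENNReal.pow_le_pow_left_iff two_ne_zero).1 h.le)
    ((ENNReal.pow_le_pow_left_iff two_ne_zero).1 h.ge)]

/-- Conjugation is an antilinear isometric involution of S₂(H), so the four norms in the
polarisation identity for one side match those for the other, two of them after multiplication by
±i. -/
theorem Conjugation.inner_barHS_left (C D : HS H) :
    inner ℂ (J.barHS C) D = inner ℂ (J.barHS D) C := by
  have h : ∀ c : ℂ, ‖J.barHS C + c • D‖ = ‖C + starRingEnd ℂ c • J.barHS D‖ := fun c => by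
    rw [← J.norm_barHS (J.barHS C + c • D), J.barHS_add, J.barHS_barHS, J.barHS_smul]
  have h1 := h 1
  have h2 := h (-1)
  have h3 := h Complex.I
  have h4 := h (-Complex.I)
  have h5 : ‖C + (-Complex.I) • J.barHS D‖ = ‖J.barHS D + Complex.I • C‖ := by
    rw [← one_mul ‖J.barHS D + _‖, ← Complex.norm_I, ← norm_neg Complex.I, ← norm_smul, smul_add,
      smul_smul]
    simp [add_comm]
  have h6 : ‖C + Complex.I • J.barHS D‖ = ‖J.barHS D - Complex.I • C‖ := by
    rw [← one_mul ‖J.barHS D - _‖, ← Complex.norm_I, ← norm_smul, smul_sub, smul_smul]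
    simp [add_comm]
  simp only [map_neg, map_one, one_smul, neg_smul, ← sub_eq_add_neg, Complex.conj_I,
    sub_neg_eq_add] at h1 h2 h3 h4 h5
  rw [inner_eq_sum_norm_sq_div_four, inner_eq_sum_norm_sq_div_four]
  simp only [Complex.coe_algebraMap, RCLike.I_to_complex]
  rw [h1, h2, h3, h4, h5, h6, add_comm C, ← norm_neg (C - _), neg_sub]

end ConjugateHS

/-! ### Algebra of the limit covariance. -/

section LimitForm

set_option linter.unusedSectionVars false

variable {H : Type*} [NormedAddCommGroup H] [InnerProductSpace ℂ H] [CompleteSpace H]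
variable {ι : Type*} [Fintype ι] (J : Conjugation H) (F : ℝ → HS H) (lam : ι → ℝ)

theorem limForm_add_left (B C D : ι → HS H) :
    limForm J F lam (B + C) D = limForm J F lam B D + limForm J F lam C D := by
  simp only [limForm, Pi.add_apply, inner_add_left, ← mul_add, ← Complex.add_re,
    ← Finset.sum_add_distrib]
  congr 2
  exact Finset.sum_congr rfl fun j _ => Finset.sum_congr rfl fun k _ => by ring

theorem limForm_add_right (B C D : ι → HS H) :
    limForm J F lam B (C + D) = limForm J F lam B C + limForm J F lam B D := by
  simp only [limForm, Pi.add_apply, map_add, J.barHS_add, inner_add_right, ← mul_add,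
    ← Complex.add_re, ← Finset.sum_add_distrib]
  congr 2
  exact Finset.sum_congr rfl fun j _ => Finset.sum_congr rfl fun k _ => by ring

theorem limForm_smul_self (u : ℝ) (B : ι → HS H) :
    limForm J F lam (u • B) (u • B) = u ^ 2 * limForm J F lam B B := by
  have h : ∀ j, (u • B) j = (u : ℂ) • B j := fun j => (Complex.coe_smul u (B j)).symm
  simp only [limForm, h, map_smul, J.barHS_smul, inner_smul_left, inner_smul_right,
    Complex.conj_ofReal, ← mul_add, ← Finset.mul_sum, Complex.re_ofReal_mul]
  ring

theorem limForm_single [DecidableEq ι] (i j : ι) (A B : HS H) :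
    limForm J F lam (Pi.single i B) (Pi.single j A) =
      1 / 2 * (inner ℂ B (Gam J F (lam i) (lam j) A) +
        inner ℂ B (Sig J F (lam i) (lam j) (J.barHS A))).re := by
  rw [limForm, Finset.sum_eq_single i, Finset.sum_eq_single j]
  · simp
  · intro k _ hk; simp [hk, J.barHS_zero]
  · simp
  · intro k _ hk; simp [hk]
  · simp

end LimitForm

/-! ### Complex covariances and independence from real marginals. -/

section ComplexGaussian

set_option linter.unusedSectionVars false

variable {H : Type*} [NormedAddCommGroup H] [InnerProductSpace ℂ H] [CompleteSpace H]
  [TopologicalSpace.SeparableSpace H] {d : ℕ} {J : Conjugation H} {F : ℝ → HS H} {lam : Fin d → ℝ}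
  {μ : Measure (Fin d → HS H)} [IsProbabilityMeasure μ]

theorem isGaussian_of_map_reInner
    (h : ∀ B, ∃ v : NNReal, (v : ℝ) = limForm J F lam B B ∧ μ.map (reInner B) = gaussianReal 0 v) :
    IsGaussian μ :=
  isGaussian_of_map_eq_gaussianReal fun L => by
    obtain ⟨v, -, hv⟩ := h (rieszRep L)
    rw [reInner_rieszRep] at hv
    exact ⟨0, v, hv⟩

theorem integral_reInner
    (h : ∀ B, ∃ v : NNReal, (v : ℝ) = limForm J F lam B B ∧ μ.map (reInner B) = gaussianReal 0 v)
    (B : Fin d → HS H) : ∫ q, reInner B q ∂μ = 0 := by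
  obtain ⟨v, -, hv⟩ := h B
  have h1 := integral_map (μ := μ) (reInner B).continuous.measurable.aemeasurable
    (f := fun x : ℝ => x) (by fun_prop)
  rw [hv, integral_id_gaussianReal] at h1
  exact h1.symm

/-- Polarisation of the variances. The symmetry of `limForm` is needed because polarisation sees
only the symmetric part. -/
theorem integral_reInner_mul
    (h : ∀ B, ∃ v : NNReal, (v : ℝ) = limForm J F lam B B ∧ μ.map (reInner B) = gaussianReal 0 v)
    (hc : ∀ B B', limForm J F lam B B' = limForm J F lam B' B) (B B' : Fin d → HS H) :
    ∫ q, reInner B q * reInner B' q ∂μ = limForm J F lam B B' := by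
  have := isGaussian_of_map_reInner h
  have hsq : ∀ B, ∫ q, reInner B q * reInner B q ∂μ = limForm J F lam B B := fun B => by
    obtain ⟨v, hv1, hv⟩ := h B
    have h1 := integral_map (μ := μ) (reInner B).continuous.measurable.aemeasurable
      (f := fun x : ℝ => x * x) (by fun_prop)
    have h2 := variance_fun_id_gaussianReal (μ := 0) (v := v)
    rw [variance_of_integral_eq_zero (by fun_prop) (by simp)] at h2
    rw [hv] at h1
    simp only [sq] at h2
    rw [← h1, h2, hv1]
  have hi : ∀ B B', Integrable (fun q => reInner B q * reInner B' q) μ := fun B B' =>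
    (IsGaussian.memLp_dual μ (reInner B) 2 (by simp)).integrable_mul
      (IsGaussian.memLp_dual μ (reInner B') 2 (by simp))
  have h1 := hsq (B + B')
  have h2 : ∀ q, reInner (B + B') q * reInner (B + B') q = reInner B q * reInner B q +
      2 * (reInner B q * reInner B' q) + reInner B' q * reInner B' q := fun q => by
    rw [reInner_add]; ring
  simp only [h2] at h1
  rw [integral_add (by exact (hi _ _).add ((hi _ _).const_mul 2)) (hi _ _),
    integral_add (hi _ _) ((hi _ _).const_mul 2), integral_const_mul, hsq, hsq, limForm_add_left,
    limForm_add_right, limForm_add_right, hc B' B] at h1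
  linarith

theorem isComplexGaussian_of_map_reInner
    (h : ∀ B, ∃ v : NNReal, (v : ℝ) = limForm J F lam B B ∧ μ.map (reInner B) = gaussianReal 0 v)
    (hc : ∀ B B', limForm J F lam B B' = limForm J F lam B' B) :
    IsComplexGaussian J μ (fun i j => Gam J F (lam i) (lam j))
      (fun i j => Sig J F (lam i) (lam j)) := by
  have hG := isGaussian_of_map_reInner h
  have hz : ∀ i (B : HS H) (q : Fin d → HS H), inner ℂ B (q i) =
      ((reInner (Pi.single i B) q : ℝ) : ℂ) +
        (reInner (Pi.single i (Complex.I • B)) q : ℝ) * Complex.I := fun i B q => by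
    rw [reInner_single, reInner_single, inner_smul_left]
    apply Complex.ext <;> simp
  have hi : ∀ B B', Integrable (fun q => reInner B q * reInner B' q) μ := fun B B' =>
    (IsGaussian.memLp_dual μ (reInner B) 2 (by simp)).integrable_mul
      (IsGaussian.memLp_dual μ (reInner B') 2 (by simp))
  -- the second moments of two complex coordinates, from those of the four real ones
  have key : ∀ (i j : Fin d) (A B : HS H) (s : ℝ),
      ∫ q, inner ℂ B (q i) * ((reInner (Pi.single j A) q : ℝ) +
        s * (reInner (Pi.single j (Complex.I • A)) q : ℝ) * Complex.I) ∂μ =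
      ((limForm J F lam (Pi.single i B) (Pi.single j A) -
        s * limForm J F lam (Pi.single i (Complex.I • B)) (Pi.single j (Complex.I • A)) : ℝ) : ℂ) +
      ((limForm J F lam (Pi.single i (Complex.I • B)) (Pi.single j A) +
        s * limForm J F lam (Pi.single i B) (Pi.single j (Complex.I • A)) : ℝ) : ℂ) * Complex.I :=
      fun i j A B s => by
    simp only [← integral_reInner_mul h hc, ← integral_const_mul]
    rw [← integral_sub (hi _ _) ((hi _ _).const_mul s), ← integral_add (hi _ _)
      ((hi _ _).const_mul s), ← integral_complex_ofReal, ← integral_complex_ofReal,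
      ← integral_mul_const, ← integral_add]
    · refine integral_congr_ae (Eventually.of_forall fun q => ?_)
      simp only [hz i B q]
      push_cast
      linear_combination (s : ℂ) * (reInner (Pi.single i (Complex.I • B)) q : ℝ) *
        (reInner (Pi.single j (Complex.I • A)) q : ℝ) * Complex.I_mul_I
    · exact ((hi _ _).sub ((hi _ _).const_mul s)).ofReal
    · exact (((hi _ _).add ((hi _ _).const_mul s)).ofReal).mul_const _
  refine ⟨hG, ?_, fun i j A B => ?_, fun i j A B => ?_⟩
  · refine (SeparatingDual.eq_zero_iff_forall_dual_eq_zero (R := ℝ) _).2 fun L => ?_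
    rw [← L.integral_comp_comm (φ := fun q => q) (IsGaussian.memLp_two_id.integrable one_le_two),
      ← reInner_rieszRep L]
    exact integral_reInner h _
  · have h1 := key i j A B (-1)
    have h2 : ∀ q : Fin d → HS H, inner ℂ (q j) A = ((reInner (Pi.single j A) q : ℝ) : ℂ) +
        ((-1 : ℝ) : ℂ) * (reInner (Pi.single j (Complex.I • A)) q : ℝ) * Complex.I := fun q => by
      rw [← inner_conj_symm, hz]
      simp
    simp only [h2]
    rw [h1]
    simp only [limForm_single, map_smul, J.barHS_smul, inner_smul_left, inner_smul_right]
    apply Complex.ext <;> simp <;> ring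
  · have h1 := key i j (J.barHS A) B 1
    have h2 : ∀ q : Fin d → HS H, inner ℂ (J.barHS (q j)) A =
        ((reInner (Pi.single j (J.barHS A)) q : ℝ) : ℂ) +
        ((1 : ℝ) : ℂ) * (reInner (Pi.single j (Complex.I • J.barHS A)) q : ℝ) * Complex.I :=
        fun q => by
      rw [J.inner_barHS_left, hz]
      simp
    simp only [h2]
    rw [h1]
    simp only [limForm_single, map_smul, J.barHS_smul, J.barHS_barHS, inner_smul_left,
      inner_smul_right]
    apply Complex.ext <;> simp <;> ring

theorem eta_eq_zero_of_abs_lt {x : ℝ} (h0 : x ≠ 0) (h : |x| < 2 * Real.pi) : eta x = 0 := by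
  rw [eta, if_neg]
  rintro ⟨z, rfl⟩
  have hz : z ≠ 0 := by rintro rfl; simp at h0
  have h1 : (1 : ℝ) ≤ |(z : ℝ)| := by exact_mod_cast Int.one_le_abs hz
  rw [abs_mul, abs_of_pos Real.two_pi_pos] at h
  nlinarith [Real.two_pi_pos]

/-- Jointly Gaussian and uncorrelated variables are independent. For distinct frequencies in [0, π]
neither λ_i - λ_j nor λ_i + λ_j is a multiple of 2π: the sum lies strictly between 0 and 2π. So both
Γ_{ij} and Σ_{ij} vanish. -/
theorem iIndepFun_of_map_reInner
    (h : ∀ B, ∃ v : NNReal, (v : ℝ) = limForm J F lam B B ∧ μ.map (reInner B) = gaussianReal 0 v)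
    (hc : ∀ B B', limForm J F lam B B' = limForm J F lam B' B)
    (hlam : ∀ j, lam j ∈ Set.Icc 0 Real.pi) (hinj : Function.Injective lam) :
    iIndepFun (fun (j : Fin d) (q : Fin d → HS H) => q j) μ := by
  have hG := isGaussian_of_map_reInner h
  have hid : HasGaussianLaw (fun (q : Fin d → HS H) i => q i) μ :=
    ⟨by rw [show (fun (q : Fin d → HS H) i => q i) = id from rfl, Measure.map_id]; exact hG⟩
  refine hid.iIndepFun_of_covariance_strongDual fun i j hij L₁ L₂ => ?_
  have hL : ∀ (i : Fin d) (L : StrongDual ℝ (HS H)), ∃ B : HS H,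
      (L ∘ fun q : Fin d → HS H => q i) = reInner (Pi.single i B) := fun i L => by
    refine ⟨reDual L, funext fun q => ?_⟩
    rw [reInner_single, Function.comp_apply, re_inner_reDual]
  obtain ⟨B, hB⟩ := hL i L₁
  obtain ⟨A, hA⟩ := hL j L₂
  rw [hB, hA, covariance_eq_sub (IsGaussian.memLp_dual μ _ 2 (by simp))
    (IsGaussian.memLp_dual μ _ 2 (by simp)), integral_reInner h, zero_mul, sub_zero]
  have h1 := integral_reInner_mul h hc (Pi.single i B) (Pi.single j A)
  refine h1.trans ?_
  have hne : lam i ≠ lam j := fun h => hij (hinj h)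
  have hi := hlam i
  have hj := hlam j
  have hpi := Real.pi_pos
  have e1 : eta (lam i - lam j) = 0 := eta_eq_zero_of_abs_lt (sub_ne_zero.2 hne) (by
    rw [abs_lt]; constructor <;> linarith [hi.1, hi.2, hj.1, hj.2])
  have e2 : eta (lam i + lam j) = 0 := by
    refine eta_eq_zero_of_abs_lt (fun h => hne ?_) ?_
    · linarith [hi.1, hj.1]
    · rw [abs_of_nonneg (by linarith [hi.1, hj.1])]
      rcases lt_or_gt_of_ne hne with h | h <;> linarith [hi.2, hj.2]
  rw [limForm_single, inner_Gam, inner_Sig, e1, e2]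
  simp

end ComplexGaussian

end QuadForm

end

noncomputable section
namespace QuadForm

/-! ### The limit law on the product space. -/

section CanonicalLimit

set_option linter.unusedSectionVars false

variable {S : Type*} [MeasurableSpace S] {μ : Measure S} [IsProbabilityMeasure μ]
variable {H : Type*} [NormedAddCommGroup H] [InnerProductSpace ℂ H] [CompleteSpace H]
  [TopologicalSpace.SeparableSpace H]
variable {β : ℕ → ℤ → ℝ} {J : Conjugation H} {f : (ℤ → S) → H} {m : ℕ → ℕ} {K : ℕ → Finset H}
  {χ : ∀ n, K n → (ℤ → S) → ℂ} {x : ∀ n, K n → H} {d : ℕ}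

/-- The forms of the approximation take values in the span of finitely many tensors x_a ⊗ x_c, which
does not depend on T, and are bounded in L². The error of replacing f is small uniformly in T. -/
theorem isTightMeasureSet_centForm (hβ : IsWeights β) (hf : StronglyMeasurable f)
    (hf4 : MemLp f 4 (iidLaw μ)) (hf0 : ∫ e, f e ∂(iidLaw μ) = 0) (hθ : theta μ f ≠ ∞)
    (h : IsApprox μ J f m K χ x) (lam : Fin d → ℝ) :
    IsTightMeasureSet (Set.range fun T => (iidLaw μ).map fun e j => centForm μ β (lam j) f f T e) := by
  refine isTightMeasureSet_of_finiteDimensional_approx (Z := fun T j => centForm μ β (lam j) f f T)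
    (fun T j => stronglyMeasurable_centForm hf hf _ _) fun δ hδ => ?_
  obtain ⟨n, hn⟩ := ((h.tendsto_replErr hf hθ).eventually_lt_const
    (pos_iff_ne_zero.2 hδ)).exists
  set g : (ℤ → S) → H := fun e => ∑ a, χ n a e • x n a with hg
  have hgm := h.stronglyMeasurable n
  have hg4 := h.memLp n
  have hg0 := h.integral_eq_zero n
  refine ⟨Submodule.span ℂ (Set.range fun p : K n × K n => tensor (x n p.1) (x n p.2)),
    FiniteDimensional.span_of_finite ℂ (Set.finite_range _),
    fun T j => centForm μ β (lam j) g g T, 4 * (theta μ g * theta μ g),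
    ENNReal.mul_ne_top (by simp) (ENNReal.mul_ne_top (h.theta_ne_top n) (h.theta_ne_top n)),
    fun T j => ⟨fun e => ?_, stronglyMeasurable_centForm hgm hgm _ _,
      eLpNorm_centForm_le hβ hgm hgm hg4 hg4 hg0 hg0 _ _,
      (eLpNorm_centForm_sub_le hβ hf hgm hf4 hg4 hf0 hg0 _ _).trans hn.le⟩⟩
  simp only [hg]
  rw [centForm_window (fun a => (h.window n a).bdd) (h.real n) (x n) (lam j) T e
      (fun _ _ _ => rfl)]
  exact Submodule.sum_mem _ fun a _ => Submodule.sum_mem _ fun c _ =>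
    Submodule.smul_mem _ _ (Submodule.subset_span ⟨(a, c), rfl⟩)

theorem exists_limit_centForm (hβ : IsWeights β) (hf : StronglyMeasurable f)
    (hf4 : MemLp f 4 (iidLaw μ)) (hf0 : ∫ e, f e ∂(iidLaw μ) = 0) (hθ : theta μ f ≠ ∞)
    (h : IsApprox μ J f m K χ x) (lam : Fin d → ℝ) :
    ∃ (ν : Measure (Fin d → HS H)) (_ : IsProbabilityMeasure ν),
      TendstoInDistribution (fun T e j => centForm μ β (lam j) f f T e) atTop
        (id : (Fin d → HS H) → (Fin d → HS H)) (fun _ => iidLaw μ) ν ∧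
      ∀ B, ∃ v : NNReal,
        (v : ℝ) = limForm J (specDens (iidLaw μ) fun t e => f (shift t e)) lam B B ∧
        ν.map (reInner B) = gaussianReal 0 v := by
  have hm : ∀ T, Measurable fun e j => centForm μ β (lam j) f f T e := fun T =>
    measurable_pi_lambda _ fun j => (stronglyMeasurable_centForm hf hf (lam j) T).measurable
  obtain ⟨ν, hν1, hν2⟩ := exists_gaussian_limit
    (ν := fun T => ⟨(iidLaw μ).map fun e j => centForm μ β (lam j) f f T e,
      Measure.isProbabilityMeasure_map (hm T).aemeasurable⟩)
    (isTightMeasureSet_centForm hβ hf hf4 hf0 hθ h lam)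
    (V := fun L => limForm J (specDens (iidLaw μ) fun t e => f (shift t e)) lam (rieszRep L)
      (rieszRep L))
    (fun u L => by rw [rieszRep_smul, limForm_smul_self]) fun L => by
      refine (tendsto_charFun_canonForm hβ hf hf4 hf0 hθ h lam (rieszRep L)).congr fun T => ?_
      rw [charFunDual_apply]
      simp only [ProbabilityMeasure.coe_mk]
      rw [integral_map (hm T).aemeasurable (by fun_prop)]
      simp_rw [← reInner_apply, reInner_rieszRep]
  refine ⟨ν, inferInstance, ⟨fun T => (hm T).aemeasurable, aemeasurable_id, ?_⟩, fun B => ?_⟩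
  · convert hν1 using 2
    refine congrArg _ (Subtype.ext ?_)
    exact Measure.map_id
  · obtain ⟨v, hv1, hv2⟩ := hν2 (reInner B)
    rw [rieszRep_reInner] at hv1
    exact ⟨v, hv1, hv2⟩

end CanonicalLimit

end QuadForm

end

noncomputable section
namespace QuadForm

/-! ### Transfer between the given probability space and the product space. -/

section Transfer

set_option linter.unusedSectionVars false

variable {Ω S : Type*} [MeasurableSpace Ω] [MeasurableSpace S] {P : Measure Ω}
  [IsProbabilityMeasure P] {ε ε' : ℤ → Ω → S}
variable {H : Type*} [NormedAddCommGroup H] [InnerProductSpace ℂ H] [CompleteSpace H]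

/-- Replacing one coordinate changes `f` by at most twice its distance to the functions of the
modified sequence. -/
theorem del_le_two_mul {μ : Measure S} [IsProbabilityMeasure μ] {f u : (ℤ → S) → H}
    (hf : StronglyMeasurable f) (hu : StronglyMeasurable u) (hui : Integrable u (iidLaw μ))
    (j : ℤ) {p : ℝ≥0∞} (hp : 1 ≤ p) (hp' : p ≠ ∞) :
    del μ p j f ≤ 2 * eLpNorm (fun q : (ℤ → S) × (ℤ → S) => f q.1 - u (mix {j}ᶜ q.1 q.2)) p
      ((iidLaw μ).prod (iidLaw μ)) := by
  have hw := stronglyMeasurable_avg (μ := μ) hu {j}ᶜ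
  have h1 : eLpNorm (f - avg μ {j}ᶜ u) p (iidLaw μ) ≤
      eLpNorm (fun q : (ℤ → S) × (ℤ → S) => f q.1 - u (mix {j}ᶜ q.1 q.2)) p
        ((iidLaw μ).prod (iidLaw μ)) := by
    have h2 : f - avg μ {j}ᶜ u =ᵐ[iidLaw μ]
        fun e => ∫ e', (f e - u (mix {j}ᶜ e e')) ∂(iidLaw μ) := by
      filter_upwards [ae_integrable_mix hui {j}ᶜ] with e he
      rw [integral_sub (integrable_const _) he]
      simp [avg]
    rw [eLpNorm_congr_ae h2]
    exact eLpNorm_integral_prod_le (F := fun q : (ℤ → S) × (ℤ → S) =>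
      f q.1 - u (mix {j}ᶜ q.1 q.2)) ((hf.comp_measurable measurable_fst).sub
        (stronglyMeasurable_comp_mix hu _)) hp hp'
  -- The average of u over coordinate j does not depend on j, so subtracting it leaves the influence
  -- unchanged. Then `del_le` bounds the influence by twice a norm.
  have h3 : del μ p j f = del μ p j (f - avg μ {j}ᶜ u) := by
    rw [del, del]
    congr 1
    funext q
    have : avg μ {j}ᶜ u (mix {j}ᶜ q.1 q.2) = avg μ {j}ᶜ u q.1 :=
      dependsOn_avg u _ fun k hk => by simp only [mix, hk, if_true]
    simp only [Pi.sub_apply, this, sub_sub_sub_cancel_right]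
  rw [h3]
  exact (del_le (hf.sub hw) j hp).trans (by gcongr)

namespace IsIIDWithCopy

theorem isProbabilityMeasure_map (h : IsIIDWithCopy ε ε' P) : IsProbabilityMeasure (P.map (ε 0)) :=
  Measure.isProbabilityMeasure_map (h.measurable 0).aemeasurable

theorem measurePreserving_pair (h : IsIIDWithCopy ε ε' P) [IsProbabilityMeasure (P.map (ε 0))] :
    MeasurePreserving (fun ω => ((fun k => ε k ω, fun k => ε' k ω) : (ℤ → S) × (ℤ → S))) P
      ((iidLaw (P.map (ε 0))).prod (iidLaw (P.map (ε 0)))) := by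
  have hm : ∀ i, Measurable (Sum.elim ε ε' i) := by
    rintro (k | k)
    exacts [h.measurable k, h.measurable' k]
  have h1 : MeasurePreserving (fun ω i => Sum.elim ε ε' i ω) P
      (Measure.infinitePi fun _ : ℤ ⊕ ℤ => P.map (ε 0)) := by
    refine ⟨measurable_pi_lambda _ hm, ?_⟩
    rw [h.indep.map_fun_eq_infinitePi_map hm]
    congr
    funext i
    rcases i with k | k
    exacts [(h.identDistrib k).map_eq, (h.identDistrib' k).map_eq]
  exact (measurePreserving_sumSplit _).comp h1

theorem measurePreserving (h : IsIIDWithCopy ε ε' P) [IsProbabilityMeasure (P.map (ε 0))] :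
    MeasurePreserving (fun ω k => ε k ω) P (iidLaw (P.map (ε 0))) :=
  measurePreserving_fst.comp h.measurePreserving_pair

/-- By Doob–Dynkin the conditional expectation is a function u of the sequence with coordinate 0
replaced. ν is thus the distance from X_t to such a function, and resampling coordinate 0 changes
X_t by at most twice that. -/
theorem del_le_nu (h : IsIIDWithCopy ε ε' P) [IsProbabilityMeasure (P.map (ε 0))]
    {f : (ℤ → S) → H} (hf : StronglyMeasurable f) (t : ℤ) :
    del (P.map (ε 0)) 4 0 (f ∘ shift t) ≤
      2 * nu P ε ε' (fun t ω => f (shift t fun k => ε k ω)) 4 t := by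
  set c : Ω → ℤ → S := fun ω => mix {0}ᶜ (fun k => ε k ω) fun k => ε' k ω with hc
  have hcm : MeasurePreserving c P (iidLaw (P.map (ε 0))) :=
    (measurePreserving_mix _ {0}ᶜ).comp h.measurePreserving_pair
  have hle : pastSigma (coupled ε ε' {0}) t ≤ MeasurableSpace.comap c inferInstance := by
    refine iSup_le fun k => ?_
    have h1 : coupled ε ε' {0} (t - k) = (fun e : ℤ → S => e (t - k)) ∘ c := by
      funext ω
      by_cases hk : t - k = 0 <;> simp [coupled, hc, mix, hk]
    rw [h1, ← MeasurableSpace.comap_comp]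
    exact MeasurableSpace.comap_mono (measurable_pi_apply _).comap_le
  set X : Ω → H := fun ω => f (shift t fun k => ε k ω) with hX
  obtain ⟨u, hu, hMu⟩ := (stronglyMeasurable_condExp (m := pastSigma (coupled ε ε' {0}) t) (μ := P)
    (f := X)).mono hle |>.exists_eq_measurable_comp
  have hui : Integrable u (iidLaw (P.map (ε 0))) := by
    rw [← hcm.map_eq, integrable_map_measure hu.aestronglyMeasurable hcm.aemeasurable, ← hMu]
    exact integrable_condExp
  have hF : StronglyMeasurable (f ∘ shift t) := hf.comp_measurable (measurable_shift t)
  refine (del_le_two_mul hF hu hui 0 (by norm_num) (by simp)).trans (le_of_eq ?_)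
  congr 1
  refine (eLpNorm_comp_measurePreserving ((hF.comp_measurable measurable_fst).sub
    (stronglyMeasurable_comp_mix hu _)).aestronglyMeasurable h.measurePreserving_pair).symm.trans ?_
  rw [nu, ← hX, hMu]
  rfl

/-- The influence of coordinate -n on f is that of coordinate 0 on X_n, by stationarity. Positive
coordinates have none. -/
theorem theta_le (h : IsIIDWithCopy ε ε' P) [IsProbabilityMeasure (P.map (ε 0))]
    {f : (ℤ → S) → H} (hf : StronglyMeasurable f) (hd : DependsOn f (Set.Iic (0 : ℤ))) :
    theta (P.map (ε 0)) f ≤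
      2 * ∑' j : ℕ, nu P ε ε' (fun t ω => f (shift t fun k => ε k ω)) 4 (j : ℤ) := by
  have hinj : Function.Injective fun n : ℕ => -(n : ℤ) := fun a b hab => by simpa using hab
  rw [theta, ← hinj.tsum_eq, ← ENNReal.tsum_mul_left]
  · refine ENNReal.tsum_le_tsum fun n => le_trans (le_of_eq ?_) (h.del_le_nu hf n)
    rw [del_comp_shift hf, zero_sub]
  · intro j hj
    by_contra hn
    refine hj (del_eq_zero hd (fun hj0 => hn ⟨j.natAbs, ?_⟩) _)
    have : j ≤ 0 := hj0
    simp only []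
    omega

end IsIIDWithCopy

theorem lagCov_comp {α : Type*} [MeasurableSpace α] {Q : Measure α} {Y : ℤ → α → H}
    (hY : ∀ t, StronglyMeasurable (Y t)) {φ : Ω → α} (hφ : MeasurePreserving φ P Q) :
    (lagCov P fun t ω => Y t (φ ω)) = lagCov Q Y := by
  funext h
  rw [lagCov, lagCov, ← hφ.map_eq, integral_map hφ.aemeasurable]
  exact (stronglyMeasurable_sesq (tensorL H) (hY h) (hY 0)).aestronglyMeasurable

theorem smul_Phi_tensor {A : ℕ → ℤ → (H →L[ℂ] H)} {β : ℕ → ℤ → ℝ} {r lam : ℝ} {T : ℕ} {s t : ℤ}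
    (h : (r : ℂ) • A T (t - s) = (β T (t - s) : ℂ) • ContinuousLinearMap.id ℂ H) (x y : H) :
    r • Phi A lam T s t (tensor x y) =
      ((β T (t - s) : ℂ) * ex lam (t - s)) • tensorL H x y := by
  have h1 := congrArg (fun B : H →L[ℂ] H => tensorL H (B x) y) h
  simp only [smul_apply, map_smul, ContinuousLinearMap.id_apply] at h1
  rw [Phi, kron_tensor, phi, ← tensorL_apply, smul_apply, map_smul, smul_apply,
    ContinuousLinearMap.id_apply, ← Complex.coe_smul, smul_comm, h1, smul_smul, mul_comm]
  rfl

theorem smul_Qhat {A : ℕ → ℤ → (H →L[ℂ] H)} {β : ℕ → ℤ → ℝ} {r : ℝ} {T : ℕ}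
    (h : ∀ k : ℤ, |k| < T → (r : ℂ) • A T k = (β T k : ℂ) • ContinuousLinearMap.id ℂ H)
    (f : (ℤ → S) → H) (φ : Ω → ℤ → S) (lam : ℝ) (ω : Ω) :
    r • Qhat A (fun t ω => f (shift t (φ ω))) lam T ω = canonForm β lam f f T (φ ω) := by
  simp only [Qhat, canonForm, qform, Finset.smul_sum]
  refine Finset.sum_congr rfl fun s hs => Finset.sum_congr rfl fun t ht => ?_
  rw [Finset.mem_Icc] at hs ht
  exact smul_Phi_tensor (h _ (abs_lt.2 ⟨by omega, by omega⟩)) _ _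

theorem smul_Qhat_sub_integral {μ : Measure S} [IsProbabilityMeasure μ]
    {A : ℕ → ℤ → (H →L[ℂ] H)} {β : ℕ → ℤ → ℝ} {r : ℝ} {T : ℕ}
    (h : ∀ k : ℤ, |k| < T → (r : ℂ) • A T k = (β T k : ℂ) • ContinuousLinearMap.id ℂ H)
    {f : (ℤ → S) → H} (hf : StronglyMeasurable f) {φ : Ω → ℤ → S}
    (hφ : MeasurePreserving φ P (iidLaw μ)) (lam : ℝ) (ω : Ω) :
    r • (Qhat A (fun t ω => f (shift t (φ ω))) lam T ω -
      ∫ ω', Qhat A (fun t ω => f (shift t (φ ω))) lam T ω' ∂P) = centForm μ β lam f f T (φ ω) := by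
  rw [smul_sub, ← integral_smul, centForm]
  simp only [smul_Qhat h]
  rw [← hφ.map_eq, integral_map (f := canonForm β lam f f T) hφ.aemeasurable
    (stronglyMeasurable_qform _ hf hf _ _ _).aestronglyMeasurable]

end Transfer

end QuadForm

end

/-! ### Assembly of the theorem. -/

theorem theorem3p4
    {H : Type*} [NormedAddCommGroup H] [InnerProductSpace ℂ H] [CompleteSpace H]
    [TopologicalSpace.SeparableSpace H] (J : QuadForm.Conjugation H)
    {Ω S : Type*} [MeasurableSpace Ω] [MeasurableSpace S]
    (P : Measure Ω) [IsProbabilityMeasure P]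
    (ε ε' : ℤ → Ω → S) (hε : QuadForm.IsIIDWithCopy ε ε' P)
    (g : (ℕ → S) → H) (hg : StronglyMeasurable g)
    (X : ℤ → Ω → H) (hX : X = QuadForm.shiftProcess g ε)
    (hreal : ∀ t, ∀ᵐ ω ∂P, J.conj (X t ω) = X t ω)
    (hL4 : ∀ t, MemLp (X t) 4 P)
    (hcent : ∀ t, ∫ ω, X t ω ∂P = 0)
    (hdep : ∑' j : ℕ, QuadForm.nu P ε ε' X 4 (j : ℤ) < ∞)
    {d : ℕ} (lam : Fin d → ℝ) (hlam : ∀ j, lam j ∈ Set.Ioc (-Real.pi) Real.pi)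
    (A : ℕ → ℤ → (H →L[ℂ] H)) (hA : ∀ j, QuadForm.AdmissibleWeights A (lam j)) :
    (Summable fun h : ℤ => ‖QuadForm.lagCov P X h‖) ∧
    ∃ (μ : Measure (Fin d → QuadForm.HS H)) (_ : IsProbabilityMeasure μ),
      QuadForm.IsComplexGaussian J μ
        (fun i j => QuadForm.Gam J (QuadForm.specDens P X) (lam i) (lam j))
        (fun i j => QuadForm.Sig J (QuadForm.specDens P X) (lam i) (lam j)) ∧
      TendstoInDistribution
        (fun (T : ℕ) (ω : Ω) (j : Fin d) =>
          (√(QuadForm.frobSq (QuadForm.phi A (lam j)) T))⁻¹ •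
            (QuadForm.Qhat A X (lam j) T ω - ∫ ω', QuadForm.Qhat A X (lam j) T ω' ∂P))
        atTop (id : (Fin d → QuadForm.HS H) → (Fin d → QuadForm.HS H)) (fun _ => P) μ ∧
      ((∀ j, lam j ∈ Set.Icc 0 Real.pi) → Function.Injective lam →
        iIndepFun (fun (j : Fin d) (q : Fin d → QuadForm.HS H) => q j) μ) := by
  have hprob := hε.isProbabilityMeasure_map
  set m : Measure S := P.map (ε 0)
  set f : (ℤ → S) → H := fun e => g fun k => e (-k) with hf_def
  have hf : StronglyMeasurable f := hg.comp_measurable (by fun_prop)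
  have hd : DependsOn f (Set.Iic (0 : ℤ)) := fun e e' h =>
    congrArg g (funext fun k => h _ (by simp))
  have hφ : MeasurePreserving (fun ω k => ε k ω) P (QuadForm.iidLaw m) := hε.measurePreserving
  have hXf : X = fun t ω => f (QuadForm.shift t fun k => ε k ω) := by
    rw [hX]
    funext t ω
    simp only [QuadForm.shiftProcess, hf_def, QuadForm.shift, neg_add_eq_sub]
  have hX0 : X 0 = f ∘ fun ω k => ε k ω := by
    rw [hXf]
    funext ω
    simp only [QuadForm.shift_zero, Function.comp]
  have hf4 : MemLp f 4 (QuadForm.iidLaw m) := by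
    rw [← hφ.map_eq, memLp_map_measure_iff hf.aestronglyMeasurable hφ.aemeasurable, ← hX0]
    exact hL4 0
  have hf0 : ∫ e, f e ∂(QuadForm.iidLaw m) = 0 := by
    rw [← hφ.map_eq, integral_map hφ.aemeasurable hf.aestronglyMeasurable, ← hcent 0, hX0]
    rfl
  have hθ : QuadForm.theta m f ≠ ∞ := by
    refine ne_top_of_le_ne_top ?_ (hε.theta_le hf hd)
    rw [← hXf]
    exact ENNReal.mul_ne_top (by simp) hdep.ne
  have hfr : ∀ᵐ e ∂(QuadForm.iidLaw m), J.conj (f e) = f e := by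
    rw [← hφ.map_eq, ae_map_iff hφ.aemeasurable
      ((J.conj.continuous.comp_stronglyMeasurable hf).measurableSet_eq_fun hf)]
    have := hreal 0
    rwa [hX0] at this
  have hlag : QuadForm.lagCov P X = QuadForm.crossCov m f f := by
    rw [hXf, QuadForm.lagCov_comp (Y := fun t e => f (QuadForm.shift t e))
      (fun t => hf.comp_measurable (QuadForm.measurable_shift t)) hφ]
    funext h
    simp only [QuadForm.lagCov, QuadForm.crossCov, QuadForm.shift_zero]
  have hspec : QuadForm.specDens P X =
      QuadForm.specDens (QuadForm.iidLaw m) fun t e => f (QuadForm.shift t e) := by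
    funext l
    rw [QuadForm.specDens_eq, QuadForm.specDens, hlag]
    simp only [QuadForm.ex_eq_cexp]
  refine ⟨?_, ?_⟩
  · rw [hlag]
    exact QuadForm.summable_norm_of_tsum_enorm (ne_top_of_le_ne_top (ENNReal.mul_ne_top hθ hθ)
      (QuadForm.tsum_enorm_crossCov_le hf hf hf4 hf4 hf0))
  -- Without frequencies there are no conditions on A to use. The product space is a point and its
  -- Dirac mass is the limit.
  rcases Nat.eq_zero_or_pos d with rfl | hd0
  · refine ⟨Measure.dirac 0, inferInstance, ⟨inferInstance, Subsingleton.elim _ _,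
      fun i => i.elim0, fun i => i.elim0⟩, ⟨fun T => ?_, aemeasurable_id, ?_⟩,
      fun _ _ => iIndepFun.of_subsingleton⟩
    · rw [Subsingleton.elim (fun (ω : Ω) (j : Fin 0) => _) fun _ => 0]
      exact aemeasurable_const
    · refine tendsto_const_nhds.congr fun T => Subtype.ext ?_
      simp only []
      rw [Measure.map_id, Subsingleton.elim (fun (ω : Ω) (j : Fin 0) => _) fun _ => 0,
        Measure.map_const]
      simp
  -- In a trivial space all norms ‖φ‖ vanish, against ‖Φ_T‖_F > 0.
  have hnt : Nontrivial H := by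
    by_contra hn
    rw [not_nontrivial_iff_subsingleton] at hn
    obtain ⟨T, hT⟩ := (hA ⟨0, hd0⟩).nondegenerate.exists
    refine hT.ne' (Finset.sum_eq_zero fun t _ => Finset.sum_eq_zero fun s _ => ?_)
    rw [Subsingleton.elim (QuadForm.phi A (lam ⟨0, hd0⟩) T (t - s)) 0]
    simp
  -- One frequency suffices: the weights and their Frobenius norm do not depend on λ, so this β
  -- serves all the λ_j at once.
  obtain ⟨β, hβ, hβA⟩ := (hA ⟨0, hd0⟩).exists_isWeights
  obtain ⟨n, K, χ, x, happ⟩ := QuadForm.exists_isApprox J hf hf4 hfr hθ hd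
  obtain ⟨ν, hν, htend, hmap⟩ := QuadForm.exists_limit_centForm hβ hf hf4 hf0 hθ happ lam
  have hcomm := QuadForm.limForm_comm hf hf4 hf0 hθ happ lam
  rw [← hspec] at hmap hcomm
  refine ⟨ν, hν, QuadForm.isComplexGaussian_of_map_reInner hmap hcomm, ?_,
    QuadForm.iIndepFun_of_map_reInner hmap hcomm⟩
  have hZ : (fun (T : ℕ) (ω : Ω) (j : Fin d) =>
      (√(QuadForm.frobSq (QuadForm.phi A (lam j)) T))⁻¹ •
        (QuadForm.Qhat A X (lam j) T ω - ∫ ω', QuadForm.Qhat A X (lam j) T ω' ∂P)) =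
      fun T ω j => QuadForm.centForm m β (lam j) f f T fun k => ε k ω := by
    funext T ω j
    rw [hXf]
    exact QuadForm.smul_Qhat_sub_integral (fun k hk => by
      rw [← hβA (lam j) T k hk]; push_cast; rfl) hf hφ (lam j) ω
  rw [hZ]
  have hm : ∀ T, Measurable fun (e : ℤ → S) (j : Fin d) => QuadForm.centForm m β (lam j) f f T e :=
    fun T => measurable_pi_lambda _ fun j =>
      (QuadForm.stronglyMeasurable_centForm hf hf (lam j) T).measurable
  refine ⟨fun T => ((hm T).comp hφ.measurable).aemeasurable, aemeasurable_id, ?_⟩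
  refine htend.tendsto.congr fun T => Subtype.ext ?_
  exact (congrArg (Measure.map _) hφ.map_eq.symm).trans (Measure.map_map (hm T) hφ.measurable)
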